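/- **Notation.** $q=e^{h/2}\in\mathbb C[[h]]$, $[x]=\frac{q^x-q^{-x}}{q-q^{-1}}$, $\theta(i)=1$ for $i\ge0$ and $\theta(i)=0$ for $i<0$; $\mathbb Z_+$ is the set of non-negative integers, $\mathbb N$ the set of positive integers, $[a;b]$ an integer interval. **The algebra $U_h(a_\infty)$** is the $h$-adically complete $\mathbb C[[h]]$-algebra topologically generated by $e_i,f_i,h_i,c$ ($i\in\mathbb Z$) with the relations: $c$ is central; $[h_i,h_j]=0$; $[h_i,e_j]=(\delta_{ij}-\delta_{i,j+1})e_j$; $[h_i,f_j]=-(\delta_{ij}-\delta_{i,j+1})f_j$; $e_if_j-f_je_i=\delta_{ij}\,[\,h_i-h_{i+1}+(\theta(-i)-\theta(-i-1))c\,]$ (quantum bracket); $e_ie_j=e_je_i$ and $f_if_j=f_jf_i$ if $|i-j|\ne1$; $e_i^2e_j-(q+q^{-1})e_ie_je_i+e_je_i^2=0=f_i^2f_j-(q+q^{-1})f_if_jf_i+f_jf_i^2$ if $|i-j|=1$. For $\alpha=\sum_i m_i\alpha_i\in Q'_+=\oplus_i\mathbb Z_+\alpha_i$, with $\alpha_j(h_i)=\delta_{ij}-\delta_{i,j+1}$,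 let $S(\alpha)=\{i: m_i\neq0\}$, and let $U_h(n_+)_\alpha$ (resp. $U_h(n_-)_{-\alpha}$) be the set of $x$ in the unital subalgebra generated by the $e_i$ (resp. $f_i$) with $[h_i,x]=\pm\alpha(h_i)x$ for all $i$. **The completion $U_h(A_\infty)$** consists of all formal series $$u=\sum_{k\ge0}h^k\sum_{l=0}^{l(k)}c^l\sum_{\alpha,\beta\in Q'_+}\ \sum_{\gamma}\ \sum_{t}\mathcal F_{t}\Big(\prod_{i}h_i^{\gamma_i}\Big)\mathcal E_{t}\qquad(*)$$ ($\gamma\in\mathbb Z_+^{\mathbb Z}$ finitely supported; the sum over $t$ is finite, $\mathcal F_t\in U_h(n_-)_{-\alpha}$, $\mathcal E_t\in U_h(n_+)_{\beta}$, both depending on $k,l,\alpha,\beta,\gamma$; the sums over $\alpha,\beta,\gamma$ may be infinite) such that (i) for all $k$ and $i$ only finitely many sets $I\ni i$ are connected components of some $S(\alpha)\cup S(\gamma)$ ($i,j$ joined if $|i-j|=1$) that belongs to a non-zero summand of $u_k$, the coefficient of $h^k$ in $(*)$; (ii) for each $r\in\mathbb N$ the series $u(r)$, obtained by substituting $0$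 for $h_i$ ($i\le-r$ or $i>r$) and for $e_i,f_i$ ($|i|\ge r$), has finitely many non-zero summands for each $k$, so $u(r)\in U_h(a_\infty)$. Two series are equal if all their truncations $u(r)$ are. A series $w$ is the product $uv$ if, for each $r$, $w(r)$ is the $h$-adic limit as $s\to\infty$ of the truncations at $r$ of $u(s)v(s)$. **The module.** Let $\{M\}=(M_i)_{i\in\mathbb Z}$, $M_i\in\mathbb C[h]$, satisfy $M_i-M_j\in\mathbb Z_+$ for $i<j$, and let it be of $(m,n)$ signature: $m\le n$ and $M_{m-k}=M_m$, $M_{n+k}=M_n$ for all $k\in\mathbb N$. Put $\xi_0=M_m$, $\xi_1=M_n$. The basis $\Gamma(\{M\})$ consists of all patterns $|M)=(M_{i,p})$, $M_{i,p}\in\mathbb C[h]$, with rows $p\ge1$ and positions $i\in[1-k;k-1]$ for $p=2k-1$, $i\in[-k;k-1]$ for $p=2k$, such that $M_{i,p}=M_i$ for all sufficiently large $p$, and, for $k\in\mathbb N$, $\theta=0,1$ and $i\in[1-\theta-k;k-1]$, $M_{i+\theta-1,2k+\theta}-M_{i,2k+\theta-1}\in\mathbb Z_+$ and $M_{i,2k+\theta-1}-M_{i+\theta,2k+\theta}\in\mathbb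 Z_+$. Let $\hat V$ be the free $\mathbb C[[h]]$-module on $\Gamma(\{M\})$ and $V=V(\{M\}_{m,n};M_m,M_n)$ its $h$-adic completion. With $L_{i,p}=M_{i,p}-i$, $e^1_i=e_i$, $e^0_i=f_i$, $S(j,l;\nu)=(-1)^\nu,1,-1$ according as $j=l$, $j<l$, $j>l$, and $|M)_{\pm\{j,p\},\dots}$ denoting the replacement $M_{j,p}\to M_{j,p}\pm1,\dots$, put $$\rho(e_{-1}^{1-\mu})|M)=\big([L_{-1,2}-L_{0,1}-\mu][L_{0,1}-L_{0,2}+\mu]\big)^{1/2}|M)_{-(-1)^\mu\{0,1\}},$$ $$\rho(e^\mu_{(-1)^\nu i-1})|M)=-\sum_{j=1-i-\nu}^{i-1}\sum_{l=-i}^{i+\nu-1}S(j,l;\nu)\,(-A_{j,l}B_{j,l})^{1/2}\,|M)_{-(-1)^{\mu+\nu}\{j,2i+\nu-1\},\,-(-1)^{\mu+\nu}\{l,2i+\nu\}},$$ $$A_{j,l}=\frac{\prod_{k\ne l}[L_{k,2i+\nu}-L_{j,2i+\nu-1}-(-1)^\nu\mu]\prod_{k}[L_{k,2i+\nu-2}-L_{j,2i+\nu-1}-(-1)^\nu\mu]}{\prod_{k\neq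 j}[L_{k,2i+\nu-1}-L_{j,2i+\nu-1}][L_{k,2i+\nu-1}-L_{j,2i+\nu-1}+(-1)^{\mu+\nu}]},$$ $$B_{j,l}=\frac{\prod_{k}[L_{k,2i+\nu+1}-L_{l,2i+\nu}+(-1)^\nu(1-\mu)]\prod_{k\ne j}[L_{k,2i+\nu-1}-L_{l,2i+\nu}+(-1)^\nu(1-\mu)]}{\prod_{k\ne l}[L_{k,2i+\nu}-L_{l,2i+\nu}][L_{k,2i+\nu}-L_{l,2i+\nu}+(-1)^{\mu+\nu}]}$$ for $i\in\mathbb N$, $\mu,\nu\in\{0,1\}$ (products over all positions $k$ of the row, with the stated exceptions; terms whose pattern is not in $\Gamma(\{M\})$ are deleted; the square root is the one with positive constant term), $\rho(c)|M)=(\xi_0-\xi_1)|M)$ and $$\rho(h_i)|M)=\Big(\sum_{j=-|i|}^{|i|+\theta(i)-1}M_{j,2|i|+\theta(i)}-\sum_{j=-|i|+1-\theta(i)}^{|i|-1}M_{j,2|i|+\theta(i)-1}+(\xi_1-\xi_0)\theta(-i)-\xi_1\Big)|M).$$ **Proposition 7.** These formulas define a representation $\rho$ of $U_h(a_\infty)$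 in $V$, and: 1. For every $u\in U_h(A_\infty)$ as in $(*)$, every $|M)\in\Gamma(\{M\})$ and every $k$, only finitely many of the summands $\rho(c)^l\sum_t\rho(\mathcal F_t)\prod_i\rho(h_i)^{\gamma_i}\rho(\mathcal E_t)|M)$ with this $k$ are non-zero, and their sum lies in $\hat V$. Hence the series $\rho(u)|M)=\sum_kh^k\sum\cdots$ converges to an element of $V$. 2. This defines (independently of the chosen series for $u$) a $\mathbb C[[h]]$-linear map $\rho:U_h(A_\infty)\to\mathrm{End}\,V$, which is a representation: it extends $\rho$ on $U_h(a_\infty)$, $\rho(w)=\rho(u)\rho(v)$ whenever $u,v,w\in U_h(A_\infty)$ and $w=uv$, and for all $u,v\in U_h(A_\infty)$, $x\in V$ one has $\rho(u(s)v(s))x\to\rho(u)\rho(v)x$ $h$-adically as $s\to\infty$. 3. $\rho$ is continuous for the $h$-adic topologies. 4. $\rho$ is a highest weight representation: the pattern $|\hat M)$ with $\hat M_{i,p}=M_i$ satisfies $\rho(U_h(n_+)_\beta)|\hat M)=0$ for $\beta\ne0$, is an eigenvector of all $\rho(h_i)$ and of $\rho(c)$, and $\rho(U_h(A_\infty))|\hat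 M)=V$. 5. $\rho$ is irreducible: $V\neq 0$, and the only $\rho(U_h(A_\infty))$-invariant $\mathbb C[[h]]$-submodules $W\subseteq V$ such that $hv\in W$ implies $v\in W$ are $0$ and $V$. 6. $\rho$ is restricted: for every $v\in\hat V$ there is $r\in\mathbb Z_+$ such that $\rho(U_h(n_+)_\beta)v=0$ if $S(\beta)\not\subset(-r;r)$; $\rho(U_h(n_-)_{-\alpha})v=0$ if $\alpha\ne0$ and $S(\alpha)\subset(-\infty;-r]$ or $S(\alpha)\subset[r;\infty)$; and $\rho(h_i)v=0$ if $|i|\ge r$. -/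

import Mathlib

noncomputable section

namespace QuantumAInf

open Polynomial PowerSeries

/-! ### Formal power series in `h`, the element `q = e^{h/2}` and quantum brackets -/

/-- The ring `ℂ[[h]]`; the variable `h` is `PowerSeries.X`. -/
abbrev R : Type := PowerSeries ℂ

/-- The formal variable `h` of `ℂ[[h]]`. -/
abbrev hh : R := PowerSeries.X

/-- `q^x = e^{h x / 2} = ∑ₘ (h x)^m / (2^m m!)` in `A[[h]]`; as `(h x)^m` is divisible by `h^m`, the
coefficient of `h^n` only involves the summands with `m ≤ n`. -/
def qpow {A : Type*} [Ring A] [Algebra ℂ A] (x : PowerSeries A) : PowerSeries A :=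
  PowerSeries.mk fun n => ∑ m ∈ Finset.range (n + 1),
    ((2 : ℂ) ^ m * (m.factorial : ℂ))⁻¹ • PowerSeries.coeff n ((PowerSeries.X * x) ^ m)

/-- The quantum bracket `[x] = (q^x - q^{-x}) / (q - q^{-1})` in `A[[h]]`. Numerator and denominator
are both divided by `h`, after which the denominator is invertible in `ℂ[[h]]`. -/
def qbr {A : Type*} [Ring A] [Algebra ℂ A] (x : PowerSeries A) : PowerSeries A :=
  (PowerSeries.mk fun n => PowerSeries.coeff (n + 1) (qpow x - qpow (-x))) *
    PowerSeries.map (algebraMap ℂ A)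
      (PowerSeries.mk fun n => PowerSeries.coeff (n + 1) (qpow (1 : R) - qpow (-1 : R)))⁻¹

/-- The quantum bracket of a polynomial in `h`. -/
def qbrP (x : ℂ[X]) : R := qbr (x : PowerSeries ℂ)

open Classical in
/-- The square root in `ℂ[[h]]` whose constant term has positive real part
(and `0` if there is none, in particular at `0`). -/
def hsqrt (z : R) : R :=
  if hz : ∃ y : R, y ^ 2 = z ∧ 0 < (PowerSeries.constantCoeff y).re then hz.choose else 0

/-- `s = ∑ₖ h^k aₖ` in the `h`-adic topology of a `ℂ[[h]]`-module. -/
def HasHSum {N : Type*} [AddCommGroup N] [Module R N] (a : ℕ → N) (s : N) : Prop :=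
  ∀ n : ℕ, ∃ y : N, s - ∑ k ∈ Finset.range n, hh ^ k • a k = hh ^ n • y

/-- `θ(i) = 1` for `i ≥ 0` and `0` for `i < 0`. -/
def theta (i : ℤ) : ℤ := if 0 ≤ i then 1 else 0

/-! ### The algebra `U_h(a_∞)` -/

/-- The Chevalley generators. -/
inductive Gen : Type
  | e (i : ℤ)
  | f (i : ℤ)
  | h (i : ℤ)
  | c

/-- The `h`-adic completion `ℂ⟨generators⟩[[h]]` of the free `ℂ[[h]]`-algebra. -/
abbrev FreeTop : Type := PowerSeries (FreeAlgebra ℂ Gen)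

/-- `FreeTop` is a `ℂ[[h]]`-algebra, `ℂ[[h]]` being mapped coefficientwise. -/
instance : Algebra R FreeTop :=
  (PowerSeries.map (algebraMap ℂ (FreeAlgebra ℂ Gen))).toAlgebra' (by
    intro a x
    ext n
    rw [PowerSeries.coeff_mul, PowerSeries.coeff_mul, ← Finset.Nat.sum_antidiagonal_swap]
    refine Finset.sum_congr rfl fun p _ => ?_
    simp [Algebra.commutes])

/-- A generator as an element of `FreeTop`. -/
def gen (g : Gen) : FreeTop := PowerSeries.C (FreeAlgebra.ι ℂ g)

open Gen in
/-- The defining relations of `U_h(a_∞)`, written as elements that have to vanish. -/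
inductive IsRelator : FreeTop → Prop
  | c_e (i : ℤ) : IsRelator (gen c * gen (e i) - gen (e i) * gen c)
  | c_f (i : ℤ) : IsRelator (gen c * gen (f i) - gen (f i) * gen c)
  | c_h (i : ℤ) : IsRelator (gen c * gen (h i) - gen (h i) * gen c)
  | h_h (i j : ℤ) : IsRelator (gen (h i) * gen (h j) - gen (h j) * gen (h i))
  | h_e (i j : ℤ) : IsRelator (gen (h i) * gen (e j) - gen (e j) * gen (h i)
      - ((if i = j then 1 else 0) - (if i = j + 1 then 1 else 0) : ℤ) • gen (e j))
  | h_f (i j : ℤ) : IsRelator (gen (h i) * gen (f j) - gen (f j) * gen (h i)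
      + ((if i = j then 1 else 0) - (if i = j + 1 then 1 else 0) : ℤ) • gen (f j))
  | e_f (i : ℤ) : IsRelator (gen (e i) * gen (f i) - gen (f i) * gen (e i)
      - qbr (gen (h i) - gen (h (i + 1)) + (theta (-i) - theta (-i - 1)) • gen c))
  | e_f_ne (i j : ℤ) (hij : i ≠ j) : IsRelator (gen (e i) * gen (f j) - gen (f j) * gen (e i))
  | e_e (i j : ℤ) (hij : |i - j| ≠ 1) : IsRelator (gen (e i) * gen (e j) - gen (e j) * gen (e i))
  | e_serre (i j : ℤ) (hij : |i - j| = 1) : IsRelator (gen (e i) ^ 2 * gen (e j)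
      - (qpow (1 : R) + qpow (-1 : R)) • (gen (e i) * gen (e j) * gen (e i))
      + gen (e j) * gen (e i) ^ 2)
  | f_f (i j : ℤ) (hij : |i - j| ≠ 1) : IsRelator (gen (f i) * gen (f j) - gen (f j) * gen (f i))
  | f_serre (i j : ℤ) (hij : |i - j| = 1) : IsRelator (gen (f i) ^ 2 * gen (f j)
      - (qpow (1 : R) + qpow (-1 : R)) • (gen (f i) * gen (f j) * gen (f i))
      + gen (f j) * gen (f i) ^ 2)

/-- The `h`-adically closed two-sided ideal generated by the relators: the closure of an ideal `I`
is the intersection of the ideals `I + (h^n)`. -/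
def relIdeal : TwoSidedIdeal FreeTop :=
  ⨅ n : ℕ, TwoSidedIdeal.span ({x | IsRelator x} ∪ {(PowerSeries.X : FreeTop) ^ n})

/-- The quantum algebra `U_h(a_∞)`. -/
def Uh : Type := relIdeal.ringCon.Quotient

instance : Ring Uh := inferInstanceAs (Ring relIdeal.ringCon.Quotient)

instance : Algebra R Uh := inferInstanceAs (Algebra R relIdeal.ringCon.Quotient)

/-- A Chevalley generator in `U_h(a_∞)`. -/
def ug (g : Gen) : Uh := relIdeal.ringCon.mk' (gen g)

/-- `U_h(n_+)_β` for `β = ∑ βᵢ αᵢ ∈ Q'_+`: the elements of weight `β` in the unital subalgebra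
generated by the `eᵢ`. Note `β(hᵢ) = βᵢ - βᵢ₋₁`. -/
def nPlus (β : ℤ →₀ ℕ) : Set Uh :=
  {x | x ∈ Algebra.adjoin R (Set.range fun i => ug (Gen.e i)) ∧
    ∀ i : ℤ, ug (Gen.h i) * x - x * ug (Gen.h i) = ((β i : ℤ) - (β (i - 1) : ℤ)) • x}

/-- `U_h(n_-)_{-α}`: the elements of weight `-α` in the unital subalgebra generated by the `fᵢ`. -/
def nMinus (α : ℤ →₀ ℕ) : Set Uh :=
  {x | x ∈ Algebra.adjoin R (Set.range fun i => ug (Gen.f i)) ∧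
    ∀ i : ℤ, ug (Gen.h i) * x - x * ug (Gen.h i) = (-((α i : ℤ) - (α (i - 1) : ℤ))) • x}

/-- The monomial `∏ᵢ hᵢ^{γᵢ}` (the factors commute; they are written in increasing order). -/
def hMon (γ : ℤ →₀ ℕ) : Uh :=
  ((γ.support.sort (· ≤ ·)).map fun i => ug (Gen.h i) ^ γ i).prod

/-! ### Formal series and the completion `U_h(A_∞)` -/

/-- The summation indices `l, α, γ, β` of a normally ordered series (for a fixed power of `h`). -/
structure Idx : Type where
  l : ℕ
  α : ℤ →₀ ℕ
  γ : ℤ →₀ ℕ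
  β : ℤ →₀ ℕ

/-- The finite sums `c^l ∑ₜ Fₜ (∏ᵢ hᵢ^{γᵢ}) Eₜ` with `Fₜ ∈ U_h(n_-)_{-α}`, `Eₜ ∈ U_h(n_+)_β`. -/
def summands (t : Idx) : Submodule R Uh :=
  Submodule.span R {x | ∃ F ∈ nMinus t.α, ∃ E ∈ nPlus t.β, x = ug Gen.c ^ t.l * (F * hMon t.γ * E)}

/-- A formal series
`∑ₖ h^k ∑_l c^l ∑_{α,β,γ} ∑ₜ F_{α,…,t} (∏ᵢ hᵢ^{γᵢ}) E_{β,…,t}`, with no restriction on the number of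
non-zero summands; `coeff k t` is the summand with indices `k` and `t = (l, α, γ, β)`. -/
structure FormalSeries : Type where
  coeff : ℕ → Idx → Uh
  mem : ∀ k t, coeff k t ∈ summands t

/-- `S(α,γ) = S(α) ∪ S(γ)`. -/
def supp (t : Idx) : Set ℤ := {i | t.α i ≠ 0 ∨ t.γ i ≠ 0}

/-- `I` is a connected component of the graph `S ⊆ ℤ` with `i, j` joined when `|i - j| = 1`
(for a finite `S`): a maximal integer interval inside `S`. -/
def IsComponent (S I : Set ℤ) : Prop :=
  ∃ a b : ℤ, a ≤ b ∧ I = Set.Icc a b ∧ I ⊆ S ∧ a - 1 ∉ S ∧ b + 1 ∉ S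

/-- The monomials of index `t` survive the substitution of `0` for all `hᵢ` with `i ≤ -r` or `i > r`
and for all `eᵢ, fᵢ` with `|i| ≥ r`. -/
def InRange (r : ℕ) (t : Idx) : Prop :=
  (∀ i, t.α i ≠ 0 → |i| < (r : ℤ)) ∧ (∀ i, t.β i ≠ 0 → |i| < (r : ℤ)) ∧
    ∀ i, t.γ i ≠ 0 → -(r : ℤ) < i ∧ i ≤ (r : ℤ)

namespace FormalSeries

/-- `Int(u,k,i)`: the connected components containing `i` of the sets `S(α,γ)` that occur in the
non-zero summands of `u_k`. -/
def interval (u : FormalSeries) (k : ℕ) (i : ℤ) : Set (Set ℤ) :=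
  {I | (∃ t, u.coeff k t ≠ 0 ∧ IsComponent (supp t) I) ∧ i ∈ I}

/-- For every `k` the powers of `c` in `u_k` are bounded; (i) the sets `Int(u,k,i)` are finite;
(ii) every truncation `u(r)` has, for each `k`, finitely many non-zero summands, that is,
`u(r) ∈ U_h(a_∞)`. -/
structure Admissible (u : FormalSeries) : Prop where
  bounded : ∀ k, ∃ L : ℕ, ∀ t : Idx, L < t.l → u.coeff k t = 0
  finite_interval : ∀ k i, (u.interval k i).Finite
  finite_truncation : ∀ r : ℕ, 0 < r → ∀ k, {t | InRange r t ∧ u.coeff k t ≠ 0}.Finite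

open Classical in
/-- The summands of the truncation `u(r)`. -/
def truncCoeff (u : FormalSeries) (r k : ℕ) (t : Idx) : Uh :=
  if InRange r t then u.coeff k t else 0

/-- `x` is the truncation `u(r)`, summed in `U_h(a_∞)`. -/
def IsTruncation (u : FormalSeries) (r : ℕ) (x : Uh) : Prop :=
  HasHSum (fun k => ∑ᶠ t, u.truncCoeff r k t) x

/-- The series `u` is admissible and its truncations `u(1), u(2), …` are the members of `x`. -/
def Represents (u : FormalSeries) (x : ℕ+ → Uh) : Prop :=
  u.Admissible ∧ ∀ r : ℕ+, u.IsTruncation r (x r)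

end FormalSeries

lemma HasHSum.add {N : Type*} [AddCommGroup N] [Module R N] {a b : ℕ → N} {s t : N}
    (ha : HasHSum a s) (hb : HasHSum b t) : HasHSum (fun k => a k + b k) (s + t) := by
  intro n
  obtain ⟨y, hy⟩ := ha n
  obtain ⟨z, hz⟩ := hb n
  refine ⟨y + z, ?_⟩
  rw [smul_add, ← hy, ← hz]
  simp only [smul_add, Finset.sum_add_distrib]
  abel

lemma HasHSum.smul {N : Type*} [AddCommGroup N] [Module R N] {a : ℕ → N} {s : N} (c : R)
    (ha : HasHSum a s) : HasHSum (fun k => c • a k) (c • s) := by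
  intro n
  obtain ⟨y, hy⟩ := ha n
  refine ⟨c • y, ?_⟩
  rw [smul_comm, ← hy, smul_sub, Finset.smul_sum]
  simp only [smul_comm c]

/-- `U_h(a_∞)` is `h`-adically complete: every series `∑ₖ h^k aₖ` has a sum. -/
lemma exists_hasHSum (a : ℕ → Uh) : ∃ s, HasHSum a s := by
  have key : ∀ (n : ℕ) (b : ℕ → FreeTop), ∃ y : FreeTop,
      (PowerSeries.mk fun n => ∑ k ∈ Finset.range (n + 1), PowerSeries.coeff (n - k) (b k))
        - ∑ k ∈ Finset.range n, PowerSeries.X ^ k * b k = PowerSeries.X ^ n * y := by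
    intro n
    induction n with
    | zero => exact fun b => ⟨_, by simp; rfl⟩
    | succ n ih =>
      intro b
      obtain ⟨y, hy⟩ := ih fun k => b (k + 1)
      refine ⟨y, ?_⟩
      have hb : (PowerSeries.mk fun n => ∑ k ∈ Finset.range (n + 1),
          PowerSeries.coeff (n - k) (b k)) = b 0 + PowerSeries.X * (PowerSeries.mk fun n =>
            ∑ k ∈ Finset.range (n + 1), PowerSeries.coeff (n - k) (b (k + 1))) := by
        ext j
        cases j with
        | zero => simp
        | succ j =>
          rw [PowerSeries.coeff_mk, Finset.sum_range_succ', map_add, PowerSeries.coeff_succ_X_mul,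
            PowerSeries.coeff_mk, add_comm]
          simp
      rw [hb, Finset.sum_range_succ', pow_succ', mul_assoc, ← hy, mul_sub, Finset.mul_sum]
      simp only [pow_succ', mul_assoc, pow_zero, one_mul]
      abel
  choose b hb using fun k => RingCon.mk'_surjective relIdeal.ringCon (a k)
  refine ⟨relIdeal.ringCon.mk' (PowerSeries.mk fun n => ∑ k ∈ Finset.range (n + 1),
    PowerSeries.coeff (n - k) (b k)), fun n => ?_⟩
  obtain ⟨y, hy⟩ := key n b
  have hX : ∀ (k : ℕ) (z : FreeTop), hh ^ k • (show Uh from relIdeal.ringCon.mk' z) =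
      relIdeal.ringCon.mk' (PowerSeries.X ^ k * z) := by
    intro k z
    have : (PowerSeries.X : FreeTop) ^ k * z = hh ^ k • z := by
      rw [Algebra.smul_def]
      congr 1
      exact (by simp : (PowerSeries.X : FreeTop) ^ k =
        PowerSeries.map (algebraMap ℂ (FreeAlgebra ℂ Gen)) (hh ^ k))
    rw [this]
    rfl
  refine ⟨relIdeal.ringCon.mk' y, ?_⟩
  refine Eq.trans ?_ (hX n y).symm
  rw [← hy, map_sub, map_sum]
  congr 1
  refine Finset.sum_congr rfl fun k _ => ?_
  rw [← hX k (b k)]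
  exact congrArg (hh ^ k • ·) (hb k).symm

/-- Every admissible series represents an element of `U_h(A_∞)`. -/
lemma FormalSeries.Admissible.exists_represents {u : FormalSeries} (hu : u.Admissible) :
    ∃ x, u.Represents x := by
  choose x hx using fun r : ℕ+ => exists_hasHSum fun k => ∑ᶠ t, u.truncCoeff r k t
  exact ⟨x, hu, hx⟩

lemma FormalSeries.Admissible.finite_support {u : FormalSeries} (hu : u.Admissible) {r : ℕ}
    (hr : 0 < r) (k : ℕ) : (Function.support (u.truncCoeff r k)).Finite := by
  refine (hu.finite_truncation r hr k).subset fun t ht => ?_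
  by_cases h : InRange r t <;> simp_all [FormalSeries.truncCoeff]

/-- `U_h(A_∞)`: all admissible series. As the normally ordered monomials are independent, a series
is determined by its truncations `u(1), u(2), …` in `U_h(a_∞)`, and is identified with the sequence
of these; so two series denote the same element if and only if all their truncations agree. -/
def UhA : Submodule R (ℕ+ → Uh) where
  carrier := {x | ∃ u : FormalSeries, u.Represents x}
  add_mem' := by
    rintro x y ⟨u, hu, hux⟩ ⟨v, hv, hvy⟩
    have key : ∀ k t, u.coeff k t + v.coeff k t ≠ 0 → u.coeff k t ≠ 0 ∨ v.coeff k t ≠ 0 := by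
      intro k t h
      by_contra! h'
      simp [h'.1, h'.2] at h
    refine ⟨⟨fun k t => u.coeff k t + v.coeff k t,
      fun k t => add_mem (u.mem k t) (v.mem k t)⟩, ⟨?_, ?_, ?_⟩, ?_⟩
    · intro k
      obtain ⟨L, hL⟩ := hu.bounded k
      obtain ⟨L', hL'⟩ := hv.bounded k
      refine ⟨max L L', fun t ht => ?_⟩
      simp [hL t (lt_of_le_of_lt (le_max_left _ _) ht),
        hL' t (lt_of_le_of_lt (le_max_right _ _) ht)]
    · intro k i
      refine ((hu.finite_interval k i).union (hv.finite_interval k i)).subset ?_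
      rintro I ⟨⟨t, ht, hI⟩, hi⟩
      rcases key k t ht with h | h
      · exact Or.inl ⟨⟨t, h, hI⟩, hi⟩
      · exact Or.inr ⟨⟨t, h, hI⟩, hi⟩
    · intro r hr k
      refine ((hu.finite_truncation r hr k).union (hv.finite_truncation r hr k)).subset ?_
      rintro t ⟨h1, h2⟩
      rcases key k t h2 with h | h
      · exact Or.inl ⟨h1, h⟩
      · exact Or.inr ⟨h1, h⟩
    · intro r
      refine (congrArg (fun a => HasHSum a (x r + y r)) (funext fun k => ?_)).mp
        ((hux r).add (hvy r))
      rw [← finsum_add_distrib (hu.finite_support r.pos k) (hv.finite_support r.pos k)]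
      refine finsum_congr fun t => ?_
      by_cases h : InRange (r : ℕ) t <;> simp [FormalSeries.truncCoeff, h]
  zero_mem' := by
    refine ⟨⟨fun _ _ => 0, fun _ _ => zero_mem _⟩, ⟨fun _ => ⟨0, fun _ _ => rfl⟩, ?_, ?_⟩, ?_⟩
    · intro k i
      simp [FormalSeries.interval]
    · intro r _ k
      simp
    · intro r n
      refine ⟨0, ?_⟩
      simp [FormalSeries.truncCoeff]
  smul_mem' := by
    rintro c x ⟨u, hu, hux⟩
    have key : ∀ k t, c • u.coeff k t ≠ 0 → u.coeff k t ≠ 0 := by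
      intro k t h h'
      simp [h'] at h
    refine ⟨⟨fun k t => c • u.coeff k t,
      fun k t => Submodule.smul_mem _ c (u.mem k t)⟩, ⟨?_, ?_, ?_⟩, ?_⟩
    · intro k
      obtain ⟨L, hL⟩ := hu.bounded k
      exact ⟨L, fun t ht => by simp [hL t ht]⟩
    · intro k i
      refine (hu.finite_interval k i).subset ?_
      rintro I ⟨⟨t, ht, hI⟩, hi⟩
      exact ⟨⟨t, key k t ht, hI⟩, hi⟩
    · intro r hr k
      refine (hu.finite_truncation r hr k).subset ?_
      rintro t ⟨h1, h2⟩
      exact ⟨h1, key k t h2⟩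
    · intro r
      refine (congrArg (fun a => HasHSum a (c • x r)) (funext fun k => ?_)).mp ((hux r).smul c)
      rw [smul_finsum' c (hu.finite_support r.pos k)]
      refine finsum_congr fun t => ?_
      by_cases h : InRange (r : ℕ) t <;> simp [FormalSeries.truncCoeff, h]

/-- `u ∈ U_h(a_∞)`, viewed as an element of `U_h(A_∞)`, is `x`: there is a normally ordered series
with finitely many non-zero summands for every power of `h` that sums up to `u` and represents `x`. -/
def IsImage (u : Uh) (x : UhA) : Prop :=
  ∃ D : FormalSeries, (∀ k, {t | D.coeff k t ≠ 0}.Finite) ∧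
    HasHSum (fun k => ∑ᶠ t, D.coeff k t) u ∧ D.Represents x

/-- The span of the normally ordered summands that the truncation at `r` sends to `0`. -/
def outOfRange (r : ℕ) : Submodule R Uh :=
  Submodule.span R {x | ∃ t, ¬ InRange r t ∧ x ∈ summands t}

/-- `w = u v` as formal series: for each `r`, the truncation `w(r)` is the `h`-adic limit for
`s → ∞` of the truncations at `r` of the products `u(s) v(s)` of partial sums. -/
def IsProduct (u v w : UhA) : Prop :=
  ∀ (r : ℕ+) (n : ℕ), ∃ s₀ : ℕ+, ∀ s ≥ s₀, ∃ z ∈ outOfRange r, ∃ y : Uh,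
    u.1 s * v.1 s - w.1 r = z + hh ^ n • y

/-! ### `C`-patterns and the module `V({M};ξ₀,ξ₁)` -/

/-- `x ∈ ℤ_+` for a polynomial `x` in `h`. -/
def IsNatP (x : ℂ[X]) : Prop := ∃ n : ℕ, x = (n : ℂ[X])

/-- The condition on the sequence `{M}`. -/
def IsSignature (M : ℤ → ℂ[X]) : Prop := ∀ i j : ℤ, i < j → IsNatP (M i - M j)

/-- `{M}` is of `(m,n)` signature. -/
def HasFiniteSignature (M : ℤ → ℂ[X]) (m n : ℤ) : Prop :=
  m ≤ n ∧ ∀ k : ℕ, M (m - k) = M m ∧ M (n + k) = M n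

/-- The positions of the `p`-th row of a pattern: `[1-k; k-1]` for `p = 2k-1` and `[-k; k-1]` for
`p = 2k` (empty for `p = 0`). -/
def row (p : ℕ) : Finset ℤ := Finset.Icc (-((p : ℤ) / 2)) (((p : ℤ) - 1) / 2)

/-- `P p i` is the entry `M_{i,p}` in row `p ≥ 1` at position `i ∈ row p`; all other values of `P`
are normalized to `0`. -/
structure IsCPattern (M : ℤ → ℂ[X]) (P : ℕ → ℤ → ℂ[X]) : Prop where
  outside : ∀ p i, i ∉ row p → P p i = 0
  stable : ∃ N : ℕ, 1 < N ∧ ∀ p ≥ N, ∀ i ∈ row p, P p i = M i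
  odd_row : ∀ k : ℕ, 1 ≤ k → ∀ i ∈ row (2 * k - 1),
    IsNatP (P (2 * k) (i - 1) - P (2 * k - 1) i) ∧ IsNatP (P (2 * k - 1) i - P (2 * k) i)
  even_row : ∀ k : ℕ, 1 ≤ k → ∀ i ∈ row (2 * k),
    IsNatP (P (2 * k + 1) i - P (2 * k) i) ∧ IsNatP (P (2 * k) i - P (2 * k + 1) (i + 1))

/-- The `C`-basis `Γ({M})`. -/
def CBasis (M : ℤ → ℂ[X]) : Type := {P : ℕ → ℤ → ℂ[X] // IsCPattern M P}

/-- The `h`-adic completion `V` of the free `ℂ[[h]]`-module on `Γ({M})`: families of coefficients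
that tend to `0`, that is, for every `n` only finitely many of them have a non-zero `h^n` term. -/
def V (M : ℤ → ℂ[X]) : Submodule R (CBasis M → R) where
  carrier := {v | ∀ n, {P | PowerSeries.coeff n (v P) ≠ 0}.Finite}
  add_mem' := by
    intro v w hv hw n
    refine ((hv n).union (hw n)).subset fun P hP => ?_
    by_contra! h
    simp only [Set.mem_union, Set.mem_ofPred_eq, not_or, not_not] at h
    simp [h.1, h.2] at hP
  zero_mem' := by
    intro n
    simp
  smul_mem' := by
    intro c v hv n
    refine ((Finset.range (n + 1)).finite_toSet.biUnion fun j _ => hv j).subset fun P hP => ?_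
    by_contra! h
    simp only [Set.mem_iUnion, Set.mem_ofPred_eq, not_exists, not_not] at h
    refine hP ?_
    simp only [Pi.smul_apply, smul_eq_mul, PowerSeries.coeff_mul]
    refine Finset.sum_eq_zero fun p hp => ?_
    rw [h p.2 (by
      have := Finset.HasAntidiagonal.mem_antidiagonal.mp hp
      simp only [Finset.coe_range, Set.mem_Iio]
      omega), mul_zero]

open Classical in
/-- The basis vector `|M)`. -/
def vec {M : ℤ → ℂ[X]} (P : CBasis M) : V M :=
  ⟨Pi.single P 1, fun n => (Set.finite_singleton P).subset fun Q hQ => by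
    by_contra h
    simp only [Set.mem_singleton_iff] at h
    simp [Pi.single_eq_of_ne h] at hQ⟩

/-- `V̂`: the finite `ℂ[[h]]`-linear combinations of basis vectors. -/
def IsFiniteVec {M : ℤ → ℂ[X]} (v : V M) : Prop := {P | v.1 P ≠ 0}.Finite

open Classical in
/-- The vector of an array of entries, deleted (set to `0`) if the array is not a `C`-pattern. -/
def vecOrZero (M : ℤ → ℂ[X]) (P : ℕ → ℤ → ℂ[X]) : V M :=
  if hP : IsCPattern M P then vec ⟨P, hP⟩ else 0

/-- Replace `M_{j,p}` by `M_{j,p} + s`. -/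
def shift (P : ℕ → ℤ → ℂ[X]) (j : ℤ) (p : ℕ) (s : ℤ) : ℕ → ℤ → ℂ[X] :=
  fun p' j' => if p' = p ∧ j' = j then P p' j' + (s : ℂ[X]) else P p' j'

/-- `L_{i,p} = M_{i,p} - i`. -/
def LL (P : ℕ → ℤ → ℂ[X]) (i : ℤ) (p : ℕ) : ℂ[X] := P p i - (i : ℂ[X])

/-- `S(j,l;ν)`. -/
def SS (j l : ℤ) (ν : ℕ) : R := if j = l then (-1) ^ ν else if j < l then 1 else -1

/-- The action of `e_{-1}^{1-μ}` (so of `e_{-1}` for `μ = 0` and of `f_{-1}` for `μ = 1`). -/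
def actMinusOne (M : ℤ → ℂ[X]) (μ : ℕ) (P : ℕ → ℤ → ℂ[X]) : V M :=
  hsqrt (qbrP (LL P (-1) 2 - LL P 0 1 - (μ : ℂ[X])) * qbrP (LL P 0 1 - LL P 0 2 + (μ : ℂ[X]))) •
    vecOrZero M (shift P 0 1 (-(-1) ^ μ))

/-- The quantity under the square root in the action of `e^μ_{(-1)^ν i - 1}`, for the pattern shifted
at the places `j` of row `2i+ν-1` and `l` of row `2i+ν`. -/
def radicand (i μ ν : ℕ) (P : ℕ → ℤ → ℂ[X]) (j l : ℤ) : R :=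
  -(((∏ k ∈ (row (2 * i + ν)).erase l,
        qbrP (LL P k (2 * i + ν) - LL P j (2 * i + ν - 1) - (-1) ^ ν * (μ : ℂ[X]))) *
      (∏ k ∈ row (2 * i + ν - 2),
        qbrP (LL P k (2 * i + ν - 2) - LL P j (2 * i + ν - 1) - (-1) ^ ν * (μ : ℂ[X])))) *
    (∏ k ∈ (row (2 * i + ν - 1)).erase j,
      (qbrP (LL P k (2 * i + ν - 1) - LL P j (2 * i + ν - 1)) *
        qbrP (LL P k (2 * i + ν - 1) - LL P j (2 * i + ν - 1) + (-1) ^ (μ + ν))))⁻¹ *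
    ((∏ k ∈ row (2 * i + ν + 1),
        qbrP (LL P k (2 * i + ν + 1) - LL P l (2 * i + ν) + (-1) ^ ν * (1 - (μ : ℂ[X])))) *
      (∏ k ∈ (row (2 * i + ν - 1)).erase j,
        qbrP (LL P k (2 * i + ν - 1) - LL P l (2 * i + ν) + (-1) ^ ν * (1 - (μ : ℂ[X]))))) *
    (∏ k ∈ (row (2 * i + ν)).erase l,
      (qbrP (LL P k (2 * i + ν) - LL P l (2 * i + ν)) *
        qbrP (LL P k (2 * i + ν) - LL P l (2 * i + ν) + (-1) ^ (μ + ν))))⁻¹)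

/-- The action of `e^μ_{(-1)^ν i - 1}` for `i ≥ 1` (`e¹ = e`, `e⁰ = f`). -/
def act (M : ℤ → ℂ[X]) (i μ ν : ℕ) (P : ℕ → ℤ → ℂ[X]) : V M :=
  -∑ j ∈ row (2 * i + ν - 1), ∑ l ∈ row (2 * i + ν),
    (SS j l ν * hsqrt (radicand i μ ν P j l)) •
      vecOrZero M (shift (shift P j (2 * i + ν - 1) (-(-1) ^ (μ + ν))) l (2 * i + ν)
        (-(-1) ^ (μ + ν)))

/-- The eigenvalue of `hᵢ` on `|M)`. -/
def hEigenvalue (ξ₀ ξ₁ : ℂ[X]) (P : ℕ → ℤ → ℂ[X]) (i : ℤ) : ℂ[X] :=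
  ∑ j ∈ row (2 * i.natAbs + (theta i).toNat), P (2 * i.natAbs + (theta i).toNat) j
    - ∑ j ∈ row (2 * i.natAbs + (theta i).toNat - 1), P (2 * i.natAbs + (theta i).toNat - 1) j
    + (ξ₁ - ξ₀) * (theta (-i) : ℂ[X]) - ξ₁

/-- `e^μ_i`: `e⁰_i = f_i` and `e¹_i = e_i`. -/
def Gen.ef (μ : ℕ) (i : ℤ) : Gen := if μ = 0 then Gen.f i else Gen.e i

/-- The transformation formulas of the `C`-basis of `V({M};ξ₀,ξ₁)` under the Chevalley generators. -/
structure IsCentralBasisAction (M : ℤ → ℂ[X]) (ξ₀ ξ₁ : ℂ[X])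
    (ρ : Uh →ₐ[R] Module.End R (V M)) : Prop where
  minus_one : ∀ μ : ℕ, μ ≤ 1 → ∀ P : CBasis M,
    ρ (ug (Gen.ef (1 - μ) (-1))) (vec P) = actMinusOne M μ P.1
  ef : ∀ i μ ν : ℕ, 1 ≤ i → μ ≤ 1 → ν ≤ 1 → ∀ P : CBasis M,
    ρ (ug (Gen.ef μ ((-1) ^ ν * (i : ℤ) - 1))) (vec P) = act M i μ ν P.1
  h : ∀ (i : ℤ) (P : CBasis M),
    ρ (ug (Gen.h i)) (vec P) = (hEigenvalue ξ₀ ξ₁ P.1 i : R) • vec P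
  c : ∀ P : CBasis M, ρ (ug Gen.c) (vec P) = ((ξ₀ - ξ₁ : ℂ[X]) : R) • vec P

/-! ### Representations of `U_h(A_∞)` -/

/-- `ρ`, together with its restriction `ρ₀` to `U_h(a_∞)`, is a homomorphism: it extends `ρ₀` (in
particular it sends `1` to `1`); it is multiplicative, `ρ(w) = ρ(u) ρ(v)` whenever `w = u v` in
`U_h(A_∞)`; and, whether or not the formal product `u v` lies in `U_h(A_∞)`, the products `u(s) v(s)`
of partial sums act in the limit `s → ∞` as `ρ(u) ρ(v)`. -/
structure IsRepresentation {M : ℤ → ℂ[X]} (ρ₀ : Uh →ₐ[R] Module.End R (V M))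
    (ρ : UhA →ₗ[R] Module.End R (V M)) : Prop where
  extends_small : ∀ u x, IsImage u x → ρ x = ρ₀ u
  mul : ∀ u v w, IsProduct u v w → ρ w = ρ u * ρ v
  mul_limit : ∀ (u v : UhA) (x : V M) (n : ℕ), ∃ s₀ : ℕ+, ∀ s ≥ s₀, ∃ y : V M,
    ρ₀ (u.1 s * v.1 s) x - ρ u (ρ v x) = hh ^ n • y

/-- Continuity for the `h`-adic topologies of `U_h(A_∞)` and `End V`. -/
def IsHContinuous {M : ℤ → ℂ[X]} (ρ : UhA →ₗ[R] Module.End R (V M)) : Prop :=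
  @Continuous UhA (Module.End R (V M)) ((Ideal.span {hh}).adicModuleTopology UhA)
    ((Ideal.span {hh}).adicModuleTopology (Module.End R (V M))) ρ

/-- `v` is a highest weight vector that generates `V` over `U_h(A_∞)`. -/
structure IsHighestWeightVector {M : ℤ → ℂ[X]} (ρ₀ : Uh →ₐ[R] Module.End R (V M))
    (ρ : UhA →ₗ[R] Module.End R (V M)) (v : V M) : Prop where
  ne_zero : v ≠ 0
  raising : ∀ β : ℤ →₀ ℕ, β ≠ 0 → ∀ x ∈ nPlus β, ρ₀ x v = 0
  eigen_h : ∀ i : ℤ, ∃ a : R, ρ₀ (ug (Gen.h i)) v = a • v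
  eigen_c : ∃ a : R, ρ₀ (ug Gen.c) v = a • v
  generates : ∀ y : V M, ∃ u : UhA, ρ u v = y

/-- Irreducibility over `ℂ[[h]]`: the only invariant submodules with torsion-free quotient are `0`
and `V`. (The submodules `h^n V` are always invariant.) Equivalently, for any `x ≠ 0` and any `y` some
`u` satisfies `ρ(u) x = a y` with `0 ≠ a ∈ ℂ[[h]]`. -/
def IsIrreducibleRep {M : ℤ → ℂ[X]} (ρ : UhA →ₗ[R] Module.End R (V M)) : Prop :=
  Nontrivial (V M) ∧ ∀ W : Submodule R (V M), (∀ u, ∀ w ∈ W, ρ u w ∈ W) →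
    (∀ v, hh • v ∈ W → v ∈ W) → W = ⊥ ∨ W = ⊤

/-- Restricted representations (`v` runs through the coefficients `v_k ∈ V̂` of the elements
`∑ₖ h^k v_k` of `V`). -/
def IsRestrictedRep {M : ℤ → ℂ[X]} (ρ₀ : Uh →ₐ[R] Module.End R (V M)) : Prop :=
  ∀ v : V M, IsFiniteVec v → ∃ r : ℕ,
    (∀ β : ℤ →₀ ℕ, ¬ (β.support : Set ℤ) ⊆ Set.Ioo (-(r : ℤ)) r → ∀ x ∈ nPlus β, ρ₀ x v = 0) ∧
    (∀ α : ℤ →₀ ℕ, α ≠ 0 →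
      ((α.support : Set ℤ) ⊆ Set.Iic (-(r : ℤ)) ∨ (α.support : Set ℤ) ⊆ Set.Ici (r : ℤ)) →
        ∀ x ∈ nMinus α, ρ₀ x v = 0) ∧
    ∀ i : ℤ, (r : ℤ) ≤ |i| → ρ₀ (ug (Gen.h i)) v = 0

end QuantumAInf

end

noncomputable section

namespace QuantumAInf

/-! ### Quantum integers with square roots in a field -/

/-- A parameter `q` of a field that is not a root of unity, with chosen square roots `σ n` of the
quantum integers `[|n|]`. -/
structure QSqrt (K : Type*) [Field K] where
  q : K
  q_ne : q ≠ 0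
  pow_ne : ∀ n : ℤ, n ≠ 0 → q ^ n ≠ q ^ (-n)
  σ : ℤ → K
  σ_neg : ∀ n, σ (-n) = σ n
  σ_sq : ∀ n : ℤ, σ n * σ n = (q ^ |n| - q ^ (-|n|)) / (q - q⁻¹)

namespace QSqrt

variable {K : Type*} [Field K] (D : QSqrt K)

/-- The quantum integer `[n]`. -/
def br (n : ℤ) : K := (D.q ^ n - D.q ^ (-n)) / (D.q - D.q⁻¹)

lemma q_sub_ne : D.q - D.q⁻¹ ≠ 0 := by
  have := D.pow_ne 1 one_ne_zero
  rw [zpow_one, zpow_neg, zpow_one] at this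
  exact sub_ne_zero.mpr this

lemma br_neg (n : ℤ) : D.br (-n) = -D.br n := by
  unfold br
  rw [neg_neg, ← neg_div, neg_sub]

@[simp] lemma br_zero : D.br 0 = 0 := by simp [br]

@[simp] lemma br_one : D.br 1 = 1 := by
  unfold br
  rw [zpow_one, zpow_neg, zpow_one, div_self D.q_sub_ne]

lemma br_ne_zero {n : ℤ} (hn : n ≠ 0) : D.br n ≠ 0 :=
  div_ne_zero (sub_ne_zero.mpr (D.pow_ne n hn)) D.q_sub_ne

lemma br_eq_zero {n : ℤ} : D.br n = 0 ↔ n = 0 :=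
  ⟨fun h => by_contra fun hn => D.br_ne_zero hn h, fun h => by simp [h]⟩

/-- The sign of an integer, with value `1` at `0`. -/
def sg (x : ℤ) : K := if 0 ≤ x then 1 else -1

lemma br_abs (x : ℤ) : D.br |x| = sg x * D.br x := by
  unfold sg
  split_ifs with h
  · rw [abs_of_nonneg h, one_mul]
  · rw [abs_of_neg (not_le.mp h), br_neg, neg_one_mul]

lemma br_abs_succ (x : ℤ) : D.br |x + 1| = sg x * D.br (x + 1) := by
  unfold sg
  split_ifs with h
  · rw [abs_of_nonneg (by omega), one_mul]
  · rw [abs_of_nonpos (by omega), br_neg, neg_one_mul]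

lemma σ_mul_self (n : ℤ) : D.σ n * D.σ n = D.br |n| := D.σ_sq n

lemma σ_eq_zero {n : ℤ} : D.σ n = 0 ↔ n = 0 := by
  rw [← mul_self_eq_zero, σ_mul_self, br_eq_zero, abs_eq_zero]

@[simp] lemma σ_zero : D.σ 0 = 0 := D.σ_eq_zero.mpr rfl

lemma σ_ne_zero {n : ℤ} (hn : n ≠ 0) : D.σ n ≠ 0 := fun h => hn (D.σ_eq_zero.mp h)

lemma σ_sub_comm (m n : ℤ) : D.σ (m - n) = D.σ (n - m) := by
  rw [← D.σ_neg, neg_sub]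

end QSqrt

/-! ### Integral arrays and interlacing -/

/-- Integral arrays; `Λ p k` is the `k`-th entry of row `p`, relevant for `k < p`. -/
abbrev Arr : Type := ℕ → ℕ → ℤ

/-- The array with entry `1` at the `k`-th place of row `p` and `0` elsewhere. -/
def dl (p k : ℕ) : Arr := fun p' k' => if p' = p ∧ k' = k then 1 else 0

@[simp] lemma dl_self (p k : ℕ) : dl p k p k = 1 := by simp [dl]

lemma dl_row_ne {p k p' k' : ℕ} (h : p' ≠ p) : dl p k p' k' = 0 := by simp [dl, h]

lemma dl_ne {p k p' k' : ℕ} (h : k' ≠ k) : dl p k p' k' = 0 := by simp [dl, h]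

@[simp] lemma dl_succ_self (p k k' : ℕ) : dl (p + 1) k p k' = 0 := dl_row_ne (by omega)
@[simp] lemma dl_self_succ (p k k' : ℕ) : dl p k (p + 1) k' = 0 := dl_row_ne (by omega)
@[simp] lemma dl_add_two_self (p k k' : ℕ) : dl (p + 2) k p k' = 0 := dl_row_ne (by omega)
@[simp] lemma dl_self_add_two (p k k' : ℕ) : dl p k (p + 2) k' = 0 := dl_row_ne (by omega)
@[simp] lemma dl_succ_add_two (p k k' : ℕ) : dl (p + 1) k (p + 2) k' = 0 := dl_row_ne (by omega)
@[simp] lemma dl_add_two_succ (p k k' : ℕ) : dl (p + 2) k (p + 1) k' = 0 := dl_row_ne (by omega)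

/-- The interlacing conditions between consecutive rows. -/
def Inter (Λ : Arr) : Prop :=
  ∀ p k, k < p → Λ p k ≤ Λ (p + 1) k ∧ Λ (p + 1) (k + 1) < Λ p k

lemma Inter.step {Λ : Arr} (h : Inter Λ) {p k : ℕ} (hk : k + 1 < p) : Λ p (k + 1) < Λ p k :=
  (h p (k + 1) hk).1.trans_lt (h p k (by omega)).2

lemma Inter.anti {Λ : Arr} (h : Inter Λ) {p k k' : ℕ} (hk : k < k') (hk' : k' < p) :
    Λ p k' < Λ p k := by
  induction k', hk using Nat.le_induction with
  | base => exact h.step hk'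
  | succ n hn ih => exact (h.step hk').trans (ih (by omega))

lemma Inter.anti_le {Λ : Arr} (h : Inter Λ) {p k k' : ℕ} (hk : k ≤ k') (hk' : k' < p) :
    Λ p k' ≤ Λ p k := by
  rcases hk.lt_or_eq with h1 | rfl
  · exact (h.anti h1 hk').le
  · exact le_rfl

lemma Inter.ne {Λ : Arr} (h : Inter Λ) {p k k' : ℕ} (hne : k ≠ k') (hk : k < p) (hk' : k' < p) :
    Λ p k ≠ Λ p k' := by
  rcases lt_or_gt_of_ne hne with h1 | h1
  · exact (h.anti h1 hk').ne'
  · exact (h.anti h1 hk).ne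

/-- The position of the entries of two consecutive rows relative to each other. -/
lemma Inter.le_iff {Λ : Arr} (h : Inter Λ) {p k a : ℕ} (hk : k < p) (ha : a < p + 1) :
    Λ p k ≤ Λ (p + 1) a ↔ a ≤ k := by
  constructor
  · intro h1
    by_contra! h2
    have h3 := (h p k hk).2
    have h4 := h.anti_le (p := p + 1) (k := k + 1) (k' := a) h2 ha
    omega
  · intro h1
    exact (h p k hk).1.trans (h.anti_le (p := p + 1) h1 (by omega))

namespace QSqrt

variable {K : Type*} [Field K] (D : QSqrt K)

/-! ### Matrix elements of the row operators -/

/-- Partial products of the matrix element for raising the `k`-th entry of row `p + 1`: `A`, `B`, `C`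
are the sets of places of the rows `p + 2`, `p` and `p + 1` that contribute. -/
def wgen (A B C : Finset ℕ) (p k : ℕ) (Λ : Arr) : K :=
  (∏ a ∈ A, D.σ (Λ (p + 2) a - Λ (p + 1) k)) * (∏ b ∈ B, D.σ (Λ (p + 1) k + 1 - Λ p b)) *
    ∏ k' ∈ C, (D.σ (Λ (p + 1) k' - Λ (p + 1) k) * D.σ (Λ (p + 1) k' - Λ (p + 1) k - 1))⁻¹

/-- The matrix element for raising the `k`-th entry of row `p + 1`. -/
def w (p k : ℕ) (Λ : Arr) : K :=
  D.wgen (Finset.range (p + 2)) (Finset.range p) ((Finset.range (p + 1)).erase k) p k Λ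

lemma wgen_congr {A B C : Finset ℕ} {p k : ℕ} {Λ Λ' : Arr} (h : Λ (p + 1) k = Λ' (p + 1) k)
    (hA : ∀ a ∈ A, Λ (p + 2) a = Λ' (p + 2) a) (hB : ∀ b ∈ B, Λ p b = Λ' p b)
    (hC : ∀ c ∈ C, Λ (p + 1) c = Λ' (p + 1) c) : D.wgen A B C p k Λ = D.wgen A B C p k Λ' := by
  unfold wgen
  rw [h]
  congr 1
  · congr 1
    · exact Finset.prod_congr rfl fun a ha => by rw [hA a ha]
    · exact Finset.prod_congr rfl fun a ha => by rw [hB a ha]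
  · exact Finset.prod_congr rfl fun a ha => by rw [hC a ha]

lemma wgen_up {A B C : Finset ℕ} {a : ℕ} (ha : a ∈ A) (p k : ℕ) (Λ : Arr) :
    D.wgen A B C p k Λ = D.σ (Λ (p + 2) a - Λ (p + 1) k) * D.wgen (A.erase a) B C p k Λ := by
  unfold wgen
  rw [← Finset.mul_prod_erase A _ ha]
  ring

lemma wgen_down {A B C : Finset ℕ} {b : ℕ} (hb : b ∈ B) (p k : ℕ) (Λ : Arr) :
    D.wgen A B C p k Λ = D.σ (Λ (p + 1) k + 1 - Λ p b) * D.wgen A (B.erase b) C p k Λ := by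
  unfold wgen
  rw [← Finset.mul_prod_erase B _ hb]
  ring

lemma wgen_side {A B C : Finset ℕ} {c : ℕ} (hc : c ∈ C) (p k : ℕ) (Λ : Arr) :
    D.wgen A B C p k Λ = (D.σ (Λ (p + 1) c - Λ (p + 1) k) * D.σ (Λ (p + 1) c - Λ (p + 1) k - 1))⁻¹ *
      D.wgen A B (C.erase c) p k Λ := by
  unfold wgen
  rw [← Finset.mul_prod_erase C _ hc]
  ring

lemma inter_add {p k : ℕ} {Λ : Arr} (h : Inter Λ) (hw : D.w p k Λ ≠ 0) (hk : k < p + 1) :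
    Inter (Λ + dl (p + 1) k) := by
  have hup : Λ (p + 2) k - Λ (p + 1) k ≠ 0 := by
    intro h0
    apply hw
    rw [w, D.wgen_up (a := k) (by simp; omega), h0, σ_zero, zero_mul]
  have hdn : ∀ b < p, Λ (p + 1) k + 1 - Λ p b ≠ 0 := by
    intro b hb h0
    apply hw
    rw [w, D.wgen_down (b := b) (by simpa using hb), h0, σ_zero, zero_mul]
  intro p' k' hk'
  obtain ⟨h1, h2⟩ := h p' k' hk'
  simp only [Pi.add_apply, dl]
  refine ⟨?_, ?_⟩
  · by_cases h3 : p' = p + 1 ∧ k' = k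
    · obtain ⟨rfl, rfl⟩ := h3
      have h4 : Λ (p + 1) k' ≤ Λ (p + 2) k' := h1
      have h5 : Λ (p + 1) k' + 1 ≤ Λ (p + 2) k' := by omega
      simpa using h5
    · rw [if_neg h3]
      split_ifs <;> omega
  · by_cases h3 : p' + 1 = p + 1 ∧ k' + 1 = k
    · obtain ⟨h4, rfl⟩ := h3
      obtain rfl : p' = p := by omega
      have := hdn k' hk'
      simp
      omega
    · rw [if_neg h3]
      split_ifs <;> omega

open Classical in
/-- The matrix element of a raising operator, in the gauge given by `ε`. -/
def cE (ε : ℕ → ℤ) (p k : ℕ) (Λ : Arr) : K :=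
  if Inter Λ then D.w p k Λ * D.q ^ (ε p * Λ (p + 1) k) else 0

open Classical in
/-- The matrix element of a lowering operator, in the gauge given by `ε`, as a function of the lowered
array. -/
def cF (ε : ℕ → ℤ) (p k : ℕ) (Λ : Arr) : K :=
  if Inter Λ then D.w p k Λ * D.q ^ (-(ε p * Λ (p + 1) k)) else 0

lemma cE_of_inter {ε : ℕ → ℤ} {p k : ℕ} {Λ : Arr} (h : Inter Λ) :
    D.cE ε p k Λ = D.w p k Λ * D.q ^ (ε p * Λ (p + 1) k) := if_pos h

lemma cF_of_inter {ε : ℕ → ℤ} {p k : ℕ} {Λ : Arr} (h : Inter Λ) :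
    D.cF ε p k Λ = D.w p k Λ * D.q ^ (-(ε p * Λ (p + 1) k)) := if_pos h

lemma cE_of_not {ε : ℕ → ℤ} {p k : ℕ} {Λ : Arr} (h : ¬ Inter Λ) : D.cE ε p k Λ = 0 := if_neg h

lemma cF_of_not {ε : ℕ → ℤ} {p k : ℕ} {Λ : Arr} (h : ¬ Inter Λ) : D.cF ε p k Λ = 0 := if_neg h

/-- After a raising step the indicator of the interlacing condition is superfluous. -/
lemma w_mul_cE {ε : ℕ → ℤ} {p k p' k' : ℕ} {Λ : Arr} (h : Inter Λ) (hk : k < p + 1) :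
    D.w p k Λ * D.cE ε p' k' (Λ + dl (p + 1) k) = D.w p k Λ *
      (D.w p' k' (Λ + dl (p + 1) k) * D.q ^ (ε p' * (Λ + dl (p + 1) k) (p' + 1) k')) := by
  by_cases hw : D.w p k Λ = 0
  · simp [hw]
  · rw [D.cE_of_inter (D.inter_add h hw hk)]

/-- The operator that moves one entry of row `r` by `s`, with matrix elements `c`. -/
def hop (r : ℕ) (s : ℤ) (c : ℕ → Arr → K) : Module.End K (Arr →₀ K) :=
  Finsupp.linearCombination K fun Λ =>
    ∑ k ∈ Finset.range r, c k Λ • Finsupp.single (Λ + s • dl r k) 1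

lemma hop_single (r : ℕ) (s : ℤ) (c : ℕ → Arr → K) (Λ : Arr) :
    hop r s c (Finsupp.single Λ 1) =
      ∑ k ∈ Finset.range r, c k Λ • Finsupp.single (Λ + s • dl r k) 1 := by
  simp [hop]

/-- The raising operator of row `p + 1`. -/
def E (ε : ℕ → ℤ) (p : ℕ) : Module.End K (Arr →₀ K) := hop (p + 1) 1 fun k => D.cE ε p k

/-- The lowering operator of row `p + 1`. -/
def F (ε : ℕ → ℤ) (p : ℕ) : Module.End K (Arr →₀ K) :=
  hop (p + 1) (-1) fun k Λ => D.cF ε p k (Λ - dl (p + 1) k)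

lemma E_single (ε : ℕ → ℤ) (p : ℕ) (Λ : Arr) : D.E ε p (Finsupp.single Λ 1) =
    ∑ k ∈ Finset.range (p + 1), D.cE ε p k Λ • Finsupp.single (Λ + dl (p + 1) k) 1 := by
  simp [E, hop_single]

lemma F_single (ε : ℕ → ℤ) (p : ℕ) (Λ : Arr) : D.F ε p (Finsupp.single Λ 1) =
    ∑ k ∈ Finset.range (p + 1), D.cF ε p k (Λ - dl (p + 1) k) •
      Finsupp.single (Λ - dl (p + 1) k) 1 := by
  simp [F, hop_single, sub_eq_add_neg]

/-- Linear operators that agree on the basis are equal. -/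
lemma end_ext {T T' : Module.End K (Arr →₀ K)}
    (h : ∀ Λ, T (Finsupp.single Λ 1) = T' (Finsupp.single Λ 1)) : T = T' :=
  Finsupp.lhom_ext' fun Λ => LinearMap.ext_ring (h Λ)

/-- The diagonal operator with eigenvalues `f`. -/
def diagOp (f : Arr → K) : Module.End K (Arr →₀ K) :=
  Finsupp.linearCombination K fun Λ => f Λ • Finsupp.single Λ 1

lemma diagOp_single (f : Arr → K) (Λ : Arr) :
    diagOp f (Finsupp.single Λ 1) = f Λ • Finsupp.single Λ 1 := by
  simp [diagOp]

lemma diagOp_mul_comm (f g : Arr → K) : diagOp f * diagOp g = diagOp g * diagOp f := by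
  refine end_ext fun Λ => ?_
  simp only [Module.End.mul_apply, diagOp_single, map_smul, smul_smul, mul_comm]

lemma diagOp_mul (f g : Arr → K) : diagOp f * diagOp g = diagOp fun Λ => f Λ * g Λ := by
  refine end_ext fun Λ => ?_
  simp only [Module.End.mul_apply, diagOp_single, map_smul, smul_smul, mul_comm]

lemma diagOp_mul_hop {f : Arr → K} {r : ℕ} {s : ℤ} {c : ℕ → Arr → K} {a : K}
    (h : ∀ Λ, ∀ k < r, c k Λ ≠ 0 → f (Λ + s • dl r k) = a * f Λ) :
    diagOp f * hop r s c = a • (hop r s c * diagOp f) := by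
  refine end_ext fun Λ => ?_
  simp only [Module.End.mul_apply, diagOp_single, hop_single, map_smul, map_sum, LinearMap.smul_apply,
    Finset.smul_sum, smul_smul]
  refine Finset.sum_congr rfl fun k hk => ?_
  by_cases hc : c k Λ = 0
  · simp [hc]
  · rw [h Λ k (by simpa using hk) hc]
    congr 1
    ring

end QSqrt

end QuantumAInf

end

noncomputable section

namespace QuantumAInf

namespace QSqrt

variable {K : Type*} [Field K] (D : QSqrt K)

/-! ### Commutation of row operators -/

/-- `w p k` without the factor of the `a`-th place of row `p + 2`. -/
def wU (p k a : ℕ) (Λ : Arr) : K :=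
  D.wgen ((Finset.range (p + 2)).erase a) (Finset.range p) ((Finset.range (p + 1)).erase k) p k Λ

/-- `w (p + 1) a` without the factor of the `k`-th place of row `p + 1`. -/
def wD (p k a : ℕ) (Λ : Arr) : K :=
  D.wgen (Finset.range (p + 3)) ((Finset.range (p + 1)).erase k) ((Finset.range (p + 2)).erase a)
    (p + 1) a Λ

lemma w_eq_wU {p k a : ℕ} (ha : a < p + 2) (Λ : Arr) :
    D.w p k Λ = D.σ (Λ (p + 2) a - Λ (p + 1) k) * D.wU p k a Λ :=
  D.wgen_up (Finset.mem_range.mpr ha) p k Λ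

lemma w_eq_wD {p k a : ℕ} (hk : k < p + 1) (Λ : Arr) :
    D.w (p + 1) a Λ = D.σ (Λ (p + 2) a + 1 - Λ (p + 1) k) * D.wD p k a Λ :=
  D.wgen_down (Finset.mem_range.mpr hk) (p + 1) a Λ

lemma wU_add (p k a : ℕ) (Λ : Arr) : D.wU p k a (Λ + dl (p + 2) a) = D.wU p k a Λ := by
  refine D.wgen_congr ?_ ?_ ?_ ?_ <;> intros <;> simp
  rename_i a' ha
  exact dl_ne (Finset.ne_of_mem_erase ha)

lemma wD_add (p k a : ℕ) (Λ : Arr) : D.wD p k a (Λ + dl (p + 1) k) = D.wD p k a Λ := by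
  refine D.wgen_congr ?_ ?_ ?_ ?_ <;> intros <;> simp
  rename_i a' ha
  exact dl_ne (Finset.ne_of_mem_erase ha)

lemma w_add_of_far {p k p' k' : ℕ} (h : p + 2 ≤ p' ∨ p' + 2 ≤ p) (Λ : Arr) :
    D.w p k (Λ + dl (p' + 1) k') = D.w p k Λ := by
  refine D.wgen_congr ?_ ?_ ?_ ?_ <;> intros <;> simp <;> exact dl_row_ne (by omega)

lemma w_square_far {p k p' k' : ℕ} (h : p + 2 ≤ p' ∨ p' + 2 ≤ p) (Λ : Arr) :
    D.w p k Λ * D.w p' k' Λ =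
      D.w p k (Λ + dl (p' + 1) k') * D.w p' k' (Λ + dl (p + 1) k) := by
  rw [D.w_add_of_far h, D.w_add_of_far h.symm]

lemma w_square_succ {p k a : ℕ} (hk : k < p + 1) (ha : a < p + 2) (Λ : Arr) :
    D.w p k Λ * D.w (p + 1) a Λ =
      D.w p k (Λ + dl (p + 2) a) * D.w (p + 1) a (Λ + dl (p + 1) k) := by
  rw [D.w_eq_wU ha, D.w_eq_wD hk, D.w_eq_wU ha, D.w_eq_wD hk, wU_add, wD_add]
  simp only [Pi.add_apply, dl_self, dl_succ_add_two, dl_add_two_succ]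
  ring_nf

lemma w_square_same {p k k' : ℕ} (hne : k ≠ k') (hk : k < p + 1) (hk' : k' < p + 1) (Λ : Arr) :
    D.w p k Λ * D.w p k' Λ =
      D.w p k (Λ + dl (p + 1) k') * D.w p k' (Λ + dl (p + 1) k) := by
  have h1 : k' ∈ (Finset.range (p + 1)).erase k := by simp [hne.symm, hk']
  have h2 : k ∈ (Finset.range (p + 1)).erase k' := by simp [hne, hk]
  simp only [w]
  rw [D.wgen_side h1, D.wgen_side h2, D.wgen_side h1, D.wgen_side h2]
  have e1 : D.wgen (Finset.range (p + 2)) (Finset.range p) (((Finset.range (p + 1)).erase k).erase k')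
      p k (Λ + dl (p + 1) k') = D.wgen (Finset.range (p + 2)) (Finset.range p)
        (((Finset.range (p + 1)).erase k).erase k') p k Λ := by
    refine D.wgen_congr ?_ ?_ ?_ ?_ <;> intros <;> simp
    · exact dl_ne hne
    · rename_i a ha
      exact dl_ne (Finset.ne_of_mem_erase ha)
  have e2 : D.wgen (Finset.range (p + 2)) (Finset.range p) (((Finset.range (p + 1)).erase k').erase k)
      p k' (Λ + dl (p + 1) k) = D.wgen (Finset.range (p + 2)) (Finset.range p)
        (((Finset.range (p + 1)).erase k').erase k) p k' Λ := by
    refine D.wgen_congr ?_ ?_ ?_ ?_ <;> intros <;> simp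
    · exact dl_ne hne.symm
    · rename_i a ha
      exact dl_ne (Finset.ne_of_mem_erase ha)
  rw [e1, e2]
  simp only [Pi.add_apply, dl_self, dl_ne hne, dl_ne hne.symm, add_zero]
  rw [D.σ_sub_comm (Λ (p + 1) k) (Λ (p + 1) k')]
  have e3 : Λ (p + 1) k' + 1 - Λ (p + 1) k - 1 = Λ (p + 1) k' - Λ (p + 1) k := by ring
  have e4 : Λ (p + 1) k + 1 - Λ (p + 1) k' - 1 = -(Λ (p + 1) k' - Λ (p + 1) k) := by ring
  have e5 : Λ (p + 1) k + 1 - Λ (p + 1) k' = -(Λ (p + 1) k' - Λ (p + 1) k - 1) := by ring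
  have e6 : Λ (p + 1) k - Λ (p + 1) k' - 1 = -(Λ (p + 1) k' + 1 - Λ (p + 1) k) := by ring
  rw [e3, e4, e5, e6, D.σ_neg, D.σ_neg, D.σ_neg]
  simp only [mul_inv]
  ring

lemma inter_meet {p k p' k' : ℕ} {Λ : Arr} (hne : p ≠ p' ∨ k ≠ k') (h1 : Inter (Λ + dl p k))
    (h2 : Inter (Λ + dl p' k')) (h3 : Inter (Λ + dl p k + dl p' k')) : Inter Λ := by
  intro r c hc
  have a1 := h1 r c hc
  have a2 := h2 r c hc
  have a3 := h3 r c hc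
  simp only [Pi.add_apply, dl] at a1 a2 a3
  constructor
  · have b1 := a1.1
    have b2 := a2.1
    have b3 := a3.1
    clear a1 a2 a3
    split_ifs at b1 b2 b3 <;> omega
  · have b1 := a1.2
    have b2 := a2.2
    have b3 := a3.2
    clear a1 a2 a3
    split_ifs at b1 b2 b3 <;> omega

lemma cF_mul_cE {ε : ℕ → ℤ} {p k p' k' : ℕ} (hne : p ≠ p' ∨ k ≠ k') (hk : k < p + 1)
    (hk' : k' < p' + 1) (Λ : Arr)
    (hw : D.w p k Λ * D.w p' k' Λ =
      D.w p k (Λ + dl (p' + 1) k') * D.w p' k' (Λ + dl (p + 1) k)) :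
    D.cF ε p' k' Λ * D.cE ε p k Λ =
      D.cE ε p k (Λ + dl (p' + 1) k') * D.cF ε p' k' (Λ + dl (p + 1) k) := by
  have d1 : dl (p' + 1) k' (p + 1) k = 0 := by
    simp only [dl]
    rw [if_neg]
    omega
  have d2 : dl (p + 1) k (p' + 1) k' = 0 := by
    simp only [dl]
    rw [if_neg]
    omega
  by_cases h : Inter Λ
  · rw [D.cF_of_inter h, D.cE_of_inter h]
    by_cases h0 : D.w p k Λ * D.w p' k' Λ = 0
    · have h1 : D.w p k (Λ + dl (p' + 1) k') * D.w p' k' (Λ + dl (p + 1) k) = 0 := hw ▸ h0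
      have l : ∀ a b : K, D.w p' k' Λ * a * (D.w p k Λ * b) =
        D.w p k Λ * D.w p' k' Λ * (a * b) := fun a b => by ring
      rw [l, h0, zero_mul]
      rcases mul_eq_zero.mp h1 with h2 | h2
      · unfold cE
        simp [h2]
      · unfold cF
        simp [h2]
    · have h2 := D.inter_add h (left_ne_zero_of_mul h0) hk
      have h3 := D.inter_add h (right_ne_zero_of_mul h0) hk'
      rw [D.cE_of_inter h3, D.cF_of_inter h2]
      simp only [Pi.add_apply, d1, d2, add_zero]
      linear_combination D.q ^ (ε p * Λ (p + 1) k) * D.q ^ (-(ε p' * Λ (p' + 1) k')) * hw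
  · rw [D.cF_of_not h, zero_mul]
    by_cases h1 : Inter (Λ + dl (p' + 1) k')
    · by_cases h2 : Inter (Λ + dl (p + 1) k)
      · by_cases h3 : D.w p k (Λ + dl (p' + 1) k') = 0
        · unfold cE
          simp [h3]
        · refine absurd (inter_meet (by omega) h1 h2 (D.inter_add h1 h3 hk)) h
      · rw [D.cF_of_not h2, mul_zero]
    · rw [D.cE_of_not h1, zero_mul]

lemma cE_mul_cE {ε : ℕ → ℤ} {p k p' k' : ℕ} {Λ : Arr} (h : Inter Λ) (hk : k < p + 1) :
    D.cE ε p k Λ * D.cE ε p' k' (Λ + dl (p + 1) k) = D.w p k Λ * D.w p' k' (Λ + dl (p + 1) k) *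
      (D.q ^ (ε p * Λ (p + 1) k) * D.q ^ (ε p' * (Λ + dl (p + 1) k) (p' + 1) k')) := by
  rw [D.cE_of_inter h, mul_right_comm, D.w_mul_cE h hk]
  ring

/-- Products of two raising operators on basis vectors. -/
lemma E_E_single (ε : ℕ → ℤ) (p p' : ℕ) (Λ : Arr) :
    D.E ε p (D.E ε p' (Finsupp.single Λ 1)) = ∑ k' ∈ Finset.range (p' + 1),
      ∑ k ∈ Finset.range (p + 1), (D.cE ε p' k' Λ * D.cE ε p k (Λ + dl (p' + 1) k')) •
        Finsupp.single (Λ + dl (p' + 1) k' + dl (p + 1) k) 1 := by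
  rw [E_single, map_sum]
  refine Finset.sum_congr rfl fun k' _ => ?_
  rw [map_smul, E_single, Finset.smul_sum]
  simp only [smul_smul]

lemma E_F_single (ε : ℕ → ℤ) (p p' : ℕ) (Λ : Arr) :
    D.E ε p (D.F ε p' (Finsupp.single Λ 1)) = ∑ k' ∈ Finset.range (p' + 1),
      ∑ k ∈ Finset.range (p + 1),
        (D.cF ε p' k' (Λ - dl (p' + 1) k') * D.cE ε p k (Λ - dl (p' + 1) k')) •
          Finsupp.single (Λ - dl (p' + 1) k' + dl (p + 1) k) 1 := by
  rw [F_single, map_sum]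
  refine Finset.sum_congr rfl fun k' _ => ?_
  rw [map_smul, E_single, Finset.smul_sum]
  simp only [smul_smul]

lemma F_E_single (ε : ℕ → ℤ) (p p' : ℕ) (Λ : Arr) :
    D.F ε p' (D.E ε p (Finsupp.single Λ 1)) = ∑ k' ∈ Finset.range (p' + 1),
      ∑ k ∈ Finset.range (p + 1),
        (D.cE ε p k Λ * D.cF ε p' k' (Λ - dl (p' + 1) k' + dl (p + 1) k)) •
          Finsupp.single (Λ - dl (p' + 1) k' + dl (p + 1) k) 1 := by
  rw [E_single, map_sum, Finset.sum_comm]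
  refine Finset.sum_congr rfl fun k' _ => ?_
  rw [map_smul, F_single, Finset.smul_sum]
  simp only [smul_smul]
  refine Finset.sum_congr rfl fun k _ => ?_
  rw [add_sub_right_comm]

lemma E_mul_F_of_ne (ε : ℕ → ℤ) {p p' : ℕ} (h : p ≠ p') :
    D.E ε p * D.F ε p' = D.F ε p' * D.E ε p := by
  refine end_ext fun Λ => ?_
  rw [Module.End.mul_apply, Module.End.mul_apply, E_F_single, F_E_single]
  refine Finset.sum_congr rfl fun k' hk' => Finset.sum_congr rfl fun k hk => ?_
  rw [Finset.mem_range] at hk hk'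
  congr 1
  have hw : ∀ Λ, D.w p k Λ * D.w p' k' Λ =
      D.w p k (Λ + dl (p' + 1) k') * D.w p' k' (Λ + dl (p + 1) k) := by
    intro Λ
    by_cases h1 : p' = p + 1
    · subst h1
      exact D.w_square_succ hk hk' Λ
    by_cases h2 : p = p' + 1
    · subst h2
      have := D.w_square_succ hk' hk Λ
      rw [mul_comm, this, mul_comm]
    · exact D.w_square_far (by omega) Λ
  have := D.cF_mul_cE (ε := ε) (Or.inl h) hk hk' (Λ - dl (p' + 1) k') (hw _)
  rwa [sub_add_cancel] at this

lemma E_mul_E_of_far (ε : ℕ → ℤ) {p p' : ℕ} (h : p + 2 ≤ p') :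
    D.E ε p * D.E ε p' = D.E ε p' * D.E ε p := by
  refine end_ext fun Λ => ?_
  rw [Module.End.mul_apply, Module.End.mul_apply, E_E_single, E_E_single, Finset.sum_comm]
  refine Finset.sum_congr rfl fun k' hk' => Finset.sum_congr rfl fun k hk => ?_
  rw [Finset.mem_range] at hk hk'
  rw [add_right_comm Λ (dl (p' + 1) k)]
  congr 1
  by_cases hΛ : Inter Λ
  · rw [D.cE_mul_cE hΛ hk, D.cE_mul_cE hΛ hk', D.w_add_of_far (Or.inl h),
      D.w_add_of_far (Or.inr h)]
    simp only [Pi.add_apply]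
    rw [dl_row_ne (by omega : p + 1 ≠ p' + 1), dl_row_ne (by omega : p' + 1 ≠ p + 1), add_zero,
      add_zero]
    ring
  · rw [D.cE_of_not hΛ, D.cE_of_not hΛ, zero_mul, zero_mul]

end QSqrt

end QuantumAInf

end

noncomputable section

namespace QuantumAInf

namespace QSqrt

variable {K : Type*} [Field K] (D : QSqrt K)

/-! ### The `q`-Serre relations of the row operators -/

lemma br_three_term (x : ℤ) : D.br (x + 1) - (D.q + D.q⁻¹) * D.br x + D.br (x - 1) = 0 := by
  have hq := D.q_ne
  have hX : D.q ^ x ≠ 0 := zpow_ne_zero _ hq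
  have hc := D.q_sub_ne
  simp only [br, neg_sub, neg_add, zpow_add₀ hq, zpow_sub₀ hq, zpow_neg, zpow_one]
  field_simp
  ring

lemma br_serre (x y : ℤ) :
    (D.br (x + 1) * D.br (y + 1) - (D.q + D.q⁻¹) * (D.br x * D.br (y + 1)) + D.br x * D.br y) *
        D.br (x - y + 1) +
      (D.br (x + 1) * D.br (y + 1) - (D.q + D.q⁻¹) * (D.br (x + 1) * D.br y) + D.br x * D.br y) *
        D.br (x - y - 1) = 0 := by
  have hq := D.q_ne
  have hX : D.q ^ x ≠ 0 := zpow_ne_zero _ hq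
  have hY : D.q ^ y ≠ 0 := zpow_ne_zero _ hq
  have hc := D.q_sub_ne
  simp only [br, neg_sub, neg_add, zpow_add₀ hq, zpow_sub₀ hq, zpow_neg, zpow_one]
  generalize D.q ^ x = X at *
  generalize D.q ^ y = Y at *
  field_simp
  ring

lemma serre_core {x y : ℤ} (hd : x ≠ y) {t : K} (ht : x - y = 1 ∨ x - y = -1 → t = 0) :
    t * ((D.br |x + 1| * D.br |y + 1| - (D.q + D.q⁻¹) * (D.br |x| * D.br |y + 1|) +
        D.br |x| * D.br |y|) * (D.br (x - y) * D.br (x - y - 1))⁻¹ +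
      (D.br |x + 1| * D.br |y + 1| - (D.q + D.q⁻¹) * (D.br |x + 1| * D.br |y|) +
        D.br |x| * D.br |y|) * (D.br (x - y) * D.br (x - y + 1))⁻¹) = 0 := by
  by_cases h : x - y = 1 ∨ x - y = -1
  · rw [ht h, zero_mul]
  · push Not at h
    have h0 : D.br (x - y) ≠ 0 := D.br_ne_zero (by omega)
    have h1 : D.br (x - y - 1) ≠ 0 := D.br_ne_zero (by omega)
    have h2 : D.br (x - y + 1) ≠ 0 := D.br_ne_zero (by omega)
    rw [D.br_abs_succ x, D.br_abs_succ y, D.br_abs x, D.br_abs y]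
    have := D.br_serre x y
    generalize D.q + D.q⁻¹ = c at *
    field_simp
    linear_combination t * sg x * sg y * this

/-- The factor of `w` contributed by another entry of the same row, at distance `d`. -/
def sd (d : ℤ) : K := (D.σ d * D.σ (d - 1))⁻¹

lemma br_abs_mul_br_abs_pred {d : ℤ} (hd : d ≠ 0) :
    D.br |d| * D.br |d - 1| = D.br d * D.br (d - 1) := by
  rcases lt_or_gt_of_ne hd with h | h
  · rw [abs_of_neg h, abs_of_neg (by omega : d - 1 < 0), br_neg, br_neg, neg_mul_neg]
  · rw [abs_of_pos h, abs_of_nonneg (by omega : 0 ≤ d - 1)]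

lemma sd_mul_sd {d : ℤ} (hd : d ≠ 0) : D.sd d * D.sd (1 - d) = (D.br d * D.br (d - 1))⁻¹ := by
  have h1 : (1 : ℤ) - d = -(d - 1) := by ring
  have h2 : (1 : ℤ) - d - 1 = -d := by ring
  rw [← D.br_abs_mul_br_abs_pred hd, sd, sd, h2, h1, D.σ_neg, D.σ_neg, ← D.σ_mul_self,
    ← D.σ_mul_self, ← mul_inv]
  congr 1
  ring

lemma sd_neg_mul_sd {d : ℤ} (hd : d ≠ 0) :
    D.sd (-d) * D.sd (d + 1) = (D.br d * D.br (d + 1))⁻¹ := by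
  have := D.sd_mul_sd (d := -d) (by omega)
  rw [sub_neg_eq_add, add_comm 1 d, br_neg, ← neg_add', br_neg, neg_mul_neg] at this
  exact this

/-- Neighbouring entries of a row at distance `1` block each other from below. -/
lemma wgen_eq_zero_of_down {A C : Finset ℕ} {p k k' : ℕ} {Λ : Arr} (h : Inter Λ) (hk : k < p + 1)
    (hk' : k' < p + 1) (hd : Λ (p + 1) k' - Λ (p + 1) k = 1) :
    D.wgen A (Finset.range p) C p k Λ = 0 := by
  have h1 : k' < k := by
    by_contra! h2
    have := h.anti_le (p := p + 1) h2 hk'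
    omega
  obtain ⟨j, rfl⟩ : ∃ j, k = j + 1 := ⟨k - 1, by omega⟩
  have h2 := h.anti_le (p := p + 1) (k := k') (k' := j) (by omega) (by omega)
  have h3 := h p j (by omega)
  rw [D.wgen_down (b := j) (by simp; omega)]
  have : Λ (p + 1) (j + 1) + 1 - Λ p j = 0 := by omega
  rw [this, σ_zero, zero_mul]

/-- Neighbouring entries of a row at distance `1` block each other from above. -/
lemma wgen_eq_zero_of_up {B C : Finset ℕ} {p k k' : ℕ} {Λ : Arr} (h : Inter Λ) (hk : k < p + 1)
    (hk' : k' < p + 1) (hd : Λ (p + 1) k' - Λ (p + 1) k = 1) :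
    D.wgen (Finset.range (p + 2)) B C p k Λ = 0 := by
  have h1 : k' < k := by
    by_contra! h2
    have := h.anti_le (p := p + 1) h2 hk'
    omega
  obtain ⟨j, rfl⟩ : ∃ j, k = j + 1 := ⟨k - 1, by omega⟩
  have h2 := h.anti_le (p := p + 1) (k := k') (k' := j) (by omega) (by omega)
  have h3 : Λ (p + 2) (j + 1) < Λ (p + 1) j := (h (p + 1) j (by omega)).2
  have h4 : Λ (p + 1) (j + 1) ≤ Λ (p + 2) (j + 1) := (h (p + 1) (j + 1) (by omega)).1
  rw [D.wgen_up (a := j + 1) (by simp; omega)]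
  have : Λ (p + 2) (j + 1) - Λ (p + 1) (j + 1) = 0 := by omega
  rw [this, σ_zero, zero_mul]

lemma serre_lower_ne {p k k' a : ℕ} (hne : k ≠ k') (hk : k < p + 1) (hk' : k' < p + 1)
    (ha : a < p + 2) {Λ : Arr} (h : Inter Λ) :
    (D.w (p + 1) a Λ * D.w p k (Λ + dl (p + 2) a) * D.w p k' (Λ + dl (p + 2) a + dl (p + 1) k) -
      (D.q + D.q⁻¹) * (D.w p k Λ * D.w (p + 1) a (Λ + dl (p + 1) k) *
        D.w p k' (Λ + dl (p + 1) k + dl (p + 2) a)) +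
      D.w p k Λ * D.w p k' (Λ + dl (p + 1) k) * D.w (p + 1) a (Λ + dl (p + 1) k + dl (p + 1) k')) +
    (D.w (p + 1) a Λ * D.w p k' (Λ + dl (p + 2) a) * D.w p k (Λ + dl (p + 2) a + dl (p + 1) k') -
      (D.q + D.q⁻¹) * (D.w p k' Λ * D.w (p + 1) a (Λ + dl (p + 1) k') *
        D.w p k (Λ + dl (p + 1) k' + dl (p + 2) a)) +
      D.w p k' Λ * D.w p k (Λ + dl (p + 1) k') * D.w (p + 1) a (Λ + dl (p + 1) k' + dl (p + 1) k))
      = 0 := by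
  set T := D.wgen ((Finset.range (p + 2)).erase a) (Finset.range p)
    (((Finset.range (p + 1)).erase k).erase k') p k with hT
  set T' := D.wgen ((Finset.range (p + 2)).erase a) (Finset.range p)
    (((Finset.range (p + 1)).erase k').erase k) p k' with hT'
  set V := D.wgen (Finset.range (p + 3)) (((Finset.range (p + 1)).erase k).erase k')
    ((Finset.range (p + 2)).erase a) (p + 1) a with hV
  have wk : ∀ Λ, D.w p k Λ = D.σ (Λ (p + 2) a - Λ (p + 1) k) *
      (D.sd (Λ (p + 1) k' - Λ (p + 1) k) * T Λ) := fun Λ => by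
    rw [w, D.wgen_up (a := a) (by simpa using ha), D.wgen_side (c := k') (by simp [hne.symm, hk'])]
    rfl
  have wk' : ∀ Λ, D.w p k' Λ = D.σ (Λ (p + 2) a - Λ (p + 1) k') *
      (D.sd (Λ (p + 1) k - Λ (p + 1) k') * T' Λ) := fun Λ => by
    rw [w, D.wgen_up (a := a) (by simpa using ha), D.wgen_side (c := k) (by simp [hne, hk])]
    rfl
  have wa : ∀ Λ, D.w (p + 1) a Λ = D.σ (Λ (p + 2) a + 1 - Λ (p + 1) k) *
      (D.σ (Λ (p + 2) a + 1 - Λ (p + 1) k') * V Λ) := fun Λ => by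
    rw [w, D.wgen_down (b := k) (by simpa using hk),
      D.wgen_down (b := k') (by simp [hne.symm, hk'])]
  have Ta : ∀ Λ, T (Λ + dl (p + 2) a) = T Λ := fun Λ => by
    refine D.wgen_congr ?_ ?_ ?_ ?_ <;> intros <;> simp
    rename_i b hb
    exact dl_ne (Finset.ne_of_mem_erase hb)
  have Ta' : ∀ Λ, T' (Λ + dl (p + 2) a) = T' Λ := fun Λ => by
    refine D.wgen_congr ?_ ?_ ?_ ?_ <;> intros <;> simp
    rename_i b hb
    exact dl_ne (Finset.ne_of_mem_erase hb)
  have Tk : ∀ Λ, T (Λ + dl (p + 1) k') = T Λ := fun Λ => by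
    refine D.wgen_congr ?_ ?_ ?_ ?_ <;> intros <;> simp
    · exact dl_ne hne
    · rename_i b hb
      exact dl_ne (Finset.ne_of_mem_erase hb)
  have Tk' : ∀ Λ, T' (Λ + dl (p + 1) k) = T' Λ := fun Λ => by
    refine D.wgen_congr ?_ ?_ ?_ ?_ <;> intros <;> simp
    · exact dl_ne hne.symm
    · rename_i b hb
      exact dl_ne (Finset.ne_of_mem_erase hb)
  have Vk : ∀ Λ, V (Λ + dl (p + 1) k) = V Λ := fun Λ => by
    refine D.wgen_congr ?_ ?_ ?_ ?_ <;> intros <;> simp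
    rename_i b hb
    exact dl_ne (Finset.ne_of_mem_erase (Finset.mem_of_mem_erase hb))
  have Vk' : ∀ Λ, V (Λ + dl (p + 1) k') = V Λ := fun Λ => by
    refine D.wgen_congr ?_ ?_ ?_ ?_ <;> intros <;> simp
    rename_i b hb
    exact dl_ne (Finset.ne_of_mem_erase hb)
  have hz : (Λ (p + 2) a - Λ (p + 1) k) - (Λ (p + 2) a - Λ (p + 1) k') = 1 ∨
      (Λ (p + 2) a - Λ (p + 1) k) - (Λ (p + 2) a - Λ (p + 1) k') = -1 → V Λ * T Λ * T' Λ = 0 := by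
    rintro (h1 | h1)
    · rw [hT, D.wgen_eq_zero_of_down h hk hk' (by omega)]
      ring
    · rw [hT', D.wgen_eq_zero_of_down h hk' hk (by omega)]
      ring
  have hd : Λ (p + 1) k' - Λ (p + 1) k ≠ 0 := sub_ne_zero.mpr (h.ne hne.symm hk' hk)
  have core := D.serre_core (x := Λ (p + 2) a - Λ (p + 1) k) (y := Λ (p + 2) a - Λ (p + 1) k')
    (by omega) hz
  have s1 := D.sd_mul_sd hd
  have s2 := D.sd_neg_mul_sd hd
  simp only [wk, wk', wa, Ta, Ta', Tk, Tk', Vk, Vk', Pi.add_apply, dl_self, dl_succ_add_two,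
    dl_add_two_succ, dl_ne hne, dl_ne hne.symm, add_zero]
  generalize Λ (p + 2) a = l at *
  generalize Λ (p + 1) k = m at *
  generalize Λ (p + 1) k' = n at *
  have e1 : l + 1 - (m + 1) = l - m := by ring
  have e2 : l + 1 - (n + 1) = l - n := by ring
  have e3 : l + 1 - m = l - m + 1 := by ring
  have e4 : l + 1 - n = l - n + 1 := by ring
  have e5 : l - m - (l - n) = n - m := by ring
  have e6 : m + 1 - n = 1 - (n - m) := by ring
  have e7 : n + 1 - m = n - m + 1 := by ring
  have e8 : m - n = -(n - m) := by ring
  rw [e5, ← s1, ← s2] at core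
  simp only [← D.σ_mul_self] at core
  rw [e1, e2, e3, e4, e6, e7, e8]
  linear_combination core

lemma serre_lower_self {p k a : ℕ} (hk : k < p + 1) (ha : a < p + 2) (Λ : Arr) :
    D.w (p + 1) a Λ * D.w p k (Λ + dl (p + 2) a) * D.w p k (Λ + dl (p + 2) a + dl (p + 1) k) -
      (D.q + D.q⁻¹) * (D.w p k Λ * D.w (p + 1) a (Λ + dl (p + 1) k) *
        D.w p k (Λ + dl (p + 1) k + dl (p + 2) a)) +
      D.w p k Λ * D.w p k (Λ + dl (p + 1) k) * D.w (p + 1) a (Λ + dl (p + 1) k + dl (p + 1) k)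
      = 0 := by
  have e : Λ + dl (p + 2) a + dl (p + 1) k = Λ + dl (p + 1) k + dl (p + 2) a := add_right_comm _ _ _
  rw [e]
  simp only [D.w_eq_wU ha, D.w_eq_wD hk, wU_add, wD_add, Pi.add_apply, dl_self, dl_succ_add_two,
    dl_add_two_succ, add_zero]
  generalize Λ (p + 2) a = l at *
  generalize Λ (p + 1) k = m at *
  have e1 : l + 1 - (m + 1) = l - m := by ring
  have e2 : l - (m + 1) = l - m - 1 := by ring
  have e3 : l + 1 - m = l - m + 1 := by ring
  have e4 : l + 1 - (m + 1 + 1) = l - m - 1 := by ring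
  rw [e1, e2, e3, e4]
  generalize l - m = x
  by_cases hx : x = 0
  · subst hx
    simp
  · have h3 : D.br |x + 1| - (D.q + D.q⁻¹) * D.br |x| + D.br |x - 1| = 0 := by
      rcases lt_or_gt_of_ne hx with h | h
      · rw [abs_of_nonpos (by omega : x + 1 ≤ 0), abs_of_neg h, abs_of_neg (by omega : x - 1 < 0)]
        simp only [br_neg]
        linear_combination -D.br_three_term x
      · rw [abs_of_pos (by omega : 0 < x + 1), abs_of_pos h, abs_of_nonneg (by omega : 0 ≤ x - 1)]
        exact D.br_three_term x
    simp only [← D.σ_mul_self] at h3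
    linear_combination (D.wD p k a Λ * D.wU p k a Λ * D.wU p k a (Λ + dl (p + 1) k) * D.σ x) * h3

lemma serre_upper_ne {p k a a' : ℕ} (hne : a ≠ a') (hk : k < p + 1) (ha : a < p + 2)
    (ha' : a' < p + 2) {Λ : Arr} (h : Inter Λ) :
    (D.w p k Λ * D.w (p + 1) a (Λ + dl (p + 1) k) *
        D.w (p + 1) a' (Λ + dl (p + 1) k + dl (p + 2) a) -
      (D.q + D.q⁻¹) * (D.w (p + 1) a Λ * D.w p k (Λ + dl (p + 2) a) *
        D.w (p + 1) a' (Λ + dl (p + 2) a + dl (p + 1) k)) +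
      D.w (p + 1) a Λ * D.w (p + 1) a' (Λ + dl (p + 2) a) *
        D.w p k (Λ + dl (p + 2) a + dl (p + 2) a')) +
    (D.w p k Λ * D.w (p + 1) a' (Λ + dl (p + 1) k) *
        D.w (p + 1) a (Λ + dl (p + 1) k + dl (p + 2) a') -
      (D.q + D.q⁻¹) * (D.w (p + 1) a' Λ * D.w p k (Λ + dl (p + 2) a') *
        D.w (p + 1) a (Λ + dl (p + 2) a' + dl (p + 1) k)) +
      D.w (p + 1) a' Λ * D.w (p + 1) a (Λ + dl (p + 2) a') *
        D.w p k (Λ + dl (p + 2) a' + dl (p + 2) a))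
      = 0 := by
  set T := D.wgen (Finset.range (p + 3)) ((Finset.range (p + 1)).erase k)
    (((Finset.range (p + 2)).erase a).erase a') (p + 1) a with hT
  set T' := D.wgen (Finset.range (p + 3)) ((Finset.range (p + 1)).erase k)
    (((Finset.range (p + 2)).erase a').erase a) (p + 1) a' with hT'
  set V := D.wgen (((Finset.range (p + 2)).erase a).erase a') (Finset.range p)
    ((Finset.range (p + 1)).erase k) p k with hV
  have wk : ∀ Λ, D.w (p + 1) a Λ = D.σ (Λ (p + 2) a + 1 - Λ (p + 1) k) *
      (D.sd (Λ (p + 2) a' - Λ (p + 2) a) * T Λ) := fun Λ => by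
    rw [w, D.wgen_down (b := k) (by simpa using hk),
      D.wgen_side (c := a') (by simp [hne.symm, ha'])]
    rfl
  have wk' : ∀ Λ, D.w (p + 1) a' Λ = D.σ (Λ (p + 2) a' + 1 - Λ (p + 1) k) *
      (D.sd (Λ (p + 2) a - Λ (p + 2) a') * T' Λ) := fun Λ => by
    rw [w, D.wgen_down (b := k) (by simpa using hk), D.wgen_side (c := a) (by simp [hne, ha])]
    rfl
  have wa : ∀ Λ, D.w p k Λ = D.σ (Λ (p + 2) a - Λ (p + 1) k) *
      (D.σ (Λ (p + 2) a' - Λ (p + 1) k) * V Λ) := fun Λ => by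
    rw [w, D.wgen_up (a := a) (by simpa using ha),
      D.wgen_up (a := a') (by simp [hne.symm, ha'])]
  have Ta : ∀ Λ, T (Λ + dl (p + 1) k) = T Λ := fun Λ => by
    refine D.wgen_congr ?_ ?_ ?_ ?_ <;> intros <;> simp
    rename_i b hb
    exact dl_ne (Finset.ne_of_mem_erase hb)
  have Ta' : ∀ Λ, T' (Λ + dl (p + 1) k) = T' Λ := fun Λ => by
    refine D.wgen_congr ?_ ?_ ?_ ?_ <;> intros <;> simp
    rename_i b hb
    exact dl_ne (Finset.ne_of_mem_erase hb)
  have Tk : ∀ Λ, T (Λ + dl (p + 2) a') = T Λ := fun Λ => by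
    refine D.wgen_congr ?_ ?_ ?_ ?_ <;> intros <;> simp
    · exact dl_ne hne
    · rename_i b hb
      exact dl_ne (Finset.ne_of_mem_erase hb)
  have Tk' : ∀ Λ, T' (Λ + dl (p + 2) a) = T' Λ := fun Λ => by
    refine D.wgen_congr ?_ ?_ ?_ ?_ <;> intros <;> simp
    · exact dl_ne hne.symm
    · rename_i b hb
      exact dl_ne (Finset.ne_of_mem_erase hb)
  have Vk : ∀ Λ, V (Λ + dl (p + 2) a) = V Λ := fun Λ => by
    refine D.wgen_congr ?_ ?_ ?_ ?_ <;> intros <;> simp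
    rename_i b hb
    exact dl_ne (Finset.ne_of_mem_erase (Finset.mem_of_mem_erase hb))
  have Vk' : ∀ Λ, V (Λ + dl (p + 2) a') = V Λ := fun Λ => by
    refine D.wgen_congr ?_ ?_ ?_ ?_ <;> intros <;> simp
    rename_i b hb
    exact dl_ne (Finset.ne_of_mem_erase hb)
  have hz : (Λ (p + 2) a' - Λ (p + 1) k) - (Λ (p + 2) a - Λ (p + 1) k) = 1 ∨
      (Λ (p + 2) a' - Λ (p + 1) k) - (Λ (p + 2) a - Λ (p + 1) k) = -1 → V Λ * T Λ * T' Λ = 0 := by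
    rintro (h1 | h1)
    · rw [hT, D.wgen_eq_zero_of_up h ha ha' (by rw [show p + 1 + 1 = p + 2 from rfl]; omega)]
      ring
    · rw [hT', D.wgen_eq_zero_of_up h ha' ha (by rw [show p + 1 + 1 = p + 2 from rfl]; omega)]
      ring
  have hd : Λ (p + 2) a' - Λ (p + 2) a ≠ 0 := sub_ne_zero.mpr (h.ne hne.symm ha' ha)
  have core := D.serre_core (x := Λ (p + 2) a' - Λ (p + 1) k) (y := Λ (p + 2) a - Λ (p + 1) k)
    (by omega) hz
  have s1 := D.sd_mul_sd hd
  have s2 := D.sd_neg_mul_sd hd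
  simp only [wk, wk', wa, Ta, Ta', Tk, Tk', Vk, Vk', Pi.add_apply, dl_self, dl_succ_add_two,
    dl_add_two_succ, dl_ne hne, dl_ne hne.symm, add_zero]
  generalize Λ (p + 2) a = m at *
  generalize Λ (p + 1) k = l at *
  generalize Λ (p + 2) a' = n at *
  have e1 : m + 1 - (l + 1) = m - l := by ring
  have e2 : n + 1 - (l + 1) = n - l := by ring
  have e3 : m + 1 - l = m - l + 1 := by ring
  have e4 : n + 1 - l = n - l + 1 := by ring
  have e5 : n - l - (m - l) = n - m := by ring
  have e6 : m + 1 - n = 1 - (n - m) := by ring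
  have e7 : n + 1 - m = n - m + 1 := by ring
  have e8 : m - n = -(n - m) := by ring
  rw [e5, ← s1, ← s2] at core
  simp only [← D.σ_mul_self] at core
  rw [e1, e2, e3, e4, e6, e7, e8]
  linear_combination core

lemma serre_upper_self {p k a : ℕ} (hk : k < p + 1) (ha : a < p + 2) (Λ : Arr) :
    D.w p k Λ * D.w (p + 1) a (Λ + dl (p + 1) k) *
        D.w (p + 1) a (Λ + dl (p + 1) k + dl (p + 2) a) -
      (D.q + D.q⁻¹) * (D.w (p + 1) a Λ * D.w p k (Λ + dl (p + 2) a) *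
        D.w (p + 1) a (Λ + dl (p + 2) a + dl (p + 1) k)) +
      D.w (p + 1) a Λ * D.w (p + 1) a (Λ + dl (p + 2) a) *
        D.w p k (Λ + dl (p + 2) a + dl (p + 2) a) = 0 := by
  have e : Λ + dl (p + 1) k + dl (p + 2) a = Λ + dl (p + 2) a + dl (p + 1) k := add_right_comm _ _ _
  rw [e]
  simp only [D.w_eq_wU ha, D.w_eq_wD hk, wU_add, wD_add, Pi.add_apply, dl_self, dl_succ_add_two,
    dl_add_two_succ, add_zero]
  generalize Λ (p + 2) a = l at *
  generalize Λ (p + 1) k = m at *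
  have e1 : l + 1 - (m + 1) = l - m := by ring
  have e2 : l + 1 + 1 - (m + 1) = l - m + 1 := by ring
  have e3 : l + 1 - m = l - m + 1 := by ring
  have e4 : l + 1 + 1 - m = l - m + 1 + 1 := by ring
  rw [e1, e2, e3, e4]
  generalize l - m = x
  by_cases hx : x + 1 = 0
  · rw [hx]
    simp
  · have h3 : D.br |x + 1 + 1| - (D.q + D.q⁻¹) * D.br |x + 1| + D.br |x| = 0 := by
      rcases lt_or_gt_of_ne hx with h | h
      · rw [abs_of_nonpos (by omega : x + 1 + 1 ≤ 0), abs_of_neg h, abs_of_neg (by omega : x < 0)]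
        simp only [br_neg]
        have := D.br_three_term (x + 1)
        rw [add_sub_cancel_right] at this
        linear_combination -this
      · rw [abs_of_pos (by omega : 0 < x + 1 + 1), abs_of_pos h, abs_of_nonneg (by omega : 0 ≤ x)]
        have := D.br_three_term (x + 1)
        rwa [add_sub_cancel_right] at this
    simp only [← D.σ_mul_self] at h3
    linear_combination
      (D.wU p k a Λ * D.wD p k a Λ * D.wD p k a (Λ + dl (p + 2) a) * D.σ (x + 1)) * h3

/-- Products of three raising operators on basis vectors. -/
lemma E_E_E_single (ε : ℕ → ℤ) (p p' p'' : ℕ) (Λ : Arr) :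
    D.E ε p (D.E ε p' (D.E ε p'' (Finsupp.single Λ 1))) = ∑ k'' ∈ Finset.range (p'' + 1),
      ∑ k' ∈ Finset.range (p' + 1), ∑ k ∈ Finset.range (p + 1),
        (D.cE ε p'' k'' Λ * D.cE ε p' k' (Λ + dl (p'' + 1) k'') *
          D.cE ε p k (Λ + dl (p'' + 1) k'' + dl (p' + 1) k')) •
        Finsupp.single (Λ + dl (p'' + 1) k'' + dl (p' + 1) k' + dl (p + 1) k) 1 := by
  rw [E_single, map_sum, map_sum]
  refine Finset.sum_congr rfl fun k' _ => ?_
  rw [map_smul, map_smul, E_E_single, Finset.smul_sum]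
  refine Finset.sum_congr rfl fun k' _ => ?_
  rw [Finset.smul_sum]
  simp only [smul_smul, mul_assoc]

lemma cE_mul_cE_mul_cE {ε : ℕ → ℤ} {p k p' k' p'' k'' : ℕ} {Λ : Arr} (h : Inter Λ)
    (hk : k < p + 1) (hk' : k' < p' + 1) :
    D.cE ε p k Λ * D.cE ε p' k' (Λ + dl (p + 1) k) *
      D.cE ε p'' k'' (Λ + dl (p + 1) k + dl (p' + 1) k') =
    D.w p k Λ * D.w p' k' (Λ + dl (p + 1) k) * D.w p'' k'' (Λ + dl (p + 1) k + dl (p' + 1) k') *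
      (D.q ^ (ε p * Λ (p + 1) k) * D.q ^ (ε p' * (Λ + dl (p + 1) k) (p' + 1) k') *
        D.q ^ (ε p'' * (Λ + dl (p + 1) k + dl (p' + 1) k') (p'' + 1) k'')) := by
  by_cases h0 : D.w p k Λ = 0
  · rw [D.cE_of_inter h, h0]
    ring
  · rw [mul_assoc, D.cE_mul_cE (D.inter_add h h0 hk) hk', D.cE_of_inter h]
    ring

/-- A double sum vanishes if its terms are antisymmetric. -/
lemma sum_sum_eq_zero_of_antisymm [CharZero K] {N : Type*} [AddCommGroup N] [Module K N]
    {s : Finset ℕ} {f : ℕ → ℕ → N} (h : ∀ i ∈ s, ∀ j ∈ s, f i j + f j i = 0) :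
    ∑ i ∈ s, ∑ j ∈ s, f i j = 0 := by
  have h1 : (2 : K) • ∑ i ∈ s, ∑ j ∈ s, f i j = 0 := by
    rw [two_smul]
    nth_rewrite 2 [Finset.sum_comm]
    simp only [← Finset.sum_add_distrib]
    exact Finset.sum_eq_zero fun i hi => Finset.sum_eq_zero fun j hj => h i hi j hj
  exact (smul_eq_zero.mp h1).resolve_left two_ne_zero

theorem serre_lower [CharZero K] (ε : ℕ → ℤ) (p : ℕ) :
    D.E ε p * (D.E ε p * D.E ε (p + 1)) -
      (D.q + D.q⁻¹) • (D.E ε p * (D.E ε (p + 1) * D.E ε p)) +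
      D.E ε (p + 1) * (D.E ε p * D.E ε p) = 0 := by
  refine end_ext fun Λ => ?_
  simp only [LinearMap.add_apply, LinearMap.sub_apply, LinearMap.smul_apply, Module.End.mul_apply,
    LinearMap.zero_apply]
  rw [E_E_E_single, E_E_E_single, E_E_E_single]
  by_cases h : Inter Λ
  swap
  · simp [D.cE_of_not h]
  have c2 : ∀ f : ℕ → ℕ → ℕ → (Arr →₀ K), ∑ k ∈ Finset.range (p + 1), ∑ a ∈ Finset.range (p + 1 + 1),
      ∑ k' ∈ Finset.range (p + 1), f k a k' = ∑ a ∈ Finset.range (p + 1 + 1),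
        ∑ k ∈ Finset.range (p + 1), ∑ k' ∈ Finset.range (p + 1), f k a k' :=
    fun f => Finset.sum_comm
  have c3 : ∀ f : ℕ → ℕ → ℕ → (Arr →₀ K), ∑ k ∈ Finset.range (p + 1), ∑ k' ∈ Finset.range (p + 1),
      ∑ a ∈ Finset.range (p + 1 + 1), f k k' a = ∑ a ∈ Finset.range (p + 1 + 1),
        ∑ k ∈ Finset.range (p + 1), ∑ k' ∈ Finset.range (p + 1), f k k' a := fun f => by
    rw [Finset.sum_comm]
    exact (Finset.sum_congr rfl fun _ _ => Finset.sum_comm).trans (Finset.sum_comm.trans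
      (Finset.sum_congr rfl fun _ _ => Finset.sum_comm))
  rw [c2, c3, Finset.smul_sum, ← Finset.sum_sub_distrib, ← Finset.sum_add_distrib]
  refine Finset.sum_eq_zero fun a ha => ?_
  simp only [Finset.smul_sum, ← Finset.sum_sub_distrib, ← Finset.sum_add_distrib]
  refine sum_sum_eq_zero_of_antisymm (K := K) fun k hk k' hk' => ?_
  rw [Finset.mem_range] at ha hk hk'
  rw [D.cE_mul_cE_mul_cE h ha hk, D.cE_mul_cE_mul_cE h hk ha, D.cE_mul_cE_mul_cE h hk hk',
    D.cE_mul_cE_mul_cE h ha hk', D.cE_mul_cE_mul_cE h hk' ha, D.cE_mul_cE_mul_cE h hk' hk]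
  have t1 : Λ + dl (p + 1) k + dl (p + 1 + 1) a + dl (p + 1) k' =
    Λ + dl (p + 1 + 1) a + dl (p + 1) k + dl (p + 1) k' := by abel
  have t2 : Λ + dl (p + 1) k + dl (p + 1) k' + dl (p + 1 + 1) a =
    Λ + dl (p + 1 + 1) a + dl (p + 1) k + dl (p + 1) k' := by abel
  have t3 : Λ + dl (p + 1) k' + dl (p + 1 + 1) a + dl (p + 1) k =
    Λ + dl (p + 1 + 1) a + dl (p + 1) k + dl (p + 1) k' := by abel
  have t4 : Λ + dl (p + 1) k' + dl (p + 1) k + dl (p + 1 + 1) a =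
    Λ + dl (p + 1 + 1) a + dl (p + 1) k + dl (p + 1) k' := by abel
  have t5 : Λ + dl (p + 1 + 1) a + dl (p + 1) k' + dl (p + 1) k =
    Λ + dl (p + 1 + 1) a + dl (p + 1) k + dl (p + 1) k' := by abel
  simp only [t1, t2, t3, t4, t5, smul_smul, ← sub_smul, ← add_smul]
  rw [smul_eq_zero]
  left
  by_cases hkk : k = k'
  · subst hkk
    have := D.serre_lower_self hk ha Λ
    simp only [Pi.add_apply, dl_self, dl_succ_self, dl_self_succ, add_zero]
    linear_combination 2 * (D.q ^ (ε (p + 1) * Λ (p + 2) a) * D.q ^ (ε p * Λ (p + 1) k) *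
      D.q ^ (ε p * (Λ (p + 1) k + 1))) * this
  · have := D.serre_lower_ne hkk hk hk' ha h
    simp only [Pi.add_apply, dl_succ_self, dl_self_succ, dl_ne hkk,
      dl_ne (Ne.symm hkk), add_zero]
    linear_combination (D.q ^ (ε (p + 1) * Λ (p + 2) a) * D.q ^ (ε p * Λ (p + 1) k) *
      D.q ^ (ε p * Λ (p + 1) k')) * this

theorem serre_upper [CharZero K] (ε : ℕ → ℤ) (p : ℕ) :
    D.E ε (p + 1) * (D.E ε (p + 1) * D.E ε p) -
      (D.q + D.q⁻¹) • (D.E ε (p + 1) * (D.E ε p * D.E ε (p + 1))) +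
      D.E ε p * (D.E ε (p + 1) * D.E ε (p + 1)) = 0 := by
  refine end_ext fun Λ => ?_
  simp only [LinearMap.add_apply, LinearMap.sub_apply, LinearMap.smul_apply, Module.End.mul_apply,
    LinearMap.zero_apply]
  rw [E_E_E_single, E_E_E_single, E_E_E_single]
  by_cases h : Inter Λ
  swap
  · simp [D.cE_of_not h]
  have c2 : ∀ f : ℕ → ℕ → ℕ → (Arr →₀ K), ∑ a ∈ Finset.range (p + 1 + 1), ∑ k ∈ Finset.range (p + 1),
      ∑ a' ∈ Finset.range (p + 1 + 1), f a k a' = ∑ k ∈ Finset.range (p + 1),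
        ∑ a ∈ Finset.range (p + 1 + 1), ∑ a' ∈ Finset.range (p + 1 + 1), f a k a' :=
    fun f => Finset.sum_comm
  have c3 : ∀ f : ℕ → ℕ → ℕ → (Arr →₀ K), ∑ a ∈ Finset.range (p + 1 + 1),
      ∑ a' ∈ Finset.range (p + 1 + 1), ∑ k ∈ Finset.range (p + 1), f a a' k =
        ∑ k ∈ Finset.range (p + 1), ∑ a ∈ Finset.range (p + 1 + 1),
          ∑ a' ∈ Finset.range (p + 1 + 1), f a a' k := fun f => by
    rw [Finset.sum_comm]
    exact (Finset.sum_congr rfl fun _ _ => Finset.sum_comm).trans (Finset.sum_comm.trans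
      (Finset.sum_congr rfl fun _ _ => Finset.sum_comm))
  rw [c2, c3, Finset.smul_sum, ← Finset.sum_sub_distrib, ← Finset.sum_add_distrib]
  refine Finset.sum_eq_zero fun k hk => ?_
  simp only [Finset.smul_sum, ← Finset.sum_sub_distrib, ← Finset.sum_add_distrib]
  refine sum_sum_eq_zero_of_antisymm (K := K) fun a ha a' ha' => ?_
  rw [Finset.mem_range] at ha hk ha'
  rw [D.cE_mul_cE_mul_cE h hk ha, D.cE_mul_cE_mul_cE h ha hk, D.cE_mul_cE_mul_cE h ha ha',
    D.cE_mul_cE_mul_cE h hk ha', D.cE_mul_cE_mul_cE h ha' hk, D.cE_mul_cE_mul_cE h ha' ha]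
  have t1 : Λ + dl (p + 1 + 1) a + dl (p + 1) k + dl (p + 1 + 1) a' =
    Λ + dl (p + 1) k + dl (p + 1 + 1) a + dl (p + 1 + 1) a' := by abel
  have t2 : Λ + dl (p + 1 + 1) a + dl (p + 1 + 1) a' + dl (p + 1) k =
    Λ + dl (p + 1) k + dl (p + 1 + 1) a + dl (p + 1 + 1) a' := by abel
  have t3 : Λ + dl (p + 1 + 1) a' + dl (p + 1) k + dl (p + 1 + 1) a =
    Λ + dl (p + 1) k + dl (p + 1 + 1) a + dl (p + 1 + 1) a' := by abel
  have t4 : Λ + dl (p + 1 + 1) a' + dl (p + 1 + 1) a + dl (p + 1) k =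
    Λ + dl (p + 1) k + dl (p + 1 + 1) a + dl (p + 1 + 1) a' := by abel
  have t5 : Λ + dl (p + 1) k + dl (p + 1 + 1) a' + dl (p + 1 + 1) a =
    Λ + dl (p + 1) k + dl (p + 1 + 1) a + dl (p + 1 + 1) a' := by abel
  simp only [t1, t2, t3, t4, t5, smul_smul, ← sub_smul, ← add_smul]
  rw [smul_eq_zero]
  left
  by_cases hkk : a = a'
  · subst hkk
    have := D.serre_upper_self hk ha Λ
    simp only [Pi.add_apply, dl_self, dl_succ_self, dl_self_succ, add_zero]
    linear_combination 2 * (D.q ^ (ε (p + 1) * Λ (p + 2) a) * D.q ^ (ε p * Λ (p + 1) k) *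
      D.q ^ (ε (p + 1) * (Λ (p + 2) a + 1))) * this
  · have := D.serre_upper_ne hkk hk ha ha' h
    simp only [Pi.add_apply, dl_succ_self, dl_self_succ, dl_ne hkk,
      dl_ne (Ne.symm hkk), add_zero]
    linear_combination (D.q ^ (ε (p + 1) * Λ (p + 2) a) * D.q ^ (ε p * Λ (p + 1) k) *
      D.q ^ (ε (p + 1) * Λ (p + 2) a')) * this

end QSqrt

end QuantumAInf

end

noncomputable section

namespace QuantumAInf

namespace QSqrt

variable {K : Type*} [Field K] (D : QSqrt K)

/-! ### A Lagrange type identity and the commutator of raising and lowering operators -/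

lemma zpow_sq_injective {a b : ℤ} (h : (D.q ^ a) ^ 2 = (D.q ^ b) ^ 2) : a = b := by
  by_contra hab
  refine D.pow_ne (a - b) (by omega) ?_
  have ha : D.q ^ a ≠ 0 := zpow_ne_zero _ D.q_ne
  have hb : D.q ^ b ≠ 0 := zpow_ne_zero _ D.q_ne
  rw [neg_sub, zpow_sub₀ D.q_ne, zpow_sub₀ D.q_ne]
  field_simp
  exact h

lemma zpow_sum {ι : Type*} (J : Finset ι) (f : ι → ℤ) :
    D.q ^ (∑ j ∈ J, f j) = ∏ j ∈ J, D.q ^ f j := by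
  induction J using Finset.cons_induction with
  | empty => simp
  | cons i s hi ih => rw [Finset.sum_cons, Finset.prod_cons, zpow_add₀ D.q_ne, ih]

lemma br_sub (x y : ℤ) : D.br (x - y) =
    (D.q - D.q⁻¹)⁻¹ * -(D.q ^ x * D.q ^ y)⁻¹ * ((D.q ^ y) ^ 2 - (D.q ^ x) ^ 2) := by
  have hx : D.q ^ x ≠ 0 := zpow_ne_zero _ D.q_ne
  have hy : D.q ^ y ≠ 0 := zpow_ne_zero _ D.q_ne
  have hc := D.q_sub_ne
  rw [br, neg_sub, zpow_sub₀ D.q_ne, zpow_sub₀ D.q_ne]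
  generalize D.q - D.q⁻¹ = c at *
  field_simp
  ring

open Polynomial in
lemma sum_lagrange {ι : Type*} [DecidableEq ι] {J : Finset ι} (X Y : ι → K)
    (hY : Set.InjOn Y J) :
    ∑ i ∈ J, (Y i - X i) * ∏ j ∈ J.erase i, ((Y i - X j) * ((Y i - Y j)⁻¹ * -Y j)) =
      ∏ j ∈ J, -X j - ∏ j ∈ J, -Y j := by
  have hdeg : (Lagrange.nodal J X - Lagrange.nodal J Y).degree < J.card := by
    by_cases hJ : J = ∅
    · subst hJ
      simp
    · refine lt_of_lt_of_eq (Polynomial.degree_sub_lt_left ?_ Lagrange.nodal_ne_zero ?_)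
        Lagrange.degree_nodal
      · rw [Lagrange.degree_nodal, Lagrange.degree_nodal]
      · rw [Lagrange.nodal_monic.leadingCoeff, Lagrange.nodal_monic.leadingCoeff]
  have h := congrArg (Polynomial.eval 0) (Lagrange.eq_interpolate hY hdeg)
  rw [eval_sub, Lagrange.eval_nodal, Lagrange.eval_nodal, Lagrange.interpolate_apply,
    eval_finsetSum] at h
  simp only [zero_sub] at h
  rw [h]
  refine Finset.sum_congr rfl fun i hi => ?_
  rw [eval_mul, eval_C, eval_sub, Lagrange.eval_nodal_at_node hi, sub_zero, Lagrange.eval_nodal,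
    Lagrange.basis, eval_prod, ← Finset.mul_prod_erase J _ hi, mul_assoc, ← Finset.prod_mul_distrib]
  congr 1
  refine Finset.prod_congr rfl fun j _ => ?_
  rw [Lagrange.basisDivisor, eval_mul, eval_C, eval_sub, eval_X, eval_C, zero_sub]

lemma sum_br_of_injOn {ι : Type*} [DecidableEq ι] {J : Finset ι} (x y : ι → ℤ)
    (hy : Set.InjOn y J) :
    ∑ i ∈ J, (∏ j ∈ J, D.br (x j - y i)) * (∏ j ∈ J.erase i, D.br (y j - y i))⁻¹ =
      D.br (∑ j ∈ J, (x j - y j)) := by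
  have hq : ∀ n : ℤ, D.q ^ n ≠ 0 := fun n => zpow_ne_zero n D.q_ne
  have hc := D.q_sub_ne
  set c := D.q - D.q⁻¹ with hcdef
  have key : ∀ i ∈ J, (∏ j ∈ J, D.br (x j - y i)) * (∏ j ∈ J.erase i, D.br (y j - y i))⁻¹ =
      c⁻¹ * (∏ j ∈ J, -(D.q ^ x j * D.q ^ y j)⁻¹) *
        (((D.q ^ y i) ^ 2 - (D.q ^ x i) ^ 2) * ∏ j ∈ J.erase i,
          (((D.q ^ y i) ^ 2 - (D.q ^ x j) ^ 2) *
            (((D.q ^ y i) ^ 2 - (D.q ^ y j) ^ 2)⁻¹ * -(D.q ^ y j) ^ 2))) := by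
    intro i hi
    rw [← Finset.mul_prod_erase J _ hi, ← Finset.mul_prod_erase J _ hi, ← Finset.prod_inv_distrib,
      mul_assoc, ← Finset.prod_mul_distrib, D.br_sub (x i) (y i)]
    have : ∀ j ∈ J.erase i, D.br (x j - y i) * (D.br (y j - y i))⁻¹ =
        -(D.q ^ x j * D.q ^ y j)⁻¹ * (((D.q ^ y i) ^ 2 - (D.q ^ x j) ^ 2) *
            (((D.q ^ y i) ^ 2 - (D.q ^ y j) ^ 2)⁻¹ * -(D.q ^ y j) ^ 2)) := by
      intro j hj
      have hne : (D.q ^ y i) ^ 2 - (D.q ^ y j) ^ 2 ≠ 0 := by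
        rw [sub_ne_zero]
        intro h
        exact Finset.ne_of_mem_erase hj
          (hy (Finset.mem_of_mem_erase hj) hi (D.zpow_sq_injective h).symm)
      rw [D.br_sub, D.br_sub, ← hcdef]
      have h1 := hq (x j)
      have h2 := hq (y j)
      have h3 := hq (y i)
      generalize D.q ^ x j = A at *
      generalize D.q ^ y j = B at *
      generalize D.q ^ y i = Y at *
      field_simp
    rw [Finset.prod_congr rfl this, Finset.prod_mul_distrib, ← hcdef]
    ring
  rw [Finset.sum_congr rfl key, ← Finset.mul_sum, sum_lagrange (fun i => (D.q ^ x i) ^ 2)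
    (fun i => (D.q ^ y i) ^ 2) fun i hi j hj h => hy hi hj (D.zpow_sq_injective h), mul_assoc,
    mul_sub, ← Finset.prod_mul_distrib, ← Finset.prod_mul_distrib, br, div_eq_inv_mul]
  rw [← Finset.sum_neg_distrib, zpow_sum, zpow_sum]
  congr 2
  · refine Finset.prod_congr rfl fun j _ => ?_
    have h1 := hq (x j)
    have h2 := hq (y j)
    rw [zpow_sub₀ D.q_ne]
    field_simp
  · refine Finset.prod_congr rfl fun j _ => ?_
    have h1 := hq (x j)
    have h2 := hq (y j)
    rw [neg_sub, zpow_sub₀ D.q_ne]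
    field_simp

/-- The Lagrange type identity, with coinciding nodes `y i = y j` allowed if they are cancelled by
the zeros `x i` and `x j`. -/
lemma sum_br {ι : Type*} [DecidableEq ι] {J : Finset ι} (x y : ι → ℤ)
    (hy : ∀ i ∈ J, ∀ j ∈ J, i ≠ j → y i = y j → x i = y i) :
    ∑ i ∈ J, (∏ j ∈ J, D.br (x j - y i)) * (∏ j ∈ J.erase i, D.br (y j - y i))⁻¹ =
      D.br (∑ j ∈ J, (x j - y j)) := by
  have hsum : ∑ j ∈ J with x j ≠ y j, (x j - y j) = ∑ j ∈ J, (x j - y j) :=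
    Finset.sum_filter_of_ne fun j _ h h' => h (by rw [h', sub_self])
  rw [← hsum, ← D.sum_br_of_injOn x y]
  · rw [Finset.sum_filter]
    refine Finset.sum_congr rfl fun i hi => ?_
    split_ifs with h
    · have e1 : (J.filter fun j => x j ≠ y j).erase i = (J.erase i).filter fun j => x j ≠ y j := by
        rw [Finset.filter_erase]
      rw [e1, ← Finset.prod_filter_mul_prod_filter_not J (fun j => x j ≠ y j),
        ← Finset.prod_filter_mul_prod_filter_not (J.erase i) (fun j => x j ≠ y j), mul_inv]
      have e2 : (J.erase i).filter (fun j => ¬ x j ≠ y j) = J.filter fun j => ¬ x j ≠ y j := by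
        rw [Finset.filter_erase, Finset.erase_eq_of_notMem]
        simp [h]
      have e3 : ∏ j ∈ J with ¬ x j ≠ y j, D.br (x j - y i) =
          ∏ j ∈ J with ¬ x j ≠ y j, D.br (y j - y i) := by
        refine Finset.prod_congr rfl fun j hj => ?_
        rw [not_not.mp (Finset.mem_filter.mp hj).2]
      have e4 : ∏ j ∈ J with ¬ x j ≠ y j, D.br (y j - y i) ≠ 0 := by
        refine Finset.prod_ne_zero_iff.mpr fun j hj => D.br_ne_zero ?_
        obtain ⟨hj1, hj2⟩ := Finset.mem_filter.mp hj
        intro h0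
        refine h (hy i hi j hj1 ?_ (by omega))
        rintro rfl
        exact hj2 h
      rw [e2, e3]
      field_simp
    · rw [Finset.prod_eq_zero hi, zero_mul]
      rw [not_not.mp h, sub_self, br_zero]
  · intro i hi j hj hij
    by_contra hne
    exact (Finset.mem_filter.mp hi).2
      (hy i (Finset.mem_filter.mp hi).1 j (Finset.mem_filter.mp hj).1 hne hij)

/-- The square of the matrix element `w`, see `w_mul_self`. -/
def wsq (p k : ℕ) (Λ : Arr) : K :=
  (∏ a ∈ Finset.range (p + 2), D.br (Λ (p + 2) a - Λ (p + 1) k)) *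
    (∏ b ∈ Finset.range p, D.br (Λ p b - 1 - Λ (p + 1) k)) *
    (-∏ k' ∈ (Finset.range (p + 1)).erase k,
      D.br (Λ (p + 1) k' - Λ (p + 1) k) * D.br (Λ (p + 1) k' - Λ (p + 1) k - 1))⁻¹

lemma prod_range_sign (n k : ℕ) :
    ∏ b ∈ Finset.range n, (if k ≤ b then (-1 : K) else 1) = (-1) ^ (n - k) := by
  induction n with
  | zero => simp
  | succ n ih =>
    rw [Finset.prod_range_succ, ih]
    split_ifs with h
    · rw [Nat.succ_sub h, pow_succ]
    · rw [Nat.sub_eq_zero_of_le (by omega), Nat.sub_eq_zero_of_le (by omega), mul_one]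

lemma prod_br_abs_up {p k : ℕ} (hk : k < p + 1) {Λ : Arr} (h : Inter Λ) {A : Finset ℕ}
    (hA : A ⊆ Finset.range (p + 2)) :
    ∏ a ∈ A, D.br |Λ (p + 2) a - Λ (p + 1) k| = (∏ a ∈ A, (if k + 1 ≤ a then (-1 : K) else 1)) *
      ∏ a ∈ A, D.br (Λ (p + 2) a - Λ (p + 1) k) := by
  rw [← Finset.prod_mul_distrib]
  refine Finset.prod_congr rfl fun a ha => ?_
  have := h.le_iff (p := p + 1) hk (Finset.mem_range.mp (hA ha))
  rw [br_abs, sg]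
  congr 1
  by_cases h1 : a ≤ k
  · rw [if_pos (sub_nonneg.mpr (this.mpr h1)), if_neg (by omega)]
  · rw [if_neg (fun h2 => h1 (this.mp (sub_nonneg.mp h2))), if_pos (by omega)]

lemma prod_br_abs_down {p k : ℕ} (hk : k < p + 1) {Λ : Arr} (h : Inter Λ) {B : Finset ℕ}
    (hB : B ⊆ Finset.range p) :
    ∏ b ∈ B, D.br |Λ (p + 1) k + 1 - Λ p b| = (∏ b ∈ B, (if k ≤ b then (-1 : K) else 1)) *
      ∏ b ∈ B, D.br (Λ p b - 1 - Λ (p + 1) k) := by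
  rw [← Finset.prod_mul_distrib]
  refine Finset.prod_congr rfl fun b hb => ?_
  have := h.le_iff (p := p) (Finset.mem_range.mp (hB hb)) hk
  rw [add_sub_right_comm, br_abs_succ, sg, show Λ p b - 1 - Λ (p + 1) k =
    -(Λ (p + 1) k - Λ p b + 1) by ring, br_neg]
  by_cases h1 : k ≤ b
  · rw [if_pos (sub_nonneg.mpr (this.mpr h1)), if_pos h1]
    ring
  · rw [if_neg (fun h2 => h1 (this.mp (sub_nonneg.mp h2))), if_neg h1]
    ring

lemma prod_br_abs_side {p k : ℕ} (hk : k < p) {Λ : Arr} (h : Inter Λ) {C : Finset ℕ}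
    (hC : C ⊆ (Finset.range p).erase k) :
    ∏ k' ∈ C, (D.br |Λ p k' - Λ p k| * D.br |Λ p k' - Λ p k - 1|) =
      ∏ k' ∈ C, (D.br (Λ p k' - Λ p k) * D.br (Λ p k' - Λ p k - 1)) := by
  refine Finset.prod_congr rfl fun c hc => D.br_abs_mul_br_abs_pred ?_
  have h1 := hC hc
  rw [Finset.mem_erase, Finset.mem_range] at h1
  exact sub_ne_zero.mpr (h.ne h1.1 h1.2 hk)

lemma wgen_mul_self (A B C : Finset ℕ) (p k : ℕ) (Λ : Arr) :
    D.wgen A B C p k Λ * D.wgen A B C p k Λ = (∏ a ∈ A, D.br |Λ (p + 2) a - Λ (p + 1) k|) *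
      (∏ b ∈ B, D.br |Λ (p + 1) k + 1 - Λ p b|) *
      (∏ k' ∈ C, (D.br |Λ (p + 1) k' - Λ (p + 1) k| * D.br |Λ (p + 1) k' - Λ (p + 1) k - 1|))⁻¹ := by
  simp only [wgen, ← D.σ_mul_self, Finset.prod_mul_distrib, Finset.prod_inv_distrib, mul_inv]
  ring

lemma w_mul_self {p k : ℕ} (hk : k < p + 1) {Λ : Arr} (h : Inter Λ) :
    D.w p k Λ * D.w p k Λ = D.wsq p k Λ := by
  rw [w, wgen_mul_self, D.prod_br_abs_up hk h subset_rfl, D.prod_br_abs_down hk h subset_rfl,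
    D.prod_br_abs_side hk h subset_rfl, prod_range_sign, prod_range_sign, wsq, inv_neg]
  have h1 : p + 2 - (k + 1) = p - k + 1 := by omega
  have h2 : (-1 : K) ^ (p - k) * (-1) ^ (p - k) = 1 := by
    rw [← mul_pow]
    norm_num
  rw [h1, pow_succ]
  linear_combination (-(∏ a ∈ Finset.range (p + 2), D.br (Λ (p + 2) a - Λ (p + 1) k)) *
    (∏ b ∈ Finset.range p, D.br (Λ p b - 1 - Λ (p + 1) k)) *
    (∏ k' ∈ (Finset.range (p + 1)).erase k,
      D.br (Λ (p + 1) k' - Λ (p + 1) k) * D.br (Λ (p + 1) k' - Λ (p + 1) k - 1))⁻¹) * h2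

lemma inter_sub {p k : ℕ} {Λ : Arr} (h : Inter Λ) (hw : D.wsq p k (Λ - dl (p + 1) k) ≠ 0)
    (hk : k < p + 1) : Inter (Λ - dl (p + 1) k) := by
  have h0 := left_ne_zero_of_mul hw
  have hup : ∀ a < p + 2, Λ (p + 2) a - Λ (p + 1) k + 1 ≠ 0 := by
    intro a ha h1
    refine left_ne_zero_of_mul h0 (Finset.prod_eq_zero (Finset.mem_range.mpr ha) ?_)
    rw [br_eq_zero]
    simp
    omega
  have hdn : ∀ b < p, Λ p b - Λ (p + 1) k ≠ 0 := by
    intro b hb h1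
    refine right_ne_zero_of_mul h0 (Finset.prod_eq_zero (Finset.mem_range.mpr hb) ?_)
    rw [br_eq_zero]
    simp
    omega
  intro p' k' hk'
  obtain ⟨h1, h2⟩ := h p' k' hk'
  simp only [Pi.sub_apply, dl]
  refine ⟨?_, ?_⟩
  · by_cases h3 : p' + 1 = p + 1 ∧ k' = k
    · obtain ⟨h4, rfl⟩ := h3
      obtain rfl : p' = p := by omega
      have := hdn k' hk'
      simp
      omega
    · rw [if_neg h3]
      split_ifs <;> omega
  · by_cases h3 : p' = p + 1 ∧ k' = k
    · obtain ⟨rfl, rfl⟩ := h3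
      have h4 : Λ (p + 2) (k' + 1) < Λ (p + 1) k' := h2
      have := hup (k' + 1) (by omega)
      have h5 : Λ (p + 2) (k' + 1) < Λ (p + 1) k' - 1 := by omega
      simpa using h5
    · rw [if_neg h3]
      split_ifs <;> omega

lemma sum_wsq {p : ℕ} {Λ : Arr} (h : Inter Λ) :
    ∑ k ∈ Finset.range (p + 1), D.wsq p k Λ -
        ∑ k ∈ Finset.range (p + 1), D.wsq p k (Λ - dl (p + 1) k) =
      D.br (∑ a ∈ Finset.range (p + 2), Λ (p + 2) a + ∑ b ∈ Finset.range p, Λ p b -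
        2 * ∑ k ∈ Finset.range (p + 1), Λ (p + 1) k + 1) := by
  set xR : ℕ → ℤ := fun k => if k < p then Λ p k - 1 else Λ (p + 2) (p + 1) with hxR
  set x : ℕ ⊕ ℕ → ℤ := Sum.elim (fun k => Λ (p + 2) k) xR with hx
  set y : ℕ ⊕ ℕ → ℤ := Sum.elim (fun k => Λ (p + 1) k) (fun k => Λ (p + 1) k - 1) with hy
  have hprod : ∀ u : ℤ, ∏ j ∈ (Finset.range (p + 1)).disjSum (Finset.range (p + 1)), D.br (x j - u) =
      (∏ a ∈ Finset.range (p + 2), D.br (Λ (p + 2) a - u)) *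
        ∏ b ∈ Finset.range p, D.br (Λ p b - 1 - u) := by
    intro u
    rw [Finset.prod_disjSum, Finset.prod_range_succ (fun a => D.br (Λ (p + 2) a - u)) (p + 1)]
    have : ∏ k ∈ Finset.range (p + 1), D.br (x (Sum.inr k) - u) =
        (∏ b ∈ Finset.range p, D.br (Λ p b - 1 - u)) * D.br (Λ (p + 2) (p + 1) - u) := by
      rw [Finset.prod_range_succ]
      congr 1
      · refine Finset.prod_congr rfl fun k hk => ?_
        simp [hx, hxR, Finset.mem_range.mp hk]
      · simp [hx, hxR]
    rw [this]
    simp only [hx, Sum.elim_inl]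
    ring
  have eL : ∀ k, ((Finset.range (p + 1)).disjSum (Finset.range (p + 1))).erase (Sum.inl k) =
      ((Finset.range (p + 1)).erase k).disjSum (Finset.range (p + 1)) := by
    intro k
    ext j
    rcases j with j | j <;> simp
  have eR : ∀ k, ((Finset.range (p + 1)).disjSum (Finset.range (p + 1))).erase (Sum.inr k) =
      (Finset.range (p + 1)).disjSum ((Finset.range (p + 1)).erase k) := by
    intro k
    ext j
    rcases j with j | j <;> simp
  have main := D.sum_br (J := (Finset.range (p + 1)).disjSum (Finset.range (p + 1))) x y ?_
  · rw [Finset.sum_disjSum, Finset.sum_disjSum] at main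
    have hsum : ∑ k ∈ Finset.range (p + 1), (x (Sum.inl k) - y (Sum.inl k)) +
        ∑ k ∈ Finset.range (p + 1), (x (Sum.inr k) - y (Sum.inr k)) =
        ∑ a ∈ Finset.range (p + 2), Λ (p + 2) a + ∑ b ∈ Finset.range p, Λ p b -
          2 * ∑ k ∈ Finset.range (p + 1), Λ (p + 1) k + 1 := by
      have h1 : ∑ k ∈ Finset.range (p + 1), x (Sum.inr k) =
          (∑ b ∈ Finset.range p, Λ p b - p) + Λ (p + 2) (p + 1) := by
        rw [Finset.sum_range_succ]
        congr 1
        · have : ∀ k ∈ Finset.range p, x (Sum.inr k) = Λ p k - 1 := fun k hk => by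
            simp [hx, hxR, Finset.mem_range.mp hk]
          rw [Finset.sum_congr rfl this, Finset.sum_sub_distrib]
          simp
        · simp [hx, hxR]
      rw [Finset.sum_sub_distrib, Finset.sum_sub_distrib, h1,
        Finset.sum_range_succ (fun a => Λ (p + 2) a) (p + 1)]
      simp only [hx, hy, Sum.elim_inl, Sum.elim_inr, Finset.sum_sub_distrib, Finset.sum_const,
        Finset.card_range, nsmul_eq_mul]
      push_cast
      ring
    rw [hsum] at main
    rw [← main, sub_eq_add_neg, ← Finset.sum_neg_distrib]
    congr 1
    · refine Finset.sum_congr rfl fun k hk => ?_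
      rw [hprod, eL, Finset.prod_disjSum, wsq,
        ← Finset.mul_prod_erase (Finset.range (p + 1)) (fun j => D.br (y (Sum.inr j) - y (Sum.inl k)))
          hk]
      simp only [hy, Sum.elim_inl, Sum.elim_inr]
      rw [sub_sub_cancel_left, br_neg, br_one, Finset.prod_mul_distrib]
      congr 2
      simp only [sub_right_comm _ (1 : ℤ)]
      ring
    · refine Finset.sum_congr rfl fun k hk => ?_
      rw [hprod, eR, Finset.prod_disjSum, wsq,
        ← Finset.mul_prod_erase (Finset.range (p + 1)) (fun j => D.br (y (Sum.inl j) - y (Sum.inr k)))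
          hk]
      simp only [hy, Sum.elim_inl, Sum.elim_inr, Pi.sub_apply, dl_self,
        dl_succ_add_two, dl_succ_self, sub_zero]
      rw [sub_sub_cancel, br_one, one_mul, ← Finset.prod_mul_distrib, inv_neg, mul_neg, neg_neg]
      congr 2
      refine Finset.prod_congr rfl fun j hj => ?_
      rw [dl_ne (Finset.ne_of_mem_erase hj), sub_zero]
      congr 2
      ring
  · rintro (i | i) hi (j | j) hj hij hyij <;>
      simp only [Finset.inl_mem_disjSum, Finset.inr_mem_disjSum, Finset.mem_range] at hi hj <;>
      simp only [hx, hy, hxR, Sum.elim_inl, Sum.elim_inr] at hyij ⊢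
    · exact absurd hyij (h.ne (by simpa using hij) hi hj)
    · have h1 : j < i := by
        by_contra! h2
        have := h.anti_le (p := p + 1) h2 hj
        omega
      obtain ⟨i, rfl⟩ : ∃ i', i = i' + 1 := ⟨i - 1, by omega⟩
      have h2 := h.anti_le (p := p + 1) (k := j) (k' := i) (by omega) (by omega)
      have h3 : Λ (p + 2) (i + 1) < Λ (p + 1) i := (h (p + 1) i (by omega)).2
      have h4 : Λ (p + 1) (i + 1) ≤ Λ (p + 2) (i + 1) := (h (p + 1) (i + 1) (by omega)).1
      omega
    · have h1 : i < j := by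
        by_contra! h2
        have := h.anti_le (p := p + 1) h2 hi
        omega
      rw [if_pos (by omega)]
      have h2 := h.anti_le (p := p + 1) (k := i + 1) (k' := j) (by omega) (by omega)
      have h3 := (h p i (by omega)).1
      have h4 := (h p i (by omega)).2
      omega
    · exact absurd (sub_left_injective hyij) (h.ne (by simpa using hij) hi hj)

/-- The sum of the entries of a row, normalized to the entries of a pattern. -/
def rsum (n : ℕ) (Λ : Arr) : ℤ := ∑ k ∈ Finset.range n, (Λ n k + k)

lemma rsum_add_dl_self {n k : ℕ} (hk : k < n) (Λ : Arr) (s : ℤ) :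
    rsum n (Λ + s • dl n k) = rsum n Λ + s := by
  unfold rsum
  have : ∀ j ∈ Finset.range n, (Λ + s • dl n k) n j + (j : ℤ) = (Λ n j + j) +
      if j = k then s else 0 := by
    intro j _
    simp only [Pi.add_apply, Pi.smul_apply, dl, true_and, smul_eq_mul]
    split_ifs <;> ring
  rw [Finset.sum_congr rfl this, Finset.sum_add_distrib, Finset.sum_ite_eq' (Finset.range n) k,
    if_pos (Finset.mem_range.mpr hk)]

lemma rsum_add_dl_ne {n m k : ℕ} (h : n ≠ m) (Λ : Arr) (s : ℤ) :
    rsum n (Λ + s • dl m k) = rsum n Λ := by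
  unfold rsum
  refine Finset.sum_congr rfl fun j _ => ?_
  simp [dl_row_ne h]

/-- The weight `h⁽ᵖ⁺¹⁾ - h⁽ᵖ⁺²⁾`. -/
def kw (p : ℕ) (Λ : Arr) : ℤ := 2 * rsum (p + 1) Λ - rsum p Λ - rsum (p + 2) Λ

lemma sum_id (n : ℕ) : (2 : ℤ) * ∑ k ∈ Finset.range n, (k : ℤ) = n * (n - 1) := by
  induction n with
  | zero => simp
  | succ n ih =>
    rw [Finset.sum_range_succ, mul_add, ih]
    push_cast
    ring

lemma kw_eq (p : ℕ) (Λ : Arr) : kw p Λ = -(∑ a ∈ Finset.range (p + 2), Λ (p + 2) a +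
    ∑ b ∈ Finset.range p, Λ p b - 2 * ∑ k ∈ Finset.range (p + 1), Λ (p + 1) k + 1) := by
  have h1 := sum_id p
  have h2 := sum_id (p + 1)
  have h3 := sum_id (p + 2)
  simp only [kw, rsum, Finset.sum_add_distrib]
  push_cast at *
  linarith

open Classical in
/-- The operator `q^{s (h⁽ᵖ⁺¹⁾ - h⁽ᵖ⁺²⁾)}` on the interlacing arrays. -/
def Kop (s : ℤ) (p : ℕ) : Module.End K (Arr →₀ K) :=
  diagOp fun Λ => if Inter Λ then D.q ^ (s * kw p Λ) else 0

theorem E_mul_F_self (ε : ℕ → ℤ) (p : ℕ) : D.E ε p * D.F ε p - D.F ε p * D.E ε p =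
    (D.q - D.q⁻¹)⁻¹ • (D.Kop 1 p - D.Kop (-1) p) := by
  refine end_ext fun Λ => ?_
  simp only [LinearMap.sub_apply, LinearMap.smul_apply, Module.End.mul_apply]
  rw [E_F_single, F_E_single, Kop, Kop, diagOp_single, diagOp_single, ← sub_smul, smul_smul]
  simp only [← Finset.sum_sub_distrib, ← sub_smul]
  have hdiag : ∀ k' ∈ Finset.range (p + 1), ∑ k ∈ Finset.range (p + 1),
      (D.cF ε p k' (Λ - dl (p + 1) k') * D.cE ε p k (Λ - dl (p + 1) k') -
        D.cE ε p k Λ * D.cF ε p k' (Λ - dl (p + 1) k' + dl (p + 1) k)) •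
          Finsupp.single (Λ - dl (p + 1) k' + dl (p + 1) k) (1 : K) =
      (D.cF ε p k' (Λ - dl (p + 1) k') * D.cE ε p k' (Λ - dl (p + 1) k') -
        D.cE ε p k' Λ * D.cF ε p k' Λ) • Finsupp.single Λ 1 := by
    intro k' hk'
    rw [Finset.sum_eq_single_of_mem k' hk']
    · rw [sub_add_cancel]
    · intro k hk hne
      rw [Finset.mem_range] at hk hk'
      have := D.cF_mul_cE (ε := ε) (Or.inr hne) hk hk' (Λ - dl (p + 1) k')
        (D.w_square_same hne hk hk' _)
      rw [sub_add_cancel] at this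
      rw [this, sub_self, zero_smul]
  rw [Finset.sum_congr rfl hdiag, ← Finset.sum_smul]
  congr 1
  have hq : ∀ n : ℤ, D.q ^ (-n) * D.q ^ n = 1 := fun n => by
    rw [← zpow_add₀ D.q_ne, neg_add_cancel, zpow_zero]
  by_cases h : Inter Λ
  · rw [if_pos h, if_pos h]
    have h1 : ∀ k ∈ Finset.range (p + 1), D.cE ε p k Λ * D.cF ε p k Λ = D.wsq p k Λ := by
      intro k hk
      rw [D.cE_of_inter h, D.cF_of_inter h, ← D.w_mul_self (Finset.mem_range.mp hk) h]
      linear_combination D.w p k Λ * D.w p k Λ * hq (ε p * Λ (p + 1) k)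
    have h2 : ∀ k ∈ Finset.range (p + 1), D.cF ε p k (Λ - dl (p + 1) k) *
        D.cE ε p k (Λ - dl (p + 1) k) = D.wsq p k (Λ - dl (p + 1) k) := by
      intro k hk
      rw [Finset.mem_range] at hk
      by_cases h3 : Inter (Λ - dl (p + 1) k)
      · rw [D.cE_of_inter h3, D.cF_of_inter h3, ← D.w_mul_self hk h3]
        linear_combination D.w p k (Λ - dl (p + 1) k) * D.w p k (Λ - dl (p + 1) k) *
          hq (ε p * (Λ - dl (p + 1) k) (p + 1) k)
      · rw [D.cF_of_not h3, zero_mul]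
        by_contra h4
        exact h3 (D.inter_sub h (Ne.symm h4) hk)
    rw [Finset.sum_sub_distrib, Finset.sum_congr rfl h1, Finset.sum_congr rfl h2]
    have h5 := D.sum_wsq (p := p) h
    have h6 : D.br (kw p Λ) = (D.q - D.q⁻¹)⁻¹ * (D.q ^ (1 * kw p Λ) - D.q ^ (-1 * kw p Λ)) := by
      rw [br, div_eq_inv_mul, one_mul, neg_one_mul]
    rw [← h6, kw_eq, br_neg, ← h5]
    ring
  · rw [if_neg h, if_neg h, sub_self, mul_zero]
    refine Finset.sum_eq_zero fun k hk => ?_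
    rw [D.cE_of_not h, zero_mul, sub_zero]
    rw [Finset.mem_range] at hk
    by_cases h3 : Inter (Λ - dl (p + 1) k)
    · by_cases h4 : D.w p k (Λ - dl (p + 1) k) = 0
      · rw [D.cF_of_inter h3, h4]
        ring
      · have := D.inter_add h3 h4 hk
        rw [sub_add_cancel] at this
        exact absurd this h
    · rw [D.cF_of_not h3, zero_mul]

end QSqrt

end QuantumAInf

end

noncomputable section

namespace QuantumAInf

set_option linter.unusedSimpArgs false

/-! ### Root vectors: relations for `q`-commutators

In this section `t` is a parameter (to be `q` or `q⁻¹`), and `e₁ e₂ - t e₂ e₁` is a root vector. -/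

section RootVectors

variable {K A : Type*} [Field K] [Ring A] [Algebra K A] {t : K}

/-- The `t`-commutator. -/
def qc (t : K) (x y : A) : A := x * y - t • (y * x)

/-- The left hand side of the `q`-Serre relation. -/
def serreL (t : K) (x y : A) : A := x * (x * y) - (t + t⁻¹) • (x * (y * x)) + y * (x * x)

lemma serreL_inv (t : K) (x y : A) : serreL t⁻¹ x y = serreL t x y := by
  rw [serreL, serreL, inv_inv, add_comm t⁻¹]

lemma mul_qc_left (ht : t ≠ 0) {x y : A} (s : serreL t x y = 0) :
    x * qc t x y = t⁻¹ • (qc t x y * x) := by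
  unfold serreL at s
  unfold qc
  linear_combination (norm := (
    simp only [mul_sub, sub_mul, mul_add, add_mul, smul_sub, smul_add, smul_mul_assoc,
      mul_smul_comm, mul_assoc, smul_smul, smul_zero, mul_zero, zero_mul,
      neg_mul, mul_neg, smul_neg]
    match_scalars <;> field_simp <;> ring)) s

lemma qc_mul_right (ht : t ≠ 0) {x y : A} (s : serreL t y x = 0) :
    qc t x y * y = t⁻¹ • (y * qc t x y) := by
  unfold serreL at s
  unfold qc
  linear_combination (norm := (
    simp only [mul_sub, sub_mul, mul_add, add_mul, smul_sub, smul_add, smul_mul_assoc,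
      mul_smul_comm, mul_assoc, smul_smul, smul_zero, mul_zero, zero_mul,
      neg_mul, mul_neg, smul_neg]
    match_scalars <;> field_simp <;> ring)) s

lemma qc_comm_qc (ht : t ≠ 0) (hc : t + t⁻¹ ≠ 0) {x y z : A} (s : serreL t y x = 0)
    (s' : serreL t y z = 0) (h : x * z = z * x) : qc t x y * qc t⁻¹ y z = qc t⁻¹ y z * qc t x y := by
  unfold serreL at s s'
  have h1 : (t + t⁻¹) • (qc t x y * qc t⁻¹ y z) = (t + t⁻¹) • (qc t⁻¹ y z * qc t x y) := by
    unfold qc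
    linear_combination (norm := (
    simp only [mul_sub, sub_mul, mul_add, add_mul, smul_sub, smul_add, smul_mul_assoc,
      mul_smul_comm, mul_assoc, smul_smul, smul_zero, mul_zero, zero_mul,
      neg_mul, mul_neg, smul_neg]
    match_scalars <;> field_simp <;> ring))
      t • (s * z - s' * x) + t⁻¹ • (x * s' - z * s) - t • (y * y * h) - t⁻¹ • (h * y * y) +
        (t + t⁻¹) • (y * h * y)
  exact (smul_right_injective A hc) h1

lemma serreL_qc_left (ht : t ≠ 0) (hc : t + t⁻¹ ≠ 0) {x y z : A} (s1 : serreL t x y = 0)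
    (s2 : serreL t y x = 0) (s3 : serreL t y z = 0) (h : x * z = z * x) :
    serreL t (qc t x y) z = 0 := by
  have r1 := mul_qc_left ht s1
  have r2 := qc_mul_right ht s2
  have g := qc_comm_qc ht hc s2 s3 h
  set a := qc t x y with ha
  have c1 : x * qc t a z = t⁻¹ • (qc t a z * x) := by
    unfold qc
    linear_combination (norm := (
    simp only [mul_sub, sub_mul, mul_add, add_mul, smul_sub, smul_add, smul_mul_assoc,
      mul_smul_comm, mul_assoc, smul_smul, smul_zero, mul_zero, zero_mul,
      neg_mul, mul_neg, smul_neg]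
    match_scalars <;> field_simp <;> ring))
      r1 * z + t⁻¹ • (a * h) - t • (h * a) - t • (z * r1)
  have c2 : y * qc t a z = qc t a z * y := by
    unfold qc at g ⊢
    linear_combination (norm := (
    simp only [mul_sub, sub_mul, mul_add, add_mul, smul_sub, smul_add, smul_mul_assoc,
      mul_smul_comm, mul_assoc, smul_smul, smul_zero, mul_zero, zero_mul,
      neg_mul, mul_neg, smul_neg]
    match_scalars <;> field_simp <;> ring))
      t • g - t • (r2 * z) + t • (z * r2)
  have c3 : a * qc t a z = t⁻¹ • (qc t a z * a) := by
    generalize qc t a z = b at c1 c2 ⊢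
    rw [ha, qc]
    linear_combination (norm := (
    simp only [mul_sub, sub_mul, mul_add, add_mul, smul_sub, smul_add, smul_mul_assoc,
      mul_smul_comm, mul_assoc, smul_smul, smul_zero, mul_zero, zero_mul,
      neg_mul, mul_neg, smul_neg]
    match_scalars <;> field_simp <;> ring))
      x * c2 + c1 * y - t • (y * c1) - c2 * x
  unfold qc at c3
  unfold serreL
  linear_combination (norm := (
    simp only [mul_sub, sub_mul, mul_add, add_mul, smul_sub, smul_add, smul_mul_assoc,
      mul_smul_comm, mul_assoc, smul_smul, smul_zero, mul_zero, zero_mul,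
      neg_mul, mul_neg, smul_neg]
    match_scalars <;> field_simp <;> ring)) c3

lemma serreL_smul_left (r : K) {x y : A} (s : serreL t x y = 0) : serreL t (r • x) y = 0 := by
  unfold serreL at s ⊢
  linear_combination (norm := (
    simp only [mul_sub, sub_mul, mul_add, add_mul, smul_sub, smul_add, smul_mul_assoc,
      mul_smul_comm, mul_assoc, smul_smul, smul_zero, mul_zero, zero_mul,
      neg_mul, mul_neg, smul_neg]
    match_scalars <;> field_simp <;> ring))
    (r ^ 2) • s

lemma serreL_qc_right (ht : t ≠ 0) (hc : t + t⁻¹ ≠ 0) {x y z : A} (s1 : serreL t y x = 0)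
    (s2 : serreL t y z = 0) (s3 : serreL t z y = 0) (h : x * z = z * x) :
    serreL t (qc t y z) x = 0 := by
  have h1 := serreL_qc_left (t := t⁻¹) (inv_ne_zero ht) (by rwa [inv_inv, add_comm])
    (x := z) (y := y) (z := x) (by rwa [serreL_inv]) (by rwa [serreL_inv]) (by rwa [serreL_inv]) h.symm
  rw [serreL_inv] at h1
  have h2 : qc t y z = (-t) • qc t⁻¹ z y := by
    unfold qc
    match_scalars <;> field_simp
  rw [h2]
  exact serreL_smul_left _ h1

lemma serreL_qc_target (r : K) {a x y : A} (s : serreL t a x = 0) (h : a * y = y * a) :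
    serreL t a (qc r x y) = 0 := by
  unfold serreL at s ⊢
  unfold qc
  linear_combination (norm := (
    simp only [mul_sub, sub_mul, mul_add, add_mul, smul_sub, smul_add, smul_mul_assoc,
      mul_smul_comm, mul_assoc, smul_smul, smul_zero, mul_zero, zero_mul,
      neg_mul, mul_neg, smul_neg]
    match_scalars <;> field_simp <;> ring))
    s * y - r • (y * s) + (t + t⁻¹) • (a * x * h) - x * (a * h + h * a) - r • ((a * h + h * a) * x) +
      ((t + t⁻¹) * r) • (h * x * a)

lemma serreL_qc_target' (r : K) {a x y : A} (s : serreL t a y = 0) (h : a * x = x * a) :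
    serreL t a (qc r x y) = 0 := by
  unfold serreL at s ⊢
  unfold qc
  linear_combination (norm := (
    simp only [mul_sub, sub_mul, mul_add, add_mul, smul_sub, smul_add, smul_mul_assoc,
      mul_smul_comm, mul_assoc, smul_smul, smul_zero, mul_zero, zero_mul,
      neg_mul, mul_neg, smul_neg]
    match_scalars <;> field_simp <;> ring))
    x * s - r • (s * x) + (a * h + h * a) * y - (t + t⁻¹) • (h * y * a) -
      ((t + t⁻¹) * r) • (a * y * h) + r • (y * (a * h + h * a))

/-- Root vectors of disjoint, not adjacent, sets of nodes commute. -/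
lemma qc_comm_of_comm {r r' : K} {x y z u : A} (h1 : x * z = z * x) (h2 : x * u = u * x)
    (h3 : y * z = z * y) (h4 : y * u = u * y) : qc r x y * qc r' z u = qc r' z u * qc r x y := by
  have a1 : Commute (qc r x y) z :=
    (Commute.mul_left h1 h3).sub_left ((Commute.mul_left h3 h1).smul_left r)
  have a2 : Commute (qc r x y) u :=
    (Commute.mul_left h2 h4).sub_left ((Commute.mul_left h4 h2).smul_left r)
  exact ((a1.mul_right a2).sub_right ((a2.mul_right a1).smul_right r')).eq

variable {c : K}

lemma qc_lie_second (hc : c * (t ^ 2 - 1) = t) (ht : t ≠ 0) {e₁ e₂ f₂ k₂ k₂' : A}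
    (h22 : e₂ * f₂ - f₂ * e₂ = c • (k₂ - k₂')) (h12 : e₁ * f₂ = f₂ * e₁)
    (k : k₂ * e₁ = t⁻¹ • (e₁ * k₂)) (k' : k₂' * e₁ = t • (e₁ * k₂')) :
    qc t e₁ e₂ * f₂ - f₂ * qc t e₁ e₂ = t • (e₁ * k₂') := by
  unfold qc
  linear_combination (norm := (
    simp only [mul_sub, sub_mul, mul_add, add_mul, smul_sub, smul_add, smul_mul_assoc,
      mul_smul_comm, mul_assoc, smul_smul, smul_zero, mul_zero, zero_mul,
      neg_mul, mul_neg, smul_neg]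
    match_scalars <;> field_simp <;> ring))
    e₁ * h22 + h12 * e₂ - t • (h22 * e₁) - t • (e₂ * h12) - (t * c) • k + (t * c) • k' +
      hc • (e₁ * k₂')

lemma qc_lie_first (hc : c * (t ^ 2 - 1) = t) (ht : t ≠ 0) {e₁ e₂ f₁ k₁ k₁' : A}
    (h11 : e₁ * f₁ - f₁ * e₁ = c • (k₁ - k₁')) (h21 : e₂ * f₁ = f₁ * e₂)
    (k : k₁ * e₂ = t⁻¹ • (e₂ * k₁)) (k' : k₁' * e₂ = t • (e₂ * k₁')) :
    qc t e₁ e₂ * f₁ - f₁ * qc t e₁ e₂ = -(e₂ * k₁) := by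
  unfold qc
  have hc' : c * t⁻¹ - c * t = -1 := by
    field_simp
    linear_combination -hc
  linear_combination (norm := (
    simp only [mul_sub, sub_mul, mul_add, add_mul, smul_sub, smul_add, smul_mul_assoc,
      mul_smul_comm, mul_assoc, smul_smul, smul_zero, mul_zero, zero_mul,
      neg_mul, mul_neg, smul_neg]
    match_scalars <;> field_simp <;> ring))
    e₁ * h21 + h11 * e₂ - t • (h21 * e₁) - t • (e₂ * h11) + c • k - c • k' + hc' • (e₂ * k₁)

lemma qc_comm_lower (hc : c * (t ^ 2 - 1) = t) (ht : t ≠ 0) {e₁ e₂ f₂ f₃ k₂ k₂' : A}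
    (h22 : e₂ * f₂ - f₂ * e₂ = c • (k₂ - k₂')) (h12 : e₁ * f₂ = f₂ * e₁)
    (h13 : e₁ * f₃ = f₃ * e₁) (h23 : e₂ * f₃ = f₃ * e₂)
    (k : k₂ * e₁ = t⁻¹ • (e₁ * k₂)) (k' : k₂' * e₁ = t • (e₁ * k₂'))
    (kf : k₂' * f₃ = t⁻¹ • (f₃ * k₂')) :
    qc t e₁ e₂ * qc t f₃ f₂ = qc t f₃ f₂ * qc t e₁ e₂ := by
  have r := qc_lie_second hc ht h22 h12 k k'
  have r3 : qc t e₁ e₂ * f₃ = f₃ * qc t e₁ e₂ :=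
    ((Commute.mul_left h13 h23).sub_left ((Commute.mul_left h23 h13).smul_left t)).eq
  set a := qc t e₁ e₂
  unfold qc
  linear_combination (norm := (
    simp only [mul_sub, sub_mul, mul_add, add_mul, smul_sub, smul_add, smul_mul_assoc,
      mul_smul_comm, mul_assoc, smul_smul, smul_zero, mul_zero, zero_mul,
      neg_mul, mul_neg, smul_neg]
    match_scalars <;> field_simp <;> ring))
    f₃ * r + r3 * f₂ - t • (r * f₃) - t • (f₂ * r3) - t • (h13 * k₂') - (t ^ 2) • (e₁ * kf)

lemma qc_comm_lower_self (hc : c * (t ^ 2 - 1) = t) (ht : t ≠ 0) {e₁ e₂ f₁ f₂ k₁ k₁' k₂ k₂' : A}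
    (h11 : e₁ * f₁ - f₁ * e₁ = c • (k₁ - k₁')) (h22 : e₂ * f₂ - f₂ * e₂ = c • (k₂ - k₂'))
    (h12 : e₁ * f₂ = f₂ * e₁) (h21 : e₂ * f₁ = f₁ * e₂)
    (k1 : k₁ * e₂ = t⁻¹ • (e₂ * k₁)) (k1' : k₁' * e₂ = t • (e₂ * k₁'))
    (k2 : k₂ * e₁ = t⁻¹ • (e₁ * k₂)) (k2' : k₂' * e₁ = t • (e₁ * k₂'))
    (kf1 : k₁ * f₂ = t • (f₂ * k₁)) (kf2 : k₂' * f₁ = t⁻¹ • (f₁ * k₂')) (kk : k₂ * k₁ = k₁ * k₂)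
    (kk' : k₁ * k₂' = k₂' * k₁) :
    qc t e₁ e₂ * qc t⁻¹ f₂ f₁ - qc t⁻¹ f₂ f₁ * qc t e₁ e₂ = c • (k₁ * k₂ - k₁' * k₂') := by
  have r2 := qc_lie_second hc ht h22 h12 k2 k2'
  have r1 := qc_lie_first hc ht h11 h21 k1 k1'
  set a := qc t e₁ e₂
  unfold qc
  linear_combination (norm := (
    simp only [mul_sub, sub_mul, mul_add, add_mul, smul_sub, smul_add, smul_mul_assoc,
      mul_smul_comm, mul_assoc, smul_smul, smul_zero, mul_zero, zero_mul,
      neg_mul, mul_neg, smul_neg]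
    match_scalars <;> field_simp <;> ring))
    f₂ * r1 + r2 * f₁ - t⁻¹ • (f₁ * r2) - t⁻¹ • (r1 * f₂) + t • (e₁ * kf2) + t⁻¹ • (e₂ * kf1) +
      h11 * k₂' + h22 * k₁ + c • kk + c • kk'

variable {κ κ' : A}

lemma qc_comm_twist (ht : t ≠ 0) {e₁ e₂ : A} (s : serreL t e₁ e₂ = 0)
    (k1 : κ * e₁ = t • (e₁ * κ)) (k2 : κ * e₂ = e₂ * κ) :
    qc t e₁ e₂ * (e₁ * κ) = (e₁ * κ) * qc t e₁ e₂ := by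
  have r := mul_qc_left ht s
  have k3 : κ * qc t e₁ e₂ = t • (qc t e₁ e₂ * κ) := by
    unfold qc
    linear_combination (norm := (
    simp only [mul_sub, sub_mul, mul_add, add_mul, smul_sub, smul_add, smul_mul_assoc,
      mul_smul_comm, mul_assoc, smul_smul, smul_zero, mul_zero, zero_mul,
      neg_mul, mul_neg, smul_neg]
    match_scalars <;> field_simp <;> ring))
      k1 * e₂ + t • (e₁ * k2) - t • (k2 * e₁) - t • (e₂ * k1)
  set a := qc t e₁ e₂
  linear_combination (norm := (
    simp only [mul_sub, sub_mul, mul_add, add_mul, smul_sub, smul_add, smul_mul_assoc,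
      mul_smul_comm, mul_assoc, smul_smul, smul_zero, mul_zero, zero_mul,
      neg_mul, mul_neg, smul_neg]
    match_scalars <;> field_simp <;> ring))
    (-t) • (r * κ) - e₁ * k3

lemma serreL_twist (hc : c * (t ^ 2 - 1) = t) (ht : t ≠ 0) {e₁ e₂ f₁ k₁ k₁' : A}
    (s2 : serreL t e₂ e₁ = 0)
    (h11 : e₁ * f₁ - f₁ * e₁ = c • (k₁ - k₁')) (h21 : e₂ * f₁ = f₁ * e₂)
    (k : k₁ * e₂ = t⁻¹ • (e₂ * k₁)) (k' : k₁' * e₂ = t • (e₂ * k₁'))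
    (ke : k₁ * e₁ = (t ^ 2) • (e₁ * k₁)) (kf : k₁ * f₁ = (t⁻¹ ^ 2) • (f₁ * k₁))
    (κe : κ' * e₁ = t⁻¹ • (e₁ * κ')) (κf : κ' * f₁ = t • (f₁ * κ')) (κe2 : κ' * e₂ = e₂ * κ')
    (kκ : k₁ * κ' = κ' * k₁) :
    serreL t (f₁ * κ') (qc t e₁ e₂) = 0 ∧ serreL t (qc t e₁ e₂) (f₁ * κ') = 0 := by
  have r2 := qc_mul_right ht s2
  have r1 := qc_lie_first hc ht h11 h21 k k'
  have κa : κ' * qc t e₁ e₂ = t⁻¹ • (qc t e₁ e₂ * κ') := by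
    unfold qc
    linear_combination (norm := (
    simp only [mul_sub, sub_mul, mul_add, add_mul, smul_sub, smul_add, smul_mul_assoc,
      mul_smul_comm, mul_assoc, smul_smul, smul_zero, mul_zero, zero_mul,
      neg_mul, mul_neg, smul_neg]
    match_scalars <;> field_simp <;> ring))
      κe * e₂ + t⁻¹ • (e₁ * κe2) - t • (κe2 * e₁) - t • (e₂ * κe)
  have ka : k₁ * qc t e₁ e₂ = t • (qc t e₁ e₂ * k₁) := by
    unfold qc
    linear_combination (norm := (
    simp only [mul_sub, sub_mul, mul_add, add_mul, smul_sub, smul_add, smul_mul_assoc,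
      mul_smul_comm, mul_assoc, smul_smul, smul_zero, mul_zero, zero_mul,
      neg_mul, mul_neg, smul_neg]
    match_scalars <;> field_simp <;> ring))
      ke * e₂ + (t ^ 2) • (e₁ * k) - t • (k * e₁) - (e₂ * ke)
  set a := qc t e₁ e₂
  have hg : t • (f₁ * κ' * a) - a * (f₁ * κ') = e₂ * k₁ * κ' := by
    linear_combination (norm := (
    simp only [mul_sub, sub_mul, mul_add, add_mul, smul_sub, smul_add, smul_mul_assoc,
      mul_smul_comm, mul_assoc, smul_smul, smul_zero, mul_zero, zero_mul,
      neg_mul, mul_neg, smul_neg]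
    match_scalars <;> field_simp <;> ring))
      t • (f₁ * κa) - r1 * κ'
  have fg : f₁ * κ' * (e₂ * k₁ * κ') = t • (e₂ * k₁ * κ' * (f₁ * κ')) := by
    linear_combination (norm := (
    simp only [mul_sub, sub_mul, mul_add, add_mul, smul_sub, smul_add, smul_mul_assoc,
      mul_smul_comm, mul_assoc, smul_smul, smul_zero, mul_zero, zero_mul,
      neg_mul, mul_neg, smul_neg]
    match_scalars <;> field_simp <;> ring))
      f₁ * κe2 * k₁ * κ' - h21 * κ' * k₁ * κ' - e₂ * f₁ * kκ * κ' - t • (e₂ * k₁ * κf * κ') -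
        (t ^ 2) • (e₂ * kf * κ' * κ')
  have ag : a * (e₂ * k₁ * κ') = t⁻¹ • (e₂ * k₁ * κ' * a) := by
    linear_combination (norm := (
    simp only [mul_sub, sub_mul, mul_add, add_mul, smul_sub, smul_add, smul_mul_assoc,
      mul_smul_comm, mul_assoc, smul_smul, smul_zero, mul_zero, zero_mul,
      neg_mul, mul_neg, smul_neg]
    match_scalars <;> field_simp <;> ring))
      r2 * k₁ * κ' - t⁻¹ • (e₂ * k₁ * κa) - (t⁻¹ ^ 2) • (e₂ * ka * κ')
  generalize f₁ * κ' = f at hg fg ⊢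
  generalize e₂ * k₁ * κ' = g at hg fg ag
  constructor
  · unfold serreL
    linear_combination (norm := (
    simp only [mul_sub, sub_mul, mul_add, add_mul, smul_sub, smul_add, smul_mul_assoc,
      mul_smul_comm, mul_assoc, smul_smul, smul_zero, mul_zero, zero_mul,
      neg_mul, mul_neg, smul_neg]
    match_scalars <;> field_simp <;> ring))
      t⁻¹ • (f * hg) - hg * f + t⁻¹ • fg
  · unfold serreL
    linear_combination (norm := (
    simp only [mul_sub, sub_mul, mul_add, add_mul, smul_sub, smul_add, smul_mul_assoc,
      mul_smul_comm, mul_assoc, smul_smul, smul_zero, mul_zero, zero_mul,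
      neg_mul, mul_neg, smul_neg]
    match_scalars <;> field_simp <;> ring))
      t⁻¹ • (hg * a) - a * hg - ag

end RootVectors

end QuantumAInf

end

noncomputable section

namespace QuantumAInf

namespace QSqrt

variable {K : Type*} [Field K] (D : QSqrt K)

/-! ### Transposition -/

/-- The bilinear form for which the arrays are orthonormal. -/
def pair (x y : Arr →₀ K) : K := Finsupp.linearCombination K (fun Λ => y Λ) x

lemma pair_single (Λ : Arr) (y : Arr →₀ K) : pair (Finsupp.single Λ 1) y = y Λ := by
  simp [pair]

/-- `T` is the transpose of `S`. -/
def IsAdj (S T : Module.End K (Arr →₀ K)) : Prop := ∀ x y, pair (S x) y = pair x (T y)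

lemma pair_add_left (x x' y : Arr →₀ K) : pair (x + x') y = pair x y + pair x' y := by
  simp [pair]

lemma pair_smul_left (c : K) (x y : Arr →₀ K) : pair (c • x) y = c * pair x y := by
  simp [pair]

lemma pair_add_right (x y y' : Arr →₀ K) : pair x (y + y') = pair x y + pair x y' := by
  simp only [pair, Finsupp.linearCombination_apply, Finsupp.sum, ← Finset.sum_add_distrib,
    Finsupp.add_apply, smul_add]

lemma pair_smul_right (c : K) (x y : Arr →₀ K) : pair x (c • y) = c * pair x y := by
  simp only [pair, Finsupp.linearCombination_apply, Finsupp.sum, Finset.mul_sum,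
    Finsupp.smul_apply, smul_eq_mul]
  exact Finset.sum_congr rfl fun _ _ => by ring

lemma pair_zero_right (x : Arr →₀ K) : pair x 0 = 0 := by
  simp [pair, Finsupp.linearCombination_apply]

lemma pair_comm (x y : Arr →₀ K) : pair x y = pair y x := by
  induction x using Finsupp.induction_linear with
  | zero => rw [pair_zero_right]; simp [pair]
  | add x x' hx hx' => rw [pair_add_left, pair_add_right, hx, hx']
  | single Λ c =>
    rw [← Finsupp.smul_single_one, pair_smul_left, pair_smul_right, pair_single]
    congr 1
    induction y using Finsupp.induction_linear with
    | zero => simp [pair]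
    | add y y' hy hy' => rw [pair_add_left, Finsupp.add_apply, hy, hy']
    | single Λ' c' =>
      rw [← Finsupp.smul_single_one, pair_smul_left, pair_single, Finsupp.smul_apply, smul_eq_mul]
      congr 1
      classical
      simp [Finsupp.single_apply, eq_comm]

lemma isAdj_of_single {S T : Module.End K (Arr →₀ K)}
    (h : ∀ Λ Λ', S (Finsupp.single Λ 1) Λ' = T (Finsupp.single Λ' 1) Λ) : IsAdj S T := by
  intro x y
  induction x using Finsupp.induction_linear with
  | zero => simp [pair]
  | add x x' hx hx' => rw [map_add, pair_add_left, pair_add_left, hx, hx']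
  | single Λ c =>
    rw [← Finsupp.smul_single_one, map_smul, pair_smul_left, pair_smul_left, pair_single]
    congr 1
    induction y using Finsupp.induction_linear with
    | zero => rw [pair_zero_right, map_zero, Finsupp.zero_apply]
    | add y y' hy hy' => rw [map_add, pair_add_right, Finsupp.add_apply, hy, hy']
    | single Λ' c' =>
      rw [← Finsupp.smul_single_one Λ' c', map_smul, pair_smul_right, Finsupp.smul_apply, ← h,
        pair_comm, pair_single, smul_eq_mul]

namespace IsAdj

variable {S T S' T' : Module.End K (Arr →₀ K)}

lemma mul (h : IsAdj S T) (h' : IsAdj S' T') : IsAdj (S * S') (T' * T) := fun x y => by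
  rw [Module.End.mul_apply, Module.End.mul_apply, h, h']

lemma add (h : IsAdj S T) (h' : IsAdj S' T') : IsAdj (S + S') (T + T') := fun x y => by
  rw [LinearMap.add_apply, LinearMap.add_apply, pair_add_left, pair_add_right, h, h']

lemma smul (c : K) (h : IsAdj S T) : IsAdj (c • S) (c • T) := fun x y => by
  rw [LinearMap.smul_apply, LinearMap.smul_apply, pair_smul_left, pair_smul_right, h]

lemma sub (h : IsAdj S T) (h' : IsAdj S' T') : IsAdj (S - S') (T - T') := fun x y => by
  have h1 : ∀ x x' y : Arr →₀ K, pair (x - x') y = pair x y - pair x' y := by simp [pair]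
  rw [LinearMap.sub_apply, LinearMap.sub_apply, h1, pair_comm x, h1, h, h', pair_comm x,
    pair_comm x]

lemma ext (h : IsAdj S T) (h' : IsAdj S T') : T = T' := by
  refine LinearMap.ext fun y => Finsupp.ext fun Λ => ?_
  rw [← pair_single, ← pair_single, ← h, ← h']

lemma comm (h : IsAdj S T) (h' : IsAdj S' T') (hS : S * S' = S' * S) : T * T' = T' * T :=
  ((h'.mul h).ext (hS ▸ h.mul h'))

lemma qc (h : IsAdj S T) (h' : IsAdj S' T') (t : K) :
    IsAdj (QuantumAInf.qc t S S') (QuantumAInf.qc t T' T) :=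
  (h.mul h').sub ((h'.mul h).smul t)

lemma serreL (h : IsAdj S T) (h' : IsAdj S' T') {t : K} (hS : serreL t S S' = 0) :
    QuantumAInf.serreL t T T' = 0 := by
  have h1 : IsAdj (QuantumAInf.serreL t S S')
      (T' * T * T - (t + t⁻¹) • (T * T' * T) + T * T * T') :=
    ((h.mul (h.mul h')).sub ((h.mul (h'.mul h)).smul _)).add (h'.mul (h.mul h))
  rw [hS] at h1
  have h2 : IsAdj (0 : Module.End K (Arr →₀ K)) 0 := fun x y => by
    rw [LinearMap.zero_apply, LinearMap.zero_apply, pair_zero_right]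
    simp [pair]
  have h3 := h1.ext h2
  rw [QuantumAInf.serreL]
  simp only [mul_assoc] at h3
  rw [← h3]
  abel

end IsAdj

lemma isAdj_E_F (ε : ℕ → ℤ) (p : ℕ) : IsAdj (D.E (-ε) p) (D.F ε p) := by
  classical
  refine isAdj_of_single fun Λ Λ' => ?_
  rw [E_single, F_single]
  simp only [Finsupp.coe_finsetSum, Finset.sum_apply, Finsupp.smul_apply, Finsupp.single_apply,
    smul_eq_mul]
  refine Finset.sum_congr rfl fun k _ => ?_
  by_cases h : Λ + dl (p + 1) k = Λ'
  · subst h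
    simp [cE, cF]
  · rw [if_neg h, if_neg (fun h' => h (by rw [← h', sub_add_cancel])), mul_zero, mul_zero]

/-! ### The generators that move entries of two consecutive rows -/

/-- The matrix element for raising the `k`-th entry of row `p + 1` and the `a`-th of row `p + 2`. -/
def z (p k a : ℕ) (Λ : Arr) : K :=
  sg (Λ (p + 2) a - Λ (p + 1) k) * (D.wU p k a Λ * D.wD p k a Λ)

open Classical in
/-- The operator that raises entries of the rows `p + 1` and `p + 2`. -/
def X (p : ℕ) : Module.End K (Arr →₀ K) :=
  Finsupp.linearCombination K fun Λ => ∑ k ∈ Finset.range (p + 1), ∑ a ∈ Finset.range (p + 2),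
    (if Inter Λ then D.z p k a Λ else 0) • Finsupp.single (Λ + dl (p + 1) k + dl (p + 2) a) 1

open Classical in
/-- The operator that lowers entries of the rows `p + 1` and `p + 2`. -/
def Y (p : ℕ) : Module.End K (Arr →₀ K) :=
  Finsupp.linearCombination K fun Λ => ∑ k ∈ Finset.range (p + 1), ∑ a ∈ Finset.range (p + 2),
    (if Inter (Λ - dl (p + 1) k - dl (p + 2) a) then D.z p k a (Λ - dl (p + 1) k - dl (p + 2) a)
      else 0) • Finsupp.single (Λ - dl (p + 1) k - dl (p + 2) a) 1

open Classical in
lemma X_single (p : ℕ) (Λ : Arr) : D.X p (Finsupp.single Λ 1) =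
    ∑ k ∈ Finset.range (p + 1), ∑ a ∈ Finset.range (p + 2),
      (if Inter Λ then D.z p k a Λ else 0) • Finsupp.single (Λ + dl (p + 1) k + dl (p + 2) a) 1 := by
  simp [X]

open Classical in
lemma Y_single (p : ℕ) (Λ : Arr) : D.Y p (Finsupp.single Λ 1) =
    ∑ k ∈ Finset.range (p + 1), ∑ a ∈ Finset.range (p + 2),
      (if Inter (Λ - dl (p + 1) k - dl (p + 2) a) then D.z p k a (Λ - dl (p + 1) k - dl (p + 2) a)
        else 0) • Finsupp.single (Λ - dl (p + 1) k - dl (p + 2) a) 1 := by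
  simp [Y]

lemma isAdj_X_Y (p : ℕ) : IsAdj (D.X p) (D.Y p) := by
  classical
  refine isAdj_of_single fun Λ Λ' => ?_
  rw [X_single, Y_single]
  simp only [Finsupp.coe_finsetSum, Finset.sum_apply, Finsupp.smul_apply, Finsupp.single_apply,
    smul_eq_mul]
  refine Finset.sum_congr rfl fun k _ => Finset.sum_congr rfl fun a _ => ?_
  by_cases h : Λ + dl (p + 1) k + dl (p + 2) a = Λ'
  · subst h
    simp [add_sub_right_comm]
  · have h1 : Λ' - dl (p + 1) k - dl (p + 2) a ≠ Λ := fun h1 => h (by subst h1; abel)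
    rw [if_neg h, if_neg h1, mul_zero, mul_zero]

lemma zpow_mul_br (s x : ℤ) (hs : s = 1 ∨ s = -1) :
    D.q ^ (s * x) * (D.br (x + 1) - D.q ^ s * D.br x) = 1 := by
  have hq := D.q_ne
  have h1 := D.q_sub_ne
  have hx : D.q ^ x ≠ 0 := zpow_ne_zero _ hq
  have h2 : D.q * D.q - 1 ≠ 0 := by
    intro h
    apply h1
    field_simp
    linear_combination h
  rcases hs with rfl | rfl
  · rw [one_mul, zpow_one, br, br, zpow_neg, zpow_neg, zpow_add₀ hq, zpow_one]
    generalize D.q ^ x = y at *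
    rw [mul_div_assoc', ← sub_div, mul_div_assoc', div_eq_one_iff_eq h1]
    field_simp
    ring
  · rw [neg_one_mul, zpow_neg, zpow_neg, zpow_one, br, br, zpow_neg, zpow_neg, zpow_add₀ hq, zpow_one]
    generalize D.q ^ x = y at *
    rw [mul_div_assoc', ← sub_div, mul_div_assoc', div_eq_one_iff_eq h1]
    field_simp
    ring

lemma X_eq_qc {ε : ℕ → ℤ} {p : ℕ} (h1 : ε p = 1 ∨ ε p = -1) (h2 : ε (p + 1) = -ε p) :
    D.X p = qc (D.q ^ (-ε p)) (D.E ε p) (D.E ε (p + 1)) := by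
  refine end_ext fun Λ => ?_
  rw [X_single, qc, LinearMap.sub_apply, LinearMap.smul_apply, Module.End.mul_apply,
    Module.End.mul_apply, E_E_single, E_E_single, Finset.sum_comm, Finset.smul_sum,
    Finset.sum_comm (s := Finset.range (p + 1 + 1)), Finset.sum_comm (s := Finset.range (p + 1 + 1)),
    ← Finset.sum_sub_distrib]
  refine Finset.sum_congr rfl fun k hk => ?_
  rw [Finset.smul_sum, ← Finset.sum_sub_distrib]
  refine Finset.sum_congr rfl fun a ha => ?_
  rw [Finset.mem_range] at hk ha
  rw [add_right_comm Λ (dl (p + 1 + 1) a), smul_smul, ← sub_smul]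
  congr 1
  split_ifs with h
  · rw [D.cE_mul_cE h hk, D.cE_mul_cE h ha, D.w_eq_wU (a := a) ha, D.w_eq_wD (k := k) hk,
      D.w_eq_wU (a := a) ha, D.w_eq_wD (k := k) hk, wU_add, wD_add, z]
    simp only [Pi.add_apply, dl_self, dl_succ_add_two, dl_add_two_succ, add_zero]
    have e1 : Λ (p + 2) a + 1 - Λ (p + 1) k = (Λ (p + 2) a - Λ (p + 1) k) + 1 := by ring
    have e2 : Λ (p + 2) a + 1 - (Λ (p + 1) k + 1) = Λ (p + 2) a - Λ (p + 1) k := by ring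
    have e3 : D.q ^ (ε p * Λ (p + 1) k) * D.q ^ (ε (p + 1) * Λ (p + 2) a) =
        D.q ^ (-ε p * (Λ (p + 2) a - Λ (p + 1) k)) := by
      rw [← zpow_add₀ D.q_ne, h2]
      ring_nf
    rw [e1, e2, mul_comm (D.q ^ (ε (p + 1) * _)), e3]
    generalize Λ (p + 2) a - Λ (p + 1) k = x
    have h3 := D.zpow_mul_br (-ε p) x (by omega)
    have h4 : D.σ (x + 1) * D.σ (x + 1) = sg x * D.br (x + 1) := by
      rw [σ_mul_self, br_abs_succ]
    have h5 : D.σ x * D.σ x = sg x * D.br x := by rw [σ_mul_self, br_abs]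
    linear_combination (-sg x * D.wU p k a Λ * D.wD p k a Λ) * h3 -
      D.wU p k a Λ * D.wD p k a Λ * D.q ^ (-ε p * x) * h4 +
      D.q ^ (-ε p) * D.wU p k a Λ * D.wD p k a Λ * D.q ^ (-ε p * x) * h5
  · rw [D.cE_of_not h, D.cE_of_not h]
    ring

lemma Y_eq_qc {ε : ℕ → ℤ} {p : ℕ} (h1 : ε p = 1 ∨ ε p = -1) (h2 : ε (p + 1) = -ε p) :
    D.Y p = qc (D.q ^ ε p) (D.F ε (p + 1)) (D.F ε p) := by
  have h3 := D.X_eq_qc (ε := -ε) (p := p) (by simpa [neg_eq_iff_eq_neg, or_comm] using h1)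
    (by simp [h2])
  have h4 := (isAdj_E_F D ε p).qc (isAdj_E_F D ε (p + 1)) (D.q ^ ε p)
  rw [Pi.neg_apply, neg_neg] at h3
  rw [← h3] at h4
  exact (D.isAdj_X_Y p).ext h4

/-! ### Relations between the row operators and the diagonal operators -/

lemma inter_of_cE_ne_zero {ε : ℕ → ℤ} {p k : ℕ} {Λ : Arr} (hk : k < p + 1)
    (h : D.cE ε p k Λ ≠ 0) : Inter Λ ∧ Inter (Λ + dl (p + 1) k) := by
  have h1 : Inter Λ := by
    by_contra h1
    exact h (D.cE_of_not h1)
  refine ⟨h1, D.inter_add h1 ?_ hk⟩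
  rw [D.cE_of_inter h1] at h
  exact left_ne_zero_of_mul h

lemma inter_of_cF_ne_zero {ε : ℕ → ℤ} {p k : ℕ} {Λ : Arr} (hk : k < p + 1)
    (h : D.cF ε p k (Λ - dl (p + 1) k) ≠ 0) : Inter Λ ∧ Inter (Λ - dl (p + 1) k) := by
  have h1 : Inter (Λ - dl (p + 1) k) := by
    by_contra h1
    exact h (D.cF_of_not h1)
  refine ⟨?_, h1⟩
  rw [D.cF_of_inter h1] at h
  have := D.inter_add h1 (left_ne_zero_of_mul h) hk
  rwa [sub_add_cancel] at this

/-- The Cartan matrix of type `A`. -/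
def cartan (p p' : ℕ) : ℤ := if p = p' then 2 else if p = p' + 1 ∨ p' = p + 1 then -1 else 0

lemma kw_add (p p' k : ℕ) (hk : k < p' + 1) (Λ : Arr) (s : ℤ) :
    kw p (Λ + s • dl (p' + 1) k) = kw p Λ + s * cartan p p' := by
  unfold kw cartan
  split_ifs with h1 h2
  · subst h1
    rw [rsum_add_dl_self hk, rsum_add_dl_ne (by omega), rsum_add_dl_ne (by omega)]
    ring
  · rcases h2 with h2 | h2
    · subst h2
      rw [rsum_add_dl_self hk, rsum_add_dl_ne (by omega), rsum_add_dl_ne (by omega)]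
      ring
    · subst h2
      rw [rsum_add_dl_self hk, rsum_add_dl_ne (by omega), rsum_add_dl_ne (by omega)]
      ring
  · rw [rsum_add_dl_ne (by omega), rsum_add_dl_ne (by omega), rsum_add_dl_ne (by omega)]
    ring

lemma Kop_mul_E (ε : ℕ → ℤ) (s : ℤ) (p p' : ℕ) :
    D.Kop s p * D.E ε p' = D.q ^ (s * cartan p p') • (D.E ε p' * D.Kop s p) := by
  refine diagOp_mul_hop fun Λ k hk hc => ?_
  obtain ⟨h1, h2⟩ := D.inter_of_cE_ne_zero hk hc
  rw [one_smul, if_pos h1, if_pos h2, ← zpow_add₀ D.q_ne]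
  have := kw_add p p' k hk Λ 1
  rw [one_smul] at this
  rw [this]
  ring_nf

lemma Kop_mul_F (ε : ℕ → ℤ) (s : ℤ) (p p' : ℕ) :
    D.Kop s p * D.F ε p' = D.q ^ (-(s * cartan p p')) • (D.F ε p' * D.Kop s p) := by
  refine diagOp_mul_hop fun Λ k hk hc => ?_
  obtain ⟨h1, h2⟩ := D.inter_of_cF_ne_zero hk hc
  have e : Λ + (-1 : ℤ) • dl (p' + 1) k = Λ - dl (p' + 1) k := by simp [sub_eq_add_neg]
  have := kw_add p p' k hk Λ (-1)
  rw [e] at this ⊢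
  rw [if_pos h1, if_pos h2, ← zpow_add₀ D.q_ne, this]
  ring_nf

/-- The diagonal operator `q^{s ℓ}` with `ℓ` the entry of row `1`. -/
def kap (s c : ℤ) : Module.End K (Arr →₀ K) := diagOp fun Λ => D.q ^ (s * Λ 1 0 + c)

lemma kap_mul_E (ε : ℕ → ℤ) (s c : ℤ) (p : ℕ) :
    D.kap s c * D.E ε p = (if p = 0 then D.q ^ s else 1) • (D.E ε p * D.kap s c) := by
  refine diagOp_mul_hop fun Λ k hk _ => ?_
  rw [one_smul, Pi.add_apply, Pi.add_apply]
  split_ifs with h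
  · subst h
    obtain rfl : k = 0 := by omega
    rw [dl_self, ← zpow_add₀ D.q_ne]
    ring_nf
  · rw [dl_row_ne (by omega), add_zero, one_mul]

lemma kap_mul_F (ε : ℕ → ℤ) (s c : ℤ) (p : ℕ) :
    D.kap s c * D.F ε p = (if p = 0 then D.q ^ (-s) else 1) • (D.F ε p * D.kap s c) := by
  refine diagOp_mul_hop fun Λ k hk _ => ?_
  rw [Pi.add_apply, Pi.add_apply, Pi.smul_apply, Pi.smul_apply]
  split_ifs with h
  · subst h
    obtain rfl : k = 0 := by omega
    rw [dl_self, ← zpow_add₀ D.q_ne]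
    simp only [smul_eq_mul]
    ring_nf
  · rw [dl_row_ne (by omega), smul_zero, add_zero, one_mul]

lemma E_zero_mul_kap (ε : ℕ → ℤ) : D.E ε 0 * D.kap (-ε 0) 0 = D.E 0 0 := by
  refine end_ext fun Λ => ?_
  rw [Module.End.mul_apply, kap, diagOp_single, map_smul, E_single, E_single, Finset.sum_range_one,
    Finset.sum_range_one, smul_smul]
  congr 1
  unfold cE
  split_ifs
  · simp only [zero_add, Pi.zero_apply, zero_mul, zpow_zero, mul_one, add_zero]
    rw [mul_left_comm, ← zpow_add₀ D.q_ne]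
    ring_nf
    simp
  · ring

lemma F_zero_mul_kap (ε : ℕ → ℤ) : D.F ε 0 * D.kap (ε 0) (-ε 0) = D.F 0 0 := by
  refine end_ext fun Λ => ?_
  rw [Module.End.mul_apply, kap, diagOp_single, map_smul, F_single, F_single, Finset.sum_range_one,
    Finset.sum_range_one, smul_smul]
  congr 1
  unfold cF
  split_ifs
  · simp only [zero_add, Pi.zero_apply, zero_mul, neg_zero, zpow_zero, mul_one, Pi.sub_apply, dl_self]
    rw [mul_left_comm, ← zpow_add₀ D.q_ne]
    ring_nf
    simp
  · ring

end QSqrt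

end QuantumAInf

end

noncomputable section

namespace QuantumAInf

namespace QSqrt

variable {K : Type*} [Field K] (D : QSqrt K)

/-! ### The generators on arrays and their relations -/

/-- An alternating gauge that is `-1` at `p`. -/
def gauge (p n : ℕ) : ℤ := if Even (n + p) then -1 else 1

lemma gauge_self (p : ℕ) : gauge p p = -1 := by simp [gauge]

lemma gauge_succ (p n : ℕ) : gauge p (n + 1) = -gauge p n := by
  unfold gauge
  have h : Even (n + 1 + p) ↔ ¬ Even (n + p) := by
    rw [add_right_comm, Nat.even_add_one]
  by_cases h1 : Even (n + p) <;> simp [h, h1]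

lemma gauge_sq (p n : ℕ) : gauge p n = 1 ∨ gauge p n = -1 := by
  unfold gauge
  split_ifs <;> simp

lemma X_eq (p : ℕ) : D.X p = qc D.q (D.E (gauge p) p) (D.E (gauge p) (p + 1)) := by
  rw [D.X_eq_qc (gauge_sq p p) (gauge_succ p p), gauge_self, neg_neg, zpow_one]

lemma X_succ_eq (p : ℕ) :
    D.X (p + 1) = qc D.q⁻¹ (D.E (gauge p) (p + 1)) (D.E (gauge p) (p + 2)) := by
  rw [D.X_eq_qc (gauge_sq p (p + 1)) (gauge_succ p (p + 1)), gauge_succ, gauge_self, neg_neg,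
    zpow_neg, zpow_one]

lemma Y_eq (p : ℕ) : D.Y p = qc D.q⁻¹ (D.F (gauge p) (p + 1)) (D.F (gauge p) p) := by
  rw [D.Y_eq_qc (gauge_sq p p) (gauge_succ p p), gauge_self, zpow_neg, zpow_one]

lemma Y_succ_eq (p : ℕ) :
    D.Y (p + 1) = qc D.q (D.F (gauge p) (p + 2)) (D.F (gauge p) (p + 1)) := by
  rw [D.Y_eq_qc (gauge_sq p (p + 1)) (gauge_succ p (p + 1)), gauge_succ, gauge_self, neg_neg,
    zpow_one]

lemma coeff_relation : (D.q - D.q⁻¹)⁻¹ * (D.q ^ 2 - 1) = D.q := by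
  have h := D.q_sub_ne
  have hq := D.q_ne
  rw [inv_mul_eq_iff_eq_mul₀ h]
  field_simp

lemma q_add_inv_ne : D.q + D.q⁻¹ ≠ 0 := by
  have h := D.pow_ne 2 two_ne_zero
  intro h1
  apply h
  have hq := D.q_ne
  have e : ∀ x : K, x ^ (2 : ℤ) = x * x := fun x => by rw [zpow_ofNat]; ring
  rw [zpow_neg, e, mul_inv]
  linear_combination (D.q - D.q⁻¹) * h1

lemma E_congr {ε ε' : ℕ → ℤ} {p : ℕ} (h : ε p = ε' p) : D.E ε p = D.E ε' p := by
  unfold E cE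
  rw [h]

/-- A gauge that vanishes at `0` and alternates from `1` on. -/
def gaugeZ (n : ℕ) : ℤ := if n = 0 then 0 else gauge 1 n

lemma E_gaugeZ : D.E 0 0 = D.E gaugeZ 0 := D.E_congr rfl

lemma X_gaugeZ {p : ℕ} (hp : p ≠ 0) :
    D.X p = qc (D.q ^ (-gaugeZ p)) (D.E gaugeZ p) (D.E gaugeZ (p + 1)) :=
  D.X_eq_qc (by simp only [gaugeZ, hp, if_false]; exact gauge_sq 1 p)
    (by simp only [gaugeZ, hp, if_false, Nat.succ_ne_zero]; exact gauge_succ 1 p)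

lemma Y_gaugeZ {p : ℕ} (hp : p ≠ 0) :
    D.Y p = qc (D.q ^ gaugeZ p) (D.F gaugeZ (p + 1)) (D.F gaugeZ p) :=
  D.Y_eq_qc (by simp only [gaugeZ, hp, if_false]; exact gauge_sq 1 p)
    (by simp only [gaugeZ, hp, if_false, Nat.succ_ne_zero]; exact gauge_succ 1 p)

lemma comm_qc {A : Type*} [Ring A] [Algebra K A] {r : K} {x y z : A} (h1 : x * y = y * x)
    (h2 : x * z = z * x) : x * qc r y z = qc r y z * x :=
  ((Commute.mul_right h1 h2).sub_right ((Commute.mul_right h2 h1).smul_right r)).eq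

/-- The operator that raises the entry of row `1` (for `s = 0`), or entries of the rows `s` and
`s + 1`. -/
def up : ℕ → Module.End K (Arr →₀ K)
  | 0 => D.E 0 0
  | p + 1 => D.X p

/-- The transpose of `up s`. -/
def dn : ℕ → Module.End K (Arr →₀ K)
  | 0 => D.F 0 0
  | p + 1 => D.Y p

lemma isAdj_up_dn (s : ℕ) : IsAdj (D.up s) (D.dn s) := by
  cases s with
  | zero =>
    have := D.isAdj_E_F 0 0
    rwa [neg_zero] at this
  | succ p => exact D.isAdj_X_Y p

lemma isAdj_dn_up (s : ℕ) : IsAdj (D.dn s) (D.up s) := fun x y => by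
  rw [pair_comm, ← D.isAdj_up_dn, pair_comm]

lemma up_dn_comm_of_lt {s s' : ℕ} (h : s < s') (h' : s' ≠ 1) :
    D.up s * D.dn s' = D.dn s' * D.up s := by
  obtain ⟨p', rfl⟩ : ∃ p', s' = p' + 1 := ⟨s' - 1, by omega⟩
  rw [show D.dn (p' + 1) = D.Y p' from rfl]
  cases s with
  | zero =>
    rw [show D.up 0 = D.E 0 0 from rfl, D.Y_gaugeZ (by omega), E_gaugeZ]
    exact comm_qc (D.E_mul_F_of_ne _ (by omega)) (D.E_mul_F_of_ne _ (by omega))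
  | succ p =>
    rw [show D.up (p + 1) = D.X p from rfl]
    by_cases hp : p' = p + 1
    · subst hp
      rw [X_eq, Y_succ_eq]
      refine qc_comm_lower D.coeff_relation D.q_ne (D.E_mul_F_self _ _)
        (D.E_mul_F_of_ne _ (by omega)) (D.E_mul_F_of_ne _ (by omega)) (D.E_mul_F_of_ne _ (by omega))
        ?_ ?_ ?_
      · rw [Kop_mul_E]; simp [cartan]
      · rw [Kop_mul_E]; simp [cartan]
      · rw [Kop_mul_F]; simp [cartan]
    · rw [D.X_eq p, D.Y_eq_qc (ε := gauge p) (p := p') (gauge_sq _ _) (gauge_succ _ _)]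
      exact qc_comm_of_comm (D.E_mul_F_of_ne _ (by omega)) (D.E_mul_F_of_ne _ (by omega))
        (D.E_mul_F_of_ne _ (by omega)) (D.E_mul_F_of_ne _ (by omega))

lemma up_dn_comm {s s' : ℕ} (h : s ≠ s') (h' : 1 < s + s') :
    D.up s * D.dn s' = D.dn s' * D.up s := by
  rcases lt_or_gt_of_ne h with h1 | h1
  · exact D.up_dn_comm_of_lt h1 (by omega)
  · exact (D.isAdj_dn_up s).comm (D.isAdj_up_dn s') (D.up_dn_comm_of_lt h1 (by omega)).symm

variable [CharZero K]

lemma serreL_E_succ (ε : ℕ → ℤ) (p : ℕ) : serreL D.q (D.E ε p) (D.E ε (p + 1)) = 0 :=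
  D.serre_lower ε p

lemma serreL_succ_E (ε : ℕ → ℤ) (p : ℕ) : serreL D.q (D.E ε (p + 1)) (D.E ε p) = 0 :=
  D.serre_upper ε p

lemma up_comm_of_lt {s s' : ℕ} (h : s < s') (h' : s' ≠ s + 2) :
    D.up s * D.up s' = D.up s' * D.up s := by
  obtain ⟨p', rfl⟩ : ∃ p', s' = p' + 1 := ⟨s' - 1, by omega⟩
  rw [show D.up (p' + 1) = D.X p' from rfl]
  cases s with
  | zero =>
    rw [show D.up 0 = D.E 0 0 from rfl]
    by_cases hp : p' = 0
    · subst hp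
      rw [X_eq, ← D.E_zero_mul_kap (gauge 0), gauge_self]
      refine (qc_comm_twist D.q_ne (D.serreL_E_succ _ 0) ?_ ?_).symm
      · rw [kap_mul_E, if_pos rfl, neg_neg, zpow_one]
      · rw [kap_mul_E, if_neg (by omega), one_smul]
    · rw [D.X_gaugeZ hp, E_gaugeZ]
      exact comm_qc (D.E_mul_E_of_far _ (by omega)) (D.E_mul_E_of_far _ (by omega))
  | succ p =>
    rw [show D.up (p + 1) = D.X p from rfl]
    by_cases hp : p' = p + 1
    · subst hp
      rw [X_eq, X_succ_eq]
      exact qc_comm_qc D.q_ne D.q_add_inv_ne (D.serreL_succ_E _ _) (D.serreL_E_succ _ _)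
        (D.E_mul_E_of_far _ (by omega))
    · rw [D.X_eq p, D.X_eq_qc (ε := gauge p) (p := p') (gauge_sq _ _) (gauge_succ _ _)]
      exact qc_comm_of_comm (D.E_mul_E_of_far _ (by omega)) (D.E_mul_E_of_far _ (by omega))
        (D.E_mul_E_of_far _ (by omega)) (D.E_mul_E_of_far _ (by omega))

lemma up_comm {s s' : ℕ} (h : s' ≠ s + 2) (h' : s ≠ s' + 2) :
    D.up s * D.up s' = D.up s' * D.up s := by
  rcases lt_trichotomy s s' with h1 | rfl | h1
  · exact D.up_comm_of_lt h1 h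
  · rfl
  · exact (D.up_comm_of_lt h1 h').symm

lemma dn_comm {s s' : ℕ} (h : s' ≠ s + 2) (h' : s ≠ s' + 2) :
    D.dn s * D.dn s' = D.dn s' * D.dn s :=
  (D.isAdj_up_dn s).comm (D.isAdj_up_dn s') (D.up_comm h h')

lemma serreL_up_add_two (s : ℕ) :
    serreL D.q (D.up s) (D.up (s + 2)) = 0 ∧ serreL D.q (D.up (s + 2)) (D.up s) = 0 := by
  rw [show D.up (s + 2) = D.X (s + 1) from rfl]
  cases s with
  | zero =>
    rw [show D.up 0 = D.E 0 0 from rfl]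
    have hg : gaugeZ 1 = -1 := gauge_self 1
    have h1 := D.X_gaugeZ one_ne_zero
    rw [hg, neg_neg, zpow_one] at h1
    rw [zero_add, h1, E_gaugeZ]
    exact ⟨serreL_qc_target _ (D.serreL_E_succ _ _) (D.E_mul_E_of_far _ (by omega)),
      serreL_qc_right D.q_ne D.q_add_inv_ne (D.serreL_succ_E _ _) (D.serreL_E_succ _ _)
        (D.serreL_succ_E _ _) (D.E_mul_E_of_far _ (by omega))⟩
  | succ p =>
    rw [show D.up (p + 1) = D.X p from rfl, X_eq, D.X_eq_qc (ε := gauge p) (p := p + 2)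
      (gauge_sq _ _) (gauge_succ _ _)]
    have hg : gauge p (p + 2) = -1 := by rw [gauge_succ, gauge_succ, gauge_self]; rfl
    rw [hg, neg_neg, zpow_one]
    have f1 := D.E_mul_E_of_far (gauge p) (by omega : p + 2 ≤ p + 2)
    have f2 := D.E_mul_E_of_far (gauge p) (by omega : p + 2 ≤ p + 3)
    have f3 := D.E_mul_E_of_far (gauge p) (by omega : p + 1 + 2 ≤ p + 3)
    have s1 := D.serreL_E_succ (gauge p)
    have s2 := D.serreL_succ_E (gauge p)
    refine ⟨serreL_qc_target _ (serreL_qc_left D.q_ne D.q_add_inv_ne (s1 _) (s2 _) (s1 _) f1)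
      ?_, serreL_qc_target' _ (serreL_qc_right D.q_ne D.q_add_inv_ne (s2 _) (s1 _) (s2 _) f3) ?_⟩
    · exact (comm_qc f2.symm f3.symm).symm
    · exact (comm_qc f1 f2).symm

lemma serreL_up {s s' : ℕ} (h : s' = s + 2 ∨ s = s' + 2) : serreL D.q (D.up s) (D.up s') = 0 := by
  rcases h with rfl | rfl
  · exact (D.serreL_up_add_two s).1
  · exact (D.serreL_up_add_two s').2

lemma serreL_dn {s s' : ℕ} (h : s' = s + 2 ∨ s = s' + 2) : serreL D.q (D.dn s) (D.dn s') = 0 :=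
  (D.isAdj_up_dn s).serreL (D.isAdj_up_dn s') (D.serreL_up h)

lemma serreL_dn_up : serreL D.q (D.dn 0) (D.up 1) = 0 ∧ serreL D.q (D.up 1) (D.dn 0) = 0 := by
  rw [show D.up 1 = D.X 0 from rfl, show D.dn 0 = D.F 0 0 from rfl, X_eq,
    ← D.F_zero_mul_kap (gauge 0), gauge_self]
  refine serreL_twist D.coeff_relation D.q_ne (k₁ := D.Kop 1 0) (k₁' := D.Kop (-1) 0)
    (D.serreL_succ_E _ _) (D.E_mul_F_self _ _) (D.E_mul_F_of_ne _ (by omega)) ?_ ?_ ?_ ?_ ?_ ?_ ?_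
    (diagOp_mul_comm _ _)
  · rw [Kop_mul_E]; simp [cartan]
  · rw [Kop_mul_E]; simp [cartan]
  · rw [Kop_mul_E]; simp [cartan, zpow_ofNat]
  · rw [Kop_mul_F]; simp [cartan, zpow_ofNat]
  · rw [kap_mul_E, if_pos rfl, zpow_neg, zpow_one]
  · rw [kap_mul_F, if_pos rfl, neg_neg, zpow_one]
  · rw [kap_mul_E, if_neg (by omega), one_smul]

lemma serreL_up_dn : serreL D.q (D.up 0) (D.dn 1) = 0 ∧ serreL D.q (D.dn 1) (D.up 0) = 0 :=
  ⟨(D.isAdj_dn_up 0).serreL (D.isAdj_up_dn 1) D.serreL_dn_up.1,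
    (D.isAdj_up_dn 1).serreL (D.isAdj_dn_up 0) D.serreL_dn_up.2⟩

/-- The weight occurring in the commutator of `up s` and `dn s`. -/
def wt : ℕ → Arr → ℤ
  | 0, Λ => 2 * rsum 1 Λ - rsum 2 Λ
  | p + 1, Λ => rsum (p + 1) Λ + rsum (p + 2) Λ - rsum p Λ - rsum (p + 3) Λ

open Classical in
lemma up_dn_self (s : ℕ) : D.up s * D.dn s - D.dn s * D.up s =
    diagOp fun Λ => if Inter Λ then D.br (wt s Λ) else 0 := by
  cases s with
  | zero =>
    refine (D.E_mul_F_self 0 0).trans (end_ext fun Λ => ?_)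
    rw [LinearMap.smul_apply, LinearMap.sub_apply, Kop, Kop, diagOp_single, diagOp_single,
      diagOp_single, ← sub_smul, smul_smul]
    congr 1
    split_ifs
    · have : kw 0 Λ = wt 0 Λ := by simp [kw, wt, rsum]
      rw [this, br, one_mul, neg_one_mul, div_eq_inv_mul]
    · ring
  | succ p =>
    rw [show D.up (p + 1) = D.X p from rfl, show D.dn (p + 1) = D.Y p from rfl, X_eq, Y_eq,
      qc_comm_lower_self D.coeff_relation D.q_ne (D.E_mul_F_self _ p) (D.E_mul_F_self _ (p + 1))
      (D.E_mul_F_of_ne _ (by omega)) (D.E_mul_F_of_ne _ (by omega)) ?_ ?_ ?_ ?_ ?_ ?_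
      (diagOp_mul_comm _ _) (diagOp_mul_comm _ _)]
    · simp only [Kop]
      rw [diagOp_mul, diagOp_mul]
      refine end_ext fun Λ => ?_
      rw [LinearMap.smul_apply, LinearMap.sub_apply, diagOp_single, diagOp_single,
        diagOp_single, ← sub_smul, smul_smul]
      congr 1
      split_ifs
      · have : wt (p + 1) Λ = kw p Λ + kw (p + 1) Λ := by
          simp only [kw, wt]
          ring
        rw [this, br, ← zpow_add₀ D.q_ne, ← zpow_add₀ D.q_ne, one_mul, one_mul, neg_one_mul,
          neg_one_mul, ← neg_add, div_eq_inv_mul]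
      · ring
    · rw [Kop_mul_E]; simp [cartan]
    · rw [Kop_mul_E]; simp [cartan]
    · rw [Kop_mul_E]; simp [cartan]
    · rw [Kop_mul_E]; simp [cartan]
    · rw [Kop_mul_F]; simp [cartan]
    · rw [Kop_mul_F]; simp [cartan]

end QSqrt

end QuantumAInf

end

noncomputable section

namespace QuantumAInf

open PowerSeries

open scoped ComplexOrder

/-! ### Quantum integers in `ℂ[[h]]` -/

lemma coeff_qpow_C {A : Type*} [Ring A] [Algebra ℂ A] (a : A) (n : ℕ) :
    PowerSeries.coeff n (qpow (PowerSeries.C a)) = ((2 : ℂ) ^ n * (n.factorial : ℂ))⁻¹ • a ^ n := by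
  have h : ∀ m, PowerSeries.coeff n ((PowerSeries.X * PowerSeries.C a) ^ m) =
      if m = n then a ^ n else 0 := by
    intro m
    rw [(PowerSeries.commute_X (PowerSeries.C a)).symm.mul_pow, ← map_pow, PowerSeries.coeff_X_pow_mul',
      PowerSeries.coeff_C]
    split_ifs with h1 h2 h3 h3
    · rw [h3]
    · omega
    · omega
    · rfl
    · omega
    · rfl
  rw [qpow, PowerSeries.coeff_mk, Finset.sum_eq_single n]
  · rw [h, if_pos rfl]
  · intro m _ hm
    rw [h, if_neg hm, smul_zero]
  · intro h1
    simp at h1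

lemma qpow_C (a : ℂ) : qpow (PowerSeries.C a : R) = PowerSeries.rescale (a / 2) (PowerSeries.exp ℂ) := by
  ext n
  rw [coeff_qpow_C, PowerSeries.coeff_rescale, PowerSeries.coeff_exp, smul_eq_mul, div_pow]
  simp
  ring

lemma qpow_C_add (a b : ℂ) : qpow (PowerSeries.C (a + b) : R) = qpow (PowerSeries.C a) * qpow (PowerSeries.C b) := by
  rw [qpow_C, qpow_C, qpow_C, PowerSeries.exp_mul_exp_eq_exp_add, add_div]

lemma constantCoeff_qpow_C (a : ℂ) : PowerSeries.constantCoeff (qpow (PowerSeries.C a : R)) = 1 := by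
  rw [qpow_C, ← PowerSeries.coeff_zero_eq_constantCoeff_apply, PowerSeries.coeff_rescale]
  simp

/-- The power series `(q - q⁻¹) / h`. -/
def den : R := PowerSeries.mk fun n => PowerSeries.coeff (n + 1) (qpow (1 : R) - qpow (-1 : R))

lemma X_mul_mk_coeff (f : R) (h : PowerSeries.constantCoeff f = 0) :
    PowerSeries.X * (PowerSeries.mk fun n => PowerSeries.coeff (n + 1) f) = f := by
  have := PowerSeries.eq_X_mul_shift_add_const f
  rw [h, map_zero, add_zero] at this
  exact this.symm

lemma constantCoeff_qpow_sub (a : ℂ) :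
    PowerSeries.constantCoeff (qpow (PowerSeries.C a : R) - qpow (-PowerSeries.C a : R)) = 0 := by
  rw [← map_neg, map_sub, constantCoeff_qpow_C, constantCoeff_qpow_C, sub_self]

lemma X_mul_den : PowerSeries.X * den = qpow (1 : R) - qpow (-1 : R) := by
  refine X_mul_mk_coeff _ ?_
  have := constantCoeff_qpow_sub 1
  rwa [map_one] at this

lemma constantCoeff_den : PowerSeries.constantCoeff den = 1 := by
  rw [den, ← PowerSeries.coeff_zero_eq_constantCoeff_apply, PowerSeries.coeff_mk, map_sub,
    show (1 : R) = PowerSeries.C 1 from (map_one _).symm, ← map_neg, coeff_qpow_C, coeff_qpow_C]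
  norm_num

lemma den_mul_inv : den * den⁻¹ = 1 :=
  PowerSeries.mul_inv_cancel _ (by rw [constantCoeff_den]; exact one_ne_zero)

lemma qbr_C_mul (a : ℂ) : qbr (PowerSeries.C a : R) * (qpow (1 : R) - qpow (-1 : R)) =
    qpow (PowerSeries.C a : R) - qpow (-PowerSeries.C a : R) := by
  have h : qbr (PowerSeries.C a : R) = (PowerSeries.mk fun n => PowerSeries.coeff (n + 1)
      (qpow (PowerSeries.C a : R) - qpow (-PowerSeries.C a : R))) * den⁻¹ := by
    rw [qbr, show algebraMap ℂ ℂ = RingHom.id ℂ from rfl, PowerSeries.map_id]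
    rfl
  have h1 := X_mul_mk_coeff _ (constantCoeff_qpow_sub a)
  rw [h, ← X_mul_den]
  linear_combination (PowerSeries.mk fun n => PowerSeries.coeff (n + 1)
      (qpow (PowerSeries.C a : R) - qpow (-PowerSeries.C a : R))) * X * den_mul_inv + h1

lemma constantCoeff_qbr_C (a : ℂ) : PowerSeries.constantCoeff (qbr (PowerSeries.C a : R)) = a := by
  rw [qbr, map_mul, ← PowerSeries.coeff_zero_eq_constantCoeff_apply, PowerSeries.coeff_mk, map_sub,
    ← map_neg, coeff_qpow_C, coeff_qpow_C, show algebraMap ℂ ℂ = RingHom.id ℂ from rfl,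
    PowerSeries.map_id]
  have : PowerSeries.constantCoeff (den⁻¹) = 1 := by
    rw [PowerSeries.constantCoeff_inv, constantCoeff_den, inv_one]
  erw [this]
  simp
  ring

/-! ### Square roots of power series -/

/-- The constant term is a positive real number. -/
def Pos (y : R) : Prop := 0 < PowerSeries.constantCoeff y

lemma Pos.mul {y z : R} (hy : Pos y) (hz : Pos z) : Pos (y * z) := by
  unfold Pos at *
  rw [map_mul]
  exact mul_pos hy hz

lemma Pos.one : Pos 1 := by
  unfold Pos
  rw [map_one]
  exact one_pos

lemma Pos.inv {y : R} (hy : Pos y) : Pos y⁻¹ := by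
  unfold Pos at *
  rw [PowerSeries.constantCoeff_inv]
  exact inv_pos.mpr hy

lemma Pos.re {y : R} (hy : Pos y) : 0 < (PowerSeries.constantCoeff y).re :=
  (Complex.pos_iff.mp hy).1

lemma exists_sq_eq_one_add {g : R} (hg : PowerSeries.constantCoeff g = 0) :
    ∃ y : R, y * y = 1 + g := by
  have hs : PowerSeries.HasSubst g := PowerSeries.HasSubst.of_constantCoeff_zero' hg
  refine ⟨PowerSeries.subst g (PowerSeries.binomialSeries ℂ (1 / 2 : ℚ)), ?_⟩
  rw [← PowerSeries.subst_mul hs, ← PowerSeries.binomialSeries_add]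
  have h1 : PowerSeries.binomialSeries ℂ (1 / 2 + 1 / 2 : ℚ) = 1 + PowerSeries.X := by
    rw [add_halves]
    have := PowerSeries.binomialSeries_nat (R := ℚ) (A := ℂ) 1
    simpa using this
  rw [h1, PowerSeries.subst_add hs, PowerSeries.subst_X hs, ← PowerSeries.coe_substAlgHom hs, map_one]

lemma Pos.exists_sqrt {y : R} (hy : Pos y) : ∃ x : R, Pos x ∧ x * x = y := by
  obtain ⟨r, hr, hc⟩ : ∃ r : ℝ, 0 < r ∧ PowerSeries.constantCoeff y = r := by
    have h := Complex.pos_iff.mp hy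
    exact ⟨_, h.1, Complex.ext rfl (by simpa using h.2.symm)⟩
  have hr' : (r : ℂ) ≠ 0 := by exact_mod_cast hr.ne'
  obtain ⟨x, hx⟩ := exists_sq_eq_one_add (g := PowerSeries.C ((r : ℂ)⁻¹) * y - 1) (by
    simp [hc, hr'])
  have hc2 : PowerSeries.constantCoeff x * PowerSeries.constantCoeff x = 1 := by
    rw [← map_mul, hx]
    simp [hc, hr']
  have hs : ((√r : ℝ) : ℂ) * ((√r : ℝ) : ℂ) = r := by
    rw [← Complex.ofReal_mul, Real.mul_self_sqrt hr.le]
  have hpos : (0 : ℂ) < ((√r : ℝ) : ℂ) := by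
    rw [Complex.zero_lt_real]
    exact Real.sqrt_pos.mpr hr
  have hsq : ∀ s : ℂ, s * s = 1 → (PowerSeries.C (s * (√r : ℝ)) * x) * (PowerSeries.C (s * (√r : ℝ)) * x) = y := by
    intro s hs1
    have : (PowerSeries.C (s * (√r : ℝ)) * x) * (PowerSeries.C (s * (√r : ℝ)) * x) =
        PowerSeries.C (s * (√r : ℝ) * (s * (√r : ℝ))) * (x * x) := by
      rw [map_mul PowerSeries.C (s * _)]
      ring
    rw [this, hx, mul_mul_mul_comm, hs1, hs, one_mul, add_sub_cancel, ← mul_assoc, ← map_mul,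
      mul_inv_cancel₀ hr', map_one, one_mul]
  rcases mul_self_eq_one_iff.mp hc2 with h | h
  · refine ⟨_, ?_, hsq 1 (by ring)⟩
    simp [Pos, h, hpos]
  · refine ⟨_, ?_, hsq (-1) (by ring)⟩
    simp [Pos, h, hpos]

lemma hsqrt_sq {y : R} (hy : Pos y) : hsqrt (y * y) = y := by
  have hz : ∃ x : R, x ^ 2 = y * y ∧ 0 < (PowerSeries.constantCoeff x).re := ⟨y, sq y, hy.re⟩
  rw [hsqrt, dif_pos hz]
  obtain ⟨h1, h2⟩ := hz.choose_spec
  rw [sq] at h1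
  rcases mul_self_eq_mul_self_iff.mp h1 with h | h
  · exact h
  · rw [h] at h2
    have := hy.re
    simp at h2
    linarith

/-! ### The quantum integers as a field datum -/

/-- The field of fractions of `ℂ[[h]]`. -/
abbrev Kh : Type := FractionRing R

/-- `[n]` as an element of `ℂ[[h]]`. -/
def qint (n : ℤ) : R := qbr (PowerSeries.C (n : ℂ) : R)

lemma constantCoeff_qint (n : ℤ) : PowerSeries.constantCoeff (qint n) = n := constantCoeff_qbr_C _

lemma qint_pos {n : ℤ} (hn : 0 < n) : Pos (qint n) := by
  rw [Pos, constantCoeff_qint]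
  exact_mod_cast hn

/-- `q` as an element of the field of fractions. -/
def qK : Kh := algebraMap R Kh (qpow 1)

lemma algebraMap_qpow (n : ℤ) : algebraMap R Kh (qpow (PowerSeries.C (n : ℂ))) = qK ^ n := by
  have h0 : qpow (PowerSeries.C (0 : ℂ) : R) = 1 := by
    rw [qpow_C]
    simp
  have h1 : qpow (1 : R) = qpow (PowerSeries.C (1 : ℂ)) := by rw [map_one]
  have hq : qK ≠ 0 := by
    rw [qK, Ne, FaithfulSMul.algebraMap_eq_zero_iff, h1]
    intro h
    have := constantCoeff_qpow_C 1
    rw [h] at this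
    simp at this
  induction n using Int.induction_on with
  | zero => rw [Int.cast_zero, h0, map_one, zpow_zero]
  | succ n ih =>
    rw [zpow_add_one₀ hq, ← ih, qK, h1, ← map_mul, ← qpow_C_add]
    push_cast
    rfl
  | pred n ih =>
    rw [zpow_sub_one₀ hq, eq_mul_inv_iff_mul_eq₀ hq, ← ih]
    rw [qK, h1, ← map_mul, ← qpow_C_add]
    push_cast
    ring_nf

lemma qK_ne : qK ≠ 0 := by
  have := algebraMap_qpow (-1)
  intro h
  rw [h, zpow_neg_one, inv_zero, FaithfulSMul.algebraMap_eq_zero_iff] at this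
  have h1 := constantCoeff_qpow_C ((-1 : ℤ) : ℂ)
  rw [this] at h1
  simp at h1

lemma qK_sub : algebraMap R Kh (PowerSeries.X * den) = qK - qK⁻¹ := by
  have h1 := algebraMap_qpow 1
  have h2 := algebraMap_qpow (-1)
  rw [X_mul_den, map_sub, ← zpow_neg_one, ← h2]
  simp [qK]

lemma qK_sub_ne : qK - qK⁻¹ ≠ 0 := by
  rw [← qK_sub, Ne, FaithfulSMul.algebraMap_eq_zero_iff]
  refine mul_ne_zero PowerSeries.X_ne_zero fun h => ?_
  have := constantCoeff_den
  rw [h] at this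
  simp at this

lemma algebraMap_qint (n : ℤ) : algebraMap R Kh (qint n) = (qK ^ n - qK ^ (-n)) / (qK - qK⁻¹) := by
  rw [eq_div_iff qK_sub_ne, ← qK_sub, X_mul_den, ← map_mul, qint, qbr_C_mul, map_sub,
    algebraMap_qpow, ← map_neg, ← Int.cast_neg, algebraMap_qpow]

/-- A square root of `[n]` with positive constant term. -/
def sqrtQint (n : ℕ) : R := if h : 0 < n then (qint_pos (Int.natCast_pos.mpr h)).exists_sqrt.choose else 0

lemma sqrtQint_pos {n : ℕ} (hn : 0 < n) : Pos (sqrtQint n) := by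
  rw [sqrtQint, dif_pos hn]
  exact (qint_pos (Int.natCast_pos.mpr hn)).exists_sqrt.choose_spec.1

lemma sqrtQint_sq (n : ℕ) : sqrtQint n * sqrtQint n = qint n := by
  rcases Nat.eq_zero_or_pos n with rfl | hn
  · have : algebraMap R Kh (qint 0) = 0 := by rw [algebraMap_qint]; simp
    rw [FaithfulSMul.algebraMap_eq_zero_iff] at this
    simp [sqrtQint, this]
  · rw [sqrtQint, dif_pos hn]
    exact (qint_pos (Int.natCast_pos.mpr hn)).exists_sqrt.choose_spec.2

/-- Quantum integers and their square roots in the field of fractions of `ℂ[[h]]`. -/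
def QD : QSqrt Kh where
  q := qK
  q_ne := qK_ne
  pow_ne n hn := by
    intro h
    have h1 := algebraMap_qint n
    rw [h, sub_self, zero_div, FaithfulSMul.algebraMap_eq_zero_iff] at h1
    have h2 := constantCoeff_qint n
    rw [h1, map_zero] at h2
    exact hn (by exact_mod_cast h2.symm)
  σ n := algebraMap R Kh (sqrtQint n.natAbs)
  σ_neg n := by rw [Int.natAbs_neg]
  σ_sq n := by
    rw [← map_mul, sqrtQint_sq, Int.natCast_natAbs, algebraMap_qint]

lemma QD_br (n : ℤ) : QD.br n = algebraMap R Kh (qint n) := (algebraMap_qint n).symm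

/-- The image of a power series with positive constant term. -/
def PosK (x : Kh) : Prop := ∃ y : R, Pos y ∧ algebraMap R Kh y = x

lemma PosK.mul {x y : Kh} (hx : PosK x) (hy : PosK y) : PosK (x * y) := by
  obtain ⟨a, ha, rfl⟩ := hx
  obtain ⟨b, hb, rfl⟩ := hy
  exact ⟨a * b, ha.mul hb, map_mul _ _ _⟩

lemma PosK.inv {x : Kh} (hx : PosK x) : PosK x⁻¹ := by
  obtain ⟨a, ha, rfl⟩ := hx
  refine ⟨a⁻¹, ha.inv, ?_⟩
  rw [eq_comm, inv_eq_iff_eq_inv, eq_comm, inv_eq_iff_eq_inv]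
  refine eq_inv_of_mul_eq_one_left ?_
  rw [← map_mul, PowerSeries.inv_mul_cancel _ (ne_of_gt ha), map_one]

lemma PosK.prod {ι : Type*} (s : Finset ι) {f : ι → Kh} (h : ∀ i ∈ s, PosK (f i)) :
    PosK (∏ i ∈ s, f i) := by
  classical
  induction s using Finset.induction_on with
  | empty => exact ⟨1, Pos.one, by simp⟩
  | insert i s hi ih =>
    rw [Finset.prod_insert hi]
    exact (h i (by simp)).mul (ih fun j hj => h j (by simp [hj]))

lemma posK_σ {n : ℤ} (hn : n ≠ 0) : PosK (QD.σ n) :=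
  ⟨_, sqrtQint_pos (Int.natAbs_pos.mpr hn), rfl⟩

lemma hsqrt_of_posK {x : Kh} (hx : PosK x) {y : R} (h : algebraMap R Kh y = x * x) :
    algebraMap R Kh (hsqrt y) = x ∧ Pos (hsqrt y) := by
  obtain ⟨a, ha, rfl⟩ := hx
  rw [← map_mul] at h
  rw [FaithfulSMul.algebraMap_injective R Kh h, hsqrt_sq ha]
  exact ⟨rfl, ha⟩

end QuantumAInf

end

noncomputable section

namespace QuantumAInf

namespace QSqrt

/-! ### The Chevalley generators on arrays -/

/-- The number of the lower of the two rows that `eᵢ` and `fᵢ` change. -/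
def level (i : ℤ) : ℕ := if 0 ≤ i then 2 * i.toNat + 1 else 2 * (-i - 1).toNat

lemma level_natCast (i : ℕ) : level i = 2 * i + 1 := by simp [level]

lemma level_neg (i : ℕ) : level (-(i : ℤ) - 1) = 2 * i := by
  rw [level, if_neg (by omega)]
  omega

/-- The number of the upper of the two rows whose sums enter `hᵢ`. -/
def hrow (i : ℤ) : ℕ := 2 * i.natAbs + (theta i).toNat

lemma hrow_natCast (i : ℕ) : hrow i = 2 * i + 1 := by simp [hrow, theta]

lemma hrow_neg (i : ℕ) : hrow (-(i : ℤ) - 1) = 2 * i + 2 := by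
  rw [hrow, theta, if_neg (by omega)]
  simp
  omega

lemma int_cases (i : ℤ) : (∃ n : ℕ, i = n) ∨ ∃ n : ℕ, i = -(n : ℤ) - 1 := by
  rcases le_or_gt 0 i with h | h
  · exact Or.inl ⟨i.toNat, by omega⟩
  · exact Or.inr ⟨(-i - 1).toNat, by omega⟩

/-- The eigenvalue of `hᵢ` on an array when `c` acts by `c₀`. -/
def hval (c₀ : ℤ) (i : ℤ) (Λ : Arr) : ℤ :=
  rsum (hrow i) Λ - rsum (hrow i - 1) Λ - c₀ * theta (-i)

variable {K : Type*} [Field K] (D : QSqrt K)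

lemma inter_of_z_ne_zero {p k a : ℕ} {Λ : Arr} (h : Inter Λ) (hk : k < p + 1) (ha : a < p + 2)
    (hz : D.z p k a Λ ≠ 0) : Inter (Λ + dl (p + 1) k + dl (p + 2) a) := by
  have hU : D.wU p k a Λ ≠ 0 := fun h0 => hz (by rw [z, h0]; ring)
  have hD : D.wD p k a Λ ≠ 0 := fun h0 => hz (by rw [z, h0]; ring)
  by_cases hx : Λ (p + 2) a - Λ (p + 1) k = 0
  · have h1 : Inter (Λ + dl (p + 2) a) := by
      refine D.inter_add (p := p + 1) h ?_ ha
      rw [D.w_eq_wD hk]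
      exact mul_ne_zero (D.σ_ne_zero (by omega)) hD
    rw [add_right_comm]
    refine D.inter_add h1 ?_ hk
    rw [D.w_eq_wU ha, wU_add]
    refine mul_ne_zero (D.σ_ne_zero ?_) hU
    simp only [Pi.add_apply, dl_self, dl_add_two_succ]
    omega
  · have h1 : Inter (Λ + dl (p + 1) k) := by
      refine D.inter_add h ?_ hk
      rw [D.w_eq_wU ha]
      exact mul_ne_zero (D.σ_ne_zero hx) hU
    refine D.inter_add (p := p + 1) h1 ?_ ha
    rw [D.w_eq_wD hk, wD_add]
    refine mul_ne_zero (D.σ_ne_zero ?_) hD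
    simp only [Pi.add_apply, dl_self, dl_succ_add_two]
    omega

/-- The change of the sum of row `n` under `up s`. -/
def rowStep (s n : ℕ) : ℤ := (if n = s ∧ s ≠ 0 then 1 else 0) + if n = s + 1 then 1 else 0

lemma rsum_add_one {n m k : ℕ} (hk : k < m) (Λ : Arr) :
    rsum n (Λ + dl m k) = rsum n Λ + if n = m then 1 else 0 := by
  have := one_smul ℤ (dl m k)
  rw [← this]
  split_ifs with h
  · subst h
    exact rsum_add_dl_self hk Λ 1
  · rw [rsum_add_dl_ne h, add_zero]

/-- `up s` raises the weights given by the row sums. -/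
lemma diagOp_mul_up {f : Arr → ℤ} {δ : ℤ} {s : ℕ}
    (h : ∀ Λ Λ', (∀ n, rsum n Λ' = rsum n Λ + rowStep s n) → f Λ' = f Λ + δ) :
    diagOp (fun Λ => (f Λ : K)) * D.up s - D.up s * diagOp (fun Λ => (f Λ : K)) = δ • D.up s := by
  refine end_ext fun Λ => ?_
  rw [LinearMap.sub_apply, Module.End.mul_apply, Module.End.mul_apply, diagOp_single, map_smul,
    sub_eq_iff_eq_add, LinearMap.smul_apply, ← Int.cast_smul_eq_zsmul K, ← add_smul, ← Int.cast_add,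
    add_comm]
  cases s with
  | zero =>
    rw [show D.up 0 = D.E 0 0 from rfl, E_single, map_sum, Finset.smul_sum]
    refine Finset.sum_congr rfl fun k hk => ?_
    rw [map_smul, diagOp_single, smul_comm, h Λ]
    intro n
    rw [rsum_add_one (Finset.mem_range.mp hk)]
    simp [rowStep]
  | succ p =>
    rw [show D.up (p + 1) = D.X p from rfl, X_single, map_sum, Finset.smul_sum]
    refine Finset.sum_congr rfl fun k hk => ?_
    rw [map_sum, Finset.smul_sum]
    refine Finset.sum_congr rfl fun a ha => ?_
    rw [map_smul, diagOp_single, smul_comm, h Λ]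
    intro n
    rw [rsum_add_one (Finset.mem_range.mp ha), rsum_add_one (Finset.mem_range.mp hk)]
    simp [rowStep]
    ring

lemma isAdj_diagOp (f : Arr → K) : IsAdj (diagOp f) (diagOp f) := by
  classical
  refine isAdj_of_single fun Λ Λ' => ?_
  rw [diagOp_single, diagOp_single]
  simp only [Finsupp.smul_apply, Finsupp.single_apply, smul_eq_mul]
  by_cases h : Λ = Λ'
  · subst h; rfl
  · rw [if_neg h, if_neg (Ne.symm h)]
    ring

lemma diagOp_mul_dn {f : Arr → ℤ} {δ : ℤ} {s : ℕ}
    (h : ∀ Λ Λ', (∀ n, rsum n Λ' = rsum n Λ + rowStep s n) → f Λ' = f Λ + δ) :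
    diagOp (fun Λ => (f Λ : K)) * D.dn s - D.dn s * diagOp (fun Λ => (f Λ : K)) =
      (-δ) • D.dn s := by
  have h1 := D.diagOp_mul_up h
  have h2 := ((isAdj_diagOp (fun Λ => (f Λ : K))).mul (D.isAdj_up_dn s)).sub
    ((D.isAdj_up_dn s).mul (isAdj_diagOp (fun Λ => (f Λ : K))))
  rw [h1] at h2
  have h4 : IsAdj (δ • D.up s) (δ • D.dn s) := fun x y => by
    rw [LinearMap.smul_apply, LinearMap.smul_apply, ← Int.cast_smul_eq_zsmul K,
      ← Int.cast_smul_eq_zsmul K, pair_smul_left, pair_smul_right, D.isAdj_up_dn s]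
  refine LinearMap.ext fun x => ?_
  have h5 := LinearMap.congr_fun (h2.ext h4) x
  simp only [LinearMap.sub_apply, LinearMap.smul_apply] at h5 ⊢
  rw [neg_smul, ← h5, neg_sub]

/-- The operators of the Chevalley generators on arrays, with `c` acting by `c₀`. -/
def gop (c₀ : ℤ) : Gen → Module.End K (Arr →₀ K)
  | Gen.e i => if 0 ≤ i then D.up (level i) else D.dn (level i)
  | Gen.f i => if 0 ≤ i then D.dn (level i) else D.up (level i)
  | Gen.h i => diagOp fun Λ => (hval c₀ i Λ : K)
  | Gen.c => diagOp fun _ => (c₀ : K)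

lemma gop_e_natCast (c₀ : ℤ) (i : ℕ) : D.gop c₀ (Gen.e i) = D.up (2 * i + 1) := by
  rw [gop, if_pos (by omega), level_natCast]

lemma gop_f_natCast (c₀ : ℤ) (i : ℕ) : D.gop c₀ (Gen.f i) = D.dn (2 * i + 1) := by
  rw [gop, if_pos (by omega), level_natCast]

lemma gop_e_neg (c₀ : ℤ) (i : ℕ) : D.gop c₀ (Gen.e (-(i : ℤ) - 1)) = D.dn (2 * i) := by
  rw [gop, if_neg (by omega), level_neg]

lemma gop_f_neg (c₀ : ℤ) (i : ℕ) : D.gop c₀ (Gen.f (-(i : ℤ) - 1)) = D.up (2 * i) := by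
  rw [gop, if_neg (by omega), level_neg]

lemma gop_c_comm (c₀ : ℤ) (T : Module.End K (Arr →₀ K)) :
    D.gop c₀ Gen.c * T = T * D.gop c₀ Gen.c := by
  have : D.gop c₀ Gen.c = (c₀ : K) • (1 : Module.End K (Arr →₀ K)) := by
    refine end_ext fun Λ => ?_
    rw [gop, diagOp_single]
    rfl
  rw [this, smul_mul_assoc, mul_smul_comm, one_mul, mul_one]

lemma gop_h_h (c₀ i j : ℤ) :
    D.gop c₀ (Gen.h i) * D.gop c₀ (Gen.h j) = D.gop c₀ (Gen.h j) * D.gop c₀ (Gen.h i) :=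
  diagOp_mul_comm _ _

lemma rsum_zero (Λ : Arr) : rsum 0 Λ = 0 := by simp [rsum]

lemma hval_step (c₀ i j : ℤ) (Λ Λ' : Arr)
    (h : ∀ n, rsum n Λ' = rsum n Λ + rowStep (level j) n) :
    hval c₀ i Λ' = hval c₀ i Λ + (if 0 ≤ j then 1 else -1) *
      ((if i = j then 1 else 0) - if i = j + 1 then 1 else 0) := by
  unfold hval
  rw [h, h]
  rcases int_cases i with ⟨n, rfl⟩ | ⟨n, rfl⟩ <;> rcases int_cases j with ⟨n', rfl⟩ | ⟨n', rfl⟩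
  · rw [hrow_natCast, level_natCast]
    unfold rowStep
    split_ifs <;> omega
  · rw [hrow_natCast, level_neg]
    unfold rowStep
    split_ifs <;> omega
  · rw [hrow_neg, level_natCast]
    unfold rowStep
    split_ifs <;> omega
  · rw [hrow_neg, level_neg]
    unfold rowStep
    split_ifs <;> omega

lemma gop_h_e (c₀ i j : ℤ) :
    D.gop c₀ (Gen.h i) * D.gop c₀ (Gen.e j) - D.gop c₀ (Gen.e j) * D.gop c₀ (Gen.h i) =
      ((if i = j then 1 else 0) - (if i = j + 1 then 1 else 0) : ℤ) • D.gop c₀ (Gen.e j) := by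
  simp only [gop]
  by_cases hj : 0 ≤ j
  · rw [if_pos hj, D.diagOp_mul_up (hval_step c₀ i j), if_pos hj, one_mul]
  · rw [if_neg hj, D.diagOp_mul_dn (hval_step c₀ i j), if_neg hj, neg_one_mul, neg_neg]

lemma gop_h_f (c₀ i j : ℤ) :
    D.gop c₀ (Gen.h i) * D.gop c₀ (Gen.f j) - D.gop c₀ (Gen.f j) * D.gop c₀ (Gen.h i) =
      -(((if i = j then 1 else 0) - (if i = j + 1 then 1 else 0) : ℤ) • D.gop c₀ (Gen.f j)) := by
  simp only [gop]
  by_cases hj : 0 ≤ j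
  · rw [if_pos hj, D.diagOp_mul_dn (hval_step c₀ i j), if_pos hj, one_mul]
    exact neg_zsmul (α := Module.End K (Arr →₀ K)) _ _
  · rw [if_neg hj, D.diagOp_mul_up (hval_step c₀ i j), if_neg hj, neg_one_mul]
    exact neg_zsmul (α := Module.End K (Arr →₀ K)) _ _

variable [CharZero K]

lemma gop_e_f (c₀ i : ℤ) {Λ : Arr} (hΛ : Inter Λ) :
    (D.gop c₀ (Gen.e i) * D.gop c₀ (Gen.f i) - D.gop c₀ (Gen.f i) * D.gop c₀ (Gen.e i))
      (Finsupp.single Λ 1) = D.br (hval c₀ i Λ - hval c₀ (i + 1) Λ +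
        (theta (-i) - theta (-i - 1)) * c₀) • Finsupp.single Λ 1 := by
  rcases int_cases i with ⟨n, rfl⟩ | ⟨n, rfl⟩
  · rw [gop_e_natCast, gop_f_natCast, up_dn_self, diagOp_single, if_pos hΛ]
    congr 2
    unfold hval
    rw [← Nat.cast_add_one, hrow_natCast, hrow_natCast]
    have e : -((n + 1 : ℕ) : ℤ) = -(n : ℤ) - 1 := by push_cast; ring
    rw [e, wt]
    simp only [Nat.add_sub_cancel]
    ring_nf
  · rw [gop_e_neg, gop_f_neg, ← neg_sub (D.up _ * _), up_dn_self, LinearMap.neg_apply, diagOp_single, if_pos hΛ,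
      ← neg_smul, ← br_neg]
    congr 2
    unfold hval
    rw [hrow_neg]
    have e1 : -(-(n : ℤ) - 1) - 1 = n := by ring
    have e2 : -(-(n : ℤ) - 1 + 1) = n := by ring
    rw [e1, e2]
    cases n with
    | zero =>
      have e3 : hrow (-((0 : ℕ) : ℤ) - 1 + 1) = 1 := by simp [hrow, theta]
      rw [e3]
      simp [wt, rsum_zero]
      ring
    | succ n =>
      have e3 : hrow (-((n + 1 : ℕ) : ℤ) - 1 + 1) = 2 * n + 2 := by
        rw [← hrow_neg]
        congr 1
        push_cast
        ring
      rw [e3]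
      have e4 : 2 * (n + 1) = (2 * n + 1) + 1 := by ring
      rw [e4, wt]
      simp only [Nat.add_succ_sub_one]
      ring

lemma gop_e_f_ne (c₀ : ℤ) {i j : ℤ} (h : i ≠ j) :
    D.gop c₀ (Gen.e i) * D.gop c₀ (Gen.f j) = D.gop c₀ (Gen.f j) * D.gop c₀ (Gen.e i) := by
  rcases int_cases i with ⟨n, rfl⟩ | ⟨n, rfl⟩ <;> rcases int_cases j with ⟨n', rfl⟩ | ⟨n', rfl⟩
  · rw [gop_e_natCast, gop_f_natCast, D.up_dn_comm (by omega) (by omega)]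
  · rw [gop_e_natCast, gop_f_neg, D.up_comm (by omega) (by omega)]
  · rw [gop_e_neg, gop_f_natCast, D.dn_comm (by omega) (by omega)]
  · rw [gop_e_neg, gop_f_neg, D.up_dn_comm (by omega) (by omega)]

lemma gop_e_e (c₀ : ℤ) {i j : ℤ} (h : |i - j| ≠ 1) :
    D.gop c₀ (Gen.e i) * D.gop c₀ (Gen.e j) = D.gop c₀ (Gen.e j) * D.gop c₀ (Gen.e i) := by
  rw [Ne, abs_eq zero_le_one] at h
  rcases int_cases i with ⟨n, rfl⟩ | ⟨n, rfl⟩ <;> rcases int_cases j with ⟨n', rfl⟩ | ⟨n', rfl⟩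
  · rw [gop_e_natCast, gop_e_natCast, D.up_comm (by omega) (by omega)]
  · rw [gop_e_natCast, gop_e_neg, D.up_dn_comm (by omega) (by omega)]
  · rw [gop_e_neg, gop_e_natCast, D.up_dn_comm (by omega) (by omega)]
  · rw [gop_e_neg, gop_e_neg, D.dn_comm (by omega) (by omega)]

lemma gop_f_f (c₀ : ℤ) {i j : ℤ} (h : |i - j| ≠ 1) :
    D.gop c₀ (Gen.f i) * D.gop c₀ (Gen.f j) = D.gop c₀ (Gen.f j) * D.gop c₀ (Gen.f i) := by
  rw [Ne, abs_eq zero_le_one] at h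
  rcases int_cases i with ⟨n, rfl⟩ | ⟨n, rfl⟩ <;> rcases int_cases j with ⟨n', rfl⟩ | ⟨n', rfl⟩
  · rw [gop_f_natCast, gop_f_natCast, D.dn_comm (by omega) (by omega)]
  · rw [gop_f_natCast, gop_f_neg, D.up_dn_comm (by omega) (by omega)]
  · rw [gop_f_neg, gop_f_natCast, D.up_dn_comm (by omega) (by omega)]
  · rw [gop_f_neg, gop_f_neg, D.up_comm (by omega) (by omega)]

lemma gop_e_serre (c₀ : ℤ) {i j : ℤ} (h : |i - j| = 1) :
    serreL D.q (D.gop c₀ (Gen.e i)) (D.gop c₀ (Gen.e j)) = 0 := by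
  rw [abs_eq zero_le_one] at h
  rcases int_cases i with ⟨n, rfl⟩ | ⟨n, rfl⟩ <;> rcases int_cases j with ⟨n', rfl⟩ | ⟨n', rfl⟩
  · rw [gop_e_natCast, gop_e_natCast, D.serreL_up (by omega)]
  · obtain ⟨rfl, rfl⟩ : n = 0 ∧ n' = 0 := by omega
    rw [gop_e_natCast, gop_e_neg]
    exact D.serreL_dn_up.2
  · obtain ⟨rfl, rfl⟩ : n = 0 ∧ n' = 0 := by omega
    rw [gop_e_natCast, gop_e_neg]
    exact D.serreL_dn_up.1
  · rw [gop_e_neg, gop_e_neg, D.serreL_dn (by omega)]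

lemma gop_f_serre (c₀ : ℤ) {i j : ℤ} (h : |i - j| = 1) :
    serreL D.q (D.gop c₀ (Gen.f i)) (D.gop c₀ (Gen.f j)) = 0 := by
  rw [abs_eq zero_le_one] at h
  rcases int_cases i with ⟨n, rfl⟩ | ⟨n, rfl⟩ <;> rcases int_cases j with ⟨n', rfl⟩ | ⟨n', rfl⟩
  · rw [gop_f_natCast, gop_f_natCast, D.serreL_dn (by omega)]
  · obtain ⟨rfl, rfl⟩ : n = 0 ∧ n' = 0 := by omega
    rw [gop_f_natCast, gop_f_neg]
    exact D.serreL_up_dn.2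
  · obtain ⟨rfl, rfl⟩ : n = 0 ∧ n' = 0 := by omega
    rw [gop_f_natCast, gop_f_neg]
    exact D.serreL_up_dn.1
  · rw [gop_f_neg, gop_f_neg, D.serreL_up (by omega)]

end QSqrt

end QuantumAInf

end

noncomputable section

namespace QuantumAInf

open Polynomial

/-! ### The quantities under the square roots -/

/-- The square of the matrix element `wU * wD` as an element of `ℂ[[h]]`. -/
def radR (p k a : ℕ) (Λ : Arr) : R :=
  -(((∏ a' ∈ (Finset.range (p + 2)).erase a, qint (Λ (p + 2) a' - Λ (p + 1) k)) *
      ∏ b ∈ Finset.range p, qint (Λ p b - 1 - Λ (p + 1) k)) *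
    (∏ k' ∈ (Finset.range (p + 1)).erase k,
      (qint (Λ (p + 1) k' - Λ (p + 1) k) * qint (Λ (p + 1) k' - Λ (p + 1) k - 1)))⁻¹ *
    ((∏ c ∈ Finset.range (p + 3), qint (Λ (p + 3) c - Λ (p + 2) a)) *
      ∏ k' ∈ (Finset.range (p + 1)).erase k, qint (Λ (p + 1) k' - 1 - Λ (p + 2) a)) *
    (∏ a' ∈ (Finset.range (p + 2)).erase a,
      (qint (Λ (p + 2) a' - Λ (p + 2) a) * qint (Λ (p + 2) a' - Λ (p + 2) a - 1)))⁻¹)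

lemma algebraMap_inv_of_constantCoeff {y : R} (h : PowerSeries.constantCoeff y ≠ 0) :
    algebraMap R Kh y⁻¹ = (algebraMap R Kh y)⁻¹ := by
  refine eq_inv_of_mul_eq_one_left ?_
  rw [← map_mul, PowerSeries.inv_mul_cancel _ h, map_one]

lemma constantCoeff_prod_qint {ι : Type*} (s : Finset ι) (f : ι → ℤ)
    (h : ∀ i ∈ s, f i ≠ 0 ∧ f i ≠ 1) :
    PowerSeries.constantCoeff (∏ i ∈ s, (qint (f i) * qint (f i - 1))) ≠ 0 := by
  rw [map_prod, Finset.prod_ne_zero_iff]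
  intro i hi
  rw [map_mul, constantCoeff_qint, constantCoeff_qint]
  have := h i hi
  exact mul_ne_zero (by exact_mod_cast this.1) (by exact_mod_cast sub_ne_zero.mpr this.2)

section

variable {p k a : ℕ} {Λ : Arr}

lemma side_ne (hk : k < p + 1) (h : Inter Λ) (h' : Inter (Λ + dl (p + 1) k + dl (p + 2) a)) :
    ∀ k' ∈ (Finset.range (p + 1)).erase k, Λ (p + 1) k' - Λ (p + 1) k ≠ 0 ∧
      Λ (p + 1) k' - Λ (p + 1) k ≠ 1 := by
  intro k' hk'
  rw [Finset.mem_erase, Finset.mem_range] at hk'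
  have h1 := h.ne hk'.1 hk'.2 hk
  have h2 := h'.ne hk'.1 hk'.2 hk
  simp only [Pi.add_apply, dl_self, dl_add_two_succ, dl_ne hk'.1] at h2
  omega

lemma side_ne' (ha : a < p + 2) (h : Inter Λ) (h' : Inter (Λ + dl (p + 1) k + dl (p + 2) a)) :
    ∀ a' ∈ (Finset.range (p + 2)).erase a, Λ (p + 2) a' - Λ (p + 2) a ≠ 0 ∧
      Λ (p + 2) a' - Λ (p + 2) a ≠ 1 := by
  intro k' hk'
  rw [Finset.mem_erase, Finset.mem_range] at hk'
  have h1 := h.ne hk'.1 hk'.2 ha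
  have h2 := h'.ne hk'.1 hk'.2 ha
  simp only [Pi.add_apply, dl_self, dl_succ_add_two, dl_ne hk'.1] at h2
  omega

lemma posK_wU (hk : k < p + 1) (h : Inter Λ)
    (h' : Inter (Λ + dl (p + 1) k + dl (p + 2) a)) : PosK (QD.wU p k a Λ) := by
  refine ((PosK.prod _ fun a' ha' => posK_σ ?_).mul (PosK.prod _ fun b hb => posK_σ ?_)).mul
    (PosK.prod _ fun k' hk' => ((posK_σ ?_).mul (posK_σ ?_)).inv)
  · rw [Finset.mem_erase, Finset.mem_range] at ha'
    have h1 := h.le_iff (p := p + 1) hk ha'.2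
    have h2 := h'.le_iff (p := p + 1) hk ha'.2
    simp only [show p + 1 + 1 = p + 2 from rfl] at h1 h2
    simp only [Pi.add_apply, dl_self, dl_succ_add_two, dl_add_two_succ, dl_ne ha'.1] at h2
    omega
  · rw [Finset.mem_range] at hb
    have h1 := h.le_iff (p := p) hb hk
    have h2 := h'.le_iff (p := p) hb hk
    simp only [Pi.add_apply, dl_self, dl_succ_self, dl_add_two_self] at h2
    omega
  · exact (side_ne hk h h' k' hk').1
  · have := (side_ne hk h h' k' hk').2
    omega

lemma posK_wD (ha : a < p + 2) (h : Inter Λ)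
    (h' : Inter (Λ + dl (p + 1) k + dl (p + 2) a)) : PosK (QD.wD p k a Λ) := by
  refine ((PosK.prod _ fun a' ha' => posK_σ ?_).mul (PosK.prod _ fun b hb => posK_σ ?_)).mul
    (PosK.prod _ fun k' hk' => ((posK_σ ?_).mul (posK_σ ?_)).inv)
  · rw [Finset.mem_range] at ha'
    have h1 := h.le_iff (p := p + 2) ha ha'
    have h2 := h'.le_iff (p := p + 2) ha ha'
    simp only [Pi.add_apply, dl_self, dl_succ_add_two,
      dl_row_ne (show p + 2 + 1 ≠ p + 1 by omega)] at h2
    change Λ (p + 2 + 1) a' - Λ (p + 2) a ≠ 0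
    omega
  · rw [Finset.mem_erase, Finset.mem_range] at hb
    have h1 := h.le_iff (p := p + 1) hb.2 ha
    have h2 := h'.le_iff (p := p + 1) hb.2 ha
    simp only [show p + 1 + 1 = p + 2 from rfl] at h1 h2
    simp only [Pi.add_apply, dl_self, dl_succ_add_two, dl_add_two_succ, dl_ne hb.1] at h2
    change Λ (p + 2) a + 1 - Λ (p + 1) b ≠ 0
    omega
  · exact (side_ne' ha h h' k' hk').1
  · have := (side_ne' ha h h' k' hk').2
    change Λ (p + 2) k' - Λ (p + 2) a - 1 ≠ 0
    omega

lemma algebraMap_radR (hk : k < p + 1) (ha : a < p + 2) (h : Inter Λ)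
    (h' : Inter (Λ + dl (p + 1) k + dl (p + 2) a)) :
    algebraMap R Kh (radR p k a Λ) =
      (QD.wU p k a Λ * QD.wD p k a Λ) * (QD.wU p k a Λ * QD.wD p k a Λ) := by
  have e1 := QD.wgen_mul_self ((Finset.range (p + 2)).erase a) (Finset.range p)
    ((Finset.range (p + 1)).erase k) p k Λ
  have e2 := QD.wgen_mul_self (Finset.range (p + 3)) ((Finset.range (p + 1)).erase k)
    ((Finset.range (p + 2)).erase a) (p + 1) a Λ
  rw [QD.prod_br_abs_up hk h (Finset.erase_subset _ _), QD.prod_br_abs_down hk h subset_rfl,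
    QD.prod_br_abs_side hk h subset_rfl, QSqrt.prod_range_sign] at e1
  rw [QD.prod_br_abs_up ha h subset_rfl, QD.prod_br_abs_down ha h (Finset.erase_subset _ _),
    QD.prod_br_abs_side ha h subset_rfl, QSqrt.prod_range_sign] at e2
  have s1 := Finset.mul_prod_erase (Finset.range (p + 2)) (fun a => if k + 1 ≤ a then (-1 : Kh) else 1)
    (Finset.mem_range.mpr ha)
  have s2 := Finset.mul_prod_erase (Finset.range (p + 1)) (fun k => if a ≤ k then (-1 : Kh) else 1)
    (Finset.mem_range.mpr hk)
  rw [QSqrt.prod_range_sign] at s1 s2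
  have hh : (QD.wU p k a Λ * QD.wD p k a Λ) * (QD.wU p k a Λ * QD.wD p k a Λ) =
    (QD.wU p k a Λ * QD.wU p k a Λ) * (QD.wD p k a Λ * QD.wD p k a Λ) := by ring
  rw [hh, QSqrt.wU, QSqrt.wD, e1, e2, radR]
  simp only [map_neg, map_mul, map_prod, algebraMap_inv_of_constantCoeff
    (constantCoeff_prod_qint _ _ (side_ne hk h h')), algebraMap_inv_of_constantCoeff
    (constantCoeff_prod_qint _ _ (side_ne' ha h h')), ← QD_br]
  simp only [show p + 1 + 1 = p + 2 from rfl, show p + 1 + 2 = p + 3 from rfl] at *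
  generalize ∏ a' ∈ (Finset.range (p + 2)).erase a, QD.br (Λ (p + 2) a' - Λ (p + 1) k) = u1
  generalize ∏ b ∈ Finset.range p, QD.br (Λ p b - 1 - Λ (p + 1) k) = u2
  generalize (∏ k' ∈ (Finset.range (p + 1)).erase k,
    (QD.br (Λ (p + 1) k' - Λ (p + 1) k) * QD.br (Λ (p + 1) k' - Λ (p + 1) k - 1)))⁻¹ = u3
  generalize ∏ c ∈ Finset.range (p + 3), QD.br (Λ (p + 3) c - Λ (p + 2) a) = u4
  generalize ∏ k' ∈ (Finset.range (p + 1)).erase k, QD.br (Λ (p + 1) k' - 1 - Λ (p + 2) a) = u5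
  generalize (∏ a' ∈ (Finset.range (p + 2)).erase a,
    (QD.br (Λ (p + 2) a' - Λ (p + 2) a) * QD.br (Λ (p + 2) a' - Λ (p + 2) a - 1)))⁻¹ = u6
  generalize (∏ x ∈ (Finset.range (p + 2)).erase a, if k + 1 ≤ x then (-1 : Kh) else 1) = t1 at *
  generalize (∏ x ∈ (Finset.range (p + 1)).erase k, if a ≤ x then (-1 : Kh) else 1) = t2 at *
  have n1 : p + 2 - (k + 1) = p - k + 1 := by omega
  have n2 : p + 3 - (a + 1) = p + 1 - a + 1 := by omega
  have sq : ∀ n : ℕ, (-1 : Kh) ^ n * (-1) ^ n = 1 := fun n => by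
    rw [← mul_pow]
    norm_num
  have q1 := sq (p - k)
  have q2 := sq (p + 1 - a)
  rw [n1, pow_succ] at s1
  rw [n2, pow_succ]
  generalize (-1 : Kh) ^ (p - k) = v1 at *
  generalize (-1 : Kh) ^ (p + 1 - a) = v2 at *
  have key : t1 * v1 * (v2 * -1 * t2) = -1 := by
    by_cases hak : a ≤ k
    · rw [if_neg (by omega)] at s1
      rw [if_pos hak] at s2
      obtain rfl : t1 = v1 * -1 := by linear_combination s1
      obtain rfl : t2 = -v2 := by linear_combination -s2
      linear_combination (-v2 * v2) * q1 - q2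
    · rw [if_pos (by omega)] at s1
      rw [if_neg hak] at s2
      obtain rfl : t1 = v1 := by linear_combination -s1
      obtain rfl : t2 = v2 := by linear_combination s2
      linear_combination (-t2 * t2) * q1 - q2
  linear_combination (-u1 * u2 * u3 * u4 * u5 * u6) * key

lemma hsqrt_radR (hk : k < p + 1) (ha : a < p + 2) (h : Inter Λ)
    (h' : Inter (Λ + dl (p + 1) k + dl (p + 2) a)) :
    algebraMap R Kh (hsqrt (radR p k a Λ)) = QD.wU p k a Λ * QD.wD p k a Λ ∧
      Pos (hsqrt (radR p k a Λ)) :=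
  hsqrt_of_posK ((posK_wU hk h h').mul (posK_wD ha h h')) (algebraMap_radR hk ha h h')

end

lemma hsqrt_node_zero {Λ : Arr} (h : Inter Λ) (h' : Inter (Λ + dl 1 0)) :
    algebraMap R Kh (hsqrt (qint (Λ 2 0 - Λ 1 0) * qint (Λ 1 0 - Λ 2 1))) = QD.w 0 0 Λ ∧
      Pos (hsqrt (qint (Λ 2 0 - Λ 1 0) * qint (Λ 1 0 - Λ 2 1))) := by
  have h1 : Λ 2 1 < Λ 1 0 := (h 1 0 (by omega)).2
  have h2 : (Λ + dl 1 0) 1 0 ≤ (Λ + dl 1 0) 2 0 := (h' 1 0 (by omega)).1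
  simp only [Pi.add_apply, dl_self, dl_row_ne (show 2 ≠ 1 by omega)] at h2
  have e : QD.w 0 0 Λ = QD.σ (Λ 2 0 - Λ 1 0) * QD.σ (Λ 2 1 - Λ 1 0) := by
    simp [QSqrt.w, QSqrt.wgen, Finset.prod_range_succ]
  refine hsqrt_of_posK ?_ ?_
  · rw [e]
    exact (posK_σ (by omega)).mul (posK_σ (by omega))
  · rw [e, map_mul, ← QD_br, ← QD_br]
    have h3 := QD.σ_mul_self (Λ 2 0 - Λ 1 0)
    have h4 := QD.σ_mul_self (Λ 2 1 - Λ 1 0)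
    rw [abs_of_nonneg (by omega)] at h3
    rw [abs_of_neg (by omega), neg_sub] at h4
    rw [← h3, ← h4]
    ring

end QuantumAInf

end

noncomputable section

namespace QuantumAInf

open Polynomial

/-! ### Patterns and integral arrays -/

/-- The `k`-th position of row `p`. -/
def posn (p k : ℕ) : ℤ := (k : ℤ) - ((p / 2 : ℕ) : ℤ)

lemma posn_injective (p : ℕ) : Function.Injective (posn p) := fun a b h => by
  unfold posn at h
  omega

lemma mem_row {p : ℕ} {i : ℤ} : i ∈ row p ↔ ∃ k < p, i = posn p k := by
  unfold row posn
  rw [Finset.mem_Icc]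
  constructor
  · intro h
    exact ⟨(i + ((p / 2 : ℕ) : ℤ)).toNat, by omega, by omega⟩
  · rintro ⟨k, hk, rfl⟩
    omega

lemma posn_mem_row {p k : ℕ} (hk : k < p) : posn p k ∈ row p := mem_row.mpr ⟨k, hk, rfl⟩

lemma row_eq (p : ℕ) : row p = (Finset.range p).image (posn p) := by
  ext i
  rw [mem_row]
  simp [eq_comm]

lemma row_erase (p k : ℕ) :
    (row p).erase (posn p k) = ((Finset.range p).erase k).image (posn p) := by
  rw [row_eq, ← Finset.image_erase (posn_injective p)]

lemma sum_row {N : Type*} [AddCommMonoid N] (p : ℕ) (f : ℤ → N) :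
    ∑ j ∈ row p, f j = ∑ k ∈ Finset.range p, f (posn p k) := by
  rw [row_eq, Finset.sum_image fun a _ b _ h => posn_injective p h]

lemma prod_row {N : Type*} [CommMonoid N] (p : ℕ) (f : ℤ → N) :
    ∏ j ∈ row p, f j = ∏ k ∈ Finset.range p, f (posn p k) := by
  rw [row_eq, Finset.prod_image fun a _ b _ h => posn_injective p h]

lemma prod_row_erase {N : Type*} [CommMonoid N] (p k : ℕ) (f : ℤ → N) :
    ∏ j ∈ (row p).erase (posn p k), f j = ∏ k' ∈ (Finset.range p).erase k, f (posn p k') := by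
  rw [row_erase, Finset.prod_image fun a _ b _ h => posn_injective p h]

/-- The integer that a constant integral polynomial equals. -/
def toZ (x : ℂ[X]) : ℤ := ⌊(x.coeff 0).re⌋

@[simp] lemma toZ_intCast (z : ℤ) : toZ (z : ℂ[X]) = z := by
  rw [toZ, Polynomial.intCast_coeff_zero]
  simp

lemma intCast_polynomial_injective {a b : ℤ} (h : (a : ℂ[X]) = b) : a = b := by
  rw [← toZ_intCast a, h, toZ_intCast]

lemma isNatP_intCast {z : ℤ} : IsNatP (z : ℂ[X]) ↔ 0 ≤ z := by
  constructor
  · rintro ⟨n, hn⟩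
    have : z = (n : ℤ) := intCast_polynomial_injective (by simpa using hn)
    omega
  · intro h
    exact ⟨z.toNat, by rw [← Int.cast_natCast, Int.toNat_of_nonneg h]⟩

/-- The array of integers of a pattern: `M_{i,p} = ξ + k + ℓ_{p,k}` with `k` the number of the position
`i`. -/
def arr (ξ : ℂ[X]) (Q : ℕ → ℤ → ℂ[X]) : Arr := fun p k =>
  if k < p then toZ (Q p (posn p k) - ξ) - k else 0

/-- The entries are integral up to the common summand `ξ`, and almost all rows agree with `M`. -/
structure IsIntArr (M : ℤ → ℂ[X]) (ξ : ℂ[X]) (Q : ℕ → ℤ → ℂ[X]) : Prop where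
  outside : ∀ p i, i ∉ row p → Q p i = 0
  integral : ∀ p, ∀ k < p, ∃ z : ℤ, Q p (posn p k) = ξ + (z : ℂ[X])
  stable : ∃ N : ℕ, 1 < N ∧ ∀ p ≥ N, ∀ i ∈ row p, Q p i = M i

section

variable {M : ℤ → ℂ[X]} {ξ : ℂ[X]} {Q Q' : ℕ → ℤ → ℂ[X]}

lemma IsIntArr.entry (hQ : IsIntArr M ξ Q) {p k : ℕ} (hk : k < p) :
    Q p (posn p k) = ξ + ((arr ξ Q p k + k : ℤ) : ℂ[X]) := by
  obtain ⟨z, hz⟩ := hQ.integral p k hk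
  rw [arr, if_pos hk, hz, add_sub_cancel_left, toZ_intCast, sub_add_cancel]

lemma IsIntArr.ext (hQ : IsIntArr M ξ Q) (hQ' : IsIntArr M ξ Q') (h : arr ξ Q = arr ξ Q') :
    Q = Q' := by
  funext p i
  by_cases hi : i ∈ row p
  · obtain ⟨k, hk, rfl⟩ := mem_row.mp hi
    rw [hQ.entry hk, hQ'.entry hk, h]
  · rw [hQ.outside p i hi, hQ'.outside p i hi]

lemma exists_int_of_isNatP_sub {x y : ℂ[X]} (hx : ∃ z : ℤ, x = ξ + (z : ℂ[X]))
    (h : IsNatP (x - y)) : ∃ z : ℤ, y = ξ + (z : ℂ[X]) := by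
  obtain ⟨z, rfl⟩ := hx
  obtain ⟨n, hn⟩ := h
  refine ⟨z - n, ?_⟩
  push_cast
  linear_combination -hn

lemma posn_odd (κ k : ℕ) : posn (2 * κ + 1) k - 1 = posn (2 * κ + 2) k ∧
    posn (2 * κ + 1) k = posn (2 * κ + 2) (k + 1) := by
  unfold posn
  omega

lemma posn_even (κ k : ℕ) : posn (2 * κ) k = posn (2 * κ + 1) k ∧
    posn (2 * κ) k + 1 = posn (2 * κ + 1) (k + 1) := by
  unfold posn
  omega

lemma IsCPattern.interlace (hQ : IsCPattern M Q) {p k : ℕ} (hk : k < p) :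
    IsNatP (Q (p + 1) (posn (p + 1) k) - Q p (posn p k)) ∧
      IsNatP (Q p (posn p k) - Q (p + 1) (posn (p + 1) (k + 1))) := by
  rcases Nat.even_or_odd' p with ⟨κ, rfl | rfl⟩
  · have := hQ.even_row κ (by omega) (posn (2 * κ) k) (posn_mem_row hk)
    rwa [← (posn_even κ k).2, ← (posn_even κ k).1]
  · have h1 := hQ.odd_row (κ + 1) (by omega)
    have e1 : 2 * (κ + 1) - 1 = 2 * κ + 1 := by omega
    have e2 : 2 * (κ + 1) = 2 * κ + 2 := by omega
    rw [e1, e2] at h1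
    have := h1 _ (posn_mem_row hk)
    rw [show 2 * κ + 1 + 1 = 2 * κ + 2 from rfl, ← (posn_odd κ k).1, ← (posn_odd κ k).2]
    exact this

lemma IsCPattern.isIntArr (hM : ∀ i, ∃ z : ℤ, M i = ξ + (z : ℂ[X])) (hQ : IsCPattern M Q) :
    IsIntArr M ξ Q := by
  refine ⟨hQ.outside, ?_, hQ.stable⟩
  obtain ⟨N, _, hN⟩ := hQ.stable
  have key : ∀ d p, N ≤ p + d → ∀ k < p, ∃ z : ℤ, Q p (posn p k) = ξ + (z : ℂ[X]) := by
    intro d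
    induction d with
    | zero =>
      intro p hp k hk
      rw [hN p (by omega) _ (posn_mem_row hk)]
      exact hM _
    | succ d ih =>
      intro p hp k hk
      exact exists_int_of_isNatP_sub (ih (p + 1) (by omega) k (by omega)) (hQ.interlace hk).1
  exact fun p => key N p (by omega)

lemma IsIntArr.sub_eq (hQ : IsIntArr M ξ Q) {p k p' k' : ℕ} (hk : k < p) (hk' : k' < p') :
    Q p (posn p k) - Q p' (posn p' k') =
      ((arr ξ Q p k + k - (arr ξ Q p' k' + k') : ℤ) : ℂ[X]) := by
  rw [hQ.entry hk, hQ.entry hk']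
  push_cast
  ring

lemma IsIntArr.isCPattern_iff (hQ : IsIntArr M ξ Q) : IsCPattern M Q ↔ Inter (arr ξ Q) := by
  constructor
  · intro h p k hk
    have := h.interlace hk
    rw [hQ.sub_eq (by omega) hk, hQ.sub_eq hk (by omega), isNatP_intCast, isNatP_intCast] at this
    push_cast at this
    omega
  · intro h
    refine ⟨hQ.outside, hQ.stable, ?_, ?_⟩
    · intro κ hκ i hi
      obtain ⟨κ, rfl⟩ : ∃ κ', κ = κ' + 1 := ⟨κ - 1, by omega⟩
      rw [show 2 * (κ + 1) - 1 = 2 * κ + 1 by omega] at hi ⊢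
      rw [show 2 * (κ + 1) = 2 * κ + 2 by omega]
      obtain ⟨k, hk, rfl⟩ := mem_row.mp hi
      have e := hQ.sub_eq hk (show k + 1 < 2 * κ + 2 by omega)
      rw [← (posn_odd κ k).2] at e
      rw [(posn_odd κ k).1, hQ.sub_eq (by omega) hk, e, isNatP_intCast, isNatP_intCast]
      have := h (2 * κ + 1) k hk
      simp only [show 2 * κ + 1 + 1 = 2 * κ + 2 from rfl] at this
      push_cast
      omega
    · intro κ hκ i hi
      obtain ⟨k, hk, rfl⟩ := mem_row.mp hi
      have e := hQ.sub_eq (show k < 2 * κ + 1 by omega) hk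
      rw [← (posn_even κ k).1] at e
      rw [(posn_even κ k).2, hQ.sub_eq hk (by omega), e, isNatP_intCast, isNatP_intCast]
      have := h (2 * κ) k hk
      push_cast
      omega

lemma shift_apply_of_ne {Q : ℕ → ℤ → ℂ[X]} {j : ℤ} {p : ℕ} {s : ℤ} {p' : ℕ} {j' : ℤ}
    (h : ¬ (p' = p ∧ j' = j)) : shift Q j p s p' j' = Q p' j' := if_neg h

lemma shift_apply_self {Q : ℕ → ℤ → ℂ[X]} {j : ℤ} {p : ℕ} {s : ℤ} :
    shift Q j p s p j = Q p j + (s : ℂ[X]) := if_pos ⟨rfl, rfl⟩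

lemma IsIntArr.shift (hQ : IsIntArr M ξ Q) {p k : ℕ} (hk : k < p) (s : ℤ) :
    IsIntArr M ξ (shift Q (posn p k) p s) := by
  refine ⟨?_, ?_, ?_⟩
  · intro p' i hi
    rw [shift_apply_of_ne, hQ.outside p' i hi]
    rintro ⟨rfl, rfl⟩
    exact hi (posn_mem_row hk)
  · intro p' k' hk'
    obtain ⟨z, hz⟩ := hQ.integral p' k' hk'
    by_cases h : p' = p ∧ posn p' k' = posn p k
    · obtain ⟨rfl, h2⟩ := h
      refine ⟨z + s, ?_⟩
      rw [h2, shift_apply_self, ← h2, hz]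
      push_cast
      ring
    · exact ⟨z, by rw [shift_apply_of_ne h, hz]⟩
  · obtain ⟨N, hN1, hN⟩ := hQ.stable
    refine ⟨max N (p + 1), by omega, fun p' hp' i hi => ?_⟩
    rw [shift_apply_of_ne (by omega), hN p' (by omega) i hi]

lemma IsIntArr.arr_shift (hQ : IsIntArr M ξ Q) {p k : ℕ} (hk : k < p) (s : ℤ) :
    arr ξ (QuantumAInf.shift Q (posn p k) p s) = arr ξ Q + s • dl p k := by
  funext p' k'
  simp only [Pi.add_apply, Pi.smul_apply, dl, smul_eq_mul]
  by_cases h : p' = p ∧ k' = k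
  · obtain ⟨rfl, rfl⟩ := h
    obtain ⟨z, hz⟩ := hQ.integral p' k' hk
    rw [arr, arr, if_pos hk, if_pos hk, shift_apply_self, hz, if_pos ⟨rfl, rfl⟩, add_assoc,
      add_sub_cancel_left, add_sub_cancel_left, ← Int.cast_add, toZ_intCast, toZ_intCast]
    ring
  · rw [if_neg h, mul_zero, add_zero]
    unfold arr
    split_ifs with hk'
    · rw [shift_apply_of_ne]
      rintro ⟨rfl, h2⟩
      exact h ⟨rfl, posn_injective _ h2⟩
    · rfl

lemma IsIntArr.LL_sub (hQ : IsIntArr M ξ Q) {p k p' k' : ℕ} (hk : k < p) (hk' : k' < p') :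
    LL Q (posn p k) p - LL Q (posn p' k') p' =
      ((arr ξ Q p k - arr ξ Q p' k' + ((p / 2 : ℕ) : ℤ) - ((p' / 2 : ℕ) : ℤ) : ℤ) : ℂ[X]) := by
  unfold LL
  rw [hQ.entry hk, hQ.entry hk']
  simp only [posn]
  push_cast
  ring

lemma qbrP_intCast (z : ℤ) : qbrP (z : ℂ[X]) = qint z := by
  rw [qbrP, qint]
  congr 1
  rw [← Polynomial.coe_C]
  congr 1

lemma IsIntArr.qbrP_LL (hQ : IsIntArr M ξ Q) {p k p' k' : ℕ} (hk : k < p) (hk' : k' < p')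
    {x : ℂ[X]} (z : ℤ) (hx : x = LL Q (posn p k) p - LL Q (posn p' k') p' + (z : ℂ[X])) {w : ℤ}
    (hw : w = arr ξ Q p k - arr ξ Q p' k' + ((p / 2 : ℕ) : ℤ) - ((p' / 2 : ℕ) : ℤ) + z) :
    qbrP x = qint w := by
  rw [hx, hQ.LL_sub hk hk', ← Int.cast_add, qbrP_intCast, hw]

/-- The shifts of the arguments of the brackets for raising (`δ = 0`) and lowering (`δ = 1`). -/
lemma IsIntArr.radicand_eq_aux (hQ : IsIntArr M ξ Q) {i μ ν p k a : ℕ} (hp : 2 * i + ν = p + 2)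
    (hk : k < p + 1) (ha : a < p + 2) {δ z₁ z₂ s : ℤ} (hz₁ : z₁ = -((-1) ^ ν * (μ : ℤ)))
    (hz₂ : z₂ = (-1) ^ ν * (1 - (μ : ℤ))) (hs : s = (-1) ^ (μ + ν))
    (h₁ : z₁ = δ - (((p + 2) / 2 : ℕ) : ℤ) + (((p + 1) / 2 : ℕ) : ℤ))
    (h₂ : z₂ = δ - (((p + 1) / 2 : ℕ) : ℤ) + ((p / 2 : ℕ) : ℤ)) (hδ : s = 2 * δ - 1)
    (hδ' : δ = 0 ∨ δ = 1) :
    radicand i μ ν Q (posn (p + 1) k) (posn (p + 2) a) =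
      radR p k a (arr ξ Q - δ • (dl (p + 1) k + dl (p + 2) a)) := by
  have e1 : 2 * i + ν - 1 = p + 1 := by omega
  have e2 : 2 * i + ν - 2 = p := by omega
  have d1 : (arr ξ Q - δ • (dl (p + 1) k + dl (p + 2) a)) (p + 1) k = arr ξ Q (p + 1) k - δ := by
    simp
  have d2 : (arr ξ Q - δ • (dl (p + 1) k + dl (p + 2) a)) (p + 2) a = arr ξ Q (p + 2) a - δ := by
    simp
  have d3 : ∀ k' ∈ (Finset.range (p + 1)).erase k,
      (arr ξ Q - δ • (dl (p + 1) k + dl (p + 2) a)) (p + 1) k' = arr ξ Q (p + 1) k' := by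
    intro k' hk'
    simp [dl_ne (Finset.ne_of_mem_erase hk')]
  have d4 : ∀ a' ∈ (Finset.range (p + 2)).erase a,
      (arr ξ Q - δ • (dl (p + 1) k + dl (p + 2) a)) (p + 2) a' = arr ξ Q (p + 2) a' := by
    intro a' ha'
    simp [dl_ne (Finset.ne_of_mem_erase ha')]
  have d5 : ∀ b, (arr ξ Q - δ • (dl (p + 1) k + dl (p + 2) a)) p b = arr ξ Q p b := by
    intro b
    simp
  have d6 : ∀ c, (arr ξ Q - δ • (dl (p + 1) k + dl (p + 2) a)) (p + 3) c = arr ξ Q (p + 3) c := by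
    intro c
    simp [dl]
  have c₁ : (z₁ : ℂ[X]) = -((-1) ^ ν * (μ : ℂ[X])) := by rw [hz₁]; push_cast; ring
  have c₂ : (z₂ : ℂ[X]) = (-1) ^ ν * (1 - (μ : ℂ[X])) := by rw [hz₂]; push_cast; ring
  have cs : (s : ℂ[X]) = (-1) ^ (μ + ν) := by rw [hs]; push_cast; ring
  have o1 : (((p + 3) / 2 : ℕ) : ℤ) = ((p + 1) / 2 : ℕ) + 1 := by omega
  have o2 : (((p + 2) / 2 : ℕ) : ℤ) = (p / 2 : ℕ) + 1 := by omega
  have mem : ∀ {n x y : ℕ}, x ∈ (Finset.range n).erase y → x < n := fun h =>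
    Finset.mem_range.mp (Finset.mem_of_mem_erase h)
  rw [radicand, radR, e1, e2, hp]
  simp only [show p + 2 + 1 = p + 3 from rfl]
  rw [prod_row_erase, prod_row, prod_row_erase, prod_row, prod_row_erase, prod_row_erase]
  rw [d1, d2]
  refine congrArg Neg.neg (congrArg₂ (· * ·) (congrArg₂ (· * ·) (congrArg₂ (· * ·)
    (congrArg₂ (· * ·) ?_ ?_) (congrArg (·⁻¹) ?_)) (congrArg₂ (· * ·) ?_ ?_)) (congrArg (·⁻¹) ?_))
  · refine Finset.prod_congr rfl fun a' ha' => ?_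
    rw [d4 a' ha']
    exact hQ.qbrP_LL (mem ha') hk z₁ (by rw [c₁]; ring) (by omega)
  · refine Finset.prod_congr rfl fun b hb => ?_
    rw [d5]
    exact hQ.qbrP_LL (Finset.mem_range.mp hb) hk z₁ (by rw [c₁]; ring) (by omega)
  · refine Finset.prod_congr rfl fun k' hk' => ?_
    rw [d3 k' hk']
    rcases hδ' with rfl | rfl
    · rw [hQ.qbrP_LL (mem hk') hk 0 (w := arr ξ Q (p + 1) k' - (arr ξ Q (p + 1) k - 0))
        (by push_cast; ring) (by omega), hQ.qbrP_LL (mem hk') hk s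
        (w := arr ξ Q (p + 1) k' - (arr ξ Q (p + 1) k - 0) - 1) (by rw [cs]) (by omega)]
    · rw [hQ.qbrP_LL (mem hk') hk 0 (w := arr ξ Q (p + 1) k' - (arr ξ Q (p + 1) k - 1) - 1)
        (by push_cast; ring) (by omega), hQ.qbrP_LL (mem hk') hk s
        (w := arr ξ Q (p + 1) k' - (arr ξ Q (p + 1) k - 1)) (by rw [cs]) (by omega), mul_comm]
  · refine Finset.prod_congr rfl fun c hc => ?_
    rw [d6]
    exact hQ.qbrP_LL (Finset.mem_range.mp hc) ha z₂ (by rw [c₂]) (by omega)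
  · refine Finset.prod_congr rfl fun k' hk' => ?_
    rw [d3 k' hk']
    exact hQ.qbrP_LL (mem hk') ha z₂ (by rw [c₂]) (by omega)
  · refine Finset.prod_congr rfl fun k' hk' => ?_
    rw [d4 k' hk']
    rcases hδ' with rfl | rfl
    · rw [hQ.qbrP_LL (mem hk') ha 0 (w := arr ξ Q (p + 2) k' - (arr ξ Q (p + 2) a - 0))
        (by push_cast; ring) (by omega), hQ.qbrP_LL (mem hk') ha s
        (w := arr ξ Q (p + 2) k' - (arr ξ Q (p + 2) a - 0) - 1) (by rw [cs]) (by omega)]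
    · rw [hQ.qbrP_LL (mem hk') ha 0 (w := arr ξ Q (p + 2) k' - (arr ξ Q (p + 2) a - 1) - 1)
        (by push_cast; ring) (by omega), hQ.qbrP_LL (mem hk') ha s
        (w := arr ξ Q (p + 2) k' - (arr ξ Q (p + 2) a - 1)) (by rw [cs]) (by omega), mul_comm]

lemma IsIntArr.radicand_eq (hQ : IsIntArr M ξ Q) {i μ ν p k a : ℕ} (hp : 2 * i + ν = p + 2)
    (hμ : μ ≤ 1) (hν : ν ≤ 1) (hk : k < p + 1) (ha : a < p + 2) :
    radicand i μ ν Q (posn (p + 1) k) (posn (p + 2) a) = radR p k a (arr ξ Q -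
      (if μ = ν then (1 : ℤ) else 0) • (dl (p + 1) k + dl (p + 2) a)) := by
  interval_cases ν <;> interval_cases μ <;>
    exact hQ.radicand_eq_aux hp hk ha rfl rfl rfl (by norm_num; omega) (by norm_num; omega)
      (by norm_num) (by simp)

lemma SS_eq {i ν p k a : ℕ} (hp : 2 * i + ν = p + 2) (hν : ν ≤ 1) :
    -SS (posn (p + 1) k) (posn (p + 2) a) ν = if a ≤ k then 1 else -1 := by
  unfold SS posn
  interval_cases ν
  · split_ifs <;> first | omega | simp
  · split_ifs <;> first | omega | simp

end

end QuantumAInf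

end

noncomputable section

namespace QuantumAInf

open Polynomial

/-! ### The action on finite linear combinations of patterns -/

/-- An integral signature: `M i = ξ₁ + cc i` with `cc` decreasing, `cc i = c₀` for `i ≤ m` and `cc i = 0`
for `i ≥ n`. -/
structure SigData (M : ℤ → ℂ[X]) where
  ξ₁ : ℂ[X]
  cc : ℤ → ℤ
  c₀ : ℤ
  m : ℤ
  n : ℤ
  M_eq : ∀ i, M i = ξ₁ + (cc i : ℂ[X])
  anti : ∀ i j, i ≤ j → cc j ≤ cc i
  left : ∀ i ≤ m, cc i = c₀
  right : ∀ i, n ≤ i → cc i = 0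

section

variable {M : ℤ → ℂ[X]} (S : SigData M)

namespace SigData

/-- The eigenvalue `M m` of the left end of the signature. -/
def ξ₀ : ℂ[X] := S.ξ₁ + (S.c₀ : ℂ[X])

lemma integral (i : ℤ) : ∃ z : ℤ, M i = S.ξ₁ + (z : ℂ[X]) := ⟨S.cc i, S.M_eq i⟩

lemma isIntArr (P : CBasis M) : IsIntArr M S.ξ₁ P.1 := P.2.isIntArr S.integral

/-- The array of a basis pattern. -/
def arrOf (P : CBasis M) : Arr := arr S.ξ₁ P.1

lemma inter (P : CBasis M) : Inter (S.arrOf P) := (S.isIntArr P).isCPattern_iff.mp P.2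

lemma arrOf_injective : Function.Injective S.arrOf := fun P P' h =>
  Subtype.ext ((S.isIntArr P).ext (S.isIntArr P') h)

end SigData

variable {N N' : Type*} [AddCommGroup N] [Module R N] [AddCommGroup N'] [Module R N']

/-- The formula for `e_{-1}^{1-μ}` with values in an arbitrary module. -/
def actMinusOneG (v : (ℕ → ℤ → ℂ[X]) → N) (μ : ℕ) (P : ℕ → ℤ → ℂ[X]) : N :=
  hsqrt (qbrP (LL P (-1) 2 - LL P 0 1 - (μ : ℂ[X])) * qbrP (LL P 0 1 - LL P 0 2 + (μ : ℂ[X]))) •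
    v (shift P 0 1 (-(-1) ^ μ))

/-- The formula for `e^μ_{(-1)^ν i - 1}` with values in an arbitrary module. -/
def actG (v : (ℕ → ℤ → ℂ[X]) → N) (i μ ν : ℕ) (P : ℕ → ℤ → ℂ[X]) : N :=
  -∑ j ∈ row (2 * i + ν - 1), ∑ l ∈ row (2 * i + ν),
    (SS j l ν * hsqrt (radicand i μ ν P j l)) •
      v (shift (shift P j (2 * i + ν - 1) (-(-1) ^ (μ + ν))) l (2 * i + ν) (-(-1) ^ (μ + ν)))

/-- The formula for `e^μ_i`. -/
def efCol (v : (ℕ → ℤ → ℂ[X]) → N) (μ : ℕ) (i : ℤ) (P : ℕ → ℤ → ℂ[X]) : N :=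
  if i = -1 then actMinusOneG v (1 - μ) P
  else if 0 ≤ i then actG v (i + 1).toNat μ 0 P else actG v (-i - 1).toNat μ 1 P

/-- The formulas for the Chevalley generators. -/
def genCol (v : (ℕ → ℤ → ℂ[X]) → N) : Gen → (ℕ → ℤ → ℂ[X]) → N
  | Gen.e i, P => efCol v 1 i P
  | Gen.f i, P => efCol v 0 i P
  | Gen.h i, P => ((hEigenvalue S.ξ₀ S.ξ₁ P i : ℂ[X]) : R) • v P
  | Gen.c, P => ((S.ξ₀ - S.ξ₁ : ℂ[X]) : R) • v P

lemma map_genCol (φ : N →ₗ[R] N') (v : (ℕ → ℤ → ℂ[X]) → N) (g : Gen) (P : ℕ → ℤ → ℂ[X]) :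
    φ (genCol S v g P) = genCol S (fun Q => φ (v Q)) g P := by
  have h1 : ∀ μ i, φ (efCol v μ i P) = efCol (fun Q => φ (v Q)) μ i P := by
    intro μ i
    unfold efCol
    split_ifs <;> simp [actMinusOneG, actG]
  cases g <;> simp [genCol, h1]

open Classical in
/-- The basis vector of an array of entries, or `0`, as a finite linear combination. -/
def vz (M : ℤ → ℂ[X]) (Q : ℕ → ℤ → ℂ[X]) : CBasis M →₀ R :=
  if h : IsCPattern M Q then Finsupp.single ⟨Q, h⟩ 1 else 0

lemma vz_val (P : CBasis M) : vz M P.1 = Finsupp.single P 1 := dif_pos P.2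

/-- The operators of the Chevalley generators on finite linear combinations of patterns. -/
def gF (g : Gen) : Module.End R (CBasis M →₀ R) :=
  Finsupp.linearCombination R fun P => genCol S (vz M) g P.1

lemma gF_single (g : Gen) (P : CBasis M) :
    gF S g (Finsupp.single P 1) = genCol S (vz M) g P.1 := by
  simp [gF]

/-- The embedding into the space of arrays over the field of fractions. -/
def toArr : (CBasis M →₀ R) →ₗ[R] (Arr →₀ Kh) :=
  Finsupp.linearCombination R fun P => Finsupp.single (S.arrOf P) 1

lemma toArr_single (P : CBasis M) :
    toArr S (Finsupp.single P 1) = Finsupp.single (S.arrOf P) 1 := by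
  simp [toArr]

lemma toArr_apply (x : CBasis M →₀ R) (P : CBasis M) :
    toArr S x (S.arrOf P) = algebraMap R Kh (x P) := by
  classical
  induction x using Finsupp.induction_linear with
  | zero => simp
  | add x y hx hy => rw [map_add, Finsupp.add_apply, hx, hy, Finsupp.add_apply, map_add]
  | single Q c =>
    rw [← Finsupp.smul_single_one, map_smul, toArr_single, Finsupp.smul_apply, Finsupp.single_apply,
      Finsupp.smul_apply, Finsupp.single_apply, S.arrOf_injective.eq_iff]
    split_ifs <;> simp [Algebra.smul_def]

lemma toArr_injective : Function.Injective (toArr S) := by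
  intro x y h
  ext1 P
  apply FaithfulSMul.algebraMap_injective R Kh
  rw [← toArr_apply S, h, toArr_apply]

open Classical in
lemma toArr_vz {Q : ℕ → ℤ → ℂ[X]} :
    toArr S (vz M Q) = if IsCPattern M Q then Finsupp.single (arr S.ξ₁ Q) 1 else 0 := by
  unfold vz
  split_ifs with h
  · exact toArr_single S _
  · simp

lemma neg_one_pow_of_ne {μ ν : ℕ} (hμ : μ ≤ 1) (hν : ν ≤ 1) :
    (-(-1) ^ (μ + ν) : ℤ) = if μ = ν then -1 else 1 := by
  interval_cases μ <;> interval_cases ν <;> norm_num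

lemma toArr_actG (P : CBasis M) {i μ ν p : ℕ} (hp : 2 * i + ν = p + 2) (hμ : μ ≤ 1) (hν : ν ≤ 1) :
    actG (fun Q => toArr S (vz M Q)) i μ ν P.1 =
      (if μ = ν then QD.Y p else QD.X p) (Finsupp.single (S.arrOf P) 1) := by
  classical
  have e1 : 2 * i + ν - 1 = p + 1 := by omega
  rw [actG, e1, hp, sum_row, ← Finset.sum_neg_distrib, neg_one_pow_of_ne hμ hν]
  have hint := S.isIntArr P
  have hi := S.inter P
  have key : ∀ k < p + 1, ∀ a < p + 2,
      -((SS (posn (p + 1) k) (posn (p + 2) a) ν * hsqrt (radicand i μ ν P.1 (posn (p + 1) k)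
        (posn (p + 2) a))) • toArr S (vz M (shift (shift P.1 (posn (p + 1) k) (p + 1)
          (if μ = ν then -1 else 1)) (posn (p + 2) a) (p + 2) (if μ = ν then -1 else 1)))) =
      if μ = ν then (if Inter (S.arrOf P - dl (p + 1) k - dl (p + 2) a) then
          QD.z p k a (S.arrOf P - dl (p + 1) k - dl (p + 2) a) else 0) •
            Finsupp.single (S.arrOf P - dl (p + 1) k - dl (p + 2) a) 1
        else (if Inter (S.arrOf P) then QD.z p k a (S.arrOf P) else 0) •
          Finsupp.single (S.arrOf P + dl (p + 1) k + dl (p + 2) a) (1 : Kh) := by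
    intro k hk a ha
    have hs1 := hint.shift hk (if μ = ν then -1 else 1)
    have hs2 := hs1.shift ha (if μ = ν then -1 else 1)
    rw [toArr_vz, hs2.isCPattern_iff, hs1.arr_shift ha, hint.arr_shift hk,
      hint.radicand_eq hp hμ hν hk ha, ← neg_smul, ← neg_mul, SS_eq hp hν,
      show arr S.ξ₁ P.1 = S.arrOf P from rfl, ← algebraMap_smul Kh]
    have hsg : ∀ Λ : Arr, Inter Λ → algebraMap R Kh (if a ≤ k then 1 else -1) =
        QSqrt.sg (Λ (p + 2) a - Λ (p + 1) k) := by
      intro Λ hΛ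
      have := hΛ.le_iff (p := p + 1) hk ha
      rw [show p + 1 + 1 = p + 2 from rfl] at this
      unfold QSqrt.sg
      simp only [sub_nonneg, this]
      split_ifs <;> simp
    by_cases h : μ = ν
    · simp only [if_pos h, one_smul]
      have e : S.arrOf P + (-1 : ℤ) • dl (p + 1) k + (-1 : ℤ) • dl (p + 2) a =
          S.arrOf P - dl (p + 1) k - dl (p + 2) a := by
        rw [neg_one_smul, neg_one_smul, ← sub_eq_add_neg, ← sub_eq_add_neg]
      rw [e, ← sub_sub]
      generalize hΛ : S.arrOf P - dl (p + 1) k - dl (p + 2) a = Λ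
      have hΛ' : Inter (Λ + dl (p + 1) k + dl (p + 2) a) := by
        rw [← hΛ]
        convert hi using 1
        abel
      by_cases h1 : Inter Λ
      · rw [if_pos h1, if_pos h1, map_mul, hsg Λ h1, (hsqrt_radR hk ha h1 hΛ').1, QSqrt.z]
      · rw [if_neg h1, if_neg h1, smul_zero, zero_smul]
    · simp only [if_neg h, one_smul, zero_smul, sub_zero, if_pos hi]
      by_cases h1 : Inter (S.arrOf P + dl (p + 1) k + dl (p + 2) a)
      · rw [if_pos h1, map_mul, hsg _ hi, (hsqrt_radR hk ha hi h1).1, QSqrt.z]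
      · rw [if_neg h1, smul_zero]
        by_cases hz : QD.z p k a (S.arrOf P) = 0
        · rw [hz, zero_smul]
        · exact absurd (QD.inter_of_z_ne_zero hi hk ha hz) h1
  rw [Finset.sum_congr rfl fun k hk => by
    rw [sum_row, ← Finset.sum_neg_distrib, Finset.sum_congr rfl fun a ha =>
      key k (Finset.mem_range.mp hk) a (Finset.mem_range.mp ha)]]
  by_cases h : μ = ν
  · simp only [if_pos h]
    rw [QSqrt.Y_single]
  · simp only [if_neg h]
    rw [QSqrt.X_single]

lemma toArr_actMinusOneG (P : CBasis M) {μ : ℕ} (hμ : μ ≤ 1) :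
    actMinusOneG (fun Q => toArr S (vz M Q)) μ P.1 =
      (if μ = 0 then QD.dn 0 else QD.up 0) (Finsupp.single (S.arrOf P) 1) := by
  classical
  have hint := S.isIntArr P
  have hi := S.inter P
  have p1 : (0 : ℤ) = posn 1 0 := rfl
  have p2 : (0 : ℤ) = posn 2 1 := rfl
  have p3 : (-1 : ℤ) = posn 2 0 := rfl
  have l1 : LL P.1 (-1) 2 - LL P.1 0 1 = ((S.arrOf P 2 0 - S.arrOf P 1 0 + 1 : ℤ) : ℂ[X]) := by
    have := hint.LL_sub (p := 2) (k := 0) (p' := 1) (k' := 0) (by omega) (by omega)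
    rw [← p3, ← p1] at this
    rw [this]
    simp [SigData.arrOf]
  have l2 : LL P.1 0 1 - LL P.1 0 2 = ((S.arrOf P 1 0 - S.arrOf P 2 1 - 1 : ℤ) : ℂ[X]) := by
    have := hint.LL_sub (p := 1) (k := 0) (p' := 2) (k' := 1) (by omega) (by omega)
    rw [← p2, ← p1] at this
    rw [this]
    simp [SigData.arrOf]
  have hs := hint.shift (p := 1) (k := 0) (by omega) (-(-1) ^ μ)
  have ha := hint.arr_shift (p := 1) (k := 0) (by omega) (-(-1) ^ μ)
  rw [← p1] at hs ha
  have q1 : LL P.1 (-1) 2 - LL P.1 0 1 - (μ : ℂ[X]) =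
      ((S.arrOf P 2 0 - S.arrOf P 1 0 + 1 - μ : ℤ) : ℂ[X]) := by
    rw [l1]
    push_cast
    ring
  have q2 : LL P.1 0 1 - LL P.1 0 2 + (μ : ℂ[X]) =
      ((S.arrOf P 1 0 - S.arrOf P 2 1 - 1 + μ : ℤ) : ℂ[X]) := by
    rw [l2]
    push_cast
    ring
  rw [actMinusOneG, toArr_vz, hs.isCPattern_iff, ha, q1, q2, qbrP_intCast, qbrP_intCast,
    ← algebraMap_smul Kh, show arr S.ξ₁ P.1 = S.arrOf P from rfl]
  interval_cases μ
  · rw [if_pos rfl, show QD.dn 0 = QD.F 0 0 from rfl, QSqrt.F_single, Finset.sum_range_one, zero_add]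
    have e : S.arrOf P + (-(-1) ^ 0 : ℤ) • dl 1 0 = S.arrOf P - dl 1 0 := by
      rw [pow_zero, neg_one_smul, ← sub_eq_add_neg]
    rw [e]
    split_ifs with h
    · have h2 := (hsqrt_node_zero h (by rwa [sub_add_cancel])).1
      rw [QD.cF_of_inter h, ← h2]
      simp only [Pi.zero_apply, zero_mul, neg_zero, zpow_zero, mul_one]
      have a1 : S.arrOf P 2 0 - S.arrOf P 1 0 + 1 - (0 : ℕ) =
          (S.arrOf P - dl 1 0) 2 0 - (S.arrOf P - dl 1 0) 1 0 := by
        simp only [Pi.sub_apply, dl_self, dl_row_ne (show 2 ≠ 1 by omega)]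
        omega
      have a2 : S.arrOf P 1 0 - S.arrOf P 2 1 - 1 + (0 : ℕ) =
          (S.arrOf P - dl 1 0) 1 0 - (S.arrOf P - dl 1 0) 2 1 := by
        simp only [Pi.sub_apply, dl_self, dl_row_ne (show 2 ≠ 1 by omega)]
        omega
      rw [a1, a2]
    · rw [QD.cF_of_not h, zero_smul, smul_zero]
  · rw [if_neg one_ne_zero, show QD.up 0 = QD.E 0 0 from rfl, QSqrt.E_single, Finset.sum_range_one,
      zero_add]
    have e : S.arrOf P + (-(-1) ^ 1 : ℤ) • dl 1 0 = S.arrOf P + dl 1 0 := by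
      rw [pow_one, neg_neg, one_smul]
    rw [e]
    split_ifs with h
    · have h2 := (hsqrt_node_zero hi h).1
      rw [QD.cE_of_inter hi, ← h2]
      simp only [Pi.zero_apply, zero_mul, zpow_zero, mul_one]
      have a1 : S.arrOf P 2 0 - S.arrOf P 1 0 + 1 - (1 : ℕ) = S.arrOf P 2 0 - S.arrOf P 1 0 := by
        omega
      have a2 : S.arrOf P 1 0 - S.arrOf P 2 1 - 1 + (1 : ℕ) = S.arrOf P 1 0 - S.arrOf P 2 1 := by
        omega
      rw [a1, a2]
    · rw [smul_zero]
      by_cases hz : QD.cE 0 0 0 (S.arrOf P) = 0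
      · rw [hz, zero_smul]
      · exact absurd (QD.inter_of_cE_ne_zero (by omega) hz).2 h

lemma IsIntArr.sum_row_eq {ξ : ℂ[X]} {Q : ℕ → ℤ → ℂ[X]} (hQ : IsIntArr M ξ Q) (p : ℕ) :
    ∑ j ∈ row p, Q p j = (p : ℂ[X]) * ξ + ((QSqrt.rsum p (arr ξ Q) : ℤ) : ℂ[X]) := by
  rw [sum_row, Finset.sum_congr rfl fun k hk => hQ.entry (Finset.mem_range.mp hk),
    Finset.sum_add_distrib, QSqrt.rsum]
  simp

lemma hEigenvalue_eq (P : CBasis M) (i : ℤ) : hEigenvalue S.ξ₀ S.ξ₁ P.1 i =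
    ((QSqrt.hval S.c₀ i (S.arrOf P) : ℤ) : ℂ[X]) := by
  have hint := S.isIntArr P
  have h1 : 1 ≤ QSqrt.hrow i := by
    rcases QSqrt.int_cases i with ⟨n, rfl⟩ | ⟨n, rfl⟩
    · rw [QSqrt.hrow_natCast]
      omega
    · rw [QSqrt.hrow_neg]
      omega
  have e : hEigenvalue S.ξ₀ S.ξ₁ P.1 i = ∑ j ∈ row (QSqrt.hrow i), P.1 (QSqrt.hrow i) j -
      ∑ j ∈ row (QSqrt.hrow i - 1), P.1 (QSqrt.hrow i - 1) j +
        (S.ξ₁ - S.ξ₀) * (theta (-i) : ℂ[X]) - S.ξ₁ := rfl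
  rw [e, hint.sum_row_eq, hint.sum_row_eq, QSqrt.hval, SigData.ξ₀, SigData.arrOf, Nat.cast_sub h1]
  push_cast
  ring

lemma coe_intCast (z : ℤ) : (((z : ℂ[X]) : PowerSeries ℂ) : R) = (z : R) := by
  rw [show (z : ℂ[X]) = Polynomial.C (z : ℂ) by simp, Polynomial.coe_C, map_intCast]

/-- The embedding into the space of arrays intertwines the actions of the generators. -/
theorem toArr_gF_single (g : Gen) (P : CBasis M) : toArr S (gF S g (Finsupp.single P 1)) =
    QD.gop S.c₀ g (Finsupp.single (S.arrOf P) 1) := by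
  have hef : ∀ μ : ℕ, μ ≤ 1 → ∀ i : ℤ, efCol (fun Q => toArr S (vz M Q)) μ i P.1 =
      (if (μ = 1 ↔ 0 ≤ i) then QD.up (QSqrt.level i) else QD.dn (QSqrt.level i))
        (Finsupp.single (S.arrOf P) 1) := by
    intro μ hμ i
    unfold efCol
    rcases QSqrt.int_cases i with ⟨n, rfl⟩ | ⟨n, rfl⟩
    · rw [if_neg (by omega), if_pos (by omega), QSqrt.level_natCast,
        toArr_actG S P (p := 2 * n) (by omega) hμ (by omega)]
      interval_cases μ <;> simp [QSqrt.up, QSqrt.dn]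
    · rw [QSqrt.level_neg]
      cases n with
      | zero =>
        rw [if_pos (by simp), toArr_actMinusOneG S P (by omega)]
        interval_cases μ <;> simp
      | succ n =>
        rw [if_neg (by omega), if_neg (by omega),
          toArr_actG S P (p := 2 * n + 1) (by omega) hμ (by omega)]
        interval_cases μ
        · rw [if_neg zero_ne_one, if_pos (by omega)]
          rfl
        · rw [if_pos rfl, if_neg (by omega)]
          rfl
  rw [gF_single, map_genCol]
  cases g with
  | e i =>
    rw [genCol, hef 1 le_rfl, QSqrt.gop]
    simp
  | f i =>
    rw [genCol, hef 0 (by omega), QSqrt.gop]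
    by_cases hi : 0 ≤ i <;> simp [hi]
  | h i =>
    simp only [genCol, QSqrt.gop]
    rw [QSqrt.diagOp_single, hEigenvalue_eq, coe_intCast, vz_val, toArr_single,
      ← algebraMap_smul Kh, map_intCast]
  | c =>
    simp only [genCol, QSqrt.gop]
    rw [QSqrt.diagOp_single, SigData.ξ₀, add_sub_cancel_left, coe_intCast, vz_val, toArr_single,
      ← algebraMap_smul Kh, map_intCast]

lemma toArr_gF (g : Gen) (x : CBasis M →₀ R) :
    toArr S (gF S g x) = QD.gop S.c₀ g (toArr S x) := by
  induction x using Finsupp.induction_linear with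
  | zero => simp
  | add x y hx hy => simp only [map_add, hx, hy]
  | single P c =>
    rw [← Finsupp.smul_single_one, map_smul, map_smul, toArr_gF_single, map_smul, toArr_single,
      ← algebraMap_smul Kh, ← algebraMap_smul Kh c, map_smul]

end

end QuantumAInf

end

noncomputable section

namespace QuantumAInf

open Polynomial

/-! ### The completed module -/

/-- The submodule `h^n N`. -/
def hpow (N : Type*) [AddCommGroup N] [Module R N] (n : ℕ) : Submodule R N :=
  LinearMap.range (LinearMap.lsmul R N (hh ^ n))

section

variable {N N' : Type*} [AddCommGroup N] [Module R N] [AddCommGroup N'] [Module R N']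

lemma mem_hpow {n : ℕ} {x : N} : x ∈ hpow N n ↔ ∃ y, x = hh ^ n • y := by
  simp [hpow, LinearMap.mem_range, eq_comm]

lemma smul_mem_hpow (n : ℕ) (y : N) : hh ^ n • y ∈ hpow N n := mem_hpow.mpr ⟨y, rfl⟩

lemma hpow_zero (x : N) : x ∈ hpow N 0 := mem_hpow.mpr ⟨x, by simp⟩

lemma hpow_anti {m n : ℕ} (h : m ≤ n) {x : N} (hx : x ∈ hpow N n) : x ∈ hpow N m := by
  obtain ⟨y, rfl⟩ := mem_hpow.mp hx
  refine mem_hpow.mpr ⟨hh ^ (n - m) • y, ?_⟩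
  rw [smul_smul, ← pow_add, Nat.add_sub_cancel' h]

lemma map_mem_hpow (T : N →ₗ[R] N') {n : ℕ} {x : N} (hx : x ∈ hpow N n) : T x ∈ hpow N' n := by
  obtain ⟨y, rfl⟩ := mem_hpow.mp hx
  rw [map_smul]
  exact smul_mem_hpow n _

lemma hasHSum_iff {a : ℕ → N} {s : N} :
    HasHSum a s ↔ ∀ n, s - ∑ k ∈ Finset.range n, hh ^ k • a k ∈ hpow N n := by
  simp only [HasHSum, mem_hpow]

lemma HasHSum.map {a : ℕ → N} {s : N} (h : HasHSum a s) (T : N →ₗ[R] N') :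
    HasHSum (fun k => T (a k)) (T s) := by
  rw [hasHSum_iff] at *
  intro n
  have := map_mem_hpow T (h n)
  simpa using this

/-- A module in which an `h`-adic limit is unique. -/
def IsSep (N : Type*) [AddCommGroup N] [Module R N] : Prop :=
  ∀ x : N, (∀ n, x ∈ hpow N n) → x = 0

lemma IsSep.hasHSum_unique (hN : IsSep N) {a : ℕ → N} {s t : N} (hs : HasHSum a s)
    (ht : HasHSum a t) : s = t := by
  rw [hasHSum_iff] at hs ht
  refine sub_eq_zero.mp (hN _ fun n => ?_)
  have := sub_mem (hs n) (ht n)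
  rwa [sub_sub_sub_cancel_right] at this

lemma IsSep.linearMap (hN : IsSep N') : IsSep (N →ₗ[R] N') := by
  intro T hT
  refine LinearMap.ext fun x => hN _ fun n => ?_
  obtain ⟨T', rfl⟩ := mem_hpow.mp (hT n)
  exact smul_mem_hpow n _

lemma hasHSum_succ {a : ℕ → N} {s : N} (h : HasHSum (fun k => a (k + 1)) s) :
    HasHSum a (a 0 + hh • s) := by
  rw [hasHSum_iff] at *
  intro n
  cases n with
  | zero => exact hpow_zero _
  | succ n =>
    obtain ⟨y, hy⟩ := mem_hpow.mp (h n)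
    refine mem_hpow.mpr ⟨y, ?_⟩
    rw [Finset.sum_range_succ', pow_succ', mul_smul, ← hy, smul_sub, Finset.smul_sum]
    simp only [pow_succ', mul_smul, pow_zero, one_smul]
    abel

end

section

variable {M : ℤ → ℂ[X]}

lemma mem_hpow_V {n : ℕ} {v : V M} : v ∈ hpow (V M) n ↔ ∀ P, (PowerSeries.X : R) ^ n ∣ v.1 P := by
  rw [mem_hpow]
  constructor
  · rintro ⟨y, rfl⟩ P
    exact ⟨y.1 P, rfl⟩
  · intro h
    choose w hw using h
    refine ⟨⟨w, fun k => ?_⟩, Subtype.ext (funext hw)⟩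
    refine (v.2 (k + n)).subset fun P hP => ?_
    have : PowerSeries.coeff (k + n) (v.1 P) = PowerSeries.coeff k (w P) := by
      rw [hw, PowerSeries.coeff_X_pow_mul]
    exact fun h0 => hP (this ▸ h0)

lemma isSep_V : IsSep (V M) := by
  intro v hv
  refine Subtype.ext (funext fun P => PowerSeries.ext fun k => ?_)
  have := mem_hpow_V.mp (hv (k + 1)) P
  rw [PowerSeries.X_pow_dvd_iff] at this
  exact this k (by omega)

lemma exists_hasHSum_V (a : ℕ → V M) : ∃ s, HasHSum a s := by
  have hc : ∀ (P : CBasis M) m k, PowerSeries.coeff m ((PowerSeries.X : R) ^ k * (a k).1 P) =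
      if k ≤ m then PowerSeries.coeff (m - k) ((a k).1 P) else 0 :=
    fun P m k => PowerSeries.coeff_X_pow_mul' _ _ _
  have hmem : (fun P => PowerSeries.mk fun m => ∑ k ∈ Finset.range (m + 1),
      PowerSeries.coeff (m - k) ((a k).1 P)) ∈ V M := by
    intro m
    refine ((Finset.range (m + 1)).finite_toSet.biUnion fun k _ => (a k).2 (m - k)).subset
      fun P hP => ?_
    simp only [Set.mem_ofPred_eq, PowerSeries.coeff_mk] at hP
    obtain ⟨k, hk, hk'⟩ := Finset.exists_ne_zero_of_sum_ne_zero hP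
    exact Set.mem_biUnion hk hk'
  refine ⟨⟨_, hmem⟩, ?_⟩
  rw [hasHSum_iff]
  intro n
  rw [mem_hpow_V]
  intro P
  rw [PowerSeries.X_pow_dvd_iff]
  intro m hm
  have e : ((⟨_, hmem⟩ : V M) - ∑ k ∈ Finset.range n, hh ^ k • a k : V M).1 P =
      (PowerSeries.mk fun m => ∑ k ∈ Finset.range (m + 1), PowerSeries.coeff (m - k) ((a k).1 P)) -
        ∑ k ∈ Finset.range n, hh ^ k * (a k).1 P := by
    simp
  rw [e, map_sub, PowerSeries.coeff_mk, map_sum, sub_eq_zero]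
  simp only [hc]
  rw [← Finset.sum_filter]
  congr 1
  ext k
  simp
  omega

/-- Finite linear combinations of basis vectors as elements of `V`. -/
def toV (M : ℤ → ℂ[X]) : (CBasis M →₀ R) →ₗ[R] V M where
  toFun x := ⟨x, fun n => x.hasFiniteSupport.subset fun P hP h0 => hP (by simp [h0])⟩
  map_add' _ _ := rfl
  map_smul' _ _ := rfl

lemma toV_single (P : CBasis M) : toV M (Finsupp.single P 1) = vec P := by
  classical
  refine Subtype.ext (funext fun Q => ?_)
  change (Finsupp.single P 1 : CBasis M →₀ R) Q = (Pi.single P 1 : CBasis M → R) Q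
  rw [Finsupp.single_apply, Pi.single_apply]
  simp only [eq_comm]

lemma toV_vz (Q : ℕ → ℤ → ℂ[X]) : toV M (vz M Q) = vecOrZero M Q := by
  unfold vz vecOrZero
  split_ifs with h
  · exact toV_single _
  · exact map_zero _

lemma isFiniteVec_iff {v : V M} : IsFiniteVec v ↔ ∃ x, toV M x = v := by
  constructor
  · intro h
    exact ⟨Finsupp.ofSupportFinite v.1 h, Subtype.ext rfl⟩
  · rintro ⟨x, rfl⟩
    exact x.hasFiniteSupport

lemma exists_approx (v : V M) (n : ℕ) : ∃ x, v - toV M x ∈ hpow (V M) n := by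
  have hf : {P | (PowerSeries.trunc n (v.1 P) : R) ≠ 0}.Finite := by
    refine ((Finset.range n).finite_toSet.biUnion fun k _ => v.2 k).subset fun P hP => ?_
    by_contra h
    simp only [Set.mem_iUnion, not_exists, Set.mem_ofPred_eq, not_not] at h
    refine hP ?_
    ext k
    rw [Polynomial.coeff_coe, PowerSeries.coeff_trunc]
    split_ifs with hk
    · exact h k (by simpa using hk)
    · rfl
  refine ⟨Finsupp.ofSupportFinite _ hf, mem_hpow_V.mpr fun P => ?_⟩
  rw [PowerSeries.X_pow_dvd_iff]
  intro m hm
  have e : (v - toV M (Finsupp.ofSupportFinite _ hf)).1 P =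
      v.1 P - (PowerSeries.trunc n (v.1 P) : R) := rfl
  rw [e, map_sub, Polynomial.coeff_coe, PowerSeries.coeff_trunc, if_pos hm, sub_self]

lemma toV_mem_hpow {x : CBasis M →₀ R} {n : ℕ} (h : toV M x ∈ hpow (V M) n) :
    ∃ z, x = hh ^ n • z := by
  obtain ⟨y, hy⟩ := mem_hpow.mp h
  have hy' : ∀ P, x P = hh ^ n * y.1 P := fun P => congrFun (congrArg Subtype.val hy) P
  have hf : {P | y.1 P ≠ 0}.Finite := x.hasFiniteSupport.subset fun P hP => by
    rw [Function.mem_support, hy']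
    exact mul_ne_zero (pow_ne_zero _ PowerSeries.X_ne_zero) hP
  exact ⟨Finsupp.ofSupportFinite y.1 hf, Finsupp.ext hy'⟩

variable {N : Type*} [AddCommGroup N] [Module R N]

/-- Linear maps on `V` that agree on the basis are equal. -/
lemma linearMap_ext_of_toV (hN : IsSep N) {T T' : V M →ₗ[R] N}
    (h : ∀ x, T (toV M x) = T' (toV M x)) : T = T' := by
  refine LinearMap.ext fun v => sub_eq_zero.mp (hN _ fun n => ?_)
  obtain ⟨x, hx⟩ := exists_approx v n
  have := map_mem_hpow (T - T') hx
  simpa [h] using this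

lemma linearMap_ext_of_vec (hN : IsSep N) {T T' : V M →ₗ[R] N}
    (h : ∀ P, T (vec P) = T' (vec P)) : T = T' := by
  refine linearMap_ext_of_toV hN fun x => ?_
  have : T.comp (toV M) = T'.comp (toV M) := by
    refine Finsupp.lhom_ext' fun P => LinearMap.ext_ring ?_
    simp only [LinearMap.comp_apply, Finsupp.lsingle_apply, toV_single, h]
  exact LinearMap.congr_fun this x

/-- A linear map on the finite linear combinations extends to `V`. -/
lemma exists_extension (L : (CBasis M →₀ R) →ₗ[R] V M) :
    ∃ T : Module.End R (V M), ∀ x, T (toV M x) = L x := by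
  have key : ∀ v : V M, ∃ s : V M, ∀ n x, v - toV M x ∈ hpow (V M) n → s - L x ∈ hpow (V M) n := by
    intro v
    choose x' hx' using exists_approx v
    set x : ℕ → CBasis M →₀ R := fun n => if n = 0 then 0 else x' n with hxdef
    have hx : ∀ n, v - toV M (x n) ∈ hpow (V M) n := by
      intro n
      by_cases h : n = 0
      · subst h
        exact hpow_zero _
      · simp only [hxdef, if_neg h]
        exact hx' n
    have hz : ∀ n, ∃ z, x (n + 1) - x n = hh ^ n • z := by
      intro n
      refine toV_mem_hpow ?_
      have := sub_mem (hx n) (hpow_anti (Nat.le_succ n) (hx (n + 1)))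
      rwa [sub_sub_sub_cancel_left, ← map_sub] at this
    choose z hz using hz
    obtain ⟨s, hs⟩ := exists_hasHSum_V fun k => L (z k)
    rw [hasHSum_iff] at hs
    have hsum : ∀ n, ∑ k ∈ Finset.range n, hh ^ k • L (z k) = L (x n) := by
      intro n
      simp only [← map_smul, ← hz, ← map_sum]
      rw [Finset.sum_range_sub]
      simp [hxdef]
    refine ⟨s, fun n y hy => ?_⟩
    have h1 := hs n
    rw [hsum] at h1
    have h2 := sub_mem hy (hx n)
    rw [sub_sub_sub_cancel_left, ← map_sub] at h2
    obtain ⟨w, hw⟩ := toV_mem_hpow h2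
    have h3 : L (x n) - L y ∈ hpow (V M) n := by
      rw [← map_sub, hw, map_smul]
      exact smul_mem_hpow n _
    have := add_mem h1 h3
    rwa [sub_add_sub_cancel] at this
  choose T hT using key
  refine ⟨{ toFun := T, map_add' := fun v w => ?_, map_smul' := fun c v => ?_ }, fun x => ?_⟩
  · refine sub_eq_zero.mp (isSep_V _ fun n => ?_)
    obtain ⟨x, hx⟩ := exists_approx v n
    obtain ⟨y, hy⟩ := exists_approx w n
    have h1 := hT (v + w) n (x + y) (by
      rw [map_add, add_sub_add_comm]
      exact add_mem hx hy)
    have h2 := add_mem (hT v n x hx) (hT w n y hy)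
    rw [map_add] at h1
    have := sub_mem h1 h2
    rwa [← add_sub_add_comm, sub_sub_sub_cancel_right] at this
  · refine sub_eq_zero.mp (isSep_V _ fun n => ?_)
    obtain ⟨x, hx⟩ := exists_approx v n
    have h0 : c • v - toV M (c • x) = c • (v - toV M x) := by
      rw [map_smul]
      exact (smul_sub c v _).symm
    have h1 := hT (c • v) n (c • x) (h0 ▸ Submodule.smul_mem _ c hx)
    have h2 := Submodule.smul_mem _ c (hT v n x hx)
    have h3 : c • (T v - L x) = c • T v - L (c • x) := by
      rw [map_smul]
      exact smul_sub c _ _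
    have := sub_mem h1 (h3 ▸ h2)
    rwa [sub_sub_sub_cancel_right] at this
  · refine sub_eq_zero.mp (isSep_V _ fun n => ?_)
    exact hT _ n x (by rw [sub_self]; exact zero_mem _)

/-- The continuous extension of a linear map on the finite linear combinations. -/
def ext (L : (CBasis M →₀ R) →ₗ[R] V M) : Module.End R (V M) := (exists_extension L).choose

lemma ext_toV (L : (CBasis M →₀ R) →ₗ[R] V M) (x : CBasis M →₀ R) : ext L (toV M x) = L x :=
  (exists_extension L).choose_spec x

end

end QuantumAInf

end

noncomputable section

namespace QuantumAInf

open Polynomial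

/-! ### Continuous homomorphisms out of the completed free algebra -/

section

variable {B : Type*} [Ring B] [Algebra R B]

lemma exists_freeAlgebraHom (G : Gen → B) : ∃ φ : FreeAlgebra ℂ Gen →+* B,
    (∀ g, φ (FreeAlgebra.ι ℂ g) = G g) ∧
      ∀ c, φ (algebraMap ℂ _ c) = algebraMap R B (PowerSeries.C c) := by
  let _ : Algebra ℂ B := Algebra.compHom B (PowerSeries.C : ℂ →+* R)
  exact ⟨(FreeAlgebra.lift ℂ G : FreeAlgebra ℂ Gen →ₐ[ℂ] B), fun g => FreeAlgebra.lift_ι_apply G g,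
    fun c => AlgHom.commutes _ c⟩

lemma mul_mem_hpow_left {n : ℕ} {x : B} (y : B) (hx : x ∈ hpow B n) : y * x ∈ hpow B n := by
  obtain ⟨z, rfl⟩ := mem_hpow.mp hx
  rw [mul_smul_comm]
  exact smul_mem_hpow n _

lemma mul_mem_hpow_right {n : ℕ} {x : B} (y : B) (hx : x ∈ hpow B n) : x * y ∈ hpow B n := by
  obtain ⟨z, rfl⟩ := mem_hpow.mp hx
  rw [smul_mul_assoc]
  exact smul_mem_hpow n _

lemma smul_mem_hpow_succ {n : ℕ} {x : B} (hx : x ∈ hpow B n) : hh • x ∈ hpow B (n + 1) := by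
  obtain ⟨z, rfl⟩ := mem_hpow.mp hx
  rw [smul_smul, ← pow_succ']
  exact smul_mem_hpow _ _

lemma exists_freeTopHom (hB : IsSep B) (hc : ∀ a : ℕ → B, ∃ T, HasHSum a T)
    (φ : FreeAlgebra ℂ Gen →+* B)
    (hφ : ∀ c, φ (algebraMap ℂ _ c) = algebraMap R B (PowerSeries.C c)) :
    ∃ Φ : FreeTop →ₐ[R] B, ∀ x, HasHSum (fun k => φ (PowerSeries.coeff k x)) (Φ x) := by
  choose Φ hΦ using fun x : FreeTop => hc fun k => φ (PowerSeries.coeff k x)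
  have step : ∀ a x, Φ (PowerSeries.X * x + PowerSeries.C a) = φ a + hh • Φ x := by
    intro a x
    refine hB.hasHSum_unique (hΦ _) ?_
    have h := hasHSum_succ (a := fun k => φ (PowerSeries.coeff k (PowerSeries.X * x + PowerSeries.C a)))
      (s := Φ x) (by simpa using hΦ x)
    simpa using h
  have add : ∀ x y, Φ (x + y) = Φ x + Φ y := fun x y => by
    refine hB.hasHSum_unique (hΦ _) ?_
    simpa using (hΦ x).add (hΦ y)
  have zero : Φ 0 = 0 := by simpa using add 0 0
  have hC : ∀ a, Φ (PowerSeries.C a) = φ a := fun a => by simpa [zero] using step a 0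
  have hX : ∀ x, Φ (PowerSeries.X * x) = hh • Φ x := fun x => by simpa using step 0 x
  have dec : ∀ x : FreeTop, ∃ a x', x = PowerSeries.X * x' + PowerSeries.C a := fun x =>
    ⟨_, _, PowerSeries.eq_X_mul_shift_add_const x⟩
  have mul : ∀ n x y, Φ (x * y) - Φ x * Φ y ∈ hpow B n := by
    intro n
    induction n with
    | zero => exact fun x y => hpow_zero _
    | succ n ih =>
      intro x y
      obtain ⟨a, x', rfl⟩ := dec x
      obtain ⟨b, y', rfl⟩ := dec y
      have e : (PowerSeries.X * x' + PowerSeries.C a) * (PowerSeries.X * y' + PowerSeries.C b) =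
          PowerSeries.X * (x' * (PowerSeries.X * y' + PowerSeries.C b) + PowerSeries.C a * y') +
            PowerSeries.C (a * b) := by
        rw [add_mul, mul_add (PowerSeries.C a), ← mul_assoc (PowerSeries.C a),
          (PowerSeries.commute_X (PowerSeries.C a)).eq, map_mul, mul_add PowerSeries.X]
        simp only [mul_assoc, add_assoc]
      rw [e, step, add, step, map_mul]
      have h1 := smul_mem_hpow_succ (ih x' (PowerSeries.X * y' + PowerSeries.C b))
      have h2 := smul_mem_hpow_succ (ih (PowerSeries.C a) y')
      have := add_mem h1 h2
      rw [step, hC] at this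
      convert this using 1
      simp only [add_mul, mul_add, smul_add, smul_sub, smul_mul_assoc, mul_smul_comm]
      rw [step]
      simp only [mul_add, smul_add, mul_smul_comm]
      abel
  have hR : ∀ n (r : R), Φ (PowerSeries.map (algebraMap ℂ _) r) - algebraMap R B r ∈ hpow B n := by
    intro n
    induction n with
    | zero => exact fun r => hpow_zero _
    | succ n ih =>
      intro r
      obtain ⟨c, r', rfl⟩ : ∃ c r', r = PowerSeries.X * r' + PowerSeries.C c :=
        ⟨_, _, PowerSeries.eq_X_mul_shift_add_const r⟩
      rw [map_add, map_mul, PowerSeries.map_X, PowerSeries.map_C, step, hφ, map_add, map_mul]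
      have := smul_mem_hpow_succ (ih r')
      convert this using 1
      rw [smul_sub, Algebra.smul_def hh (algebraMap R B r')]
      abel
  have hR' : ∀ r : R, Φ (algebraMap R FreeTop r) = algebraMap R B r := fun r =>
    sub_eq_zero.mp (hB _ fun n => hR n r)
  refine ⟨{
    toFun := Φ
    map_one' := ?_
    map_mul' := fun x y => sub_eq_zero.mp (hB _ fun n => mul n x y)
    map_zero' := zero
    map_add' := add
    commutes' := hR' }, hΦ⟩
  have := hR' 1
  rwa [map_one, map_one] at this

lemma algebraMap_X_pow (n : ℕ) : algebraMap R FreeTop (hh ^ n) = PowerSeries.X ^ n :=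
  show PowerSeries.map (algebraMap ℂ (FreeAlgebra ℂ Gen)) (hh ^ n) = _ by simp

/-- Homomorphisms that kill the relators factor through `U_h(a_∞)`. -/
lemma exists_lift (hB : IsSep B) (Φ : FreeTop →ₐ[R] B) (h : ∀ x, IsRelator x → Φ x = 0) :
    ∃ ρ : Uh →ₐ[R] B, ∀ x, ρ (relIdeal.ringCon.mk' x) = Φ x := by
  have key : ∀ x ∈ relIdeal, Φ x = 0 := by
    intro x hx
    refine hB _ fun n => ?_
    let J : TwoSidedIdeal FreeTop := TwoSidedIdeal.mk' {x | Φ x ∈ hpow B n}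
      (by simp) (fun {x y} hx hy => by
        rw [Set.mem_ofPred_eq, map_add]; exact add_mem hx hy)
      (fun {x} hx => by rw [Set.mem_ofPred_eq, map_neg]; exact neg_mem hx)
      (fun {x y} hy => by rw [Set.mem_ofPred_eq, map_mul]; exact mul_mem_hpow_left _ hy)
      (fun {x y} hx => by rw [Set.mem_ofPred_eq, map_mul]; exact mul_mem_hpow_right _ hx)
    have hJ : ∀ x, x ∈ J ↔ Φ x ∈ hpow B n := fun x => TwoSidedIdeal.mem_mk' ..
    have hle : TwoSidedIdeal.span ({x | IsRelator x} ∪ {(PowerSeries.X : FreeTop) ^ n}) ≤ J := by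
      rw [TwoSidedIdeal.span_le]
      rintro y (hy | hy)
      · rw [SetLike.mem_coe, hJ, h y hy]
        exact zero_mem _
      · rw [Set.mem_singleton_iff] at hy
        subst hy
        rw [SetLike.mem_coe, hJ, ← algebraMap_X_pow, AlgHom.commutes, Algebra.algebraMap_eq_smul_one]
        exact smul_mem_hpow n _
    exact (hJ x).mp (hle ((TwoSidedIdeal.mem_iInf (R := FreeTop)).mp hx n))
  refine ⟨RingCon.liftₐ (R := R) relIdeal.ringCon Φ fun x y hxy => ?_, fun x => rfl⟩
  have := key _ ((TwoSidedIdeal.rel_iff _ _ _).mp hxy)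
  rw [map_sub, sub_eq_zero] at this
  exact this

end

section

variable {N : Type*} [AddCommGroup N] [Module R N]

lemma hasHSum_C_smul (c : ℕ → ℂ) (v : N) :
    HasHSum (fun k => (PowerSeries.C (c k) : R) • v) ((PowerSeries.mk c : R) • v) := by
  have h : HasHSum (fun k => (PowerSeries.C (c k) : R)) (PowerSeries.mk c : R) := by
    have all : ∀ n (c : ℕ → ℂ), (PowerSeries.mk c : R) =
        ∑ k ∈ Finset.range n, hh ^ k • PowerSeries.C (c k) +
          hh ^ n • (PowerSeries.mk fun k => c (k + n)) := by
      intro n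
      induction n with
      | zero => intro c; simp
      | succ n ih =>
        intro c
        have := PowerSeries.eq_X_mul_shift_add_const (PowerSeries.mk fun k => c (k + n))
        rw [ih c, this, Finset.sum_range_succ]
        simp only [PowerSeries.coeff_mk, smul_eq_mul, mul_add, pow_succ, add_right_comm _ 1 n,
          ← PowerSeries.coeff_zero_eq_constantCoeff_apply, zero_add, mul_assoc]
        simp only [add_assoc]
        ring
    exact fun n => ⟨_, sub_eq_of_eq_add' (all n c)⟩
  exact h.map (LinearMap.toSpanSingleton R N v)

lemma IsSep.end (hN : IsSep N) :
    @IsSep (Module.End R N) Ring.toAddCommGroup Algebra.toModule := hN.linearMap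

lemma exists_pointwise_hasHSum (hN : IsSep N) (hc : ∀ a : ℕ → N, ∃ s, HasHSum a s)
    (b : ℕ → Module.End R N) :
    ∃ T : Module.End R N, ∀ v, HasHSum (fun k => b k v) (T v) := by
  choose s hs using fun v : N => hc fun k => b k v
  refine ⟨{ toFun := s, map_add' := fun v w => ?_, map_smul' := fun c v => ?_ }, hs⟩
  · refine hN.hasHSum_unique (hs _) ?_
    simpa using (hs v).add (hs w)
  · refine hN.hasHSum_unique (hs _) ?_
    simpa using (hs v).smul c

lemma exists_hasHSum_end (hN : IsSep N) (hc : ∀ a : ℕ → N, ∃ s, HasHSum a s)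
    (a : ℕ → Module.End R N) :
    ∃ T, @HasHSum (Module.End R N) Ring.toAddCommGroup Algebra.toModule a T := by
  choose T hT using exists_pointwise_hasHSum hN hc
  have step : ∀ b, T b = b 0 + hh • T (fun k => b (k + 1)) := fun b => LinearMap.ext fun v =>
    hN.hasHSum_unique (hT b v)
      (hasHSum_succ (a := fun k => b k v) (hT (fun k => b (k + 1)) v))
  have all : ∀ n b, T b = ∑ k ∈ Finset.range n, hh ^ k • b k + hh ^ n • T fun k => b (k + n) := by
    intro n
    induction n with
    | zero => intro b; simp
    | succ n ih =>
      intro b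
      rw [ih b, step fun k => b (k + n), Finset.sum_range_succ, smul_add, zero_add, smul_smul,
        ← pow_succ, add_assoc]
      simp only [add_right_comm _ 1 n, add_assoc]
  exact ⟨T a, fun n => ⟨_, sub_eq_of_eq_add' (all n a)⟩⟩

/-- A family of operators on a separated complete module extends to a continuous action of the
completed free algebra. -/
lemma exists_freeRep (hN : IsSep N) (hc : ∀ a : ℕ → N, ∃ s, HasHSum a s)
    (G : Gen → Module.End R N) : ∃ (φ : FreeAlgebra ℂ Gen →+* Module.End R N)
    (Φ : FreeTop →ₐ[R] Module.End R N),
    (∀ c, φ (algebraMap ℂ _ c) = algebraMap R _ (PowerSeries.C c)) ∧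
    (∀ g, φ (FreeAlgebra.ι ℂ g) = G g) ∧
    (∀ x v, HasHSum (fun k => φ (PowerSeries.coeff k x) v) (Φ x v)) ∧ ∀ g, Φ (gen g) = G g := by
  obtain ⟨φ, hφg, hφ⟩ := exists_freeAlgebraHom G
  obtain ⟨Φ, hΦ⟩ := exists_freeTopHom hN.end (exists_hasHSum_end hN hc) φ hφ
  refine ⟨φ, Φ, hφ, hφg, fun x v => (hΦ x).map (LinearMap.applyₗ v : Module.End R N →ₗ[R] N),
    fun g => ?_⟩
  refine hN.end.hasHSum_unique (hΦ _) ?_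
  have := hasHSum_succ (a := fun k => φ (PowerSeries.coeff k (gen g))) (s := 0) (by
    intro n
    exact ⟨0, by simp [gen]⟩)
  simpa [gen, hφg] using this

variable (hN : IsSep N) {φ : FreeAlgebra ℂ Gen →+* Module.End R N}
  (hφ : ∀ c, φ (algebraMap ℂ _ c) = algebraMap R _ (PowerSeries.C c))
  {Φ : FreeTop →ₐ[R] Module.End R N}
  (hΦ : ∀ x v, HasHSum (fun k => φ (PowerSeries.coeff k x) v) (Φ x v))

include hN hΦ in
lemma apply_eq_smul {x : FreeTop} {v : N} {c : ℕ → ℂ}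
    (h : ∀ k, φ (PowerSeries.coeff k x) v = (PowerSeries.C (c k) : R) • v) :
    Φ x v = (PowerSeries.mk c : R) • v := by
  refine hN.hasHSum_unique (hΦ x v) ?_
  simp only [h]
  exact hasHSum_C_smul c v

include hN hφ hΦ in
/-- The quantum bracket of an element with an eigenvector. -/
lemma qbr_apply {a : FreeAlgebra ℂ Gen} {v : N} {z : ℂ} (h : φ a v = (PowerSeries.C z : R) • v) :
    Φ (qbr (PowerSeries.C a)) v = qbr (PowerSeries.C z : R) • v := by
  have hpow' : ∀ (a : FreeAlgebra ℂ Gen) (z : ℂ), φ a v = (PowerSeries.C z : R) • v → ∀ n : ℕ,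
      φ (a ^ n) v = (PowerSeries.C (z ^ n) : R) • v := by
    intro a z h n
    induction n with
    | zero => simp
    | succ n ih =>
      rw [pow_succ, map_mul, Module.End.mul_apply, h, map_smul, ih, smul_smul, ← map_mul, pow_succ,
        mul_comm]
  have hneg : φ (-a) v = (PowerSeries.C (-z) : R) • v := by
    rw [map_neg, LinearMap.neg_apply, h, map_neg, neg_smul]
  have hsm : ∀ (c : ℂ) (b : FreeAlgebra ℂ Gen) (y : ℂ), φ b v = (PowerSeries.C y : R) • v →
      φ (c • b) v = (PowerSeries.C (c • y) : R) • v := by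
    intro c b y hb
    rw [Algebra.smul_def, map_mul, hφ, Module.End.mul_apply, hb, Module.algebraMap_end_apply,
      smul_smul, ← map_mul, smul_eq_mul]
  have h1 : Φ (PowerSeries.mk fun n => PowerSeries.coeff (n + 1)
      (qpow (PowerSeries.C a) - qpow (-PowerSeries.C a))) v =
        (PowerSeries.mk fun n => PowerSeries.coeff (n + 1)
          (qpow (PowerSeries.C z : R) - qpow (-PowerSeries.C z : R))) • v := by
    refine apply_eq_smul hN hΦ fun k => ?_
    rw [PowerSeries.coeff_mk, ← map_neg, ← map_neg, map_sub, map_sub (PowerSeries.coeff (k + 1)),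
      coeff_qpow_C, coeff_qpow_C, coeff_qpow_C, coeff_qpow_C, map_sub, LinearMap.sub_apply, hsm _ _ _ (hpow' _ _ h _),
      hsm _ _ _ (hpow' _ _ hneg _), ← sub_smul, ← map_sub]
  have h2 : qbr (PowerSeries.C a) = (PowerSeries.mk fun n => PowerSeries.coeff (n + 1)
      (qpow (PowerSeries.C a) - qpow (-PowerSeries.C a))) * algebraMap R FreeTop den⁻¹ := rfl
  have h3 : qbr (PowerSeries.C z : R) = (PowerSeries.mk fun n => PowerSeries.coeff (n + 1)
      (qpow (PowerSeries.C z : R) - qpow (-PowerSeries.C z : R))) * den⁻¹ := by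
    rw [qbr, show algebraMap ℂ ℂ = RingHom.id ℂ from rfl, PowerSeries.map_id]
    rfl
  rw [h2, map_mul, AlgHom.commutes, Module.End.mul_apply, Module.algebraMap_end_apply, map_smul, h1,
    smul_smul, h3, mul_comm]

lemma exists_lift_end (hN : IsSep N) (Φ : FreeTop →ₐ[R] Module.End R N)
    (h : ∀ x, IsRelator x → Φ x = 0) :
    ∃ ρ : Uh →ₐ[R] Module.End R N, ∀ g, ρ (ug g) = Φ (gen g) := by
  obtain ⟨ρ, hρ⟩ := exists_lift hN.end Φ h
  exact ⟨ρ, fun g => hρ _⟩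

end

end QuantumAInf

end

noncomputable section

namespace QuantumAInf

open Polynomial

/-! ### The representation of `U_h(a_∞)` -/

lemma neg_zsmul_add_zsmul {N : Type*} [AddCommGroup N] (z : ℤ) (y : N) : (-z) • y + z • y = 0 := by
  rw [neg_zsmul, neg_add_cancel]

lemma intCast_smul_combine {N : Type*} [AddCommGroup N] [Module R N] (a b n c : ℤ) (v : N) :
    (a : R) • v - (b : R) • v + n • (c : R) • v = ((a - b + n * c : ℤ) : R) • v := by
  rw [← sub_smul, ← Int.cast_smul_eq_zsmul R, smul_smul, ← add_smul]
  push_cast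
  rfl

section

variable {M : ℤ → ℂ[X]} (S : SigData M)

instance : CharZero R := charZero_of_injective_algebraMap (PowerSeries.C_injective (R := ℂ))

instance : CharZero Kh := charZero_of_injective_algebraMap (FaithfulSMul.algebraMap_injective R Kh)

lemma toArr_smul (r : R) (x : CBasis M →₀ R) : toArr S (r • x) = algebraMap R Kh r • toArr S x := by
  rw [map_smul, algebraMap_smul]

lemma gF_comm {g g' : Gen} (h : QD.gop S.c₀ g * QD.gop S.c₀ g' = QD.gop S.c₀ g' * QD.gop S.c₀ g)
    (x : CBasis M →₀ R) : gF S g (gF S g' x) = gF S g' (gF S g x) := by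
  apply toArr_injective S
  simp only [toArr_gF]
  exact LinearMap.congr_fun h _

lemma qpow_neg_one : algebraMap R Kh (qpow (-1 : R)) = qK⁻¹ := by
  have h := algebraMap_qpow (-1)
  rw [zpow_neg_one] at h
  rw [← h]
  simp

lemma gF_serre {g g' : Gen} (h : serreL QD.q (QD.gop S.c₀ g) (QD.gop S.c₀ g') = 0)
    (x : CBasis M →₀ R) : gF S g (gF S g (gF S g' x)) -
      (qpow (1 : R) + qpow (-1 : R)) • gF S g (gF S g' (gF S g x)) + gF S g' (gF S g (gF S g x)) = 0 := by
  apply toArr_injective S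
  rw [map_add, map_sub, toArr_smul, map_add, qpow_neg_one]
  simp only [toArr_gF]
  have := LinearMap.congr_fun h (toArr S x)
  rw [map_zero]
  exact this

lemma gF_h_single (i : ℤ) (P : CBasis M) : gF S (Gen.h i) (Finsupp.single P 1) =
    (QSqrt.hval S.c₀ i (S.arrOf P) : R) • Finsupp.single P 1 := by
  rw [gF_single, genCol, hEigenvalue_eq, coe_intCast, vz_val]

lemma gF_c (x : CBasis M →₀ R) : gF S Gen.c x = (S.c₀ : R) • x := by
  have : gF S Gen.c = (S.c₀ : R) • LinearMap.id := by
    refine Finsupp.lhom_ext' fun P => LinearMap.ext_ring ?_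
    rw [LinearMap.comp_apply, LinearMap.comp_apply, Finsupp.lsingle_apply, gF_single, genCol,
      SigData.ξ₀, add_sub_cancel_left, coe_intCast, vz_val]
    rfl
  rw [this]
  rfl

lemma gF_h_weight {g : Gen} {i z : ℤ}
    (h : QD.gop S.c₀ (Gen.h i) * QD.gop S.c₀ g - QD.gop S.c₀ g * QD.gop S.c₀ (Gen.h i) =
      z • QD.gop S.c₀ g) (x : CBasis M →₀ R) :
    gF S (Gen.h i) (gF S g x) - gF S g (gF S (Gen.h i) x) = z • gF S g x := by
  apply toArr_injective S
  rw [map_sub, map_zsmul]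
  simp only [toArr_gF]
  exact LinearMap.congr_fun h _

lemma gF_e_f (i : ℤ) (P : CBasis M) :
    gF S (Gen.e i) (gF S (Gen.f i) (Finsupp.single P 1)) -
      gF S (Gen.f i) (gF S (Gen.e i) (Finsupp.single P 1)) =
    qint (QSqrt.hval S.c₀ i (S.arrOf P) - QSqrt.hval S.c₀ (i + 1) (S.arrOf P) +
      (theta (-i) - theta (-i - 1)) * S.c₀) • Finsupp.single P 1 := by
  apply toArr_injective S
  rw [map_sub, toArr_smul, ← QD_br]
  simp only [toArr_gF, toArr_single]
  exact QD.gop_e_f S.c₀ i (S.inter P)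

lemma apply_relator {φ : FreeAlgebra ℂ Gen →+* Module.End R (V M)}
    (hφ : ∀ c, φ (algebraMap ℂ _ c) = algebraMap R _ (PowerSeries.C c))
    (hg0 : ∀ g x, φ (FreeAlgebra.ι ℂ g) (toV M x) = toV M (gF S g x))
    {Φ : FreeTop →ₐ[R] Module.End R (V M)}
    (hΦ : ∀ x v, HasHSum (fun k => φ (PowerSeries.coeff k x) v) (Φ x v))
    (hg : ∀ g x, Φ (gen g) (toV M x) = toV M (gF S g x)) (x : FreeTop) (hx : IsRelator x) :
    Φ x = 0 := by
  refine linearMap_ext_of_vec isSep_V fun P => ?_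
  rw [← toV_single, LinearMap.zero_apply]
  cases hx with
  | c_e i =>
    simp only [map_sub, map_mul, LinearMap.sub_apply, Module.End.mul_apply, hg]
    rw [gF_comm S (QD.gop_c_comm _ _), sub_self]
  | c_f i =>
    simp only [map_sub, map_mul, LinearMap.sub_apply, Module.End.mul_apply, hg]
    rw [gF_comm S (QD.gop_c_comm _ _), sub_self]
  | c_h i =>
    simp only [map_sub, map_mul, LinearMap.sub_apply, Module.End.mul_apply, hg]
    rw [gF_comm S (QD.gop_c_comm _ _), sub_self]
  | h_h i j =>
    simp only [map_sub, map_mul, LinearMap.sub_apply, Module.End.mul_apply, hg]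
    rw [gF_comm S (QD.gop_h_h _ _ _), sub_self]
  | h_e i j =>
    rw [map_sub, map_sub, map_mul, map_mul, map_zsmul, LinearMap.sub_apply, LinearMap.sub_apply,
      Module.End.mul_apply, Module.End.mul_apply, LinearMap.smul_apply]
    simp only [hg]
    rw [← map_sub, gF_h_weight S (QD.gop_h_e _ _ _), map_zsmul, sub_self]
  | h_f i j =>
    have := gF_h_weight S (g := Gen.f j) (i := i)
      (z := -((if i = j then 1 else 0) - (if i = j + 1 then 1 else 0) : ℤ))
      ((QD.gop_h_f _ _ _).trans (neg_zsmul (α := Module.End Kh (Arr →₀ Kh)) _ _).symm)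
      (Finsupp.single P 1)
    rw [map_add, map_sub, map_mul, map_mul, map_zsmul, LinearMap.add_apply, LinearMap.sub_apply,
      Module.End.mul_apply, Module.End.mul_apply, LinearMap.smul_apply]
    simp only [hg]
    rw [← map_sub, this, map_zsmul]
    exact neg_zsmul_add_zsmul _ _
  | e_f i =>
    have ha : gen (Gen.h i) - gen (Gen.h (i + 1)) + (theta (-i) - theta (-i - 1)) • gen Gen.c =
        PowerSeries.C (FreeAlgebra.ι ℂ (Gen.h i) - FreeAlgebra.ι ℂ (Gen.h (i + 1)) +
          (theta (-i) - theta (-i - 1)) • FreeAlgebra.ι ℂ Gen.c) := by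
      simp only [gen, map_add, map_sub, map_zsmul]
    have hv := qbr_apply isSep_V hφ hΦ (a := FreeAlgebra.ι ℂ (Gen.h i) -
        FreeAlgebra.ι ℂ (Gen.h (i + 1)) + (theta (-i) - theta (-i - 1)) • FreeAlgebra.ι ℂ Gen.c)
      (v := toV M (Finsupp.single P 1)) (z := ((QSqrt.hval S.c₀ i (S.arrOf P) -
        QSqrt.hval S.c₀ (i + 1) (S.arrOf P) + (theta (-i) - theta (-i - 1)) * S.c₀ : ℤ) : ℂ)) (by
      rw [map_add, map_sub, map_zsmul, LinearMap.add_apply, LinearMap.sub_apply,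
        LinearMap.smul_apply, hg0, hg0, hg0, gF_h_single, gF_h_single, gF_c, map_intCast]
      simp only [map_smul]
      exact intCast_smul_combine _ _ _ _ _)
    rw [ha, map_sub, map_sub, map_mul, map_mul, LinearMap.sub_apply, LinearMap.sub_apply, hv]
    simp only [Module.End.mul_apply, hg]
    rw [← map_sub, gF_e_f, ← map_smul]
    exact sub_self _
  | e_f_ne i j hij =>
    simp only [map_sub, map_mul, LinearMap.sub_apply, Module.End.mul_apply, hg]
    rw [gF_comm S (QD.gop_e_f_ne _ hij), sub_self]
  | e_e i j hij =>
    simp only [map_sub, map_mul, LinearMap.sub_apply, Module.End.mul_apply, hg]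
    rw [gF_comm S (QD.gop_e_e _ hij), sub_self]
  | f_f i j hij =>
    simp only [map_sub, map_mul, LinearMap.sub_apply, Module.End.mul_apply, hg]
    rw [gF_comm S (QD.gop_f_f _ hij), sub_self]
  | e_serre i j hij =>
    rw [map_add, map_sub, map_smul]
    simp only [pow_two, map_mul, LinearMap.sub_apply, LinearMap.add_apply, LinearMap.smul_apply,
      Module.End.mul_apply, hg]
    rw [← map_smul, ← map_sub, ← map_add, gF_serre S (QD.gop_e_serre _ hij), map_zero]
  | f_serre i j hij =>
    rw [map_add, map_sub, map_smul]
    simp only [pow_two, map_mul, LinearMap.sub_apply, LinearMap.add_apply, LinearMap.smul_apply,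
      Module.End.mul_apply, hg]
    rw [← map_smul, ← map_sub, ← map_add, gF_serre S (QD.gop_f_serre _ hij), map_zero]

lemma exists_rep : ∃ ρ₀ : Uh →ₐ[R] Module.End R (V M),
    ∀ g x, ρ₀ (ug g) (toV M x) = toV M (gF S g x) := by
  obtain ⟨φ, Φ, hφ, hφg, hΦ, hg⟩ := exists_freeRep isSep_V exists_hasHSum_V
    fun g => ext ((toV M).comp (gF S g))
  have hg0 : ∀ g x, φ (FreeAlgebra.ι ℂ g) (toV M x) = toV M (gF S g x) := fun g x => by
    rw [hφg, ext_toV]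
    rfl
  have hg' : ∀ g x, Φ (gen g) (toV M x) = toV M (gF S g x) := fun g x => by
    rw [hg, ext_toV]
    rfl
  obtain ⟨ρ₀, hρ₀⟩ := exists_lift_end isSep_V Φ (apply_relator S hφ hg0 hΦ hg')
  exact ⟨ρ₀, fun g x => by rw [hρ₀, hg']⟩

/-- The representation of `U_h(a_∞)` on `V`. -/
def rep : Uh →ₐ[R] Module.End R (V M) := (exists_rep S).choose

lemma rep_ug (g : Gen) (x : CBasis M →₀ R) : rep S (ug g) (toV M x) = toV M (gF S g x) :=
  (exists_rep S).choose_spec g x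

lemma rep_ug_vec (g : Gen) (P : CBasis M) :
    rep S (ug g) (vec P) = genCol S (vecOrZero M) g P.1 := by
  rw [← toV_single, rep_ug, gF_single, map_genCol]
  simp only [toV_vz]

lemma isCentralBasisAction_rep : IsCentralBasisAction M S.ξ₀ S.ξ₁ (rep S) where
  minus_one μ hμ P := by
    have h : ∀ μ' ≤ 1, genCol S (vecOrZero M) (Gen.ef μ' (-1)) P.1 =
        actMinusOne M (1 - μ') P.1 := by
      intro μ' hμ'
      interval_cases μ' <;> simp [Gen.ef, genCol, efCol] <;> rfl
    rw [rep_ug_vec, h (1 - μ) (by omega), show 1 - (1 - μ) = μ by omega]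
  ef i μ ν hi hμ hν P := by
    have h : ∀ μ' ≤ 1, ∀ i, genCol S (vecOrZero M) (Gen.ef μ' i) P.1 =
        efCol (vecOrZero M) μ' i P.1 := by
      intro μ' hμ' i
      interval_cases μ' <;> simp [Gen.ef, genCol]
    rw [rep_ug_vec, h μ hμ, efCol]
    interval_cases ν
    · rw [if_neg (by simp; omega), if_pos (by simp; omega)]
      simp
      rfl
    · rw [if_neg (by simp; omega), if_neg (by simp; omega)]
      simp
      rfl
  h i P := by
    rw [rep_ug_vec, genCol, vecOrZero, dif_pos P.2]
    rfl
  c P := by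
    rw [rep_ug_vec, genCol, vecOrZero, dif_pos P.2]
    rfl

end

end QuantumAInf

end

noncomputable section

namespace QuantumAInf

open Polynomial QSqrt

/-! ### Matrix elements of the Chevalley generators -/

/-- `Λ'` arises from `Λ` by raising one entry in each of the rows `s` and `s + 1`. -/
def Step : ℕ → Arr → Arr → Prop
  | 0, Λ, Λ' => Λ' = Λ + dl 1 0
  | p + 1, Λ, Λ' => ∃ k < p + 1, ∃ a < p + 2, Λ' = Λ + dl (p + 1) k + dl (p + 2) a

lemma Step.row {s p : ℕ} {Λ Λ' : Arr} (h : Step s Λ Λ') (h1 : p ≠ s) (h2 : p ≠ s + 1) (k : ℕ) :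
    Λ' p k = Λ p k := by
  cases s with
  | zero =>
    rw [show Λ' = Λ + dl 1 0 from h]
    simp [dl_row_ne h2]
  | succ s =>
    obtain ⟨k, _, a, _, rfl⟩ := h
    simp [dl_row_ne h1, dl_row_ne h2]

lemma Step.top {s : ℕ} {Λ Λ' : Arr} (h : Step s Λ Λ') :
    ∃ a < s + 1, ∀ b, Λ' (s + 1) b = Λ (s + 1) b + if b = a then 1 else 0 := by
  cases s with
  | zero =>
    rw [show Λ' = Λ + dl 1 0 from h]
    exact ⟨0, by omega, fun b => by simp [dl]⟩
  | succ s =>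
    obtain ⟨k, _, a, ha, rfl⟩ := h
    exact ⟨a, ha, fun b => by simp [dl]⟩

lemma Step.bot {s : ℕ} {Λ Λ' : Arr} (h : Step s Λ Λ') (hs : 0 < s) :
    ∃ k < s, ∀ b, Λ' s b = Λ s b + if b = k then 1 else 0 := by
  obtain ⟨s, rfl⟩ : ∃ s', s = s' + 1 := ⟨s - 1, by omega⟩
  obtain ⟨k, hk, a, _, rfl⟩ := h
  exact ⟨k, hk, fun b => by simp [dl]⟩

lemma dl_add_dl_inj {p k a k' a' : ℕ} (h : dl (p + 1) k + dl (p + 2) a = dl (p + 1) k' + dl (p + 2) a') :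
    k = k' ∧ a = a' := by
  have h1 := congrFun (congrFun h (p + 1)) k
  have h2 := congrFun (congrFun h (p + 2)) a
  simp [dl] at h1 h2
  exact ⟨h1, h2⟩

lemma up_apply_of_not_step {s : ℕ} {Λ Λ' : Arr} (h : ¬ Step s Λ Λ') :
    QD.up s (Finsupp.single Λ 1) Λ' = 0 := by
  classical
  cases s with
  | zero =>
    rw [show QD.up 0 = QD.E 0 0 from rfl, E_single, Finset.sum_range_one, Finsupp.smul_apply,
      Finsupp.single_apply, if_neg (fun h' => h h'.symm), smul_zero]
  | succ p =>
    rw [show QD.up (p + 1) = QD.X p from rfl, X_single]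
    simp only [Finsupp.coe_finsetSum, Finset.sum_apply, Finsupp.smul_apply, Finsupp.single_apply]
    refine Finset.sum_eq_zero fun k hk => Finset.sum_eq_zero fun a ha => ?_
    have hne : Λ + dl (p + 1) k + dl (p + 2) a ≠ Λ' := by
      rintro rfl
      exact h ⟨k, Finset.mem_range.mp hk, a, Finset.mem_range.mp ha, rfl⟩
    rw [if_neg hne, smul_zero]

open scoped ComplexOrder in
lemma up_apply_of_step {s : ℕ} {Λ Λ' : Arr} (hΛ : Inter Λ) (hΛ' : Inter Λ') (h : Step s Λ Λ') :
    ∃ y : R, PowerSeries.constantCoeff y ≠ 0 ∧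
      QD.up s (Finsupp.single Λ 1) Λ' = algebraMap R Kh y := by
  classical
  have pos : ∀ {y : R}, Pos y → PowerSeries.constantCoeff y ≠ 0 := fun hy => ne_of_gt hy
  cases s with
  | zero =>
    obtain rfl : Λ' = Λ + dl 1 0 := h
    obtain ⟨h1, h2⟩ := hsqrt_node_zero hΛ hΛ'
    refine ⟨_, pos h2, ?_⟩
    rw [show QD.up 0 = QD.E 0 0 from rfl, E_single, Finset.sum_range_one, Finsupp.smul_apply,
      Finsupp.single_apply, if_pos rfl, h1, QD.cE_of_inter hΛ]
    simp
  | succ p =>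
    obtain ⟨k, hk, a, ha, rfl⟩ := h
    obtain ⟨h1, h2⟩ := hsqrt_radR hk ha hΛ hΛ'
    have e : QD.up (p + 1) (Finsupp.single Λ 1) (Λ + dl (p + 1) k + dl (p + 2) a) =
        QD.z p k a Λ := by
      rw [show QD.up (p + 1) = QD.X p from rfl, X_single]
      simp only [Finsupp.coe_finsetSum, Finset.sum_apply, Finsupp.smul_apply, Finsupp.single_apply,
        if_pos hΛ]
      rw [Finset.sum_eq_single k, Finset.sum_eq_single a]
      · simp
      · intro a' _ ha'
        rw [if_neg, smul_zero]
        rw [add_assoc, add_assoc, add_right_inj]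
        exact fun h => ha' (dl_add_dl_inj h).2
      · exact fun h => absurd (Finset.mem_range.mpr ha) h
      · intro k' _ hk'
        refine Finset.sum_eq_zero fun a' _ => ?_
        rw [if_neg, smul_zero]
        rw [add_assoc, add_assoc, add_right_inj]
        exact fun h => hk' (dl_add_dl_inj h).1
      · exact fun h => absurd (Finset.mem_range.mpr hk) h
    rw [e, QSqrt.z, ← h1]
    unfold sg
    split_ifs
    · exact ⟨_, pos h2, one_mul _⟩
    · exact ⟨-hsqrt (radR p k a Λ), by rw [map_neg]; exact neg_ne_zero.mpr (pos h2), by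
        rw [map_neg, neg_one_mul]⟩

lemma dn_apply (s : ℕ) (Λ Λ' : Arr) :
    QD.dn s (Finsupp.single Λ 1) Λ' = QD.up s (Finsupp.single Λ' 1) Λ := by
  rw [← pair_single Λ', ← QD.isAdj_up_dn s, pair_comm, pair_single]

/-- `Λ'` is one of the arrays that occur when `eᵢ` is applied to `Λ`. -/
def EStep (i : ℤ) (Λ Λ' : Arr) : Prop := if 0 ≤ i then Step (level i) Λ Λ' else Step (level i) Λ' Λ

section

variable {M : ℤ → ℂ[X]} (S : SigData M)

/-- The matrix elements of the generators. -/
def mel (g : Gen) (Q P : CBasis M) : R := gF S g (Finsupp.single P 1) Q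

lemma gF_apply (g : Gen) (x : CBasis M →₀ R) (Q : CBasis M) :
    gF S g x Q = x.sum fun P c => c * mel S g Q P := by
  induction x using Finsupp.induction_linear with
  | zero => simp
  | add x y hx hy =>
    rw [map_add, Finsupp.add_apply, hx, hy, Finsupp.sum_add_index'] <;> intros <;> ring
  | single P c =>
    rw [← Finsupp.smul_single_one, map_smul, Finsupp.smul_apply, Finsupp.smul_single_one,
      Finsupp.sum_single_index (zero_mul _), mel, smul_eq_mul]

lemma algebraMap_mel (g : Gen) (Q P : CBasis M) :
    algebraMap R Kh (mel S g Q P) = QD.gop S.c₀ g (Finsupp.single (S.arrOf P) 1) (S.arrOf Q) := by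
  rw [mel, ← toArr_apply, toArr_gF_single]

lemma mel_e_of_not {i : ℤ} {P Q : CBasis M} (h : ¬ EStep i (S.arrOf P) (S.arrOf Q)) :
    mel S (Gen.e i) Q P = 0 := by
  apply FaithfulSMul.algebraMap_injective R Kh
  rw [algebraMap_mel, map_zero, gop]
  unfold EStep at h
  split_ifs at h ⊢
  · exact up_apply_of_not_step h
  · rw [dn_apply]
    exact up_apply_of_not_step h

lemma mel_e_of_step {i : ℤ} {P Q : CBasis M} (h : EStep i (S.arrOf P) (S.arrOf Q)) :
    PowerSeries.constantCoeff (mel S (Gen.e i) Q P) ≠ 0 := by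
  obtain ⟨y, hy, h1⟩ : ∃ y : R, PowerSeries.constantCoeff y ≠ 0 ∧
      QD.gop S.c₀ (Gen.e i) (Finsupp.single (S.arrOf P) 1) (S.arrOf Q) = algebraMap R Kh y := by
    rw [gop]
    unfold EStep at h
    split_ifs at h ⊢
    · exact up_apply_of_step (S.inter P) (S.inter Q) h
    · rw [dn_apply]
      exact up_apply_of_step (S.inter Q) (S.inter P) h
  rw [← algebraMap_mel] at h1
  rwa [FaithfulSMul.algebraMap_injective R Kh h1]

lemma mel_f (i : ℤ) (P Q : CBasis M) : mel S (Gen.f i) Q P = mel S (Gen.e i) P Q := by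
  apply FaithfulSMul.algebraMap_injective R Kh
  rw [algebraMap_mel, algebraMap_mel, gop, gop]
  split_ifs
  · exact dn_apply _ _ _
  · exact (dn_apply _ _ _).symm

lemma exists_arrOf (P : CBasis M) {p k p' k' : ℕ} (hk : k < p) (hk' : k' < p') {s s' : ℤ}
    (h : Inter (S.arrOf P + s • dl p k + s' • dl p' k')) :
    ∃ Q : CBasis M, S.arrOf Q = S.arrOf P + s • dl p k + s' • dl p' k' := by
  have h1 := (S.isIntArr P).shift hk s
  have h2 := h1.shift hk' s'
  have e : arr S.ξ₁ (shift (shift P.1 (posn p k) p s) (posn p' k') p' s') =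
      S.arrOf P + s • dl p k + s' • dl p' k' := by
    rw [h1.arr_shift hk', (S.isIntArr P).arr_shift hk]
    rfl
  exact ⟨⟨_, h2.isCPattern_iff.mpr (e ▸ h)⟩, e⟩

/-- The rows from the `N`-th on agree with the signature. -/
def Stab (N : ℕ) (Λ : Arr) : Prop := ∀ p, N ≤ p → ∀ k < p, Λ p k = S.cc (posn p k) - k

lemma stab_arrOf_iff {N : ℕ} {P : CBasis M} :
    Stab S N (S.arrOf P) ↔ ∀ p, N ≤ p → ∀ i ∈ row p, P.1 p i = M i := by
  have key : ∀ p, ∀ k < p, S.arrOf P p k = S.cc (posn p k) - k ↔ P.1 p (posn p k) = M (posn p k) := by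
    intro p k hk
    rw [(S.isIntArr P).entry hk, S.M_eq, add_right_inj]
    constructor
    · intro h
      rw [show arr S.ξ₁ P.1 = S.arrOf P from rfl, h]
      push_cast
      ring
    · intro h
      have := intCast_polynomial_injective h
      rw [show arr S.ξ₁ P.1 = S.arrOf P from rfl] at this
      omega
  constructor
  · intro h p hp i hi
    obtain ⟨k, hk, rfl⟩ := mem_row.mp hi
    exact (key p k hk).mp (h p hp k hk)
  · intro h p hp k hk
    exact (key p k hk).mpr (h p hp _ (posn_mem_row hk))

lemma exists_stab (P : CBasis M) : ∃ N, Stab S N (S.arrOf P) := by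
  obtain ⟨N, _, hN⟩ := P.2.stable
  exact ⟨N, (stab_arrOf_iff S).mpr hN⟩

lemma Stab.mono {N N' : ℕ} {Λ : Arr} (h : Stab S N Λ) (hN : N ≤ N') : Stab S N' Λ :=
  fun p hp => h p (hN.trans hp)

lemma EStep.row {i : ℤ} {Λ Λ' : Arr} (h : EStep i Λ Λ') {p : ℕ} (h1 : p ≠ level i)
    (h2 : p ≠ level i + 1) (k : ℕ) : Λ' p k = Λ p k := by
  unfold EStep at h
  split_ifs at h
  · exact h.row h1 h2 k
  · exact (h.row h1 h2 k).symm

lemma EStep.stab_iff {i : ℤ} {Λ Λ' : Arr} (h : EStep i Λ Λ') {N : ℕ} (hN : level i + 1 < N) :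
    Stab S N Λ ↔ Stab S N Λ' := by
  have : ∀ p, N ≤ p → ∀ k, Λ' p k = Λ p k := fun p hp k => h.row (by omega) (by omega) k
  refine forall₂_congr fun p hp => forall₂_congr fun k hk => ?_
  rw [this p hp]

lemma posn_succ_even {t k : ℕ} (ht : Even t) : posn (t + 1) k = posn t k := by
  obtain ⟨κ, rfl⟩ := ht
  unfold posn
  omega

lemma posn_succ_odd {t k : ℕ} (ht : Odd t) : posn (t + 1) (k + 1) = posn t k := by
  obtain ⟨κ, rfl⟩ := ht
  unfold posn
  omega

lemma level_of_nonneg {i : ℤ} (hi : 0 ≤ i) : Odd (level i) ∧ (level i : ℤ) = 2 * i + 1 := by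
  rw [level, if_pos hi]
  exact ⟨⟨_, rfl⟩, by omega⟩

lemma level_of_neg {i : ℤ} (hi : ¬ 0 ≤ i) : Even (level i) ∧ (level i : ℤ) = 2 * (-i - 1) := by
  rw [level, if_neg hi]
  exact ⟨even_two_mul _, by omega⟩

/-- `eᵢ` does not change rows that agree with the signature. -/
lemma not_eStep_of_stab {i : ℤ} {Λ Λ' : Arr} {N : ℕ} (hΛ : Stab S N Λ) (hΛ' : Inter Λ')
    (hN : N ≤ level i + 1) : ¬ EStep i Λ Λ' := by
  intro h
  have hr : ∀ k, Λ' (level i + 1 + 1) k = Λ (level i + 1 + 1) k :=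
    fun k => h.row (by omega) (by omega) k
  unfold EStep at h
  split_ifs at h with hi
  · obtain ⟨a, ha, h1⟩ := h.top
    have h2 := (hΛ' (level i + 1) a ha).1
    have h3 := h1 a
    rw [if_pos rfl] at h3
    have h4 := posn_succ_even (k := a) (level_of_nonneg hi).1.add_one
    rw [hr, hΛ _ (by omega) a (by omega), h3, hΛ _ hN a ha, h4] at h2
    omega
  · obtain ⟨a, ha, h1⟩ := h.top
    have h2 := (hΛ' (level i + 1) a ha).2
    have h3 := h1 a
    rw [if_pos rfl] at h3
    have h4 := posn_succ_odd (k := a) (level_of_neg hi).1.add_one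
    rw [hΛ _ hN a ha] at h3
    rw [hr, hΛ _ (by omega) (a + 1) (by omega), h4] at h2
    push_cast at h2
    omega

/-- `fᵢ` does not change rows that agree with a locally constant signature. -/
lemma not_fStep_of_stab {i : ℤ} {Λ Λ' : Arr} {N : ℕ} (hΛ : Stab S N Λ) (hΛ' : Inter Λ')
    (hi : (N : ℤ) + |S.m| + |S.n| + 2 ≤ |i|) : ¬ EStep i Λ' Λ := by
  intro h
  have hm := neg_abs_le S.m
  have hn := le_abs_self S.n
  have hm0 := abs_nonneg S.m
  have hn0 := abs_nonneg S.n
  have hr := fun p h1 h2 k => h.row (p := p) h1 h2 k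
  unfold EStep at h
  split_ifs at h with h0
  · rw [abs_of_nonneg h0] at hi
    obtain ⟨ho, hl⟩ := level_of_nonneg h0
    obtain ⟨a, ha, h1⟩ := h.top
    obtain ⟨k, hk, h2⟩ := h.bot (by omega)
    generalize level i = s at *
    have b1 := (hΛ' (s + 1) a ha).2
    have b2 := (hΛ' s k hk).2
    have c1 := hr (s + 1 + 1) (by omega) (by omega) (a + 1)
    have c2 := h1 a
    have c3 := h1 (k + 1)
    have c4 := h2 k
    rw [if_pos rfl] at c2 c4
    rw [hΛ _ (by omega) _ (by omega)] at c1 c2 c3 c4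
    rw [posn_succ_odd ho] at c3
    have hak : a = k + 1 := by
      by_contra hne
      rw [if_neg (Ne.symm hne)] at c3
      push_cast at c3
      omega
    have e1 : posn (s + 1 + 1) (a + 1) = posn (s + 1) a + 1 := by
      obtain ⟨κ, rfl⟩ := ho
      unfold posn
      omega
    have hpn : posn (s + 1) a < S.n := by
      by_contra hge
      rw [e1, S.right _ (by omega)] at c1
      rw [S.right _ (by omega)] at c2
      push_cast at c1
      omega
    have hk' : k < s - 1 := by
      obtain ⟨κ, rfl⟩ := ho
      unfold posn at hpn
      omega
    obtain ⟨s, rfl⟩ : ∃ s', s = s' + 1 := ⟨s - 1, by omega⟩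
    have b3 := (hΛ' s k (by omega)).1
    have c5 := hr s (by omega) (by omega) k
    have hse : Even s := by
      rcases Nat.even_or_odd s with h | h
      · exact h
      · exact absurd ho (Nat.not_odd_iff_even.mpr h.add_one)
    rw [hΛ _ (by omega) _ (by omega)] at c5
    rw [posn_succ_even hse] at c4
    omega
  · rw [abs_of_neg (show i < 0 by omega)] at hi
    obtain ⟨he, hl⟩ := level_of_neg h0
    obtain ⟨a, ha, h1⟩ := h.top
    obtain ⟨k, hk, h2⟩ := h.bot (by omega)
    generalize level i = s at *
    have b1 := (hΛ' (s + 1) a ha).1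
    have b2 := (hΛ' s k hk).1
    have c1 := hr (s + 1 + 1) (by omega) (by omega) a
    have c2 := h1 a
    have c3 := h1 k
    have c4 := h2 k
    rw [if_pos rfl] at c2 c4
    rw [hΛ _ (by omega) _ (by omega)] at c1 c2 c3 c4
    rw [posn_succ_even he] at c3
    have hak : a = k := by
      by_contra hne
      rw [if_neg (Ne.symm hne)] at c3
      omega
    have e1 : posn (s + 1 + 1) a = posn (s + 1) a - 1 := by
      obtain ⟨κ, rfl⟩ := he
      unfold posn
      omega
    have hpm : S.m < posn (s + 1) a := by
      by_contra hge
      rw [e1, S.left _ (by omega)] at c1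
      rw [S.left _ (by omega)] at c2
      omega
    have hk' : 0 < k := by
      obtain ⟨κ, rfl⟩ := he
      unfold posn at hpm
      omega
    obtain ⟨s, rfl⟩ : ∃ s', s = s' + 1 := ⟨s - 1, by omega⟩
    obtain ⟨k, rfl⟩ : ∃ k', k = k' + 1 := ⟨k - 1, by omega⟩
    have b3 := (hΛ' s k (by omega)).2
    have c5 := hr s (by omega) (by omega) k
    have hso : Odd s := by
      rcases Nat.even_or_odd s with h | h
      · exact absurd he (Nat.not_even_iff_odd.mpr h.add_one)
      · exact h
    rw [hΛ _ (by omega) _ (by omega)] at c5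
    rw [posn_succ_odd hso] at c4
    push_cast at c4
    omega

lemma hval_of_stab {i : ℤ} {Λ : Arr} {N : ℕ} (hΛ : Stab S N Λ)
    (hi : (N : ℤ) + |S.m| + |S.n| + 2 ≤ |i|) : hval S.c₀ i Λ = 0 := by
  have hm := neg_abs_le S.m
  have hn := le_abs_self S.n
  have hm0 := abs_nonneg S.m
  have hn0 := abs_nonneg S.n
  have hsum : ∀ p, N ≤ p → rsum p Λ = ∑ k ∈ Finset.range p, S.cc (posn p k) := by
    intro p hp
    unfold rsum
    refine Finset.sum_congr rfl fun k hk => ?_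
    rw [hΛ p hp k (Finset.mem_range.mp hk)]
    ring
  unfold hval
  rcases int_cases i with ⟨n, rfl⟩ | ⟨n, rfl⟩
  · rw [abs_of_nonneg (show (0 : ℤ) ≤ n by omega)] at hi
    rw [hrow_natCast, Nat.add_sub_cancel, hsum _ (by omega), hsum _ (by omega),
      Finset.sum_range_succ, theta, if_neg (by omega)]
    simp only [posn_succ_even (even_two_mul n)]
    rw [S.right (posn (2 * n) (2 * n)) (by unfold posn; omega)]
    ring
  · rw [abs_of_neg (show -(n : ℤ) - 1 < 0 by omega)] at hi
    rw [hrow_neg, show 2 * n + 2 - 1 = 2 * n + 1 by omega, hsum _ (by omega), hsum _ (by omega),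
      Finset.sum_range_succ', theta, if_pos (by omega)]
    have e : ∀ k, posn (2 * n + 2) (k + 1) = posn (2 * n + 1) k :=
      fun k => posn_succ_odd (odd_two_mul_add_one n)
    simp only [e]
    rw [S.left (posn (2 * n + 2) 0) (by unfold posn; omega)]
    ring

end

end QuantumAInf

end

noncomputable section

namespace QuantumAInf

open Polynomial QSqrt

/-! ### Words in the generators and weight spaces -/

lemma mk_relator {x : FreeTop} (hx : IsRelator x) :
    (show Uh from relIdeal.ringCon.mk' x) = 0 := by
  have h : x ∈ relIdeal := (TwoSidedIdeal.mem_iInf (R := FreeTop)).mpr fun n =>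
    TwoSidedIdeal.subset_span (Or.inl hx)
  exact Quotient.sound h

lemma ug_h_e (i j : ℤ) : ug (Gen.h i) * ug (Gen.e j) - ug (Gen.e j) * ug (Gen.h i) =
    (1 * ((if i = j then 1 else 0) - (if i = j + 1 then 1 else 0)) : ℤ) • ug (Gen.e j) := by
  rw [one_mul]
  exact sub_eq_zero.mp (mk_relator (IsRelator.h_e i j))

lemma ug_h_f (i j : ℤ) : ug (Gen.h i) * ug (Gen.f j) - ug (Gen.f j) * ug (Gen.h i) =
    (-1 * ((if i = j then 1 else 0) - (if i = j + 1 then 1 else 0)) : ℤ) • ug (Gen.f j) := by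
  rw [neg_one_mul]
  exact (eq_neg_of_add_eq_zero_left (mk_relator (IsRelator.h_f i j))).trans (neg_zsmul _ _).symm

/-- The product of a list of generators. -/
def word (W : List Gen) : Uh := (W.map ug).prod

lemma word_append (W W' : List Gen) : word (W ++ W') = word W * word W' := by
  simp [word]

/-- The number of occurrences of each letter. -/
def content (L : List ℤ) : ℤ →₀ ℕ := (L.map fun i => Finsupp.single i 1).sum

lemma content_cons (i : ℤ) (L : List ℤ) : content (i :: L) = Finsupp.single i 1 + content L := by
  simp [content]

lemma mem_iff_content {L : List ℤ} {i : ℤ} : i ∈ L ↔ content L i ≠ 0 := by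
  induction L with
  | nil => simp [content]
  | cons j L ih =>
    rw [List.mem_cons, ih, content_cons, Finsupp.add_apply, Finsupp.single_apply]
    by_cases h : i = j
    · simp [h]
    · simp [h, Ne.symm h]

/-- The span of the words with a given content. -/
def wordSpan (g : ℤ → Gen) (β : ℤ →₀ ℕ) : Submodule R Uh :=
  Submodule.span R {x | ∃ L, content L = β ∧ x = word (L.map g)}

/-- The weight of content `β` on `hᵢ`. -/
def wtOf (ε : ℤ) (β : ℤ →₀ ℕ) (i : ℤ) : ℤ := ε * ((β i : ℤ) - β (i - 1))

lemma wtOf_injective {ε : ℤ} (hε : ε ≠ 0) {β γ : ℤ →₀ ℕ} (h : β ≠ γ) :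
    ∃ i, wtOf ε β i ≠ wtOf ε γ i := by
  by_contra! h'
  refine h (Finsupp.ext fun i => ?_)
  have key : ∀ n : ℕ, (β i : ℤ) - γ i = β (i - n) - γ (i - n) := by
    intro n
    induction n with
    | zero => simp
    | succ n ih =>
      have := mul_left_cancel₀ hε (h' (i - n))
      rw [ih, Nat.cast_succ, ← sub_sub]
      linarith
  have hf : ((β.support ∪ γ.support : Finset ℤ) : Set ℤ).Finite := Finset.finite_toSet _
  obtain ⟨b, hb⟩ := hf.bddBelow
  have hz : i - ((i - b + 1).toNat : ℤ) ∉ β.support ∪ γ.support := fun hm => by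
    have := hb hm
    omega
  have := key (i - b + 1).toNat
  simp only [Finset.mem_union, Finsupp.mem_support_iff, not_or, not_not] at hz
  rw [hz.1, hz.2] at this
  omega

section

variable {g : ℤ → Gen} {ε : ℤ}
  (hg : ∀ i j, ug (Gen.h i) * ug (g j) - ug (g j) * ug (Gen.h i) =
    (ε * ((if i = j then 1 else 0) - (if i = j + 1 then 1 else 0)) : ℤ) • ug (g j))

include hg in
lemma word_weight (i : ℤ) (L : List ℤ) : ug (Gen.h i) * word (L.map g) -
    word (L.map g) * ug (Gen.h i) = wtOf ε (content L) i • word (L.map g) := by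
  induction L with
  | nil => simp [word, wtOf, content]
  | cons j L ih =>
    have e : word ((j :: L).map g) = ug (g j) * word (L.map g) := by simp [word]
    have ew : wtOf ε (content (j :: L)) i =
        (ε * ((if i = j then 1 else 0) - (if i = j + 1 then 1 else 0)) : ℤ) + wtOf ε (content L) i := by
      rw [wtOf, wtOf, content_cons, Finsupp.add_apply, Finsupp.add_apply, Finsupp.single_apply,
        Finsupp.single_apply]
      have h1 : (j = i - 1) = (i = j + 1) := propext ⟨fun h => by omega, fun h => by omega⟩
      simp only [h1, eq_comm (a := j)]
      push_cast
      ring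
    rw [e, ew, add_zsmul]
    have hij := hg i j
    generalize (ε * ((if i = j then 1 else 0) - (if i = j + 1 then 1 else 0)) : ℤ) = d at hij ⊢
    have h1 := congrArg (· * word (L.map g)) hij
    have h2 := congrArg (ug (g j) * ·) ih
    simp only [sub_mul, mul_sub, smul_mul_assoc, mul_smul_comm, mul_assoc] at h1 h2
    rw [← h1, ← h2, mul_assoc]
    abel

/-- The commutator with `hᵢ`. -/
def adH (i : ℤ) : Uh →ₗ[R] Uh :=
  LinearMap.mulLeft R (ug (Gen.h i)) - LinearMap.mulRight R (ug (Gen.h i))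

lemma adH_apply (i : ℤ) (x : Uh) : adH i x = ug (Gen.h i) * x - x * ug (Gen.h i) := rfl

include hg in
lemma adH_of_mem_wordSpan {β : ℤ →₀ ℕ} {x : Uh} (hx : x ∈ wordSpan g β) (i : ℤ) :
    adH i x = wtOf ε β i • x := by
  refine Submodule.span_induction ?_ ?_ ?_ ?_ hx
  · rintro y ⟨L, rfl, rfl⟩
    rw [adH_apply, word_weight hg]
  · simp
  · intro y z _ _ hy hz
    rw [map_add, hy, hz, zsmul_add]
  · intro c y _ hy
    rw [map_smul, hy, smul_comm]

lemma mem_of_zsmul_mem {N : Type*} [AddCommGroup N] [Module R N] {A : Submodule R N} {z : ℤ}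
    (hz : z ≠ 0) {x : N} (h : z • x ∈ A) : x ∈ A := by
  have h1 := A.smul_mem (PowerSeries.C ((z : ℂ)⁻¹) : R) h
  rw [← Int.cast_smul_eq_zsmul R, smul_smul] at h1
  have h2 : (PowerSeries.C ((z : ℂ)⁻¹) : R) * (z : R) = 1 := by
    rw [← map_intCast (PowerSeries.C : ℂ →+* R), ← map_mul, inv_mul_cancel₀ (by exact_mod_cast hz),
      map_one]
  rwa [h2, one_smul] at h1

include hg in
lemma mem_wordSpan_of_weight (hε : ε ≠ 0) {β : ℤ →₀ ℕ} (s : Finset (ℤ →₀ ℕ)) {x : Uh}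
    (hx : x ∈ ⨆ γ ∈ s, wordSpan g γ) (hw : ∀ i, adH i x = wtOf ε β i • x) : x ∈ wordSpan g β := by
  classical
  induction s using Finset.induction_on generalizing x with
  | empty =>
    simp only [Finset.notMem_empty, iSup_false, iSup_bot, Submodule.mem_bot] at hx
    rw [hx]
    exact zero_mem _
  | insert γ s hγ ih =>
    rw [Finset.iSup_insert, Submodule.mem_sup] at hx
    obtain ⟨a, ha, b, hb, rfl⟩ := hx
    by_cases hβ : γ = β
    · subst hβ
      refine add_mem ha (ih hb fun i => ?_)
      have := hw i
      rw [map_add, adH_of_mem_wordSpan hg ha, zsmul_add] at this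
      exact add_left_cancel this
    · obtain ⟨i, hi⟩ := wtOf_injective hε hβ
      refine ih ?_ hw
      refine mem_of_zsmul_mem (sub_ne_zero.mpr hi) ?_
      have h1 : (wtOf ε γ i - wtOf ε β i) • (a + b) = wtOf ε γ i • b - adH i b := by
        have := hw i
        rw [map_add, adH_of_mem_wordSpan hg ha] at this
        rw [sub_zsmul, ← this, zsmul_add]
        abel
      rw [h1]
      have hstab : ∀ y ∈ ⨆ γ ∈ s, wordSpan g γ, adH i y ∈ ⨆ γ ∈ s, wordSpan g γ := by
        intro y hy
        have : (⨆ γ ∈ s, wordSpan g γ) ≤ (⨆ γ ∈ s, wordSpan g γ).comap (adH i) := by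
          refine iSup₂_le fun δ hδ z hz => ?_
          rw [Submodule.mem_comap, adH_of_mem_wordSpan hg hz]
          exact zsmul_mem (Submodule.mem_iSup_of_mem δ (Submodule.mem_iSup_of_mem hδ hz)) _
        exact this hy
      exact sub_mem (zsmul_mem hb _) (hstab b hb)

include hg in
lemma mem_wordSpan (hε : ε ≠ 0) {β : ℤ →₀ ℕ} {x : Uh}
    (hx : x ∈ Algebra.adjoin R (Set.range fun i => ug (g i)))
    (hw : ∀ i, ug (Gen.h i) * x - x * ug (Gen.h i) = wtOf ε β i • x) : x ∈ wordSpan g β := by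
  have h1 : x ∈ ⨆ γ, wordSpan g γ := by
    have h2 : x ∈ Subalgebra.toSubmodule (Algebra.adjoin R (Set.range fun i => ug (g i))) := hx
    rw [Algebra.adjoin_eq_span] at h2
    refine Submodule.span_le.mpr ?_ h2
    intro y hy
    obtain ⟨l, hl, rfl⟩ := Submonoid.exists_list_of_mem_closure hy
    have h3 : ∀ l : List Uh, (∀ y ∈ l, y ∈ Set.range fun i => ug (g i)) →
        ∃ L : List ℤ, l = L.map fun i => ug (g i) := by
      intro l
      induction l with
      | nil => exact fun _ => ⟨[], rfl⟩
      | cons y l ih =>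
        intro h
        obtain ⟨i, hi⟩ := h y (by simp)
        obtain ⟨L, rfl⟩ := ih fun z hz => h z (by simp [hz])
        exact ⟨i :: L, by rw [← hi]; rfl⟩
    obtain ⟨L, rfl⟩ := h3 l hl
    refine Submodule.mem_iSup_of_mem (content L) (Submodule.subset_span ⟨L, rfl, ?_⟩)
    simp [word, Function.comp_def]
  obtain ⟨s, hs⟩ := Submodule.mem_iSup_iff_exists_finset.mp h1
  exact mem_wordSpan_of_weight hg hε s hs hw

end

lemma nPlus_subset {β : ℤ →₀ ℕ} {x : Uh} (hx : x ∈ nPlus β) : x ∈ wordSpan Gen.e β :=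
  mem_wordSpan ug_h_e one_ne_zero hx.1 fun i => by rw [hx.2 i, wtOf, one_mul]

lemma nMinus_subset {α : ℤ →₀ ℕ} {x : Uh} (hx : x ∈ nMinus α) : x ∈ wordSpan Gen.f α :=
  mem_wordSpan ug_h_f (by norm_num) hx.1 fun i => by rw [hx.2 i, wtOf, neg_one_mul]

lemma word_e_mem (L : List ℤ) : word (L.map Gen.e) ∈ nPlus (content L) := by
  refine ⟨?_, fun i => ?_⟩
  · refine list_prod_mem fun x hx => ?_
    simp only [List.map_map, List.mem_map, Function.comp] at hx
    obtain ⟨j, _, rfl⟩ := hx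
    exact Algebra.subset_adjoin ⟨j, rfl⟩
  · rw [word_weight ug_h_e, wtOf, one_mul]

lemma word_f_mem (L : List ℤ) : word (L.map Gen.f) ∈ nMinus (content L) := by
  refine ⟨?_, fun i => ?_⟩
  · refine list_prod_mem fun x hx => ?_
    simp only [List.map_map, List.mem_map, Function.comp] at hx
    obtain ⟨j, _, rfl⟩ := hx
    exact Algebra.subset_adjoin ⟨j, rfl⟩
  · rw [word_weight ug_h_f, wtOf, neg_one_mul]

/-- The letters of `∏ᵢ hᵢ^{γᵢ}`. -/
def hList (γ : ℤ →₀ ℕ) : List Gen :=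
  (γ.support.sort (· ≤ ·)).flatMap fun i => List.replicate (γ i) (Gen.h i)

lemma word_hList (γ : ℤ →₀ ℕ) : word (hList γ) = hMon γ := by
  unfold word hList hMon
  induction γ.support.sort (· ≤ ·) with
  | nil => rfl
  | cons i l ih => simp_all

lemma mem_hList {γ : ℤ →₀ ℕ} {x : Gen} : x ∈ hList γ ↔ ∃ i, γ i ≠ 0 ∧ x = Gen.h i := by
  simp only [hList, List.mem_flatMap, Finset.mem_sort, Finsupp.mem_support_iff, List.mem_replicate]
  exact exists_congr fun i => by tauto

/-- A normally ordered monomial. -/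
def monomialWord (l : ℕ) (L : List ℤ) (γ : ℤ →₀ ℕ) (L' : List ℤ) : List Gen :=
  List.replicate l Gen.c ++ (L.map Gen.f ++ (hList γ ++ L'.map Gen.e))

lemma summands_le (t : Idx) : summands t ≤ Submodule.span R
    {x | ∃ L L', content L = t.α ∧ content L' = t.β ∧ x = word (monomialWord t.l L t.γ L')} := by
  refine Submodule.span_le.mpr ?_
  rintro x ⟨F, hF, E, hE, rfl⟩
  refine Submodule.span_induction (p := fun F _ => ug Gen.c ^ t.l * (F * hMon t.γ * E) ∈ _) ?_ ?_ ?_ ?_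
    (nMinus_subset hF)
  · rintro F ⟨L, hL, rfl⟩
    refine Submodule.span_induction (p := fun E _ =>
      ug Gen.c ^ t.l * (word (L.map Gen.f) * hMon t.γ * E) ∈ _) ?_ ?_ ?_ ?_ (nPlus_subset hE)
    · rintro E ⟨L', hL', rfl⟩
      refine Submodule.subset_span ⟨L, L', hL, hL', ?_⟩
      rw [monomialWord, word_append, word_append, word_append, word_hList, mul_assoc]
      simp [word]
    · simp
    · intro a b _ _ ha hb
      rw [mul_add, mul_add]
      exact add_mem ha hb
    · intro c a _ ha
      rw [mul_smul_comm, mul_smul_comm]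
      exact Submodule.smul_mem _ c ha
  · simp
  · intro a b _ _ ha hb
    rw [add_mul, add_mul, mul_add]
    exact add_mem ha hb
  · intro c a _ ha
    rw [smul_mul_assoc, smul_mul_assoc, mul_smul_comm]
    exact Submodule.smul_mem _ c ha

end QuantumAInf

end

noncomputable section

namespace QuantumAInf

open Polynomial QSqrt

/-! ### The action of normally ordered monomials -/

section

variable {M : ℤ → ℂ[X]} (S : SigData M)

/-- The operator of a word on finite linear combinations of patterns. -/
def wF (W : List Gen) : Module.End R (CBasis M →₀ R) := (W.map (gF S)).prod

lemma wF_cons (g : Gen) (W : List Gen) (x : CBasis M →₀ R) :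
    wF S (g :: W) x = gF S g (wF S W x) := by
  simp [wF]

lemma wF_append (W W' : List Gen) (x : CBasis M →₀ R) :
    wF S (W ++ W') x = wF S W (wF S W' x) := by
  simp [wF]

lemma rep_word (W : List Gen) (x : CBasis M →₀ R) :
    rep S (word W) (toV M x) = toV M (wF S W x) := by
  induction W with
  | nil => simp [word, wF]
  | cons g W ih =>
    have e : word (g :: W) = ug g * word W := by simp [word]
    rw [e, map_mul, Module.End.mul_apply, ih, rep_ug, wF_cons]

/-- Finite linear combinations of the patterns with the property `A`. -/
abbrev supportedOn (A : Set (CBasis M)) : Submodule R (CBasis M →₀ R) := Finsupp.supported R R A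

lemma gF_mem {A A' : Set (CBasis M)} {g : Gen} (h : ∀ P ∈ A, ∀ Q ∉ A', mel S g Q P = 0)
    {x : CBasis M →₀ R} (hx : x ∈ supportedOn A) : gF S g x ∈ supportedOn A' := by
  rw [Finsupp.mem_supported'] at *
  intro Q hQ
  rw [gF_apply]
  refine Finset.sum_eq_zero fun P _ => show x P * mel S g Q P = 0 from ?_
  by_cases hP : P ∈ A
  · rw [h P hP Q hQ, mul_zero]
  · rw [hx P hP, zero_mul]

lemma eq_zero_of_supportedOn_empty {x : CBasis M →₀ R} (hx : x ∈ supportedOn (∅ : Set (CBasis M))) : x = 0 := by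
  simpa using hx

/-- The patterns whose rows from the `N`-th on agree with the signature. -/
def stabSet (N : ℕ) : Set (CBasis M) := {P | Stab S N (S.arrOf P)}

lemma gF_e_mem (N : ℕ) (i : ℤ) {x : CBasis M →₀ R} (hx : x ∈ supportedOn (stabSet S N)) :
    gF S (Gen.e i) x ∈ supportedOn (stabSet S N) := by
  refine gF_mem S (fun P hP Q hQ => mel_e_of_not S fun h => ?_) hx
  by_cases hN : level i + 1 < N
  · exact hQ ((h.stab_iff S hN).mp hP)
  · exact not_eStep_of_stab S hP (S.inter Q) (by omega) h

lemma gF_e_eq_zero {N : ℕ} {i : ℤ} (hN : N ≤ level i + 1) {x : CBasis M →₀ R}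
    (hx : x ∈ supportedOn (stabSet S N)) : gF S (Gen.e i) x = 0 :=
  eq_zero_of_supportedOn_empty (gF_mem S (fun _ hP Q _ => mel_e_of_not S fun h =>
    not_eStep_of_stab S hP (S.inter Q) hN h) hx)

/-- A radius outside of which the generators act trivially on `stabSet S N`. -/
def radius (N : ℕ) : ℕ := N + S.m.natAbs + S.n.natAbs + 2

lemma radius_le {N : ℕ} {i : ℤ} (hi : (radius S N : ℤ) ≤ |i|) :
    (N : ℤ) + |S.m| + |S.n| + 2 ≤ |i| := by
  unfold radius at hi
  push_cast at hi
  exact hi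

lemma le_level {N : ℕ} {i : ℤ} (hi : (radius S N : ℤ) ≤ |i|) : N ≤ level i + 1 := by
  unfold radius at hi
  rcases int_cases i with ⟨n, rfl⟩ | ⟨n, rfl⟩
  · rw [abs_of_nonneg (by omega)] at hi
    rw [level_natCast]
    omega
  · rw [abs_of_neg (by omega)] at hi
    rw [level_neg]
    omega

lemma gF_f_eq_zero {N : ℕ} {i : ℤ} (hi : (radius S N : ℤ) ≤ |i|) {x : CBasis M →₀ R}
    (hx : x ∈ supportedOn (stabSet S N)) : gF S (Gen.f i) x = 0 :=
  eq_zero_of_supportedOn_empty (gF_mem S (fun P hP Q _ => by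
    rw [mel_f]
    exact mel_e_of_not S (not_fStep_of_stab S hP (S.inter Q) (radius_le S hi))) hx)

lemma mel_h {i : ℤ} (P Q : CBasis M) : mel S (Gen.h i) Q P =
    (hval S.c₀ i (S.arrOf P) : R) * (Finsupp.single P 1 : CBasis M →₀ R) Q := by
  rw [mel, gF_h_single]
  rfl

lemma gF_h_mem (A : Set (CBasis M)) (i : ℤ) {x : CBasis M →₀ R} (hx : x ∈ supportedOn A) :
    gF S (Gen.h i) x ∈ supportedOn A := by
  classical
  refine gF_mem S (fun P hP Q hQ => ?_) hx
  have hne : P ≠ Q := fun h => hQ (h ▸ hP)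
  rw [mel_h, Finsupp.single_apply, if_neg hne, mul_zero]

lemma gF_h_eq_zero {N : ℕ} {i : ℤ} (hi : (radius S N : ℤ) ≤ |i|) {x : CBasis M →₀ R}
    (hx : x ∈ supportedOn (stabSet S N)) : gF S (Gen.h i) x = 0 :=
  eq_zero_of_supportedOn_empty (gF_mem S (fun P hP Q _ => by
    rw [mel_h, hval_of_stab S hP (radius_le S hi), Int.cast_zero, zero_mul]) hx)

lemma gF_f_mem_compl (N : ℕ) (i : ℤ) {x : CBasis M →₀ R} (hx : x ∈ supportedOn (stabSet S N)ᶜ) :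
    gF S (Gen.f i) x ∈ supportedOn (stabSet S N)ᶜ := by
  refine gF_mem S (fun P hP Q hQ => ?_) hx
  rw [mel_f]
  refine mel_e_of_not S fun h => ?_
  rw [Set.notMem_compl_iff] at hQ
  by_cases hN : level i + 1 < N
  · exact hP ((h.stab_iff S hN).mp hQ)
  · exact not_eStep_of_stab S hQ (S.inter P) (by omega) h

lemma gF_f_mem_compl_of_le {N : ℕ} {i : ℤ} (hN : N ≤ level i + 1) (x : CBasis M →₀ R) :
    gF S (Gen.f i) x ∈ supportedOn (stabSet S N)ᶜ := by
  refine gF_mem S (A := Set.univ) (fun P _ Q hQ => ?_) (by simp)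
  rw [mel_f]
  rw [Set.notMem_compl_iff] at hQ
  exact mel_e_of_not S fun h => not_eStep_of_stab S hQ (S.inter P) hN h

lemma wF_mem {A : Submodule R (CBasis M →₀ R)} {W : List Gen}
    (hp : ∀ g ∈ W, ∀ x ∈ A, gF S g x ∈ A) {x : CBasis M →₀ R} (hx : x ∈ A) : wF S W x ∈ A := by
  induction W with
  | nil => simpa [wF] using hx
  | cons g W ih =>
    rw [wF_cons]
    exact hp g (by simp) _ (ih fun g' hg' => hp g' (by simp [hg']))

lemma wF_eq_zero {A : Submodule R (CBasis M →₀ R)} {W : List Gen}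
    (hp : ∀ g ∈ W, ∀ x ∈ A, gF S g x ∈ A) {g : Gen} (hg : g ∈ W) (hk : ∀ x ∈ A, gF S g x = 0)
    {x : CBasis M →₀ R} (hx : x ∈ A) : wF S W x = 0 := by
  induction W with
  | nil => simp at hg
  | cons g' W ih =>
    have hp' : ∀ g ∈ W, ∀ x ∈ A, gF S g x ∈ A := fun g' hg' => hp g' (by simp [hg'])
    rw [wF_cons]
    rcases List.mem_cons.mp hg with rfl | h
    · exact hk _ (wF_mem S hp' hx)
    · rw [ih hp' h, map_zero]

/-- An `f`-word kills a vector if the letters of a union of components of its support do. -/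
lemma wF_f_eq_zero {x : CBasis M →₀ R} {L : List ℤ} {I : Set ℤ} (hI : ∃ i ∈ L, i ∈ I)
    (hc : ∀ i ∈ L, i ∈ I → ∀ j ∈ L, j ∉ I → |i - j| ≠ 1)
    (hk : ∀ i ∈ L, i ∈ I → gF S (Gen.f i) x = 0) : wF S (L.map Gen.f) x = 0 := by
  induction L with
  | nil => simp at hI
  | cons j L ih =>
    rw [List.map_cons, wF_cons]
    by_cases h : ∃ i ∈ L, i ∈ I
    · rw [ih h (fun i hi hi' j hj => hc i (by simp [hi]) hi' j (by simp [hj]))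
        (fun i hi => hk i (by simp [hi])), map_zero]
    · push Not at h
      have hj : j ∈ I := by
        obtain ⟨i, hi, hi'⟩ := hI
        rcases List.mem_cons.mp hi with rfl | h'
        · exact hi'
        · exact absurd hi' (h i h')
      have hcomm : ∀ L' : List ℤ, (∀ i ∈ L', |j - i| ≠ 1) → gF S (Gen.f j) (wF S (L'.map Gen.f) x) =
          wF S (L'.map Gen.f) (gF S (Gen.f j) x) := by
        intro L' hL'
        induction L' with
        | nil => simp [wF]
        | cons i L' ih' =>
          rw [List.map_cons, wF_cons, wF_cons, gF_comm S (QD.gop_f_f _ (hL' i (by simp))),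
            ih' fun i hi => hL' i (by simp [hi])]
      rw [hcomm L fun i hi => hc j (by simp) hj i (by simp [hi]) (h i hi), hk j (by simp) hj, map_zero]

lemma wF_c (l : ℕ) (x : CBasis M →₀ R) : wF S (List.replicate l Gen.c) x = (S.c₀ : R) ^ l • x := by
  induction l with
  | zero => simp [wF]
  | succ l ih => rw [List.replicate_succ, wF_cons, ih, gF_c, smul_smul, pow_succ']

lemma wF_monomialWord (l : ℕ) (L : List ℤ) (γ : ℤ →₀ ℕ) (L' : List ℤ) (x : CBasis M →₀ R) :
    wF S (monomialWord l L γ L') x = (S.c₀ : R) ^ l • wF S (L.map Gen.f) (wF S (hList γ)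
      (wF S (L'.map Gen.e) x)) := by
  rw [monomialWord, wF_append, wF_append, wF_append, wF_c]

lemma wF_e_mem {N : ℕ} (L : List ℤ) {x : CBasis M →₀ R} (hx : x ∈ supportedOn (stabSet S N)) :
    wF S (L.map Gen.e) x ∈ supportedOn (stabSet S N) := by
  refine wF_mem S (fun g hg y hy => ?_) hx
  obtain ⟨i, _, rfl⟩ := List.mem_map.mp hg
  exact gF_e_mem S N i hy

lemma wF_e_eq_zero {N : ℕ} {L : List ℤ} {i : ℤ} (hi : i ∈ L) (hN : N ≤ level i + 1)
    {x : CBasis M →₀ R} (hx : x ∈ supportedOn (stabSet S N)) : wF S (L.map Gen.e) x = 0 := by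
  refine wF_eq_zero S (fun g hg y hy => ?_) (List.mem_map.mpr ⟨i, hi, rfl⟩)
    (fun y hy => gF_e_eq_zero S hN hy) hx
  obtain ⟨j, _, rfl⟩ := List.mem_map.mp hg
  exact gF_e_mem S N j hy

lemma wF_h_mem (A : Set (CBasis M)) (γ : ℤ →₀ ℕ) {x : CBasis M →₀ R} (hx : x ∈ supportedOn A) :
    wF S (hList γ) x ∈ supportedOn A := by
  refine wF_mem S (fun g hg y hy => ?_) hx
  obtain ⟨i, _, rfl⟩ := mem_hList.mp hg
  exact gF_h_mem S A i hy

lemma wF_h_eq_zero {N : ℕ} {γ : ℤ →₀ ℕ} {i : ℤ} (hγ : γ i ≠ 0) (hi : (radius S N : ℤ) ≤ |i|)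
    {x : CBasis M →₀ R} (hx : x ∈ supportedOn (stabSet S N)) : wF S (hList γ) x = 0 := by
  refine wF_eq_zero S (fun g hg y hy => ?_) (mem_hList.mpr ⟨i, hγ, rfl⟩)
    (fun y hy => gF_h_eq_zero S hi hy) hx
  obtain ⟨j, _, rfl⟩ := mem_hList.mp hg
  exact gF_h_mem S _ j hy

/-- Necessary conditions for a normally ordered monomial to act non-trivially. -/
structure Relevant (r : ℕ) (t : Idx) : Prop where
  β : ∀ i, t.β i ≠ 0 → |i| < (r : ℤ)
  γ : ∀ i, t.γ i ≠ 0 → |i| < (r : ℤ)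
  component : ∀ I, IsComponent (supp t) I → ∃ i ∈ I, |i| < (r : ℤ)

lemma wF_monomialWord_eq_zero {N : ℕ} {x : CBasis M →₀ R} (hx : x ∈ supportedOn (stabSet S N)) {t : Idx}
    (ht : ¬ Relevant (radius S N) t) {L L' : List ℤ} (hL : content L = t.α) (hL' : content L' = t.β) :
    wF S (monomialWord t.l L t.γ L') x = 0 := by
  rw [wF_monomialWord]
  by_cases h1 : ∀ i, t.β i ≠ 0 → |i| < (radius S N : ℤ)
  swap
  · push Not at h1
    obtain ⟨i, hi, hi'⟩ := h1
    rw [← hL', ← mem_iff_content] at hi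
    rw [wF_e_eq_zero S hi (le_level S hi') hx]
    simp
  have hx1 := wF_e_mem S L' hx
  by_cases h2 : ∀ i, t.γ i ≠ 0 → |i| < (radius S N : ℤ)
  swap
  · push Not at h2
    obtain ⟨i, hi, hi'⟩ := h2
    rw [wF_h_eq_zero S hi hi' hx1]
    simp
  have hx2 := wF_h_mem S _ t.γ hx1
  have h3 : ¬ ∀ I, IsComponent (supp t) I → ∃ i ∈ I, |i| < (radius S N : ℤ) :=
    fun h3 => ht ⟨h1, h2, h3⟩
  push Not at h3
  obtain ⟨I, hI, hI'⟩ := h3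
  obtain ⟨a, b, hab, rfl, hsub, ha, hb⟩ := hI
  have hα : ∀ j, j ∈ L ↔ t.α j ≠ 0 := fun j => by rw [mem_iff_content, hL]
  have hmem : a ∈ L := by
    rw [hα]
    rcases hsub (Set.left_mem_Icc.mpr hab) with h | h
    · exact h
    · exact absurd (h2 a h) (not_lt.mpr (hI' a (Set.left_mem_Icc.mpr hab)))
  rw [wF_f_eq_zero S (I := Set.Icc a b) ⟨a, hmem, Set.left_mem_Icc.mpr hab⟩, smul_zero]
  · intro i _ hi j hj hj' hij
    rw [Set.mem_Icc] at hi hj'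
    have hne1 : j ≠ a - 1 := fun h => ha (Or.inl (h ▸ (hα j).mp hj))
    have hne2 : j ≠ b + 1 := fun h => hb (Or.inl (h ▸ (hα j).mp hj))
    rw [abs_eq zero_le_one] at hij
    omega
  · exact fun i _ hi => gF_f_eq_zero S (hI' i hi) hx2

lemma wF_f_mem_compl {N : ℕ} {L : List ℤ} {i : ℤ} (hi : i ∈ L) (hN : N ≤ level i + 1)
    (x : CBasis M →₀ R) : wF S (L.map Gen.f) x ∈ supportedOn (stabSet S N)ᶜ := by
  induction L with
  | nil => simp at hi
  | cons j L ih =>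
    rw [List.map_cons, wF_cons]
    rcases List.mem_cons.mp hi with rfl | h
    · exact gF_f_mem_compl_of_le S hN _
    · exact gF_f_mem_compl S N j (ih h)

lemma wF_monomialWord_mem_compl {N r : ℕ} (hr : radius S N ≤ r) {x : CBasis M →₀ R}
    (hx : x ∈ supportedOn (stabSet S N)) {t : Idx} (ht : ¬ InRange r t) {L L' : List ℤ}
    (hL : content L = t.α) (hL' : content L' = t.β) :
    wF S (monomialWord t.l L t.γ L') x ∈ supportedOn (stabSet S N)ᶜ := by
  by_cases h : Relevant (radius S N) t
  swap
  · rw [wF_monomialWord_eq_zero S hx h hL hL']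
    exact zero_mem _
  have hr' : (radius S N : ℤ) ≤ r := by exact_mod_cast hr
  have h1 : ∃ i, t.α i ≠ 0 ∧ (r : ℤ) ≤ |i| := by
    by_contra! h1
    refine ht ⟨h1, fun i hi => (h.β i hi).trans_le hr', fun i hi => ?_⟩
    have := abs_lt.mp ((h.γ i hi).trans_le hr')
    omega
  obtain ⟨i, hi, hi'⟩ := h1
  rw [← hL, ← mem_iff_content] at hi
  rw [wF_monomialWord]
  exact Submodule.smul_mem _ _ (wF_f_mem_compl S hi (le_level S (hr'.trans hi')) _)

/-- Every summand acts on the finite linear combinations of patterns. -/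
lemma rep_summand_toV {t : Idx} {y : Uh} (hy : y ∈ summands t) (x : CBasis M →₀ R) :
    ∃ z, rep S y (toV M x) = toV M z := by
  refine Submodule.span_induction (p := fun y _ => ∃ z, rep S y (toV M x) = toV M z) ?_ ?_ ?_ ?_
    (summands_le t hy)
  · rintro _ ⟨L, L', _, _, rfl⟩
    exact ⟨_, rep_word S _ x⟩
  · exact ⟨0, by simp⟩
  · rintro a b _ _ ⟨z, hz⟩ ⟨z', hz'⟩
    exact ⟨z + z', by rw [map_add, LinearMap.add_apply, hz, hz', map_add]⟩
  · rintro c a _ ⟨z, hz⟩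
    exact ⟨c • z, by rw [map_smul, LinearMap.smul_apply, hz, map_smul]⟩

lemma rep_summand_eq_zero {N : ℕ} {x : CBasis M →₀ R} (hx : x ∈ supportedOn (stabSet S N)) {t : Idx}
    (ht : ¬ Relevant (radius S N) t) {y : Uh} (hy : y ∈ summands t) : rep S y (toV M x) = 0 := by
  refine Submodule.span_induction (p := fun y _ => rep S y (toV M x) = 0) ?_ ?_ ?_ ?_
    (summands_le t hy)
  · rintro _ ⟨L, L', hL, hL', rfl⟩
    rw [rep_word, wF_monomialWord_eq_zero S hx ht hL hL', map_zero]
  · simp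
  · intro a b _ _ ha hb
    rw [map_add, LinearMap.add_apply, ha, hb, add_zero]
  · intro c a _ ha
    rw [map_smul, LinearMap.smul_apply, ha, smul_zero]

lemma rep_outOfRange {N r : ℕ} (hr : radius S N ≤ r) {x : CBasis M →₀ R}
    (hx : x ∈ supportedOn (stabSet S N)) {y : Uh} (hy : y ∈ outOfRange r) {Q : CBasis M}
    (hQ : Q ∈ stabSet S N) : (rep S y (toV M x)).1 Q = 0 := by
  have key : ∀ t, ¬ InRange r t → ∀ y ∈ summands t, (rep S y (toV M x)).1 Q = 0 := by
    intro t ht y hy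
    refine Submodule.span_induction (p := fun y _ => (rep S y (toV M x)).1 Q = 0) ?_ ?_ ?_ ?_
      (summands_le t hy)
    · rintro _ ⟨L, L', hL, hL', rfl⟩
      rw [rep_word]
      have := wF_monomialWord_mem_compl S hr hx ht hL hL'
      rw [Finsupp.mem_supported'] at this
      exact this Q (Set.notMem_compl_iff.mpr hQ)
    · rw [map_zero]
      rfl
    · intro a b _ _ ha hb
      rw [map_add, LinearMap.add_apply, Submodule.coe_add, Pi.add_apply, ha, hb, add_zero]
    · intro c a _ ha
      rw [map_smul, LinearMap.smul_apply, Submodule.coe_smul, Pi.smul_apply, ha, smul_zero]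
  refine Submodule.span_induction (p := fun y _ => (rep S y (toV M x)).1 Q = 0) ?_ ?_ ?_ ?_ hy
  · rintro y ⟨t, ht, hy⟩
    exact key t ht y hy
  · rw [map_zero]
    rfl
  · intro a b _ _ ha hb
    rw [map_add, LinearMap.add_apply, Submodule.coe_add, Pi.add_apply, ha, hb, add_zero]
  · intro c a _ ha
    rw [map_smul, LinearMap.smul_apply, Submodule.coe_smul, Pi.smul_apply, ha, smul_zero]

end

end QuantumAInf

end

noncomputable section

namespace QuantumAInf

open Polynomial QSqrt

/-! ### The action of the completion -/

lemma exists_isComponent {T : Set ℤ} (hT : T.Finite) {i : ℤ} (hi : i ∈ T) :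
    ∃ I, IsComponent T I ∧ i ∈ I := by
  classical
  have key : ∀ s : ℤ, s ≠ 0 → ∃ n : ℕ, i + s * n ∉ T ∧ ∀ m < n, i + s * m ∈ T := by
    intro s hs
    have hex : ∃ n : ℕ, i + s * n ∉ T := by
      by_contra! h
      refine Set.infinite_range_of_injective (f := fun n : ℕ => i + s * (n : ℤ)) ?_
        (hT.subset (Set.range_subset_iff.mpr h))
      intro a b hab
      have := mul_left_cancel₀ hs (add_left_cancel hab)
      exact_mod_cast this
    exact ⟨Nat.find hex, Nat.find_spec hex, fun m hm => not_not.mp (Nat.find_min hex hm)⟩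
  obtain ⟨p, hp, hp'⟩ := key 1 one_ne_zero
  obtain ⟨m, hm, hm'⟩ := key (-1) (by norm_num)
  have hp0 : p ≠ 0 := fun h => hp (by simpa [h] using hi)
  have hm0 : m ≠ 0 := fun h => hm (by simpa [h] using hi)
  refine ⟨Set.Icc (i - m + 1) (i + p - 1), ⟨_, _, by omega, rfl, fun j hj => ?_, ?_, ?_⟩, ?_⟩
  · rw [Set.mem_Icc] at hj
    rcases le_total i j with h | h
    · have := hp' (j - i).toNat (by omega)
      rwa [show i + 1 * ((j - i).toNat : ℤ) = j by omega] at this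
    · have := hm' (i - j).toNat (by omega)
      rwa [show i + -1 * ((i - j).toNat : ℤ) = j by omega] at this
  · rwa [show i - m + 1 - 1 = i + -1 * (m : ℤ) by ring]
  · rwa [show i + p - 1 + 1 = i + 1 * (p : ℤ) by ring]
  · rw [Set.mem_Icc]
    omega

lemma supp_finite (t : Idx) : (supp t).Finite := by
  refine ((t.α.support ∪ t.γ.support : Finset ℤ).finite_toSet).subset fun i hi => ?_
  rcases hi with h | h <;> simp [h]

lemma InRange.mono {r r' : ℕ} {t : Idx} (h : InRange r t) (hr : r ≤ r') : InRange r' t := by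
  have hr' : (r : ℤ) ≤ r' := by exact_mod_cast hr
  refine ⟨fun i hi => (h.1 i hi).trans_le hr', fun i hi => (h.2.1 i hi).trans_le hr', fun i hi => ?_⟩
  have := h.2.2 i hi
  omega

lemma FormalSeries.Admissible.exists_inRange {u : FormalSeries} (hu : u.Admissible) (k r : ℕ) :
    ∃ r' : ℕ, ∀ t, u.coeff k t ≠ 0 → Relevant r t → InRange r' t := by
  have hU : (⋃ i ∈ Set.Icc (-(r : ℤ)) r, u.interval k i).Finite :=
    (Set.finite_Icc _ _).biUnion fun i _ => hu.finite_interval k i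
  have hU' : (⋃₀ ⋃ i ∈ Set.Icc (-(r : ℤ)) r, u.interval k i).Finite := by
    refine hU.sUnion fun I hI => ?_
    simp only [Set.mem_iUnion] at hI
    obtain ⟨i, _, ⟨t, _, a, b, _, rfl, _⟩, _⟩ := hI
    exact Set.finite_Icc a b
  obtain ⟨B, hB⟩ := (hU'.image fun i => |i|).bddAbove
  refine ⟨max r (B.toNat + 1), fun t ht hrel => ?_⟩
  have hmax : (r : ℤ) ≤ (max r (B.toNat + 1) : ℕ) := by exact_mod_cast le_max_left _ _
  have hmax' : (B.toNat : ℤ) + 1 ≤ (max r (B.toNat + 1) : ℕ) := by exact_mod_cast le_max_right _ _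
  refine ⟨fun i hi => ?_, fun i hi => (hrel.β i hi).trans_le hmax, fun i hi => ?_⟩
  · obtain ⟨I, hI, hiI⟩ := exists_isComponent (supp_finite t) (show i ∈ supp t from Or.inl hi)
    obtain ⟨j, hj, hjr⟩ := hrel.component I hI
    have hj' := abs_lt.mp hjr
    have := hB ⟨i, ⟨I, Set.mem_biUnion (Set.mem_Icc.mpr ⟨hj'.1.le, hj'.2.le⟩)
      ⟨⟨t, ht, hI⟩, hj⟩, hiI⟩, rfl⟩
    simp only at this
    omega
  · have := abs_lt.mp (hrel.γ i hi)
    omega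

section

variable {M : ℤ → ℂ[X]} (S : SigData M)

lemma single_mem_supportedOn {A : Set (CBasis M)} {P : CBasis M} (hP : P ∈ A) :
    Finsupp.single P 1 ∈ supportedOn A := Finsupp.single_mem_supported R 1 hP

lemma exists_inRange {u : FormalSeries} (hu : u.Admissible) (P : CBasis M) (k : ℕ) :
    ∃ r : ℕ, 0 < r ∧ ∀ t, rep S (u.coeff k t) (vec P) ≠ 0 → InRange r t := by
  obtain ⟨N, hN⟩ := exists_stab S P
  obtain ⟨r, hr⟩ := hu.exists_inRange k (radius S N)
  refine ⟨r + 1, by omega, fun t ht => InRange.mono (hr t ?_ ?_) (Nat.le_succ r)⟩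
  · intro h0
    rw [h0, map_zero] at ht
    exact ht rfl
  · by_contra h
    refine ht ?_
    rw [← toV_single]
    exact rep_summand_eq_zero S (single_mem_supportedOn hN) h (u.mem k t)

lemma finite_summands {u : FormalSeries} (hu : u.Admissible) (P : CBasis M) (k : ℕ) :
    {t | rep S (u.coeff k t) (vec P) ≠ 0}.Finite := by
  obtain ⟨r, hr0, hr⟩ := exists_inRange S hu P k
  refine (hu.finite_truncation r hr0 k).subset fun t ht => ⟨hr t ht, fun h0 => ht ?_⟩
  rw [h0, map_zero]
  rfl

lemma isFiniteVec_sum {u : FormalSeries} (hu : u.Admissible) (P : CBasis M) (k : ℕ) :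
    IsFiniteVec (∑ᶠ t, rep S (u.coeff k t) (vec P)) := by
  rw [isFiniteVec_iff, finsum_eq_sum _ (finite_summands S hu P k)]
  choose z hz using fun t => rep_summand_toV S (u.mem k t) (Finsupp.single P 1)
  refine ⟨∑ t ∈ (finite_summands S hu P k).toFinset, z t, ?_⟩
  rw [map_sum]
  refine Finset.sum_congr rfl fun t _ => ?_
  rw [← hz, toV_single]

/-- The action on a fixed vector. -/
def evalRep (v : V M) : Uh →ₗ[R] V M where
  toFun y := rep S y v
  map_add' x y := by rw [map_add, LinearMap.add_apply]
  map_smul' c x := by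
    rw [map_smul, LinearMap.smul_apply]
    rfl

lemma evalRep_apply (v : V M) (y : Uh) : evalRep S v y = rep S y v := rfl

/-- `T` is the limit of the operators of a sequence. -/
def IsLim (x : ℕ+ → Uh) (T : Module.End R (V M)) : Prop :=
  ∀ v n, ∃ r₀ : ℕ+, ∀ r ≥ r₀, rep S (x r) v - T v ∈ hpow (V M) n

lemma IsLim.unique {x : ℕ+ → Uh} {T T' : Module.End R (V M)} (h : IsLim S x T) (h' : IsLim S x T') :
    T = T' := by
  refine LinearMap.ext fun v => sub_eq_zero.mp (isSep_V _ fun n => ?_)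
  obtain ⟨r, hr⟩ := h v n
  obtain ⟨r', hr'⟩ := h' v n
  have := sub_mem (hr' (max r r') (le_max_right _ _)) (hr (max r r') (le_max_left _ _))
  rwa [sub_sub_sub_cancel_left] at this

lemma eq_of_hasHSum_sub {N : Type*} [AddCommGroup N] [Module R N] {a b : ℕ → N} {s t : N} {n : ℕ}
    (ha : HasHSum a s) (hb : HasHSum b t) (h : ∀ k < n, a k = b k) : s - t ∈ hpow N n := by
  rw [hasHSum_iff] at ha hb
  have h1 := sub_mem (ha n) (hb n)
  rw [Finset.sum_congr rfl fun k hk => by rw [h k (Finset.mem_range.mp hk)],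
    sub_sub_sub_cancel_right] at h1
  exact h1

lemma exists_forall_lt_bound (p : ℕ → ℕ → Prop) (hp : ∀ k r r', r ≤ r' → p k r → p k r')
    (h : ∀ k, ∃ r, p k r) (n : ℕ) : ∃ r : ℕ+, ∀ k < n, p k r := by
  choose f hf using h
  refine ⟨⟨∑ k ∈ Finset.range n, f k + 1, Nat.succ_pos _⟩, fun k hk => hp k _ _ ?_ (hf k)⟩
  exact (Finset.single_le_sum (f := f) (fun _ _ => Nat.zero_le _) (Finset.mem_range.mpr hk)).trans
    (Nat.le_succ _)

lemma rep_truncation_sub {u : FormalSeries} {x : ℕ+ → Uh} (hu : u.Represents x) (P : CBasis M)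
    {s : V M} (hs : HasHSum (fun k => ∑ᶠ t, rep S (u.coeff k t) (vec P)) s) (n : ℕ) :
    ∃ r₀ : ℕ+, ∀ r ≥ r₀, rep S (x r) (vec P) - s ∈ hpow (V M) n := by
  obtain ⟨r₀, hr₀⟩ := exists_forall_lt_bound
    (fun k r => ∀ t, rep S (u.coeff k t) (vec P) ≠ 0 → InRange r t)
    (fun k r r' h h1 t ht => (h1 t ht).mono h)
    (fun k => (exists_inRange S hu.1 P k).imp fun r h => h.2) n
  refine ⟨r₀, fun r hr => ?_⟩
  have h1 := (hu.2 r).map (evalRep S (vec P))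
  refine eq_of_hasHSum_sub h1 hs fun k hk => ?_
  rw [map_finsum _ (hu.1.finite_support r.pos k)]
  refine finsum_congr fun t => ?_
  rw [evalRep_apply, FormalSeries.truncCoeff]
  split_ifs with h
  · rfl
  · rw [map_zero, LinearMap.zero_apply]
    by_contra h2
    exact h ((hr₀ k hk t (Ne.symm h2)).mono hr)

lemma exists_isLim (x : UhA) : ∃ T, IsLim S x.1 T := by
  obtain ⟨u, hu⟩ := x.2
  choose s hs using fun P : CBasis M => exists_hasHSum_V fun k =>
    ∑ᶠ t, rep S (u.coeff k t) (vec P)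
  have hvec := fun P => rep_truncation_sub S hu P (hs P)
  refine ⟨ext (Finsupp.linearCombination R s), fun v n => ?_⟩
  have hfin : ∀ y : CBasis M →₀ R, ∃ r₀ : ℕ+, ∀ r ≥ r₀,
      rep S (x.1 r) (toV M y) - Finsupp.linearCombination R s y ∈ hpow (V M) n := by
    intro y
    induction y using Finsupp.induction_linear with
    | zero => exact ⟨1, fun r _ => by simp⟩
    | add y z hy hz =>
      obtain ⟨a, ha⟩ := hy
      obtain ⟨b, hb⟩ := hz
      refine ⟨max a b, fun r hr => ?_⟩
      rw [map_add, map_add, map_add, add_sub_add_comm]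
      exact add_mem (ha r ((le_max_left _ _).trans hr)) (hb r ((le_max_right _ _).trans hr))
    | single P c =>
      obtain ⟨a, ha⟩ := hvec P n
      refine ⟨a, fun r hr => ?_⟩
      have h2 : rep S (x.1 r) (toV M (Finsupp.single P c)) -
          Finsupp.linearCombination R s (Finsupp.single P c) =
            c • (rep S (x.1 r) (vec P) - s P) := by
        rw [← Finsupp.smul_single_one, map_smul, map_smul, map_smul, toV_single,
          Finsupp.linearCombination_single, one_smul]
        exact (smul_sub c _ _).symm
      rw [h2]
      exact Submodule.smul_mem _ c (ha r hr)
  obtain ⟨y, hy⟩ := exists_approx v n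
  obtain ⟨r₀, hr₀⟩ := hfin y
  refine ⟨r₀, fun r hr => ?_⟩
  have h1 := map_mem_hpow (rep S (x.1 r)) hy
  have h2 := map_mem_hpow (ext (Finsupp.linearCombination R s)) hy
  have h3 := add_mem (sub_mem h1 h2) (hr₀ r hr)
  rw [map_sub, map_sub, ext_toV] at h3
  convert h3 using 1
  abel

/-- The representation of the completion. -/
def repA : UhA →ₗ[R] Module.End R (V M) where
  toFun x := (exists_isLim S x).choose
  map_add' x y := by
    refine IsLim.unique S (exists_isLim S (x + y)).choose_spec fun v n => ?_
    obtain ⟨a, ha⟩ := (exists_isLim S x).choose_spec v n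
    obtain ⟨b, hb⟩ := (exists_isLim S y).choose_spec v n
    refine ⟨max a b, fun r hr => ?_⟩
    have := add_mem (ha r ((le_max_left _ _).trans hr)) (hb r ((le_max_right _ _).trans hr))
    have e : (x + y : UhA).1 r = x.1 r + y.1 r := rfl
    rwa [e, map_add, LinearMap.add_apply, LinearMap.add_apply, add_sub_add_comm]
  map_smul' c x := by
    refine IsLim.unique S (exists_isLim S (c • x)).choose_spec fun v n => ?_
    obtain ⟨a, ha⟩ := (exists_isLim S x).choose_spec v n
    refine ⟨a, fun r hr => ?_⟩
    have := Submodule.smul_mem _ c (ha r hr)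
    have e : (c • x : UhA).1 r = c • x.1 r := rfl
    rw [e, map_smul, LinearMap.smul_apply, RingHom.id_apply, LinearMap.smul_apply]
    convert this using 1
    exact (smul_sub c _ _).symm

lemma isLim_repA (x : UhA) : IsLim S x.1 (repA S x) := (exists_isLim S x).choose_spec

lemma hasHSum_repA {x : UhA} {u : FormalSeries} (hu : u.Represents x.1) (P : CBasis M) :
    HasHSum (fun k => ∑ᶠ t, rep S (u.coeff k t) (vec P)) (repA S x (vec P)) := by
  obtain ⟨s, hs⟩ := exists_hasHSum_V fun k => ∑ᶠ t, rep S (u.coeff k t) (vec P)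
  suffices h : repA S x (vec P) = s by rwa [h]
  refine sub_eq_zero.mp (isSep_V _ fun n => ?_)
  obtain ⟨r, hr⟩ := rep_truncation_sub S hu P hs n
  obtain ⟨r', hr'⟩ := isLim_repA S x (vec P) n
  have := sub_mem (hr (max r r') (le_max_left _ _)) (hr' (max r r') (le_max_right _ _))
  rwa [sub_sub_sub_cancel_left] at this

lemma repA_mul_limit (u v : UhA) (x : V M) (n : ℕ) : ∃ s₀ : ℕ+, ∀ s ≥ s₀,
    rep S (u.1 s * v.1 s) x - repA S u (repA S v x) ∈ hpow (V M) n := by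
  obtain ⟨a, ha⟩ := isLim_repA S v x n
  obtain ⟨b, hb⟩ := isLim_repA S u (repA S v x) n
  refine ⟨max a b, fun s hs => ?_⟩
  have h1 := map_mem_hpow (rep S (u.1 s)) (ha s ((le_max_left _ _).trans hs))
  have h2 := add_mem h1 (hb s ((le_max_right _ _).trans hs))
  rwa [map_sub, sub_add_sub_cancel, ← Module.End.mul_apply, ← map_mul] at h2

lemma exists_inRange_idx (t : Idx) : ∃ r, InRange r t := by
  have hf : ((t.α.support ∪ t.β.support ∪ t.γ.support : Finset ℤ) : Set ℤ).Finite :=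
    Finset.finite_toSet _
  obtain ⟨B, hB⟩ := (hf.image fun i => |i|).bddAbove
  have hB' : ∀ i, t.α i ≠ 0 ∨ t.β i ≠ 0 ∨ t.γ i ≠ 0 → |i| ≤ B := fun i hi =>
    hB ⟨i, by simpa [or_assoc] using hi, rfl⟩
  refine ⟨B.toNat + 1, fun i hi => ?_, fun i hi => ?_, fun i hi => ?_⟩
  · have := hB' i (Or.inl hi)
    omega
  · have := hB' i (Or.inr (Or.inl hi))
    omega
  · have := abs_le.mp (hB' i (Or.inr (Or.inr hi)))
    omega

lemma exists_inRange_of_finite {T : Set Idx} (hT : T.Finite) : ∃ r, ∀ t ∈ T, InRange r t := by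
  choose f hf using exists_inRange_idx
  refine ⟨∑ t ∈ hT.toFinset, f t, fun t ht => (hf t).mono ?_⟩
  exact Finset.single_le_sum (f := f) (fun _ _ => Nat.zero_le _) (hT.mem_toFinset.mpr ht)

lemma repA_of_isImage {u : Uh} {x : UhA} (h : IsImage u x) : repA S x = rep S u := by
  obtain ⟨D, hD, hsum, hrep⟩ := h
  refine IsLim.unique S (isLim_repA S x) fun v n => ?_
  obtain ⟨r₀, hr₀⟩ := exists_forall_lt_bound (fun k r => ∀ t, D.coeff k t ≠ 0 → InRange r t)
    (fun k r r' h h1 t ht => (h1 t ht).mono h) (fun k => exists_inRange_of_finite (hD k)) n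
  refine ⟨r₀, fun r hr => ?_⟩
  have h1 : x.1 r - u ∈ hpow Uh n := by
    refine eq_of_hasHSum_sub (hrep.2 r) hsum fun k hk => finsum_congr fun t => ?_
    rw [FormalSeries.truncCoeff]
    split_ifs with h
    · rfl
    · by_contra h2
      exact h ((hr₀ k hk t (Ne.symm h2)).mono hr)
  have := map_mem_hpow (evalRep S v) h1
  rwa [map_sub] at this

lemma repA_of_isProduct {u v w : UhA} (h : IsProduct u v w) : repA S w = repA S u * repA S v := by
  refine linearMap_ext_of_vec isSep_V fun P => ?_
  refine Subtype.ext (funext fun Q => ?_)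
  rw [← sub_eq_zero]
  have key : ∀ n, (PowerSeries.X : R) ^ n ∣
      (repA S w (vec P) - repA S u (repA S v (vec P))).1 Q := by
    intro n
    obtain ⟨N₁, hN₁⟩ := exists_stab S P
    obtain ⟨N₂, hN₂⟩ := exists_stab S Q
    have hP : P ∈ stabSet S (max N₁ N₂) := hN₁.mono S (le_max_left _ _)
    have hQ : Q ∈ stabSet S (max N₁ N₂) := hN₂.mono S (le_max_right _ _)
    obtain ⟨a, ha⟩ := isLim_repA S w (vec P) n
    obtain ⟨r, har, hr⟩ : ∃ r : ℕ+, a ≤ r ∧ radius S (max N₁ N₂) ≤ r :=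
      ⟨max a (Nat.succPNat (radius S (max N₁ N₂))), le_max_left _ _,
        (Nat.le_succ _).trans ((PNat.coe_le_coe (Nat.succPNat (radius S (max N₁ N₂))) _).mpr
          (le_max_right a _))⟩
    obtain ⟨s₀, hs₀⟩ := h r n
    obtain ⟨s₁, hs₁⟩ := repA_mul_limit S u v (vec P) n
    obtain ⟨z, hz, y, hy⟩ := hs₀ (max s₀ s₁) (le_max_left _ _)
    have h1 := mem_hpow_V.mp (hs₁ (max s₀ s₁) (le_max_right _ _)) Q
    have h2 := mem_hpow_V.mp (ha r har) Q
    have h3 := rep_outOfRange S hr (single_mem_supportedOn hP) hz hQ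
    rw [toV_single] at h3
    have h4 := congrArg (fun y => (evalRep S (vec P) y).1 Q) hy
    simp only [map_sub, map_add, map_smul, evalRep_apply] at h4
    have h5 : (PowerSeries.X : R) ^ n ∣ (hh ^ n • rep S y (vec P) : V M).1 Q := ⟨_, rfl⟩
    generalize rep S (u.1 (max s₀ s₁) * v.1 (max s₀ s₁)) (vec P) = A at *
    generalize rep S (w.1 r) (vec P) = B at *
    generalize (hh ^ n • rep S y (vec P) : V M) = C at *
    have h6 : (repA S w (vec P) - repA S u (repA S v (vec P))).1 Q =
        (A - repA S u (repA S v (vec P))).1 Q - (B - repA S w (vec P)).1 Q - C.1 Q := by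
      have h4' : A.1 Q - B.1 Q = (rep S z (vec P)).1 Q + C.1 Q := h4
      rw [h3, zero_add] at h4'
      rw [← h4']
      change (repA S w (vec P)).1 Q - (repA S u (repA S v (vec P))).1 Q =
        (A.1 Q - (repA S u (repA S v (vec P))).1 Q) - (B.1 Q - (repA S w (vec P)).1 Q) -
          (A.1 Q - B.1 Q)
      ring
    rw [h6]
    exact dvd_sub (dvd_sub h1 h2) h5
  have key' : (repA S w (vec P) - repA S u (repA S v (vec P))).1 Q = 0 := by
    refine PowerSeries.ext fun k => ?_
    exact (PowerSeries.X_pow_dvd_iff.mp (key (k + 1))) k (by omega)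
  exact key'

lemma isRepresentation_repA : IsRepresentation (rep S) (repA S) where
  extends_small u x h := repA_of_isImage S h
  mul u v w h := repA_of_isProduct S h
  mul_limit u v x n := by
    obtain ⟨s₀, hs₀⟩ := repA_mul_limit S u v x n
    exact ⟨s₀, fun s hs => mem_hpow.mp (hs₀ s hs)⟩

end

end QuantumAInf

end

noncomputable section

namespace QuantumAInf

open Polynomial QSqrt

/-! ### Continuity, restrictedness and the highest weight vector -/

lemma continuous_adic {N N' : Type*} [AddCommGroup N] [Module R N] [AddCommGroup N'] [Module R N']
    (I : Ideal R) (f : N →ₗ[R] N') :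
    @Continuous N N' (I.adicModuleTopology N) (I.adicModuleTopology N') f := by
  let _ : TopologicalSpace R := I.adic_basis.topology
  have h1 := fun x => (I.ringFilterBasis.moduleFilterBasis
    (I.adic_module_basis N)).toAddGroupFilterBasis.nhds_hasBasis x
  have h2 := fun x => (I.ringFilterBasis.moduleFilterBasis
    (I.adic_module_basis N')).toAddGroupFilterBasis.nhds_hasBasis x
  let _ := I.adicModuleTopology N
  let _ := I.adicModuleTopology N'
  rw [continuous_iff_continuousAt]
  intro x
  refine ((h1 x).tendsto_iff (h2 (f x))).mpr ?_
  rintro _ ⟨n, rfl⟩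
  refine ⟨_, ⟨n, rfl⟩, ?_⟩
  rintro _ ⟨y, hy, rfl⟩
  refine ⟨f y, ?_, (map_add f x y).symm⟩
  have h3 : (I ^ n • (⊤ : Submodule R N)).map f ≤ I ^ n • (⊤ : Submodule R N') := by
    rw [Submodule.map_smul'']
    exact smul_mono_right _ le_top
  exact h3 (Submodule.mem_map_of_mem hy)

section

variable {M : ℤ → ℂ[X]} (S : SigData M)

lemma isHContinuous_repA : IsHContinuous (repA S) := by
  have h := continuous_adic (N := UhA) (N' := Module.End R (V M)) (Ideal.span {hh}) (repA S)
  unfold IsHContinuous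
  exact h

lemma rep_wordSpan_eq_zero {g : ℤ → Gen} {β : ℤ →₀ ℕ} {v : V M}
    (h : ∀ L, content L = β → rep S (word (L.map g)) v = 0) {x : Uh} (hx : x ∈ wordSpan g β) :
    rep S x v = 0 := by
  refine Submodule.span_induction (p := fun x _ => rep S x v = 0) ?_ ?_ ?_ ?_ hx
  · rintro _ ⟨L, hL, rfl⟩
    exact h L hL
  · simp
  · intro a b _ _ ha hb
    rw [map_add, LinearMap.add_apply, ha, hb, add_zero]
  · intro c a _ ha
    rw [map_smul, LinearMap.smul_apply, ha, smul_zero]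

lemma exists_mem_supportedOn (x : CBasis M →₀ R) : ∃ N, x ∈ supportedOn (stabSet S N) := by
  choose f hf using exists_stab S
  refine ⟨∑ P ∈ x.support, f P, fun P hP => (hf P).mono S ?_⟩
  exact Finset.single_le_sum (f := f) (fun _ _ => Nat.zero_le _) hP

lemma isRestrictedRep_rep : IsRestrictedRep (rep S) := by
  intro v hv
  obtain ⟨x, rfl⟩ := isFiniteVec_iff.mp hv
  obtain ⟨N, hN⟩ := exists_mem_supportedOn S x
  refine ⟨radius S N, fun β hβ y hy => ?_, fun α hα hα' y hy => ?_, fun i hi => ?_⟩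
  · obtain ⟨i, hi, hi'⟩ := Set.not_subset.mp hβ
    have hi'' : (radius S N : ℤ) ≤ |i| := by
      rw [Set.mem_Ioo, ← abs_lt] at hi'
      exact not_lt.mp hi'
    refine rep_wordSpan_eq_zero S (fun L hL => ?_) (nPlus_subset hy)
    rw [rep_word, wF_e_eq_zero S (mem_iff_content.mpr ?_) (le_level S hi'') hN, map_zero]
    rw [hL]
    simpa using hi
  · refine rep_wordSpan_eq_zero S (fun L hL => ?_) (nMinus_subset hy)
    have hmem : ∀ i ∈ L, (radius S N : ℤ) ≤ |i| := by
      intro i hi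
      have hi' : i ∈ (α.support : Set ℤ) := by
        rw [mem_iff_content, hL] at hi
        simpa using hi
      rcases hα' with h | h
      · have := h hi'
        rw [Set.mem_Iic] at this
        rw [le_abs]
        omega
      · exact (h hi').trans (le_abs_self i)
    have hne : ∃ i ∈ L, i ∈ Set.univ := by
      obtain ⟨i, hi⟩ := Finsupp.ne_iff.mp hα
      exact ⟨i, mem_iff_content.mpr (by rw [hL]; exact hi), trivial⟩
    rw [rep_word, wF_f_eq_zero S hne (fun _ _ _ _ _ h => absurd trivial h)
      (fun i hi _ => gF_f_eq_zero S (hmem i hi) hN), map_zero]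
  · rw [rep_ug, gF_h_eq_zero S hi hN, map_zero]

open Classical in
/-- The entries of the pattern all of whose rows agree with the signature. -/
def topEntries (M : ℤ → ℂ[X]) : ℕ → ℤ → ℂ[X] := fun p i => if i ∈ row p then M i else 0

include S in
lemma isCPattern_topEntries : IsCPattern M (topEntries M) := by
  have hM : ∀ i j : ℤ, i ≤ j → IsNatP (M i - M j) := by
    intro i j hij
    have := S.anti i j hij
    have e : M i - M j = ((S.cc i - S.cc j : ℤ) : ℂ[X]) := by
      rw [S.M_eq i, S.M_eq j]
      push_cast
      ring
    rw [e, isNatP_intCast]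
    omega
  have hrow : ∀ {p : ℕ} {i : ℤ}, i ∈ row p → topEntries M p i = M i := fun h => if_pos h
  refine ⟨fun p i hi => if_neg hi, ⟨2, by omega, fun p _ i hi => hrow hi⟩, ?_, ?_⟩
  · intro k hk i hi
    unfold row at hi
    rw [Finset.mem_Icc] at hi
    rw [hrow (p := 2 * k) (i := i - 1) (by unfold row; rw [Finset.mem_Icc]; omega),
      hrow (p := 2 * k - 1) (i := i) (by unfold row; rw [Finset.mem_Icc]; omega),
      hrow (p := 2 * k) (i := i) (by unfold row; rw [Finset.mem_Icc]; omega)]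
    exact ⟨hM _ _ (by omega), hM _ _ le_rfl⟩
  · intro k hk i hi
    unfold row at hi
    rw [Finset.mem_Icc] at hi
    rw [hrow (p := 2 * k) (i := i) (by unfold row; rw [Finset.mem_Icc]; omega),
      hrow (p := 2 * k + 1) (i := i) (by unfold row; rw [Finset.mem_Icc]; omega),
      hrow (p := 2 * k + 1) (i := i + 1) (by unfold row; rw [Finset.mem_Icc]; omega)]
    exact ⟨hM _ _ le_rfl, hM _ _ (by omega)⟩

/-- The pattern all of whose rows agree with the signature. -/
def topP : CBasis M := ⟨topEntries M, isCPattern_topEntries S⟩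

lemma topP_apply (p : ℕ) (i : ℤ) (hi : i ∈ row p) : (topP S).1 p i = M i := if_pos hi

lemma stab_zero_iff {P : CBasis M} : P ∈ stabSet S 0 ↔ P = topP S := by
  rw [stabSet, Set.mem_ofPred_eq, stab_arrOf_iff]
  constructor
  · intro h
    refine Subtype.ext (funext fun p => funext fun i => ?_)
    by_cases hi : i ∈ row p
    · rw [h p (Nat.zero_le _) i hi, topP_apply S p i hi]
    · rw [P.2.outside p i hi, (topP S).2.outside p i hi]
  · rintro rfl p _ i hi
    exact topP_apply S p i hi

lemma raising_topP {β : ℤ →₀ ℕ} (hβ : β ≠ 0) {x : Uh} (hx : x ∈ nPlus β) :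
    rep S x (vec (topP S)) = 0 := by
  refine rep_wordSpan_eq_zero S (fun L hL => ?_) (nPlus_subset hx)
  obtain ⟨i, hi⟩ := Finsupp.ne_iff.mp hβ
  rw [← toV_single, rep_word, wF_e_eq_zero S (N := 0) (mem_iff_content.mpr (by rw [hL]; exact hi))
    (Nat.zero_le _) (single_mem_supportedOn ((stab_zero_iff S).mpr rfl)), map_zero]

end

/-! ### Elements of the completion given by series of normally ordered elements -/

lemma finite_components (t : Idx) : {I | IsComponent (supp t) I}.Finite := by
  refine (((supp_finite t).prod (supp_finite t)).image fun p => Set.Icc p.1 p.2).subset ?_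
  rintro I ⟨a, b, hab, rfl, hsub, _⟩
  exact ⟨(a, b), ⟨hsub (Set.left_mem_Icc.mpr hab), hsub (Set.right_mem_Icc.mpr hab)⟩, rfl⟩

lemma exists_isImage {F : ℕ → Uh} (hF : ∀ k, F k ∈ ⨆ t, summands t) :
    ∃ (y : Uh) (x : UhA), HasHSum F y ∧ IsImage y x := by
  choose f hf hsum using fun k => (Submodule.mem_iSup_iff_exists_finsupp _ _).mp (hF k)
  let D : FormalSeries := ⟨fun k t => f k t, fun k t => hf k t⟩
  have hfin : ∀ k, {t | D.coeff k t ≠ 0}.Finite := fun k => (f k).hasFiniteSupport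
  have hD : D.Admissible := by
    refine ⟨fun k => ?_, fun k i => ?_, fun r _ k => (hfin k).subset fun t ht => ht.2⟩
    · obtain ⟨L, hL⟩ := ((hfin k).image Idx.l).bddAbove
      refine ⟨L, fun t ht => ?_⟩
      by_contra h
      exact absurd (hL ⟨t, h, rfl⟩) (not_le.mpr ht)
    · refine ((hfin k).biUnion fun t _ => finite_components t).subset ?_
      rintro I ⟨⟨t, ht, hI⟩, _⟩
      exact Set.mem_biUnion ht hI
  obtain ⟨x, hx⟩ := hD.exists_represents
  obtain ⟨y, hy⟩ := exists_hasHSum F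
  refine ⟨y, ⟨x, D, hx⟩, hy, D, hfin, ?_, hx⟩
  have e : (fun k => ∑ᶠ t, D.coeff k t) = F := by
    funext k
    rw [← hsum k, finsum_eq_sum_of_support_subset]
    · rfl
    · intro t ht
      exact Finsupp.mem_support_iff.mpr ht
  rwa [e]

lemma hMon_zero : hMon 0 = 1 := by simp [hMon]

lemma word_f_mem_summands (L : List ℤ) : word (L.map Gen.f) ∈ ⨆ t, summands t := by
  refine Submodule.mem_iSup_of_mem ⟨0, content L, 0, 0⟩ (Submodule.subset_span
    ⟨_, word_f_mem L, 1, ?_, ?_⟩)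
  · exact word_e_mem []
  · simp [hMon_zero]

lemma word_e_mem_summands (L : List ℤ) : word (L.map Gen.e) ∈ ⨆ t, summands t := by
  refine Submodule.mem_iSup_of_mem ⟨0, 0, 0, content L⟩ (Submodule.subset_span
    ⟨1, ?_, _, word_e_mem L, ?_⟩)
  · exact word_f_mem []
  · simp [hMon_zero]

end QuantumAInf

end

noncomputable section

namespace QuantumAInf

open Polynomial QSqrt

/-! ### Extremal rows -/

/-- The entries of row `t` are as close to those of row `t + 1` as for a constant pattern. -/
def RowExt (t : ℕ) (Λ : Arr) : Prop :=
  ∀ κ < t, if Even t then Λ t κ = Λ (t + 1) κ else Λ t κ = Λ (t + 1) (κ + 1) + 1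

lemma rowExt_even {t : ℕ} (ht : Even t) {Λ : Arr} :
    RowExt t Λ ↔ ∀ κ < t, Λ t κ = Λ (t + 1) κ := by simp [RowExt, ht]

lemma rowExt_odd {t : ℕ} (ht : ¬ Even t) {Λ : Arr} :
    RowExt t Λ ↔ ∀ κ < t, Λ t κ = Λ (t + 1) (κ + 1) + 1 := by simp [RowExt, ht]

lemma exists_inter_raise {r a : ℕ} {Λ : Arr} (h : Inter Λ) (h0 : ∀ κ < r, Λ r κ = Λ (r + 1) κ)
    (h1 : ∀ κ < r + 1, Λ (r + 1) κ = Λ (r + 2) (κ + 1) + 1) (ha : a < r + 2)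
    (h2 : Λ (r + 2) a < Λ (r + 3) a) :
    ∃ k < r + 1, Inter (Λ + dl (r + 1) k + dl (r + 2) a) := by
  refine ⟨a - 1, by omega, fun p κ hκ => ?_⟩
  have I := h p κ hκ
  simp only [Pi.add_apply, dl]
  by_cases hp : p = r
  · subst hp
    have A := h0 κ hκ
    have B := h1 κ (by omega)
    have C := h1 (κ + 1) (by omega)
    have D := (h (p + 2) (κ + 1) (by omega)).2
    simp only [Nat.add_assoc, Nat.reduceAdd] at *
    by_cases e : κ + 2 = a
    · subst e
      simp
      omega
    · split_ifs <;> omega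
  by_cases hp1 : p = r + 1
  · subst hp1
    have B := h1 κ (by omega)
    have D := (h (r + 2) κ (by omega)).2
    simp only [Nat.add_assoc, Nat.reduceAdd] at *
    by_cases e : κ + 1 = a
    · subst e
      simp
      omega
    · simp
      split_ifs <;> omega
  by_cases hp2 : p = r + 2
  · subst hp2
    simp only [Nat.add_assoc, Nat.reduceAdd] at *
    by_cases e : κ = a
    · subst e
      simp
      omega
    · split_ifs <;> omega
  · split_ifs <;> omega

lemma exists_inter_lower {r a : ℕ} {Λ : Arr} (h : Inter Λ)
    (h0 : ∀ κ < r, Λ r κ = Λ (r + 1) (κ + 1) + 1)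
    (h1 : ∀ κ < r + 1, Λ (r + 1) κ = Λ (r + 2) κ) (ha : a < r + 2)
    (h2 : Λ (r + 3) (a + 1) + 1 < Λ (r + 2) a) :
    ∃ k < r + 1, Inter (Λ - dl (r + 1) k - dl (r + 2) a) := by
  refine ⟨min a r, by omega, fun p κ hκ => ?_⟩
  have I := h p κ hκ
  simp only [Pi.sub_apply, dl]
  by_cases hp : p = r
  · subst hp
    have A := h0 κ hκ
    have B := h1 κ (by omega)
    have C := h1 (κ + 1) (by omega)
    have D := (h (p + 2) (κ + 1) (by omega)).1
    simp only [Nat.add_assoc, Nat.reduceAdd] at *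
    by_cases e : κ = a
    · subst e
      rw [min_eq_left hκ.le]
      simp
      omega
    · split_ifs <;> omega
  by_cases hp1 : p = r + 1
  · subst hp1
    have B := h1 κ (by omega)
    have D := (h (r + 2) (κ + 1) (by omega)).1
    simp only [Nat.add_assoc, Nat.reduceAdd] at *
    by_cases e : κ = a
    · subst e
      rw [min_eq_left (by omega)]
      simp
      omega
    · simp
      split_ifs <;> omega
  by_cases hp2 : p = r + 2
  · subst hp2
    simp only [Nat.add_assoc, Nat.reduceAdd] at *
    by_cases e : κ = a
    · subst e
      simp
      omega
    · split_ifs <;> omega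
  · split_ifs <;> omega

lemma eq_of_raise {r k a k' a' : ℕ} {Λ Λ' : Arr} (h0 : ∀ κ < r, Λ r κ = Λ (r + 1) κ)
    (h1 : ∀ κ < r + 1, Λ (r + 1) κ = Λ (r + 2) (κ + 1) + 1) (h0' : ∀ κ < r, Λ' r κ = Λ' (r + 1) κ)
    (h1' : ∀ κ < r + 1, Λ' (r + 1) κ = Λ' (r + 2) (κ + 1) + 1) (hk : k < r + 1) (hk' : k' < r + 1)
    (ha : a < r + 2) (ha' : a' < r + 2)
    (h : Λ + dl (r + 1) k + dl (r + 2) a = Λ' + dl (r + 1) k' + dl (r + 2) a') : Λ = Λ' := by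
  have hv := fun p κ => congrFun (congrFun h p) κ
  simp only [Pi.add_apply, dl] at hv
  have ek : k = k' := by
    by_contra hne
    obtain ⟨κ, hκ, hκr⟩ : ∃ κ, (κ = k ∨ κ = k') ∧ κ < r := by
      by_cases hkr : k < r
      · exact ⟨k, Or.inl rfl, hkr⟩
      · exact ⟨k', Or.inr rfl, by omega⟩
    have A := h0 κ hκr
    have A' := h0' κ hκr
    have B := hv r κ
    have C := hv (r + 1) κ
    split_ifs at B C <;> omega
  subst ek
  have ea : a = a' := by
    by_contra hne
    obtain ⟨κ, hκ, hκr⟩ : ∃ κ, (κ + 1 = a ∨ κ + 1 = a') ∧ κ < r + 1 := by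
      by_cases hkr : 0 < a
      · exact ⟨a - 1, by omega, by omega⟩
      · exact ⟨a' - 1, by omega, by omega⟩
    have A := h1 κ hκr
    have A' := h1' κ hκr
    have B := hv (r + 1) κ
    have C := hv (r + 2) (κ + 1)
    split_ifs at B C <;> omega
  subst ea
  simpa using h

lemma eq_of_lower {r k a k' a' : ℕ} {Λ Λ' Λ'' : Arr}
    (h0 : ∀ κ < r, Λ r κ = Λ (r + 1) (κ + 1) + 1)
    (h1 : ∀ κ < r + 1, Λ (r + 1) κ = Λ (r + 2) κ)
    (h0' : ∀ κ < r, Λ' r κ = Λ' (r + 1) (κ + 1) + 1)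
    (h1' : ∀ κ < r + 1, Λ' (r + 1) κ = Λ' (r + 2) κ) (hk : k < r + 1) (hk' : k' < r + 1)
    (ha : a < r + 2) (ha' : a' < r + 2) (h : Λ = Λ'' + dl (r + 1) k + dl (r + 2) a)
    (h' : Λ' = Λ'' + dl (r + 1) k' + dl (r + 2) a') : Λ = Λ' := by
  have hv := fun p κ => congrFun (congrFun h p) κ
  have hv' := fun p κ => congrFun (congrFun h' p) κ
  simp only [Pi.add_apply, dl] at hv hv'
  have ek : k = k' := by
    by_contra hne
    obtain ⟨κ, hκ, hκr⟩ : ∃ κ, (κ + 1 = k ∨ κ + 1 = k') ∧ κ < r := by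
      by_cases hkr : 0 < k
      · exact ⟨k - 1, by omega, by omega⟩
      · exact ⟨k' - 1, by omega, by omega⟩
    have A := h0 κ hκr
    have A' := h0' κ hκr
    have B := hv r κ
    have C := hv (r + 1) (κ + 1)
    have B' := hv' r κ
    have C' := hv' (r + 1) (κ + 1)
    split_ifs at B C B' C' <;> omega
  subst ek
  have ea : a = a' := by
    by_contra hne
    obtain ⟨κ, hκ, hκr⟩ : ∃ κ, (κ = a ∨ κ = a') ∧ κ < r + 1 := by
      by_cases hkr : a < r + 1
      · exact ⟨a, Or.inl rfl, hkr⟩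
      · exact ⟨a', Or.inr rfl, by omega⟩
    have A := h1 κ hκr
    have A' := h1' κ hκr
    have B := hv (r + 1) κ
    have C := hv (r + 2) κ
    have B' := hv' (r + 1) κ
    have C' := hv' (r + 2) κ
    split_ifs at B C B' C' <;> omega
  subst ea
  rw [h, h']

lemma exists_level (s : ℕ) : ∃ i : ℤ, level i = s ∧ (0 ≤ i ↔ ¬ Even s) := by
  rcases Nat.even_or_odd s with ⟨n, rfl⟩ | ⟨n, rfl⟩
  · refine ⟨-(n : ℤ) - 1, by rw [level_neg]; omega, ?_⟩
    simp
    omega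
  · exact ⟨n, level_natCast n, by simp⟩

section

variable {M : ℤ → ℂ[X]} (S : SigData M)

/-- A pattern whose row `t` is the first non-extremal one is not annihilated by the `eᵢ` that changes
the rows `t - 1` and `t`. -/
lemma exists_eStep {t : ℕ} {P : CBasis M} (hP : ∀ r < t, RowExt r (S.arrOf P))
    (ht : ¬ RowExt t (S.arrOf P)) {i : ℤ} (hi : level i + 1 = t) :
    ∃ Q : CBasis M, EStep i (S.arrOf P) (S.arrOf Q) := by
  unfold EStep
  have hI := S.inter P
  obtain _ | _ | r := t
  · omega
  · obtain hi0 : level i = 0 := by omega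
    have hi1 : ¬ 0 ≤ i := fun h => by have := (level_of_nonneg h).2; omega
    rw [rowExt_odd (by decide)] at ht
    push Not at ht
    obtain ⟨κ, hκ, hne⟩ := ht
    obtain rfl : κ = 0 := by omega
    have h1 := hI 1 0 (by omega)
    simp only [Nat.zero_add, Nat.reduceAdd] at hne h1
    obtain ⟨Q, hQ⟩ := exists_arrOf S P (p := 1) (k := 0) (p' := 1) (k' := 0) (s := -1) (s' := 0)
      (by omega) (by omega) (by
        intro p κ hκ
        have I := hI p κ hκ
        simp only [Pi.add_apply, Pi.smul_apply, dl, smul_eq_mul]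
        by_cases hp : p = 1
        · subst hp
          obtain rfl : κ = 0 := by omega
          simp
          omega
        · split_ifs <;> omega)
    refine ⟨Q, ?_⟩
    rw [if_neg hi1, hi0]
    show S.arrOf P = S.arrOf Q + dl 1 0
    rw [hQ]
    simp
  · have hi0 : level i = r + 1 := by omega
    have e0 := hP r (by omega)
    have e1 := hP (r + 1) (by omega)
    by_cases hr : Even r
    · have hr1 : ¬ Even (r + 1) := by simpa [Nat.even_add_one] using hr
      have hr2 : Even (r + 1 + 1) := by simpa [Nat.even_add_one] using hr
      have hi1 : 0 ≤ i := by
        by_contra h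
        exact hr1 (hi0 ▸ (level_of_neg h).1)
      rw [rowExt_even hr] at e0
      rw [rowExt_odd hr1] at e1
      rw [rowExt_even hr2] at ht
      push Not at ht
      obtain ⟨a, ha, hne⟩ := ht
      have := (hI (r + 2) a ha).1
      obtain ⟨k, hk, h⟩ := exists_inter_raise hI e0 e1 ha (lt_of_le_of_ne this hne)
      obtain ⟨Q, hQ⟩ := exists_arrOf S P (s := 1) (s' := 1) hk ha (by simpa using h)
      refine ⟨Q, ?_⟩
      rw [if_pos hi1, hi0]
      exact ⟨k, hk, a, ha, by simpa using hQ⟩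
    · have hr1 : Even (r + 1) := by simpa [Nat.even_add_one] using hr
      have hr2 : ¬ Even (r + 1 + 1) := by simpa [Nat.even_add_one] using hr
      have hi1 : ¬ 0 ≤ i := by
        intro h
        exact Nat.not_even_iff_odd.mpr (level_of_nonneg h).1 (hi0 ▸ hr1)
      rw [rowExt_odd hr] at e0
      rw [rowExt_even hr1] at e1
      rw [rowExt_odd hr2] at ht
      push Not at ht
      obtain ⟨a, ha, hne⟩ := ht
      have := (hI (r + 2) a ha).2
      obtain ⟨k, hk, h⟩ := exists_inter_lower hI e0 e1 ha (by
        simp only [Nat.add_assoc, Nat.reduceAdd] at *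
        omega)
      obtain ⟨Q, hQ⟩ := exists_arrOf S P (s := -1) (s' := -1) hk ha (by
        simpa [sub_eq_add_neg] using h)
      refine ⟨Q, ?_⟩
      rw [if_neg hi1, hi0]
      refine ⟨k, hk, a, ha, ?_⟩
      rw [hQ]
      simp only [neg_smul, one_smul]
      abel

lemma eStep_source_unique {t : ℕ} {P P' Q : CBasis M} (hP : ∀ r < t, RowExt r (S.arrOf P))
    (hP' : ∀ r < t, RowExt r (S.arrOf P')) {i : ℤ} (hi : level i + 1 = t)
    (h : EStep i (S.arrOf P) (S.arrOf Q)) (h' : EStep i (S.arrOf P') (S.arrOf Q)) : P = P' := by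
  apply S.arrOf_injective
  unfold EStep at h h'
  obtain _ | _ | r := t
  · omega
  · obtain hi0 : level i = 0 := by omega
    have hi1 : ¬ 0 ≤ i := fun h => by have := (level_of_nonneg h).2; omega
    rw [if_neg hi1, hi0] at h h'
    exact Eq.trans (show S.arrOf P = S.arrOf Q + dl 1 0 from h)
      (show S.arrOf P' = S.arrOf Q + dl 1 0 from h').symm
  · have hi0 : level i = r + 1 := by omega
    have e0 := hP r (by omega)
    have e1 := hP (r + 1) (by omega)
    have e0' := hP' r (by omega)
    have e1' := hP' (r + 1) (by omega)
    by_cases hr : Even r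
    · have hr1 : ¬ Even (r + 1) := by simpa [Nat.even_add_one] using hr
      have hi1 : 0 ≤ i := by
        by_contra h
        exact hr1 (hi0 ▸ (level_of_neg h).1)
      rw [rowExt_even hr] at e0 e0'
      rw [rowExt_odd hr1] at e1 e1'
      rw [if_pos hi1, hi0] at h h'
      obtain ⟨k, hk, a, ha, h⟩ := h
      obtain ⟨k', hk', a', ha', h'⟩ := h'
      exact eq_of_raise e0 e1 e0' e1' hk hk' ha ha' (h.symm.trans h')
    · have hr1 : Even (r + 1) := by simpa [Nat.even_add_one] using hr
      have hi1 : ¬ 0 ≤ i := by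
        intro h
        exact Nat.not_even_iff_odd.mpr (level_of_nonneg h).1 (hi0 ▸ hr1)
      rw [rowExt_odd hr] at e0 e0'
      rw [rowExt_even hr1] at e1 e1'
      rw [if_neg hi1, hi0] at h h'
      obtain ⟨k, hk, a, ha, h⟩ := h
      obtain ⟨k', hk', a', ha', h'⟩ := h'
      exact eq_of_lower e0 e1 e0' e1' hk hk' ha ha' h h'

lemma eq_topP_of_rowExt {P : CBasis M} (h : ∀ t, RowExt t (S.arrOf P)) : P = topP S := by
  rw [← stab_zero_iff]
  obtain ⟨N, hN⟩ := exists_stab S P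
  induction N with
  | zero => exact hN
  | succ N ih =>
    refine ih fun p hp k hk => ?_
    by_cases hpN : N + 1 ≤ p
    · exact hN p hpN k hk
    · obtain rfl : p = N := by omega
      by_cases hp : Even p
      · rw [(rowExt_even hp).mp (h p) k hk, hN _ le_rfl k (by omega), posn_succ_even hp]
      · rw [(rowExt_odd hp).mp (h p) k hk, hN _ le_rfl (k + 1) (by omega),
          posn_succ_odd (Nat.not_even_iff_odd.mp hp)]
        push_cast
        ring

end

end QuantumAInf

end

noncomputable section

namespace QuantumAInf

open Polynomial QSqrt

/-! ### Reduction modulo `h` -/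

section

variable {M : ℤ → ℂ[X]} (S : SigData M)

/-- Reduction of the coefficients modulo `h`. -/
def red (M : ℤ → ℂ[X]) : (CBasis M →₀ R) →+ (CBasis M →₀ ℂ) :=
  Finsupp.mapRange.addMonoidHom (PowerSeries.constantCoeff (R := ℂ)).toAddMonoidHom

lemma red_apply (x : CBasis M →₀ R) (P : CBasis M) :
    red M x P = PowerSeries.constantCoeff (x P) := rfl

lemma red_smul (c : R) (x : CBasis M →₀ R) :
    red M (c • x) = PowerSeries.constantCoeff c • red M x := by
  ext P
  simp [red_apply]

lemma red_single (P : CBasis M) : red M (Finsupp.single P 1) = Finsupp.single P 1 := by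
  simp [red]

/-- The generators acting modulo `h`. -/
def gC (g : Gen) : Module.End ℂ (CBasis M →₀ ℂ) :=
  Finsupp.linearCombination ℂ fun P => red M (gF S g (Finsupp.single P 1))

lemma gC_single (g : Gen) (P Q : CBasis M) :
    gC S g (Finsupp.single P 1) Q = PowerSeries.constantCoeff (mel S g Q P) := by
  rw [gC, Finsupp.linearCombination_single, one_smul]
  rfl

lemma gC_apply (g : Gen) (x : CBasis M →₀ ℂ) (Q : CBasis M) :
    gC S g x Q = x.sum fun P c => c * PowerSeries.constantCoeff (mel S g Q P) := by
  rw [gC, Finsupp.linearCombination_apply, Finsupp.sum, Finsupp.coe_finsetSum, Finset.sum_apply]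
  rfl

lemma red_gF (g : Gen) (x : CBasis M →₀ R) : red M (gF S g x) = gC S g (red M x) := by
  induction x using Finsupp.induction_linear with
  | zero => simp
  | add x y hx hy => simp only [map_add, hx, hy]
  | single P c =>
    rw [← Finsupp.smul_single_one, map_smul, red_smul, red_smul, map_smul, red_single]
    congr 1
    rw [gC, Finsupp.linearCombination_single, one_smul]

/-- The words in the generators acting modulo `h`. -/
def wC (W : List Gen) : Module.End ℂ (CBasis M →₀ ℂ) := (W.map (gC S)).prod

lemma wC_nil (x : CBasis M →₀ ℂ) : wC S [] x = x := by simp [wC]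

lemma wC_cons (g : Gen) (W : List Gen) (x : CBasis M →₀ ℂ) :
    wC S (g :: W) x = gC S g (wC S W x) := by
  simp [wC]

lemma wC_append (W W' : List Gen) (x : CBasis M →₀ ℂ) :
    wC S (W ++ W') x = wC S W (wC S W' x) := by
  simp [wC]

lemma red_wF (W : List Gen) (x : CBasis M →₀ R) : red M (wF S W x) = wC S W (red M x) := by
  induction W with
  | nil => simp [wF, wC]
  | cons g W ih => rw [wF_cons, wC_cons, red_gF, ih]

/-- Reduction of `V` modulo `h`. -/
def redV (v : V M) : CBasis M →₀ ℂ :=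
  Finsupp.ofSupportFinite (fun P => PowerSeries.constantCoeff (v.1 P)) (by
    have h := v.2 0
    simp only [PowerSeries.coeff_zero_eq_constantCoeff_apply] at h
    exact h)

lemma redV_apply (v : V M) (P : CBasis M) : redV v P = PowerSeries.constantCoeff (v.1 P) := rfl

lemma redV_toV (x : CBasis M →₀ R) : redV (toV M x) = red M x :=
  Finsupp.ext fun _ => rfl

lemma redV_vec (P : CBasis M) : redV (vec P) = Finsupp.single P 1 := by
  rw [← toV_single, redV_toV, red_single]

lemma redV_eq_iff {v w : V M} : redV v = redV w ↔ v - w ∈ hpow (V M) 1 := by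
  rw [mem_hpow_V, DFunLike.ext_iff]
  refine forall_congr' fun P => ?_
  have e : (v - w).1 P = v.1 P - w.1 P := rfl
  rw [redV_apply, redV_apply, pow_one, PowerSeries.X_dvd_iff, e, map_sub, sub_eq_zero]

lemma redV_word (W : List Gen) (v : V M) : redV (rep S (word W) v) = wC S W (redV v) := by
  obtain ⟨x, hx⟩ := exists_approx v 1
  rw [redV_eq_iff.mpr hx, redV_toV, ← red_wF, ← redV_toV, ← rep_word, redV_eq_iff, ← map_sub]
  exact map_mem_hpow _ hx

/-! ### Singular vectors modulo `h` -/

lemma gC_e_apply_of_unique {x : CBasis M →₀ ℂ} {i : ℤ} {P Q : CBasis M}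
    (h : ∀ P', x P' ≠ 0 → EStep i (S.arrOf P') (S.arrOf Q) → P' = P) :
    gC S (Gen.e i) x Q = x P * PowerSeries.constantCoeff (mel S (Gen.e i) Q P) := by
  rw [gC_apply, Finsupp.sum]
  refine Finset.sum_eq_single P (fun P' hP' hne => ?_) (fun hP => ?_)
  · rw [mel_e_of_not S fun h' => hne (h P' (Finsupp.mem_support_iff.mp hP') h'), map_zero, mul_zero]
  · rw [Finsupp.notMem_support_iff.mp hP, zero_mul]

/-- A vector annihilated by all the `eᵢ` is a multiple of the highest weight vector. -/
lemma eq_topP_of_singular {x : CBasis M →₀ ℂ} (hx : ∀ i, gC S (Gen.e i) x = 0) {P : CBasis M}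
    (hP : x P ≠ 0) : P = topP S := by
  have key : ∀ t, ∀ P, x P ≠ 0 → RowExt t (S.arrOf P) := by
    intro t
    induction t using Nat.strong_induction_on with
    | _ t ih =>
      intro P hP
      obtain _ | s := t
      · intro κ hκ
        omega
      obtain ⟨i, hi, _⟩ := exists_level s
      by_contra hne
      obtain ⟨Q, hQ⟩ := exists_eStep S (fun r hr => ih r hr P hP) hne (i := i) (by omega)
      have h1 := gC_e_apply_of_unique S (x := x) (P := P) (Q := Q) (i := i) fun P' hP' h' =>
        eStep_source_unique S (fun r hr => ih r hr P' hP') (fun r hr => ih r hr P hP) (by omega) h' hQ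
      rw [hx i, Finsupp.zero_apply] at h1
      exact mul_ne_zero hP (mel_e_of_step S hQ) h1.symm
  exact eq_topP_of_rowExt S fun t => key t P hP

/-- A weight that grows by one under the `eᵢ` that change only rows below the `N`-th. -/
def energy (N : ℕ) (Λ : Arr) : ℤ := ∑ p ∈ Finset.range N, (-1) ^ p * (p : ℤ) * rsum p Λ

lemma Step.rsum_eq {s : ℕ} {Λ Λ' : Arr} (h : Step s Λ Λ') (n : ℕ) :
    rsum n Λ' = rsum n Λ + (if n = s + 1 then 1 else 0) + if n = s ∧ 0 < s then 1 else 0 := by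
  cases s with
  | zero =>
    rw [show Λ' = Λ + dl 1 0 from h, rsum_add_one (by omega)]
    simp
  | succ s =>
    obtain ⟨k, hk, a, ha, rfl⟩ := h
    rw [rsum_add_one ha, rsum_add_one hk]
    simp only [Nat.zero_lt_succ, and_true]
    ring

lemma Step.energy_eq {s N : ℕ} {Λ Λ' : Arr} (h : Step s Λ Λ') (hN : s + 1 < N) :
    energy N Λ' = energy N Λ - (-1) ^ s := by
  have e : ∀ p : ℕ, (-1) ^ p * (p : ℤ) * rsum p Λ' = (-1) ^ p * (p : ℤ) * rsum p Λ +
      ((if p = s + 1 then (-1) ^ p * (p : ℤ) else 0) + if p = s then (-1) ^ p * (p : ℤ) else 0) := by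
    intro p
    rw [h.rsum_eq p]
    rcases Nat.eq_zero_or_pos p with rfl | hp
    · split_ifs <;> simp
    · split_ifs <;> first | omega | ring
  unfold energy
  rw [Finset.sum_congr rfl fun p _ => e p, Finset.sum_add_distrib, Finset.sum_add_distrib,
    Finset.sum_ite_eq', Finset.sum_ite_eq', if_pos (Finset.mem_range.mpr hN),
    if_pos (Finset.mem_range.mpr (by omega))]
  push_cast
  ring

lemma EStep.energy_eq {i : ℤ} {N : ℕ} {Λ Λ' : Arr} (h : EStep i Λ Λ') (hN : level i + 1 < N) :
    energy N Λ' = energy N Λ + 1 := by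
  unfold EStep at h
  split_ifs at h with hi
  · rw [h.energy_eq hN, (level_of_nonneg hi).1.neg_one_pow]
    ring
  · have := h.energy_eq hN
    rw [(level_of_neg hi).1.neg_one_pow] at this
    omega

lemma Inter.le_add {Λ : Arr} (h : Inter Λ) (d : ℕ) {p k : ℕ} (hk : k < p) :
    Λ p k ≤ Λ (p + d) k ∧ Λ (p + d) (k + d) ≤ Λ p k := by
  induction d with
  | zero => simp
  | succ d ih =>
    have h1 := (h (p + d) k (by omega)).1
    have h2 := (h (p + d) (k + d) (by omega)).2
    simp only [← add_assoc]
    omega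

lemma finite_stabSet (N : ℕ) : (stabSet S N).Finite := by
  let f : CBasis M → (Fin N → Fin N → ℤ) := fun P p k => if k.1 < p.1 then S.arrOf P p k else 0
  refine Set.Finite.of_finite_image (f := f) ?_ ?_
  · let lo : Fin N → Fin N → ℤ := fun p k => min 0 (S.cc (posn N (k.1 + (N - p.1))) - (k.1 + (N - p.1) : ℕ))
    let hi : Fin N → Fin N → ℤ := fun p k => max 0 (S.cc (posn N k.1) - (k.1 : ℕ))
    refine (Set.finite_Icc lo hi).subset ?_
    rintro _ ⟨P, hP, rfl⟩
    have hP' : Stab S N (S.arrOf P) := hP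
    have key : ∀ p k : Fin N, lo p k ≤ f P p k ∧ f P p k ≤ hi p k := by
      intro p k
      simp only [f, lo, hi]
      split_ifs with h
      · have h1 := (S.inter P).le_add (N - p.1) h
        rw [show p.1 + (N - p.1) = N by omega] at h1
        rw [hP' N le_rfl k.1 k.2, hP' N le_rfl (k.1 + (N - p.1)) (by omega)] at h1
        exact ⟨(min_le_right _ _).trans h1.2, h1.1.trans (le_max_right _ _)⟩
      · exact ⟨min_le_left _ _, le_max_left _ _⟩
    exact ⟨fun p k => (key p k).1, fun p k => (key p k).2⟩
  · intro P hP Q hQ h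
    have hP' : Stab S N (S.arrOf P) := hP
    have hQ' : Stab S N (S.arrOf Q) := hQ
    refine S.arrOf_injective (funext fun p => funext fun k => ?_)
    by_cases hk : k < p
    · by_cases hp : N ≤ p
      · rw [hP' p hp k hk, hQ' p hp k hk]
      · have := congrFun (congrFun h ⟨p, by omega⟩) ⟨k, by omega⟩
        simpa [f, hk] using this
    · simp [SigData.arrOf, arr, hk]

/-- Every non-zero vector is mapped to a non-zero multiple of the highest weight vector by some word
in the `eᵢ`. -/
lemma exists_word_e {N : ℕ} {x : CBasis M →₀ ℂ} (hx : ∀ P, x P ≠ 0 → P ∈ stabSet S N) (h0 : x ≠ 0) :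
    ∃ L : List ℤ, (∀ i ∈ L, level i + 1 < N) ∧
      ∃ c : ℂ, c ≠ 0 ∧ wC S (L.map Gen.e) x = Finsupp.single (topP S) c := by
  obtain ⟨B, hB⟩ := ((finite_stabSet S N).image fun P => energy N (S.arrOf P)).bddAbove
  have hB' : ∀ P ∈ stabSet S N, energy N (S.arrOf P) ≤ B := fun P hP => hB ⟨P, hP, rfl⟩
  have main : ∀ d : ℕ, ∀ x : CBasis M →₀ ℂ,
      (∀ P, x P ≠ 0 → P ∈ stabSet S N ∧ B - d < energy N (S.arrOf P)) → x ≠ 0 →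
      ∃ L : List ℤ, (∀ i ∈ L, level i + 1 < N) ∧
        ∃ c : ℂ, c ≠ 0 ∧ wC S (L.map Gen.e) x = Finsupp.single (topP S) c := by
    intro d
    induction d with
    | zero =>
      intro x hx h0
      obtain ⟨P, hP⟩ := Finsupp.ne_iff.mp h0
      have h1 := hx P hP
      have h2 := hB' P h1.1
      push_cast at h1
      omega
    | succ d ih =>
      intro x hx h0
      by_cases hs : ∀ i, gC S (Gen.e i) x = 0
      · refine ⟨[], by simp, x (topP S), ?_, ?_⟩
        · obtain ⟨P, hP⟩ := Finsupp.ne_iff.mp h0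
          rwa [eq_topP_of_singular S hs hP] at hP
        · rw [List.map_nil, wC_nil]
          ext P
          by_cases hP : P = topP S
          · subst hP
            simp
          · rw [Finsupp.single_eq_of_ne hP]
            by_contra h
            exact hP (eq_topP_of_singular S hs h)
      · push Not at hs
        obtain ⟨i, hi⟩ := hs
        have hN : level i + 1 < N := by
          by_contra h
          refine hi (Finsupp.ext fun Q => ?_)
          rw [gC_apply]
          refine Finset.sum_eq_zero fun P hP => show x P * _ = 0 from ?_
          rw [mel_e_of_not S (not_eStep_of_stab S (hx P (Finsupp.mem_support_iff.mp hP)).1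
            (S.inter Q) (by omega)), map_zero, mul_zero]
        obtain ⟨L, hLN, c, hc, hL⟩ := ih (gC S (Gen.e i) x) (fun Q hQ => by
          rw [gC_apply] at hQ
          obtain ⟨P, hP, hPQ⟩ := Finset.exists_ne_zero_of_sum_ne_zero hQ
          have h1 := hx P (Finsupp.mem_support_iff.mp hP)
          have h2 : EStep i (S.arrOf P) (S.arrOf Q) := by
            by_contra h
            exact hPQ (show x P * _ = 0 by rw [mel_e_of_not S h, map_zero, mul_zero])
          refine ⟨(h2.stab_iff S hN).mp h1.1, ?_⟩
          rw [h2.energy_eq hN]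
          push_cast at h1
          omega) hi
        refine ⟨L ++ [i], ?_, c, hc, ?_⟩
        · simpa [or_imp, forall_and] using ⟨hLN, hN⟩
        rw [List.map_append, wC_append, ← hL]
        simp [wC]
  obtain ⟨A, hA⟩ := ((finite_stabSet S N).image fun P => energy N (S.arrOf P)).bddBelow
  refine main (B - A + 1).toNat x (fun P hP => ⟨hx P hP, ?_⟩) h0
  have : A ≤ energy N (S.arrOf P) := hA ⟨P, hx P hP, rfl⟩
  have := hB' P (hx P hP)
  omega

lemma exists_forall_mem_stabSet (x : CBasis M →₀ ℂ) : ∃ N, ∀ P, x P ≠ 0 → P ∈ stabSet S N := by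
  choose f hf using exists_stab S
  refine ⟨∑ P ∈ x.support, f P, fun P hP => (hf P).mono S ?_⟩
  exact Finset.single_le_sum (f := f) (fun _ _ => Nat.zero_le _) (Finsupp.mem_support_iff.mpr hP)

end

end QuantumAInf

end

noncomputable section

namespace QuantumAInf

open Polynomial QSqrt

/-! ### Generation by the highest weight vector -/

section

variable {M : ℤ → ℂ[X]} (S : SigData M)

open Classical in
/-- The coefficients of a functional at the patterns in `stabSet S N`. -/
def cut (N : ℕ) (φ : (CBasis M →₀ ℂ) →ₗ[ℂ] ℂ) : CBasis M →₀ ℂ :=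
  Finsupp.ofSupportFinite (fun P => if P ∈ stabSet S N then φ (Finsupp.single P 1) else 0)
    ((finite_stabSet S N).subset fun P hP => by
      by_contra h
      exact hP (if_neg h))

lemma cut_apply {N : ℕ} (φ : (CBasis M →₀ ℂ) →ₗ[ℂ] ℂ) {P : CBasis M} (hP : P ∈ stabSet S N) :
    cut S N φ P = φ (Finsupp.single P 1) := if_pos hP

lemma cut_apply_of_notMem {N : ℕ} (φ : (CBasis M →₀ ℂ) →ₗ[ℂ] ℂ) {P : CBasis M}
    (hP : P ∉ stabSet S N) : cut S N φ P = 0 := if_neg hP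

lemma gC_e_cut {N : ℕ} {i : ℤ} (hi : level i + 1 < N) (φ : (CBasis M →₀ ℂ) →ₗ[ℂ] ℂ) :
    gC S (Gen.e i) (cut S N φ) = cut S N (φ ∘ₗ gC S (Gen.f i)) := by
  have hstep : ∀ P Q : CBasis M, (P ∈ stabSet S N ↔ Q ∈ stabSet S N) ∨ mel S (Gen.e i) Q P = 0 := by
    intro P Q
    by_cases h : EStep i (S.arrOf P) (S.arrOf Q)
    · exact Or.inl (h.stab_iff S hi)
    · exact Or.inr (mel_e_of_not S h)
  have hsub : ∀ y : CBasis M →₀ ℂ, (∀ P ∉ stabSet S N, y P = 0) →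
      y.support ⊆ (finite_stabSet S N).toFinset := by
    intro y hy P hP
    rw [Set.Finite.mem_toFinset]
    by_contra h
    exact Finsupp.mem_support_iff.mp hP (hy P h)
  ext Q
  rw [gC_apply]
  by_cases hQ : Q ∈ stabSet S N
  · have hy : ∀ P ∉ stabSet S N, gC S (Gen.f i) (Finsupp.single Q 1) P = 0 := by
      intro P hP
      rw [gC_single, mel_f, (hstep P Q).resolve_left fun h => hP (h.mpr hQ), map_zero]
    rw [cut_apply S _ hQ, LinearMap.comp_apply,
      Finsupp.sum_of_support_subset _ (hsub _ fun P hP => cut_apply_of_notMem S φ hP) _ (by simp)]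
    conv_rhs => rw [← Finsupp.sum_single (gC S (Gen.f i) (Finsupp.single Q 1)), map_finsuppSum,
      Finsupp.sum_of_support_subset _ (hsub _ hy) _ (by simp)]
    refine Finset.sum_congr rfl fun P hP => ?_
    rw [Set.Finite.mem_toFinset] at hP
    rw [cut_apply S _ hP, gC_single, mel_f, ← Finsupp.smul_single_one _ (PowerSeries.constantCoeff _),
      map_smul, smul_eq_mul, mul_comm]
  · rw [cut_apply_of_notMem S _ hQ]
    refine Finset.sum_eq_zero fun P _ => show cut S N φ P * _ = 0 from ?_
    rcases hstep P Q with h | h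
    · rw [cut_apply_of_notMem S _ fun hP => hQ (h.mp hP), zero_mul]
    · rw [h, map_zero, mul_zero]

lemma wC_e_cut {N : ℕ} {L : List ℤ} (hL : ∀ i ∈ L, level i + 1 < N)
    (φ : (CBasis M →₀ ℂ) →ₗ[ℂ] ℂ) :
    wC S (L.map Gen.e) (cut S N φ) = cut S N (φ ∘ₗ wC S (L.reverse.map Gen.f)) := by
  induction L with
  | nil =>
    rw [List.map_nil, wC_nil]
    rfl
  | cons i L ih =>
    rw [List.map_cons, wC_cons, ih fun j hj => hL j (List.mem_cons_of_mem i hj),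
      gC_e_cut S (hL i List.mem_cons_self)]
    congr 1
    ext P
    simp [wC]

/-- The words in the `fᵢ` applied to the highest weight vector span the module modulo `h`. -/
lemma span_word_f :
    Submodule.span ℂ (Set.range fun L : List ℤ =>
      wC S (L.map Gen.f) (Finsupp.single (topP S) 1)) = ⊤ := by
  by_contra hne
  obtain ⟨φ, hφ, hle⟩ := Submodule.exists_le_ker_of_lt_top _ (lt_top_iff_ne_top.mpr hne)
  obtain ⟨P, hP⟩ : ∃ P, φ (Finsupp.single P 1) ≠ 0 := by
    by_contra! h
    exact hφ (Finsupp.lhom_ext' fun P => LinearMap.ext_ring (by simpa using h P))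
  obtain ⟨N, hN⟩ := exists_stab S P
  have hx : ∀ Q, cut S N φ Q ≠ 0 → Q ∈ stabSet S N := fun Q hQ => by
    by_contra h
    exact hQ (cut_apply_of_notMem S φ h)
  have h0 : cut S N φ ≠ 0 := fun h => hP (by rw [← cut_apply S (N := N) φ hN, h]; rfl)
  obtain ⟨L, hL, c, hc, h⟩ := exists_word_e S hx h0
  rw [wC_e_cut S hL] at h
  have htop : topP S ∈ stabSet S N :=
    Stab.mono S (show topP S ∈ stabSet S 0 from (stab_zero_iff S).mpr rfl) (Nat.zero_le N)
  have h1 := DFunLike.congr_fun h (topP S)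
  rw [cut_apply S _ htop, Finsupp.single_eq_same, LinearMap.comp_apply] at h1
  exact hc (h1 ▸ hle (Submodule.subset_span ⟨L.reverse, rfl⟩))

/-- Finite combinations of words in the `fᵢ`. -/
def fSpan : Submodule R Uh := Submodule.span R (Set.range fun L : List ℤ => word (L.map Gen.f))

lemma fSpan_le : fSpan ≤ ⨆ t, summands t := by
  refine Submodule.span_le.mpr ?_
  rintro _ ⟨L, rfl⟩
  exact word_f_mem_summands L

lemma redV_zero : redV (0 : V M) = 0 :=
  Finsupp.ext fun P => by rw [redV_apply]; exact map_zero _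

lemma redV_add (v w : V M) : redV (v + w) = redV v + redV w :=
  Finsupp.ext fun P => by rw [redV_apply]; exact map_add _ _ _

lemma redV_smul (c : R) (v : V M) : redV (c • v) = PowerSeries.constantCoeff c • redV v :=
  Finsupp.ext fun P => by rw [redV_apply]; exact map_mul _ _ _

lemma exists_fSpan_approx {w : V M} (hw : redV w = Finsupp.single (topP S) 1) (v : V M) :
    ∃ F ∈ fSpan, ∃ v' : V M, v = rep S F w + hh • v' := by
  have key : ∀ z : CBasis M →₀ ℂ, ∃ F ∈ fSpan, redV (evalRep S w F) = z := by
    intro z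
    have hz : z ∈ Submodule.span ℂ (Set.range fun L : List ℤ =>
        wC S (L.map Gen.f) (Finsupp.single (topP S) 1)) := by
      rw [span_word_f S]
      trivial
    induction hz using Submodule.span_induction with
    | mem z hz =>
      obtain ⟨L, rfl⟩ := hz
      exact ⟨_, Submodule.subset_span ⟨L, rfl⟩, by rw [evalRep_apply, redV_word, hw]⟩
    | zero => exact ⟨0, zero_mem _, by rw [map_zero, redV_zero]⟩
    | add x y _ _ hx hy =>
      obtain ⟨F, hF, rfl⟩ := hx
      obtain ⟨F', hF', rfl⟩ := hy
      exact ⟨F + F', add_mem hF hF', by rw [map_add, redV_add]⟩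
    | smul c x _ hx =>
      obtain ⟨F, hF, rfl⟩ := hx
      refine ⟨(PowerSeries.C c : R) • F, Submodule.smul_mem _ _ hF, ?_⟩
      rw [map_smul, redV_smul, PowerSeries.constantCoeff_C]
  obtain ⟨F, hF, h⟩ := key (redV v)
  obtain ⟨v', hv'⟩ := mem_hpow.mp (redV_eq_iff.mp h.symm)
  refine ⟨F, hF, v', ?_⟩
  rw [pow_one, evalRep_apply] at hv'
  rw [← hv', add_sub_cancel]

/-- A vector that reduces to the highest weight vector modulo `h` generates `V`. -/
lemma exists_repA_eq {w : V M} (hw : redV w = Finsupp.single (topP S) 1) (v : V M) :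
    ∃ u : UhA, repA S u w = v := by
  choose F hF v' hv' using exists_fSpan_approx S hw
  let vs : ℕ → V M := fun k => v'^[k] v
  have hs : ∀ n, v - ∑ k ∈ Finset.range n, hh ^ k • evalRep S w (F (vs k)) = hh ^ n • vs n := by
    intro n
    induction n with
    | zero => simp [vs]
    | succ n ih =>
      have e : vs (n + 1) = v' (vs n) := Function.iterate_succ_apply' _ _ _
      rw [Finset.sum_range_succ, ← sub_sub, ih, e, pow_succ, mul_smul, sub_eq_iff_eq_add,
        ← smul_add, evalRep_apply, add_comm, ← hv']
  obtain ⟨y, x, hy, hx⟩ := exists_isImage fun k => fSpan_le (hF (vs k))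
  refine ⟨x, ?_⟩
  rw [repA_of_isImage S hx]
  exact isSep_V.hasHSum_unique (hy.map (evalRep S w)) fun n => ⟨_, hs n⟩

lemma vec_topP_ne_zero : vec (topP S) ≠ 0 := by
  intro h
  have := DFunLike.congr_fun (redV_vec (topP S)) (topP S)
  rw [h] at this
  simp [redV_apply] at this

lemma isHighestWeightVector_topP : IsHighestWeightVector (rep S) (repA S) (vec (topP S)) where
  ne_zero := vec_topP_ne_zero S
  raising _ hβ _ hx := raising_topP S hβ hx
  eigen_h i := ⟨_, (isCentralBasisAction_rep S).h i _⟩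
  eigen_c := ⟨_, (isCentralBasisAction_rep S).c _⟩
  generates v := exists_repA_eq S (redV_vec _) v

lemma exists_redV_ne_zero {v : V M} (hv : v ≠ 0) : ∃ (n : ℕ) (w : V M), v = hh ^ n • w ∧ redV w ≠ 0 := by
  classical
  have hex : ∃ n, v ∉ hpow (V M) n := by
    by_contra! h
    exact hv (isSep_V v h)
  obtain ⟨n, hn⟩ : ∃ n, Nat.find hex = n + 1 :=
    Nat.exists_eq_succ_of_ne_zero fun h => Nat.find_spec hex (h ▸ hpow_zero v)
  obtain ⟨w, rfl⟩ := mem_hpow.mp (not_not.mp (Nat.find_min hex (m := n) (by omega)))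
  refine ⟨n, w, rfl, fun h => Nat.find_spec hex ?_⟩
  have h0 : redV w = redV (0 : V M) := h.trans redV_zero.symm
  obtain ⟨y, hy⟩ := mem_hpow.mp (redV_eq_iff.mp h0)
  rw [hn, mem_hpow]
  refine ⟨y, ?_⟩
  rw [sub_zero] at hy
  rw [hy, smul_smul, pow_one, pow_succ]

lemma exists_repA_word_e (L : List ℤ) (w : V M) :
    ∃ x : UhA, repA S x w = rep S (word (L.map Gen.e)) w := by
  obtain ⟨y, x, hy, hx⟩ := exists_isImage (F := fun k => if k = 0 then word (L.map Gen.e) else 0)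
    (fun k => by
      split_ifs
      · exact word_e_mem_summands L
      · exact zero_mem _)
  refine ⟨x, ?_⟩
  rw [repA_of_isImage S hx]
  refine isSep_V.hasHSum_unique (hy.map (evalRep S w)) (hasHSum_iff.mpr fun n => ?_)
  cases n with
  | zero => exact hpow_zero _
  | succ n =>
    rw [Finset.sum_range_succ']
    simp [evalRep_apply]

lemma isIrreducibleRep_repA : IsIrreducibleRep (repA S) := by
  refine ⟨⟨vec (topP S), 0, vec_topP_ne_zero S⟩, fun W hW hsat => ?_⟩
  rw [or_iff_not_imp_left, Submodule.eq_bot_iff]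
  intro h
  push Not at h
  obtain ⟨v, hvW, hv⟩ := h
  obtain ⟨n, w, rfl, hw⟩ := exists_redV_ne_zero hv
  have hwW : w ∈ W := by
    induction n with
    | zero => simpa using hvW
    | succ n ih =>
      have h1 : hh ^ n • w ∈ W := hsat _ (by rw [smul_smul, ← pow_succ']; exact hvW)
      refine ih h1 fun h0 => hv ?_
      rw [pow_succ', mul_smul, h0, smul_zero]
  obtain ⟨N, hN⟩ := exists_forall_mem_stabSet S (redV w)
  obtain ⟨L, -, c, hc, hL⟩ := exists_word_e S hN hw
  obtain ⟨x, hx⟩ := exists_repA_word_e S L w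
  have h1 := hW x w hwW
  rw [hx] at h1
  have h2 := W.smul_mem (PowerSeries.C c⁻¹ : R) h1
  have h3 : redV ((PowerSeries.C c⁻¹ : R) • rep S (word (L.map Gen.e)) w) =
      Finsupp.single (topP S) 1 := by
    rw [redV_smul, redV_word, hL, PowerSeries.constantCoeff_C, Finsupp.smul_single, smul_eq_mul,
      inv_mul_cancel₀ hc]
  rw [eq_top_iff]
  intro y _
  obtain ⟨u, rfl⟩ := exists_repA_eq S h3 y
  exact hW u _ h2

end

end QuantumAInf

end

noncomputable section

namespace QuantumAInf

open Polynomial QSqrt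

lemma exists_sigData {M : ℤ → ℂ[X]} (hM : IsSignature M) {m n : ℤ}
    (hmn : HasFiniteSignature M m n) : ∃ S : SigData M, S.ξ₀ = M m ∧ S.ξ₁ = M n := by
  have hnat : ∀ i j, i ≤ j → ∃ k : ℕ, M i - M j = (k : ℂ[X]) := by
    intro i j hij
    rcases hij.eq_or_lt with rfl | h
    · exact ⟨0, by simp⟩
    · exact hM i j h
  have hleft : ∀ i ≤ m, M i = M m := by
    intro i hi
    have := (hmn.2 (m - i).toNat).1
    rwa [Int.toNat_of_nonneg (by omega), sub_sub_cancel] at this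
  have hright : ∀ i, n ≤ i → M i = M n := by
    intro i hi
    have := (hmn.2 (i - n).toNat).2
    rwa [Int.toNat_of_nonneg (by omega), add_sub_cancel] at this
  have hint : ∀ i, ∃ z : ℤ, M i = M n + (z : ℂ[X]) := by
    intro i
    rcases le_total i n with h | h
    · obtain ⟨k, hk⟩ := hnat i n h
      exact ⟨k, by rw [Int.cast_natCast, ← hk, add_sub_cancel]⟩
    · exact ⟨0, by rw [hright i h]; simp⟩
  choose cc hcc using hint
  have hinj : ∀ i j, M i = M j → cc i = cc j := by
    intro i j h
    rw [hcc i, hcc j, add_right_inj] at h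
    exact intCast_polynomial_injective h
  have hn : cc n = 0 := by
    have h := hcc n
    rw [left_eq_add] at h
    exact intCast_polynomial_injective (by rw [h, Int.cast_zero])
  refine ⟨⟨M n, cc, cc m, m, n, hcc, fun i j hij => ?_, fun i hi => hinj i m (hleft i hi),
    fun i hi => (hinj i n (hright i hi)).trans hn⟩, (hcc m).symm, rfl⟩
  obtain ⟨k, hk⟩ := hnat i j hij
  have e : ((cc i - cc j : ℤ) : ℂ[X]) = M i - M j := by
    rw [hcc i, hcc j]
    push_cast
    ring
  have := isNatP_intCast.mp ⟨k, e.trans hk⟩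
  omega

end QuantumAInf

end

open QuantumAInf Polynomial in
theorem proposition7 (M : ℤ → ℂ[X]) (hM : IsSignature M) (m n : ℤ)
    (hmn : HasFiniteSignature M m n) :
    ∃ ρ₀ : Uh →ₐ[R] Module.End R (V M),
      IsCentralBasisAction M (M m) (M n) ρ₀ ∧
      (∀ u : FormalSeries, u.Admissible → ∀ P : CBasis M, ∀ k : ℕ,
        {t : Idx | ρ₀ (u.coeff k t) (vec P) ≠ 0}.Finite ∧
          IsFiniteVec (∑ᶠ t, ρ₀ (u.coeff k t) (vec P))) ∧
      ∃ ρ : UhA →ₗ[R] Module.End R (V M),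
        (∀ (x : UhA) (u : FormalSeries), u.Represents x → ∀ P : CBasis M,
          HasHSum (fun k => ∑ᶠ t, ρ₀ (u.coeff k t) (vec P)) (ρ x (vec P))) ∧
        IsRepresentation ρ₀ ρ ∧
        IsHContinuous ρ ∧
        (∃ P : CBasis M, (∀ p, ∀ i ∈ row p, P.1 p i = M i) ∧
          IsHighestWeightVector ρ₀ ρ (vec P)) ∧
        IsIrreducibleRep ρ ∧
        IsRestrictedRep ρ₀ := by
  obtain ⟨S, h₀, h₁⟩ := exists_sigData hM hmn
  refine ⟨rep S, h₀ ▸ h₁ ▸ isCentralBasisAction_rep S,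
    fun u hu P k => ⟨finite_summands S hu P k, isFiniteVec_sum S hu P k⟩, repA S,
    fun x u hu P => hasHSum_repA S hu P, isRepresentation_repA S, isHContinuous_repA S,
    ⟨topP S, topP_apply S, isHighestWeightVector_topP S⟩, isIrreducibleRep_repA S,
    isRestrictedRep_rep S⟩
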